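/- **Setting.** $\mathbf{Man}$ is the category of finite-dimensional smooth manifolds. A prestack is a pseudofunctor $\mathbf{Man}^{\mathrm{op}}\to\mathbf{Cat}$; a pseudo-natural transformation $F:X\to Y$ consists of functors $F_U:X(U)\to Y(U)$ and natural isomorphisms $F_h: h^*F_{U'}\Rightarrow F_U h^*$, for $h:U\to U'$, that are coherent with identities and compositions. The following prestacks are used. * $\mathbf{Loc}_1^\infty(U)$: objects are pairs $(\pi:M\to U,E)$ of a smooth locally trivial fibre bundle with typical fibre an open interval and a nowhere vanishing vertical one-form $E$; morphisms are bundle maps $f$ over $U$ that are open embeddings with $f^*E'=E$; $h^*$ is the pullback of bundles and forms, with canonical map $\overline h:h^*M\to M$. * $[\{*\}/U(1)]_{\mathrm{pre}}(U)$: one object, with $C^\infty(U,U(1))$ as morphisms; $h^*$ is precomposition with $h$. * $\mathbf{IPVec}^\infty_{\mathbb C}(U)$: sheaves $V$ of modules over the sheaf $C^\infty_{\mathbb{C},U}$ of smooth complex functions on $U$, with an antilinear involution $*$ and a symmetric bilinear pairing $\langle\cdot,\cdot\rangle:V\otimes V\to C^\infty_{\mathbb{C},U}$ satisfying $\langle v,w\rangle^*=\langle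 v^*,w^*\rangle$; morphisms are module maps preserving both; $h^*V=h^{-1}V\otimes_{h^{-1}C^\infty_{\mathbb{C},U'}}C^\infty_{\mathbb{C},U}$. * ${}^*\mathbf{Alg}^\infty_{\mathbb C}(U)$: sheaves of associative unital $*$-algebras over $C^\infty_{\mathbb{C},U}$, with $(ab)^*=b^*a^*$ and the analogous $h^*$. For a Lie group $G$, a $G$-equivariant smooth $1$-dimensional AQFT is a pseudo-natural transformation $\mathbf{Loc}_1^\infty\times[\{*\}/G]_{\mathrm{pre}}\to{}^*\mathbf{Alg}^\infty_{\mathbb C}$. **Dirac field.** Let $(\pi:M\to U,E)\in\mathbf{Loc}_1^\infty(U)$. Let $C^\infty_\pi(W)=C^\infty(\pi^{-1}(W),\mathbb C)$ for $W\subseteq U$ open. For $S\subseteq M$ let $J^\pm_{\mathrm v}(S)$ be the set of points reached from $S$ along vertical curves on which $E$ is $\geq 0$, respectively $\leq 0$. Let $C^\infty_{\pi\,\mathrm{vpc}}$, $C^\infty_{\pi\,\mathrm{vfc}}$, $C^\infty_{\pi\,\mathrm{vc}}\subseteq C^\infty_\pi$ be the subsheaves of functions whose support is, locally over $U$, contained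 in $J^+_{\mathrm v}(\sigma)$, in $J^-_{\mathrm v}(\sigma')$, in $J^+_{\mathrm v}(\sigma)\cap J^-_{\mathrm v}(\sigma')$, respectively, for some local smooth sections $\sigma,\sigma'$ of $\pi$. Let $D=\mathrm{diag}(\mathrm i\,{*_{\mathrm v}}\mathrm d_{\mathrm v},-\mathrm i\,{*_{\mathrm v}}\mathrm d_{\mathrm v})$ on $C^\infty_\pi\otimes\mathbb C^2$, where $\mathrm d_{\mathrm v}\varphi=({*_{\mathrm v}}\mathrm d_{\mathrm v}\varphi)E$. The retarded/advanced Green operator $S^\pm$ is the morphism of sheaves of $C^\infty_{\mathbb{C},U}$-modules on $C^\infty_{\pi\,\mathrm{vpc}/\mathrm{vfc}}\otimes\mathbb C^2$ that is inverse to $D$ and satisfies $\mathrm{supp}(S^\pm\Psi)\subseteq J^\pm_{\mathrm v}(\mathrm{supp}\,\Psi)$; put $S=S^+-S^-$. **Proposition.** The Green operators $S^\pm$ exist for every object of every $\mathbf{Loc}_1^\infty(U)$, and there is a pseudo-natural transformation $$\tilde{\mathfrak L}:\mathbf{Loc}_1^\infty\times[\{*\}/U(1)]_{\mathrm{pre}}\longrightarrow\mathbf{IPVec}^\infty_{\mathbb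 C}$$ with the following properties. 1. On objects, $\tilde{\mathfrak L}_U(\pi,E)$ is the quotient sheaf $(C^\infty_{\pi\,\mathrm{vc}}\otimes\mathbb C^2)/D(C^\infty_{\pi\,\mathrm{vc}}\otimes\mathbb C^2)$ with the involution $(\psi,\overline\psi)\mapsto(\overline\psi^{\,*},\psi^*)$ and the pairing $$\Big\langle\Psi,\Psi'\Big\rangle=\int_\pi\big(\mathrm i\,\psi\,(S\Psi')_2-\mathrm i\,\overline\psi\,(S\Psi')_1\big)\,E,\qquad \Psi=(\psi,\overline\psi),$$ where the fibres are oriented by $E$. 2. A morphism $(f,g)$, with $f:(\pi:M\to U,E)\to(\pi':M'\to U,E')$ in $\mathbf{Loc}_1^\infty(U)$ and $g\in C^\infty(U,U(1))$, acts on classes by $$(\psi,\overline\psi)\longmapsto\big(\pi'^*(g)\,f_*\psi,\ \pi'^*(g)^{-1}f_*\overline\psi\big),$$ where $f_*$ is the extension by zero along $f$. 3. For $h:U\to U'$, the coherence isomorphism $h^*\tilde{\mathfrak L}_{U'}(\pi,E)\to\tilde{\mathfrak L}_U(h^*(\pi,E))$ is induced by the pullback of functions $\Psi\mapsto\Psi\circ\overline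 h$. Moreover, there is a pseudo-natural transformation $\mathfrak{CAR}:\mathbf{IPVec}^\infty_{\mathbb C}\to{}^*\mathbf{Alg}^\infty_{\mathbb C}$ which assigns to $V$ the universal sheaf of $*$-algebras generated by $V$, via a $*$-preserving linear map $\iota_V:V\to\mathfrak{CAR}(V)$, subject to $\iota_V(v)\iota_V(w)+\iota_V(w)\iota_V(v)=\langle v,w\rangle\,1$, and whose action on morphisms and coherence isomorphisms are the canonical ones on generators. The composite $\tilde{\mathfrak A}=\mathfrak{CAR}\circ\tilde{\mathfrak L}$ is a $U(1)$-equivariant smooth $1$-dimensional AQFT, on which $(f,g)$ acts by $$\iota\big([\psi,\overline\psi]\big)\longmapsto\iota\big([\pi'^*(g)f_*\psi,\ \pi'^*(g)^{-1}f_*\overline\psi]\big);$$ for $f=\mathrm{id}$ this is the global $U(1)$-symmetry of the massless Dirac field. -/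

import Mathlib

open CategoryTheory TopologicalSpace Opposite Set Topology Bicategory
open scoped Manifold ContDiff TensorProduct

noncomputable section

namespace SmoothAQFT

/-! ### Manifolds -/

/-- Finite-dimensional smooth manifolds (Hausdorff, second countable, without boundary). -/
structure Man : Type 1 where
  dim : ℕ
  carrier : Type
  [top : TopologicalSpace carrier]
  [charted : ChartedSpace (EuclideanSpace ℝ (Fin dim)) carrier]
  [smooth : IsManifold (𝓡 dim) ∞ carrier]
  [t2 : T2Space carrier]
  [second : SecondCountableTopology carrier]

instance : CoeSort Man Type := ⟨Man.carrier⟩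

attribute [instance] Man.top Man.charted Man.smooth Man.t2 Man.second

/-- Morphisms of `Man` are the smooth maps. -/
instance : Category Man where
  Hom U V := C^∞⟮𝓡 U.dim, U; 𝓡 V.dim, V⟯
  id _ := ContMDiffMap.id
  comp f g := ContMDiffMap.comp g f

instance (U V : Man) : FunLike (U ⟶ V) U V :=
  inferInstanceAs (FunLike C^∞⟮𝓡 U.dim, U; 𝓡 V.dim, V⟯ U V)

theorem Man.smooth_hom {U V : Man} (h : U ⟶ V) : ContMDiff (𝓡 U.dim) (𝓡 V.dim) ∞ h :=
  ContMDiffMap.contMDiff h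

theorem Man.cont_hom {U V : Man} (h : U ⟶ V) : Continuous h := (Man.smooth_hom h).continuous

@[ext] theorem Man.hom_ext {U V : Man} {f g : U ⟶ V} (H : ∀ x, f x = g x) : f = g :=
  ContMDiffMap.ext H

@[simp] theorem Man.id_apply {U : Man} (x : U) : (𝟙 U : U ⟶ U) x = x := rfl
@[simp] theorem Man.comp_apply {U V W : Man} (f : U ⟶ V) (g : V ⟶ W) (x : U) :
    (f ≫ g) x = g (f x) := rfl

/-- The preimage of an open subset under a smooth map. -/
def pre {U U' : Man} (h : U ⟶ U') (W : Opens U') : Opens U := Opens.comap ⟨h, Man.cont_hom h⟩ W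

@[simp] theorem mem_pre {U U' : Man} (h : U ⟶ U') (W : Opens U') (x : U) :
    x ∈ pre h W ↔ h x ∈ W := Iff.rfl

theorem pre_mono {U U' : Man} (h : U ⟶ U') {W₁ W₂ : Opens U'} (i : W₁ ≤ W₂) :
    pre h W₁ ≤ pre h W₂ := fun _ hx => i hx

/-! ### Smooth complex functions -/

instance : ContMDiffRing 𝓘(ℝ, ℂ) ∞ ℂ :=
  { (instNormedSpaceLieAddGroup : LieAddGroup 𝓘(ℝ, ℂ) ∞ ℂ) with
    contMDiff_mul := by
      rw [contMDiff_iff]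
      refine ⟨continuous_mul, fun x y => ?_⟩
      simp only [mfld_simps, chartAt_self_eq]
      rw [contDiffOn_univ]
      exact contDiff_mul }

/-- The ring of smooth complex-valued functions on an open subset. -/
abbrev Fn (U : Man) (W : Opens U) : Type := C^∞⟮𝓡 U.dim, W; 𝓘(ℝ, ℂ), ℂ⟯

/-- The sheaf of rings of smooth complex-valued functions. -/
def 𝒪 (U : Man) : Sheaf (Opens.grothendieckTopology (TopCat.of U)) RingCat.{0} :=
  smoothSheafRing (𝓡 U.dim) 𝓘(ℝ, ℂ) U ℂ

/-- Restriction of smooth functions. -/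
def resFn {U : Man} {W₁ W₂ : Opens U} (i : W₁ ≤ W₂) : Fn U W₂ →+* Fn U W₁ :=
  ContMDiffMap.restrictRingHom (𝓡 U.dim) 𝓘(ℝ, ℂ) ℂ i

@[simp] theorem resFn_apply {U : Man} {W₁ W₂ : Opens U} (i : W₁ ≤ W₂) (a : Fn U W₂) (x : W₁) :
    resFn i a x = a ⟨x, i x.2⟩ := rfl

/-- Complex conjugation. -/
instance {U : Man} {W : Opens U} : StarRing (Fn U W) where
  star a := ⟨fun x => (starRingEnd ℂ) (a x),
    (Complex.conjCLE.contDiff (n := ∞)).contMDiff.comp a.contMDiff⟩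
  star_involutive a := by ext x; exact Complex.conj_conj _
  star_mul a b := by ext x; exact (map_mul (starRingEnd ℂ) _ _).trans (mul_comm _ _)
  star_add a b := by ext x; exact map_add (starRingEnd ℂ) _ _

@[simp] theorem Fn.star_apply {U : Man} {W : Opens U} (a : Fn U W) (x : W) :
    (star a) x = (starRingEnd ℂ) (a x) := rfl

/-- Pullback of functions. -/
def pullFn {U U' : Man} (h : U ⟶ U') (W : Opens U') : Fn U' W →+* Fn U (pre h W) where
  toFun a := ⟨fun x => a ⟨h x, x.2⟩, a.contMDiff.comp (by
    rw [← ContMDiff.subtypeVal_comp_iff]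
    exact (Man.smooth_hom h).comp contMDiff_subtype_val)⟩
  map_one' := rfl
  map_zero' := rfl
  map_mul' _ _ := rfl
  map_add' _ _ := rfl

@[simp] theorem pullFn_apply {U U' : Man} (h : U ⟶ U') (W : Opens U') (a : Fn U' W)
    (x : pre h W) : pullFn h W a x = a ⟨h x, x.2⟩ := rfl

/-! ### Sheaves of modules, sectionwise -/

/-- Sheaves of modules over the sheaf of smooth complex-valued functions. -/
abbrev ModSheaf (U : Man) : Type 1 := SheafOfModules.{0} (𝒪 U)

/-- The module of sections over an open subset. -/
def Sec {U : Man} (V : ModSheaf U) (W : Opens U) : Type := V.val.obj (op W)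

instance {U : Man} (V : ModSheaf U) (W : Opens U) : AddCommGroup (Sec V W) :=
  inferInstanceAs (AddCommGroup (V.val.obj (op W)))

instance {U : Man} (V : ModSheaf U) (W : Opens U) : Module (Fn U W) (Sec V W) :=
  inferInstanceAs (Module ((𝒪 U).obj.obj (op W)) (V.val.obj (op W)))

namespace Sec
variable {U : Man} {V : ModSheaf U}

/-- Restriction of sections. -/
def res {W₁ W₂ : Opens U} (i : W₁ ≤ W₂) : Sec V W₂ →+ Sec V W₁ :=
  (V.val.restrictₛₗ (homOfLE i).op).toAddMonoidHom

theorem res_smul {W₁ W₂ : Opens U} (i : W₁ ≤ W₂) (a : Fn U W₂) (v : Sec V W₂) :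
    res i (a • v) = resFn i a • res i v :=
  (V.val.restrictₛₗ (homOfLE i).op).map_smulₛₗ a v

@[simp] theorem res_id {W : Opens U} (v : Sec V W) : res le_rfl v = v := by
  have : V.val.map (𝟙 (op W)) v = v := by rw [V.val.map_id]; rfl
  exact this

@[simp] theorem res_res {W₁ W₂ W₃ : Opens U} (i : W₁ ≤ W₂) (j : W₂ ≤ W₃) (v : Sec V W₃) :
    res i (res j v) = res (i.trans j) v :=
  (V.val.map_comp_apply (homOfLE j).op (homOfLE i).op v).symm

theorem eq_of_locally {W : Opens U} {v w : Sec V W}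
    (H : ∀ x ∈ W, ∃ (N : Opens U) (i : N ≤ W), x ∈ N ∧ res i v = res i w) : v = w := by
  choose N i hx hN using H
  have := TopCat.Sheaf.eq_of_locally_eq' (⟨V.val.presheaf, V.isSheaf⟩ : TopCat.Sheaf Ab _)
    (fun x : W => N x x.2) W (fun x => homOfLE (i x x.2))
    (fun x hxW => Opens.mem_iSup.2 ⟨⟨x, hxW⟩, hx x hxW⟩) v w (fun x => hN x x.2)
  exact this

theorem glue {W : Opens U} {ι : Type} (N : ι → Opens U) (i : ∀ j, N j ≤ W)
    (hc : ∀ x ∈ W, ∃ j, x ∈ N j) (s : ∀ j, Sec V (N j))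
    (hs : ∀ j k (M : Opens U) (hj : M ≤ N j) (hk : M ≤ N k), res hj (s j) = res hk (s k)) :
    ∃! v : Sec V W, ∀ j, res (i j) v = s j := by
  have := TopCat.Sheaf.existsUnique_gluing' (⟨V.val.presheaf, V.isSheaf⟩ : TopCat.Sheaf Ab _)
    N W (fun x => homOfLE (i x))
    (fun x hxW => Opens.mem_iSup.2 (hc x hxW)) s (fun j k => hs j k _ inf_le_left inf_le_right)
  exact this

end Sec

/-- A sheaf of modules from its modules of sections. -/
structure SecData (U : Man) : Type 1 where
  S : Opens U → Type
  [grp : ∀ W, AddCommGroup (S W)]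
  [mod : ∀ W, Module (Fn U W) (S W)]
  r : ∀ {W₁ W₂ : Opens U}, W₁ ≤ W₂ → S W₂ →+ S W₁
  r_smul : ∀ {W₁ W₂ : Opens U} (i : W₁ ≤ W₂) (a : Fn U W₂) (v : S W₂),
    r i (a • v) = resFn i a • r i v
  r_id : ∀ {W : Opens U} (v : S W), r le_rfl v = v
  r_r : ∀ {W₁ W₂ W₃ : Opens U} (i : W₁ ≤ W₂) (j : W₂ ≤ W₃) (v : S W₃),
    r i (r j v) = r (i.trans j) v
  glue : ∀ {W : Opens U} {ι : Type} (N : ι → Opens U) (i : ∀ j, N j ≤ W)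
    (_ : ∀ x ∈ W, ∃ j, x ∈ N j) (s : ∀ j, S (N j))
    (_ : ∀ j k (M : Opens U) (hj : M ≤ N j) (hk : M ≤ N k), r hj (s j) = r hk (s k)),
    ∃! v : S W, ∀ j, r (i j) v = s j

attribute [instance] SecData.grp SecData.mod

namespace SecData
variable {U : Man} (D : SecData U)

def presheaf : (Opens (TopCat.of U))ᵒᵖ ⥤ Ab.{0} where
  obj W := AddCommGrpCat.of (D.S W.unop)
  map i := AddCommGrpCat.ofHom (D.r i.unop.le)
  map_id W := by ext v; exact D.r_id v
  map_comp i j := by ext v; exact (D.r_r _ _ v).symm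

instance (W : (Opens (TopCat.of U))ᵒᵖ) : Module ((𝒪 U).obj.obj W) (D.presheaf.obj W) :=
  inferInstanceAs (Module (Fn U W.unop) (D.S W.unop))

def toModSheaf : ModSheaf U where
  val := PresheafOfModules.ofPresheaf D.presheaf (fun _ _ f a v => D.r_smul f.unop.le a v)
  isSheaf := by
    change TopCat.Presheaf.IsSheaf (X := TopCat.of U) D.presheaf
    rw [TopCat.Presheaf.isSheaf_iff_isSheaf_comp (forget Ab),
      TopCat.Presheaf.isSheaf_iff_isSheafUniqueGluing_types]
    intro ι N s hs
    exact D.glue N (fun j => le_iSup N j) (fun x hx => Opens.mem_iSup.1 hx) s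
      (fun j k M hj hk => by
        have := congrArg (D.r (le_inf hj hk)) (hs j k)
        exact ((D.r_r _ _ _).symm.trans this).trans (D.r_r _ _ _))

end SecData


/-! ### Pullback of sheaves of modules -/

/-- The continuous map underlying a smooth map. -/
def topHom {U U' : Man} (h : U ⟶ U') : TopCat.of U ⟶ TopCat.of U' :=
  TopCat.ofHom ⟨h, Man.cont_hom h⟩

instance {U U' : Man} (h : U ⟶ U') : (Opens.map (topHom h)).IsContinuous
    (Opens.grothendieckTopology (TopCat.of U')) (Opens.grothendieckTopology (TopCat.of U)) := by
  have (X Y : TopCat.{0}) (f : X ⟶ Y) : (Opens.map f).IsContinuous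
      (Opens.grothendieckTopology Y) (Opens.grothendieckTopology X) := inferInstance
  exact this _ _ _

/-- The morphism of sheaves of rings induced by a smooth map. -/
def comorphism {U U' : Man} (h : U ⟶ U') :
    𝒪 U' ⟶ ((Opens.map (topHom h)).sheafPushforwardContinuous RingCat.{0}
      (Opens.grothendieckTopology _) (Opens.grothendieckTopology _)).obj (𝒪 U) where
  hom := { app := fun W => RingCat.ofHom (pullFn h W.unop) }

instance {U U' : Man} (h : U ⟶ U') :
    (SheafOfModules.pushforward.{0} (comorphism h)).IsRightAdjoint := by
  have (C D : Type) [SmallCategory C] [SmallCategory D] (F : C ⥤ D) (R : Dᵒᵖ ⥤ RingCat.{0})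
      (S : Cᵒᵖ ⥤ RingCat.{0}) (φ : S ⟶ F.op ⋙ R) :
      (PresheafOfModules.pushforward.{0} φ).IsRightAdjoint := inferInstance
  have : (PresheafOfModules.pushforward.{0} (comorphism h).hom).IsRightAdjoint :=
    this _ _ (Opens.map (topHom h)) _ _ _
  infer_instance

/-- The direct image of a sheaf of modules. -/
abbrev pushMod {U U' : Man} (h : U ⟶ U') (V : ModSheaf U) : ModSheaf U' :=
  (SheafOfModules.pushforward.{0} (comorphism h)).obj V

/-- The inverse image `h⁻¹ V ⊗_{h⁻¹ 𝒪'} 𝒪` of a sheaf of modules, i.e. the value of the left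
adjoint of the direct image functor. -/
def pullMod {U U' : Man} (h : U ⟶ U') (V : ModSheaf U') : ModSheaf U :=
  (SheafOfModules.pullback.{0} (comorphism h)).obj V

/-- Morphisms from a sheaf of modules `V'` on `U'` to a sheaf of modules `V` on `U` over a smooth
map `h : U ⟶ U'`. -/
@[ext] structure Como {U U' : Man} (h : U ⟶ U') (V' : ModSheaf U') (V : ModSheaf U) : Type where
  app : ∀ W : Opens U', Sec V' W →+ Sec V (pre h W)
  smul : ∀ {W : Opens U'} (a : Fn U' W) (v : Sec V' W), app W (a • v) = pullFn h W a • app W v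
  nat : ∀ {W₁ W₂ : Opens U'} (i : W₁ ≤ W₂) (v : Sec V' W₂),
    app W₁ (Sec.res i v) = Sec.res (pre_mono h i) (app W₂ v)

namespace Como

/-- Morphisms over `h` as morphisms into the direct image. -/
def ofHom {U U' : Man} {h : U ⟶ U'} {V' : ModSheaf U'} {V : ModSheaf U}
    (f : V' ⟶ pushMod h V) : Como h V' V where
  app W := (f.val.app (op W)).hom.toAddMonoidHom
  smul {W} a v := (f.val.app (op W)).hom.map_smul a v
  nat i v := PresheafOfModules.naturality_apply f.val (homOfLE i).op v

def toHom {U U' : Man} {h : U ⟶ U'} {V' : ModSheaf U'} {V : ModSheaf U}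
    (κ : Como h V' V) : V' ⟶ pushMod h V where
  val :=
    { app := fun W => ModuleCat.ofHom (Y := (pushMod h V).val.obj W)
        { toFun := κ.app W.unop
          map_add' := map_add _
          map_smul' := fun a v => κ.smul a v }
      naturality := fun i => by
        ext v
        exact κ.nat i.unop.le v }

theorem toHom_ofHom {U U' : Man} {h : U ⟶ U'} {V' : ModSheaf U'} {V : ModSheaf U}
    (f : V' ⟶ pushMod h V) : toHom (ofHom f) = f := rfl

theorem ofHom_toHom {U U' : Man} {h : U ⟶ U'} {V' : ModSheaf U'} {V : ModSheaf U}
    (κ : Como h V' V) : ofHom κ.toHom = κ := rfl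

/-- The universal morphism into the inverse image. -/
def unit {U U' : Man} (h : U ⟶ U') (V : ModSheaf U') : Como h V (pullMod h V) :=
  ofHom ((SheafOfModules.pullbackPushforwardAdjunction (comorphism h)).unit.app V)

theorem existsUnique {U U' T : Man} {h : U ⟶ U'} {k : T ⟶ U} {V : ModSheaf U'} {Z : ModSheaf T}
    (κ : Como (k ≫ h) V Z) :
    ∃! μ : Como k (pullMod h V) Z, ∀ W v, μ.app _ ((unit h V).app W v) = κ.app W v := by
  let κ' : Como h V (pushMod k Z) := ⟨κ.app, κ.smul, κ.nat⟩
  let A := SheafOfModules.pullbackPushforwardAdjunction.{0} (comorphism h)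
  have key : ∀ f : pullMod h V ⟶ pushMod k Z,
      (∀ W v, (ofHom f).app _ ((unit h V).app W v) = κ.app W v) ↔
        A.homEquiv V (pushMod k Z) f = κ'.toHom := by
    intro f
    have hf : A.homEquiv V (pushMod k Z) f =
      A.unit.app V ≫ (SheafOfModules.pushforward (comorphism h)).map f := A.homEquiv_unit ..
    refine Iff.trans ?_ (Eq.congr_left hf.symm)
    constructor
    · intro H
      have : ofHom (A.unit.app V ≫ (SheafOfModules.pushforward (comorphism h)).map f) = κ' := by
        ext W v
        exact H W v
      exact congrArg toHom this
    · intro H W v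
      have := congrArg (fun g => (ofHom g).app W v) H
      exact this
  refine ⟨ofHom ((A.homEquiv V (pushMod k Z)).symm κ'.toHom), ?_, ?_⟩
  · exact (key _).2 (Equiv.apply_symm_apply _ _)
  · intro μ hμ
    have := (key μ.toHom).1 hμ
    have h2 : μ.toHom = (A.homEquiv V (pushMod k Z)).symm κ'.toHom := by
      rw [← this]
      exact (Equiv.symm_apply_apply (A.homEquiv V (pushMod k Z)) μ.toHom).symm
    exact congrArg ofHom h2


/-- The identity. -/
def id {U : Man} (V : ModSheaf U) : Como (𝟙 U) V V :=
  ⟨fun _ => AddMonoidHom.id _, fun _ _ => rfl, fun _ _ => rfl⟩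

/-- Composition. -/
def comp {U U' U'' : Man} {h : U' ⟶ U''} {k : U ⟶ U'} {V'' : ModSheaf U''} {V' : ModSheaf U'}
    {V : ModSheaf U} (κ : Como h V'' V') (μ : Como k V' V) : Como (k ≫ h) V'' V where
  app W := (μ.app (pre h W)).comp (κ.app W)
  smul {W} a v := (congrArg (μ.app (pre h W)) (κ.smul a v)).trans (μ.smul _ _)
  nat {W₁ _} i v := (congrArg (μ.app (pre h W₁)) (κ.nat i v)).trans (μ.nat _ _)

section ext
variable {U U' : Man} {h : U ⟶ U'} {V : ModSheaf U'} {Z : ModSheaf U}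

/-- The extension of a morphism over `h` to the inverse image. -/
def ext' (κ : Como h V Z) : Como (𝟙 U) (pullMod h V) Z :=
  (existsUnique (k := 𝟙 U) (h := h) κ).choose

theorem ext'_unit (κ : Como h V Z) (W : Opens U') (v : Sec V W) :
    (ext' κ).app (pre h W) ((unit h V).app W v) = κ.app W v :=
  (existsUnique (k := 𝟙 U) (h := h) κ).choose_spec.1 W v

theorem pull_induction (P : ∀ N : Opens U, Sec (pullMod h V) N → Prop)
    (hloc : ∀ N s, (∀ x ∈ N, ∃ (M : Opens U) (i : M ≤ N), x ∈ M ∧ P M (Sec.res i s)) → P N s)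
    (hadd : ∀ N s t, P N s → P N t → P N (s + t))
    (hsmul : ∀ N (a : Fn U N) s, P N s → P N (a • s))
    (hunit : ∀ W v N (i : N ≤ pre h W), P N (Sec.res i ((unit h V).app W v)))
    (N : Opens U) (s : Sec (pullMod h V) N) : P N s := by
  have hzero : ∀ N, P N 0 := fun N => by
    simpa using hunit ⊤ 0 N (fun _ _ => trivial)
  let G (N : Opens U) : Submodule (Fn U N) (Sec (pullMod h V) N) :=
    { carrier := {s | ∀ (M : Opens U) (i : M ≤ N), P M (Sec.res i s)}
      add_mem' := fun hs ht M i => by rw [map_add]; exact hadd _ _ _ (hs M i) (ht M i)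
      zero_mem' := fun M i => by rw [map_zero]; exact hzero M
      smul_mem' := fun a s hs M i => by rw [Sec.res_smul]; exact hsmul _ _ _ (hs M i) }
  have hres : ∀ {N₁ N₂ : Opens U} (i : N₁ ≤ N₂) (s), s ∈ G N₂ → Sec.res i s ∈ G N₁ :=
    fun i s hs M j => by rw [Sec.res_res]; exact hs M _
  let D : SecData U :=
    { S := fun N => G N
      r := fun i => (((Sec.res i).comp (G _).subtype.toAddMonoidHom).codRestrict
        (G _).toAddSubgroup (fun s => hres i _ s.2))
      r_smul := fun i a s => Subtype.ext (Sec.res_smul i a s.1)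
      r_id := fun s => Subtype.ext (Sec.res_id s.1)
      r_r := fun i j s => Subtype.ext (Sec.res_res i j s.1)
      glue := fun {W ι} N i hc s hs => by
        obtain ⟨v, hv, hu⟩ := Sec.glue N i hc (fun j => (s j).1)
          (fun j k M hj hk => congrArg Subtype.val (hs j k M hj hk))
        refine ⟨⟨v, fun M hM => hloc _ _ fun x hx => ?_⟩, fun j => Subtype.ext (hv j),
          fun w hw => Subtype.ext (hu _ fun j => congrArg Subtype.val (hw j))⟩
        obtain ⟨j, hj⟩ := hc x (hM hx)
        refine ⟨M ⊓ N j, inf_le_left, ⟨hx, hj⟩, ?_⟩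
        rw [Sec.res_res, ← Sec.res_res inf_le_right (i j), hv j]
        exact (s j).2 _ _ }
  let κ : Como h V D.toModSheaf :=
    { app := fun W => ((unit h V).app W).codRestrict (G (pre h W)).toAddSubgroup
        (fun v M i => hunit W v M i)
      smul := fun a v => Subtype.ext ((unit h V).smul a v)
      nat := fun i v => Subtype.ext ((unit h V).nat i v) }
  let ι : Como (𝟙 U) D.toModSheaf (pullMod h V) :=
    { app := fun N => (G N).subtype.toAddMonoidHom
      smul := fun a v => rfl
      nat := fun i v => rfl }
  have e : (ext' κ).comp ι = Como.id _ :=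
    (existsUnique (k := 𝟙 U) (unit h V)).unique
      (fun W v => congrArg Subtype.val (ext'_unit κ W v)) (fun W v => rfl)
  have e2 : (G N).subtype ((ext' κ).app N s) = s := congrArg (fun f => f.app N s) e
  have h3 : s ∈ G N := e2 ▸ ((ext' κ).app N s : G N).2
  simpa using h3 N le_rfl

end ext

/-- The sheaf `N' ↦ Z(N' ∩ N)`. -/
def cutMod {U : Man} (Z : ModSheaf U) (N : Opens U) : ModSheaf U :=
  SecData.toModSheaf
    { S := fun W => Sec Z (W ⊓ N)
      mod := fun W => Module.compHom _ (resFn (inf_le_left : W ⊓ N ≤ W))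
      r := fun i => Sec.res (inf_le_inf_right N i)
      r_smul := fun _ _ _ => Sec.res_smul _ _ _
      r_id := fun v => Sec.res_id v
      r_r := fun _ _ v => Sec.res_res _ _ v
      glue := fun {W ι} M i hc s hs => by
        refine Sec.glue (fun j => M j ⊓ N) (fun j => inf_le_inf_right N (i j))
          (fun x hx => (hc x hx.1).imp fun j hj => ⟨hj, hx.2⟩) s (fun j k K hj hk => ?_)
        have := congrArg (Sec.res (le_inf (le_inf (hj.trans inf_le_left) (hk.trans inf_le_left))
          (hj.trans inf_le_right))) (hs j k (M j ⊓ M k) inf_le_left inf_le_right)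
        rwa [Sec.res_res, Sec.res_res] at this }

/-- The structure sheaf as a sheaf of modules. -/
def fnMod (U : Man) : ModSheaf U := SheafOfModules.unit (𝒪 U)

/-- The same sheaf of abelian groups with the complex conjugate module structure. -/
def conjMod {U : Man} (Z : ModSheaf U) : ModSheaf U :=
  SecData.toModSheaf
    { S := fun W => Sec Z W
      mod := fun W => Module.compHom _ (starRingEnd (Fn U W))
      r := fun i => Sec.res i
      r_smul := fun _ _ _ => Sec.res_smul _ _ _
      r_id := fun v => Sec.res_id v
      r_r := fun _ _ v => Sec.res_res _ _ v
      glue := Sec.glue }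

theorem ext'_unique {U U' : Man} {h : U ⟶ U'} {V : ModSheaf U'} {Z : ModSheaf U}
    {μ μ' : Como (𝟙 U) (pullMod h V) Z}
    (H : ∀ (W : Opens U') (v : Sec V W),
      μ.app (pre h W) ((unit h V).app W v) = μ'.app (pre h W) ((unit h V).app W v)) : μ = μ' :=
  (existsUnique (k := 𝟙 U) (h := h) ((unit h V).comp μ')).unique H (fun _ _ => rfl)

/-- Linear morphisms with values in the sections over the intersection with `N`. -/
@[ext] structure CutLin {U : Man} (V Z : ModSheaf U) (N : Opens U) where
  app : ∀ W : Opens U, Sec V W →+ Sec Z (W ⊓ N)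
  smul : ∀ {W} (a : Fn U W) (v : Sec V W),
    app W (a • v) = resFn (inf_le_left : W ⊓ N ≤ W) a • app W v
  nat : ∀ {W₁ W₂ : Opens U} (i : W₁ ≤ W₂) (v : Sec V W₂),
    app W₁ (Sec.res i v) = Sec.res (inf_le_inf_right N i) (app W₂ v)

/-- The same over a smooth map. -/
structure CutComo {U U' : Man} (h : U ⟶ U') (V : ModSheaf U') (Z : ModSheaf U) (N : Opens U) where
  app : ∀ W : Opens U', Sec V W →+ Sec Z (pre h W ⊓ N)
  smul : ∀ {W} (a : Fn U' W) (v : Sec V W),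
    app W (a • v) = resFn (inf_le_left : pre h W ⊓ N ≤ pre h W) (pullFn h W a) • app W v
  nat : ∀ {W₁ W₂ : Opens U'} (i : W₁ ≤ W₂) (v : Sec V W₂),
    app W₁ (Sec.res i v) = Sec.res (inf_le_inf_right N (pre_mono h i)) (app W₂ v)

section
variable {U U' : Man} {h : U ⟶ U'} {V : ModSheaf U'} {Z : ModSheaf U} {N : Opens U}

def CutComo.toComo (κ : CutComo h V Z N) : Como h V (cutMod Z N) := ⟨κ.app, κ.smul, κ.nat⟩

/-- The extension to the inverse image. -/
def CutComo.ext (κ : CutComo h V Z N) : CutLin (pullMod h V) Z N :=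
  ⟨(ext' κ.toComo).app, (ext' κ.toComo).smul, (ext' κ.toComo).nat⟩

theorem CutComo.ext_unit (κ : CutComo h V Z N) (W : Opens U') (v : Sec V W) :
    κ.ext.app (pre h W) ((unit h V).app W v) = κ.app W v := ext'_unit κ.toComo W v

theorem CutLin.unique {μ μ' : CutLin (pullMod h V) Z N}
    (H : ∀ (W : Opens U') (v : Sec V W),
      μ.app (pre h W) ((unit h V).app W v) = μ'.app (pre h W) ((unit h V).app W v)) : μ = μ' := by
  have := ext'_unique (Z := cutMod Z N) (μ := ⟨μ.app, μ.smul, μ.nat⟩)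
    (μ' := ⟨μ'.app, μ'.smul, μ'.nat⟩) H
  exact CutLin.ext (congrArg Como.app this)

variable {V Z : ModSheaf U} {N : Opens U}

instance : Add (CutLin V Z N) where
  add κ μ :=
    { app := fun W => κ.app W + μ.app W
      smul := fun a v => by simp [κ.smul, μ.smul]
      nat := fun i v => by simp [κ.nat, μ.nat] }

theorem CutLin.add_app (κ μ : CutLin V Z N) (W : Opens U) (v : Sec V W) :
    (κ + μ).app W v = κ.app W v + μ.app W v := rfl

/-- Multiplication by a function. -/
def CutLin.scal (a : Fn U N) (κ : CutLin V Z N) : CutLin V Z N where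
  app W := (DistribSMul.toAddMonoidHom (Sec Z (W ⊓ N)) (resFn (inf_le_right : W ⊓ N ≤ N) a)).comp
    (κ.app W)
  smul b v := by simp [κ.smul, smul_comm (resFn _ a)]
  nat i v := by
    simp only [AddMonoidHom.comp_apply, κ.nat, DistribSMul.toAddMonoidHom_apply, Sec.res_smul]
    rfl

theorem CutLin.scal_app (a : Fn U N) (κ : CutLin V Z N) (W : Opens U) (v : Sec V W) :
    (κ.scal a).app W v = resFn (inf_le_right : W ⊓ N ≤ N) a • κ.app W v := rfl

/-- Restriction to a smaller open subset. -/
def CutLin.cut {N' : Opens U} (j : N' ≤ N) (κ : CutLin V Z N) : CutLin V Z N' where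
  app W := (Sec.res (inf_le_inf_left W j)).comp (κ.app W)
  smul b v := by
    simp only [AddMonoidHom.comp_apply, κ.smul, Sec.res_smul]
    rfl
  nat i v := by simp [κ.nat]

theorem CutLin.cut_app {N' : Opens U} (j : N' ≤ N) (κ : CutLin V Z N) (W : Opens U) (v : Sec V W) :
    (κ.cut j).app W v = Sec.res (inf_le_inf_left W j) (κ.app W v) := rfl

end

/-- Bilinear morphisms over `h`. -/
structure Bi {U U' : Man} (h : U ⟶ U') (V : ModSheaf U') (Z : ModSheaf U) where
  app : ∀ W : Opens U', Sec V W → Sec V W → Sec Z (pre h W)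
  add_left : ∀ {W} (v v' w : Sec V W), app W (v + v') w = app W v w + app W v' w
  add_right : ∀ {W} (v w w' : Sec V W), app W v (w + w') = app W v w + app W v w'
  smul_left : ∀ {W} (a : Fn U' W) (v w : Sec V W), app W (a • v) w = pullFn h W a • app W v w
  smul_right : ∀ {W} (a : Fn U' W) (v w : Sec V W), app W v (a • w) = pullFn h W a • app W v w
  nat : ∀ {W₁ W₂ : Opens U'} (i : W₁ ≤ W₂) (v w : Sec V W₂),
    app W₁ (Sec.res i v) (Sec.res i w) = Sec.res (pre_mono h i) (app W₂ v w)

namespace Bi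
variable {U U' : Man} {h : U ⟶ U'} {V : ModSheaf U'} {Z : ModSheaf U} (β : Bi h V Z)

theorem pre_inf (W W₀ : Opens U') : pre h W ⊓ pre h W₀ ≤ pre h (W ⊓ W₀) := fun _ hx => hx

def L₁ {W₀ : Opens U'} (v : Sec V W₀) : CutComo h V Z (pre h W₀) where
  app W := AddMonoidHom.mk' (fun w : Sec V W => Sec.res (pre_inf W W₀)
      (β.app (W ⊓ W₀) (Sec.res inf_le_right v) (Sec.res inf_le_left w)))
    (fun w w' => by rw [map_add, β.add_right, map_add])
  smul {W} a w := by
    simp only [AddMonoidHom.mk'_apply, Sec.res_smul, β.smul_right]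
    rfl
  nat {W₁ W₂} i w := by
    have := β.nat (inf_le_inf_right W₀ i) (Sec.res inf_le_right v) (Sec.res inf_le_left w)
    rw [Sec.res_res, Sec.res_res] at this
    simp only [AddMonoidHom.mk'_apply, Sec.res_res, this]

theorem L₁_app {W₀ : Opens U'} (v : Sec V W₀) (W : Opens U') (w : Sec V W) :
    (β.L₁ v).app W w = Sec.res (pre_inf W W₀)
      (β.app (W ⊓ W₀) (Sec.res inf_le_right v) (Sec.res inf_le_left w)) := rfl

def B₁ {W₀ : Opens U'} (v : Sec V W₀) : CutLin (pullMod h V) Z (pre h W₀) := (β.L₁ v).ext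

theorem B₁_unit {W₀ : Opens U'} (v : Sec V W₀) (W : Opens U') (w : Sec V W) :
    (β.B₁ v).app (pre h W) ((unit h V).app W w) = Sec.res (pre_inf W W₀)
      (β.app (W ⊓ W₀) (Sec.res inf_le_right v) (Sec.res inf_le_left w)) :=
  CutComo.ext_unit _ _ _

theorem B₁_add {W₀ : Opens U'} (v v' : Sec V W₀) : β.B₁ (v + v') = β.B₁ v + β.B₁ v' :=
  CutLin.unique fun W w => by
    simp only [CutLin.add_app, B₁_unit, map_add, β.add_left]

theorem B₁_smul {W₀ : Opens U'} (a : Fn U' W₀) (v : Sec V W₀) :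
    β.B₁ (a • v) = (β.B₁ v).scal (pullFn h W₀ a) :=
  CutLin.unique fun W w => by
    simp only [CutLin.scal_app, B₁_unit, Sec.res_smul, β.smul_left]
    rfl

theorem B₁_nat {W₀ W₁ : Opens U'} (j : W₁ ≤ W₀) (v : Sec V W₀) :
    β.B₁ (Sec.res j v) = (β.B₁ v).cut (pre_mono h j) :=
  CutLin.unique fun W w => by
    have := β.nat (inf_le_inf_left W j) (Sec.res inf_le_right v) (Sec.res inf_le_left w)
    rw [Sec.res_res, Sec.res_res] at this
    simp only [CutLin.cut_app, B₁_unit, Sec.res_res, this]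

def L₂ {N : Opens U} (s : Sec (pullMod h V) N) : CutComo h V Z N where
  app W := AddMonoidHom.mk' (fun v : Sec V W =>
      Sec.res (le_of_eq (inf_comm _ _)) ((β.B₁ v).app N s))
    (fun v v' => by simp only [B₁_add, CutLin.add_app, map_add])
  smul {W} a v := by
    simp only [AddMonoidHom.mk'_apply, B₁_smul, CutLin.scal_app, Sec.res_smul]
    rfl
  nat {W₁ W₂} i v := by
    simp only [AddMonoidHom.mk'_apply, B₁_nat, CutLin.cut_app, Sec.res_res]

def B₂ {N : Opens U} (s : Sec (pullMod h V) N) : CutLin (pullMod h V) Z N := (β.L₂ s).ext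

theorem B₂_unit {N : Opens U} (s : Sec (pullMod h V) N) (W : Opens U') (v : Sec V W) :
    (β.B₂ s).app (pre h W) ((unit h V).app W v) =
      Sec.res (le_of_eq (inf_comm _ _)) ((β.B₁ v).app N s) := CutComo.ext_unit _ _ _

theorem B₂_add {N : Opens U} (s t : Sec (pullMod h V) N) : β.B₂ (s + t) = β.B₂ s + β.B₂ t :=
  CutLin.unique fun W v => by
    simp only [CutLin.add_app, B₂_unit, map_add]

theorem B₂_smul {N : Opens U} (a : Fn U N) (s : Sec (pullMod h V) N) :
    β.B₂ (a • s) = (β.B₂ s).scal a :=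
  CutLin.unique fun W v => by
    simp only [CutLin.scal_app, B₂_unit, (β.B₁ v).smul, Sec.res_smul]
    rfl

theorem B₂_nat {N N' : Opens U} (j : N' ≤ N) (s : Sec (pullMod h V) N) :
    β.B₂ (Sec.res j s) = (β.B₂ s).cut j :=
  CutLin.unique fun W v => by
    simp only [CutLin.cut_app, B₂_unit, (β.B₁ v).nat, Sec.res_res]

/-- The extension of a bilinear morphism over `h` to the inverse image. -/
def ext {N : Opens U} (s t : Sec (pullMod h V) N) : Sec Z N :=
  Sec.res (le_inf le_rfl le_rfl) ((β.B₂ t).app N s)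

theorem ext_add_left {N : Opens U} (s s' t : Sec (pullMod h V) N) :
    β.ext (s + s') t = β.ext s t + β.ext s' t := by
  simp only [ext, map_add]

theorem ext_add_right {N : Opens U} (s t t' : Sec (pullMod h V) N) :
    β.ext s (t + t') = β.ext s t + β.ext s t' := by
  simp only [ext, B₂_add, CutLin.add_app, map_add]

theorem ext_zero_left {N : Opens U} (t : Sec (pullMod h V) N) : β.ext 0 t = 0 := by
  simp only [ext, map_zero]

theorem ext_smul_left {N : Opens U} (a : Fn U N) (s t : Sec (pullMod h V) N) :
    β.ext (a • s) t = a • β.ext s t := by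
  simp only [ext, (β.B₂ t).smul, Sec.res_smul]
  rfl

theorem ext_smul_right {N : Opens U} (a : Fn U N) (s t : Sec (pullMod h V) N) :
    β.ext s (a • t) = a • β.ext s t := by
  simp only [ext, B₂_smul, CutLin.scal_app, Sec.res_smul]
  rfl

theorem ext_zero_right {N : Opens U} (s : Sec (pullMod h V) N) : β.ext s 0 = 0 := by
  simpa using β.ext_smul_right (0 : Fn U N) s 0

theorem ext_res {N N' : Opens U} (i : N' ≤ N) (s t : Sec (pullMod h V) N) :
    β.ext (Sec.res i s) (Sec.res i t) = Sec.res i (β.ext s t) := by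
  simp only [ext, B₂_nat, CutLin.cut_app, (β.B₂ t).nat, Sec.res_res]

theorem ext_unit (W : Opens U') (v w : Sec V W) :
    β.ext ((unit h V).app W v) ((unit h V).app W w) = β.app W v w := by
  simp only [ext, B₂_unit, B₁_unit, Sec.res_res]
  have := β.nat (inf_le_left : W ⊓ W ≤ W) v w
  rw [this, Sec.res_res, Sec.res_id]

end Bi

/-- Conjugate linear morphisms. -/
@[ext] structure ConjLin {U : Man} (V Z : ModSheaf U) where
  app : ∀ W : Opens U, Sec V W →+ Sec Z W
  smul : ∀ {W} (a : Fn U W) (v : Sec V W), app W (a • v) = star a • app W v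
  nat : ∀ {W₁ W₂ : Opens U} (i : W₁ ≤ W₂) (v : Sec V W₂),
    app W₁ (Sec.res i v) = Sec.res i (app W₂ v)

/-- The same over a smooth map. -/
structure ConjComo {U U' : Man} (h : U ⟶ U') (V : ModSheaf U') (Z : ModSheaf U) where
  app : ∀ W : Opens U', Sec V W →+ Sec Z (pre h W)
  smul : ∀ {W} (a : Fn U' W) (v : Sec V W), app W (a • v) = star (pullFn h W a) • app W v
  nat : ∀ {W₁ W₂ : Opens U'} (i : W₁ ≤ W₂) (v : Sec V W₂),
    app W₁ (Sec.res i v) = Sec.res (pre_mono h i) (app W₂ v)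

section
variable {U U' : Man} {h : U ⟶ U'} {V : ModSheaf U'} {Z : ModSheaf U}

def ConjComo.toComo (κ : ConjComo h V Z) : Como h V (conjMod Z) := ⟨κ.app, κ.smul, κ.nat⟩

/-- The extension to the inverse image. -/
def ConjComo.ext (κ : ConjComo h V Z) : ConjLin (pullMod h V) Z :=
  ⟨(ext' κ.toComo).app, (ext' κ.toComo).smul, (ext' κ.toComo).nat⟩

theorem ConjComo.ext_unit (κ : ConjComo h V Z) (W : Opens U') (v : Sec V W) :
    κ.ext.app (pre h W) ((unit h V).app W v) = κ.app W v := ext'_unit κ.toComo W v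
end

section gens
variable {U U' : Man} {h : U ⟶ U'} {V : ModSheaf U'}

/-- The sections of the inverse image over `M` generated by the sections over `W`. -/
def gens {W : Opens U'} {M : Opens U} (j : M ≤ pre h W) : Submodule (Fn U M) (Sec (pullMod h V) M) :=
  Submodule.span _ (Set.range fun v => Sec.res j ((unit h V).app W v))

theorem gens_res {W W' : Opens U'} {M M' : Opens U} (j : M ≤ pre h W) (j' : M' ≤ pre h W')
    (i : M' ≤ M) (k : W' ≤ W) {s : Sec (pullMod h V) M} (hs : s ∈ gens j) :
    Sec.res i s ∈ gens j' := by
  induction hs using Submodule.span_induction with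
  | mem s hs =>
    obtain ⟨v, rfl⟩ := hs
    refine Submodule.subset_span ⟨Sec.res k v, ?_⟩
    simp only [(unit h V).nat, Sec.res_res]
  | zero => rw [map_zero]; exact Submodule.zero_mem _
  | add s t _ _ h₁ h₂ => rw [map_add]; exact Submodule.add_mem _ h₁ h₂
  | smul a s _ h₁ => rw [Sec.res_smul]; exact Submodule.smul_mem _ _ h₁

theorem local_gens (N : Opens U) (s : Sec (pullMod h V) N) : ∀ x ∈ N, ∃ (M : Opens U) (i : M ≤ N)
    (W : Opens U') (j : M ≤ pre h W), x ∈ M ∧ Sec.res i s ∈ gens j := by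
  induction N, s using pull_induction with
  | hloc N s H =>
    intro x hx
    obtain ⟨M, i, hxM, hM⟩ := H x hx
    obtain ⟨M', i', W, j, hxM', h'⟩ := hM x hxM
    exact ⟨M', i'.trans i, W, j, hxM', by rwa [Sec.res_res] at h'⟩
  | hadd N s t hs ht =>
    intro x hx
    obtain ⟨M, i, W, j, hxM, hM⟩ := hs x hx
    obtain ⟨M', i', W', j', hxM', hM'⟩ := ht x hx
    have J : M ⊓ M' ≤ pre h (W ⊓ W') := fun y hy => ⟨j hy.1, j' hy.2⟩
    refine ⟨M ⊓ M', inf_le_left.trans i, W ⊓ W', J, ⟨hxM, hxM'⟩, ?_⟩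
    have h₁ := gens_res j J inf_le_left inf_le_left hM
    have h₂ := gens_res j' J inf_le_right inf_le_right hM'
    rw [Sec.res_res] at h₁ h₂
    rw [map_add]
    exact Submodule.add_mem _ h₁ h₂
  | hsmul N a s hs =>
    intro x hx
    obtain ⟨M, i, W, j, hxM, hM⟩ := hs x hx
    exact ⟨M, i, W, j, hxM, by rw [Sec.res_smul]; exact Submodule.smul_mem _ _ hM⟩
  | hunit W v N i =>
    intro x hx
    exact ⟨N, le_rfl, W, i, hx, by rw [Sec.res_res]; exact Submodule.subset_span ⟨v, rfl⟩⟩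

theorem local_gens₃ (N : Opens U) (s t u : Sec (pullMod h V) N) (x : U) (hx : x ∈ N) :
    ∃ (M : Opens U) (i : M ≤ N) (W : Opens U') (j : M ≤ pre h W), x ∈ M ∧
      Sec.res i s ∈ gens j ∧ Sec.res i t ∈ gens j ∧ Sec.res i u ∈ gens j := by
  obtain ⟨M₁, i₁, W₁, j₁, hx₁, h₁⟩ := local_gens N s x hx
  obtain ⟨M₂, i₂, W₂, j₂, hx₂, h₂⟩ := local_gens N t x hx
  obtain ⟨M₃, i₃, W₃, j₃, hx₃, h₃⟩ := local_gens N u x hx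
  have J : M₁ ⊓ (M₂ ⊓ M₃) ≤ pre h (W₁ ⊓ (W₂ ⊓ W₃)) :=
    fun y hy => ⟨j₁ hy.1, j₂ hy.2.1, j₃ hy.2.2⟩
  have h₁ := gens_res j₁ J inf_le_left inf_le_left h₁
  have h₂ := gens_res j₂ J (inf_le_right.trans inf_le_left) (inf_le_right.trans inf_le_left) h₂
  have h₃ := gens_res j₃ J (inf_le_right.trans inf_le_right) (inf_le_right.trans inf_le_right) h₃
  rw [Sec.res_res] at h₁ h₂ h₃
  exact ⟨_, _, _, J, ⟨hx₁, hx₂, hx₃⟩, h₁, h₂, h₃⟩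

end gens
end Como

/-! ### Sheaves with involution, inner product sheaves and algebra sheaves -/

/-- A sheaf of modules with a complex conjugate linear involution. -/
structure StarSheaf (U : Man) : Type 1 where
  V : ModSheaf U
  st : ∀ {W : Opens U}, Sec V W → Sec V W
  st_add : ∀ {W} (v w : Sec V W), st (v + w) = st v + st w
  st_smul : ∀ {W} (a : Fn U W) (v : Sec V W), st (a • v) = star a • st v
  st_st : ∀ {W} (v : Sec V W), st (st v) = v
  res_st : ∀ {W₁ W₂ : Opens U} (i : W₁ ≤ W₂) (v : Sec V W₂), Sec.res i (st v) = st (Sec.res i v)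

/-- A sheaf of modules with involution and a compatible symmetric bilinear pairing with values in
the structure sheaf. -/
structure IPSheaf (U : Man) : Type 1 extends StarSheaf U where
  pair : ∀ {W : Opens U}, Sec V W → Sec V W → Fn U W
  pair_add : ∀ {W} (v v' w : Sec V W), pair (v + v') w = pair v w + pair v' w
  pair_smul : ∀ {W} (a : Fn U W) (v w : Sec V W), pair (a • v) w = a * pair v w
  pair_symm : ∀ {W} (v w : Sec V W), pair v w = pair w v
  pair_st : ∀ {W} (v w : Sec V W), pair (st v) (st w) = star (pair v w)
  res_pair : ∀ {W₁ W₂ : Opens U} (i : W₁ ≤ W₂) (v w : Sec V W₂),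
    resFn i (pair v w) = pair (Sec.res i v) (Sec.res i w)

/-- A sheaf of associative unital `*`-algebras over the structure sheaf. -/
structure AlgSheaf (U : Man) : Type 1 extends StarSheaf U where
  mul : ∀ {W : Opens U}, Sec V W → Sec V W → Sec V W
  one : ∀ W : Opens U, Sec V W
  add_mul : ∀ {W} (v v' w : Sec V W), mul (v + v') w = mul v w + mul v' w
  mul_add : ∀ {W} (v w w' : Sec V W), mul v (w + w') = mul v w + mul v w'
  smul_mul : ∀ {W} (a : Fn U W) (v w : Sec V W), mul (a • v) w = a • mul v w
  mul_smul : ∀ {W} (a : Fn U W) (v w : Sec V W), mul v (a • w) = a • mul v w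
  mul_assoc : ∀ {W} (u v w : Sec V W), mul (mul u v) w = mul u (mul v w)
  one_mul : ∀ {W} (v : Sec V W), mul (one W) v = v
  mul_one : ∀ {W} (v : Sec V W), mul v (one W) = v
  st_mul : ∀ {W} (v w : Sec V W), st (mul v w) = mul (st w) (st v)
  res_mul : ∀ {W₁ W₂ : Opens U} (i : W₁ ≤ W₂) (v w : Sec V W₂),
    Sec.res i (mul v w) = mul (Sec.res i v) (Sec.res i w)
  res_one : ∀ {W₁ W₂ : Opens U} (i : W₁ ≤ W₂), Sec.res i (one W₂) = one W₁

/-- Morphisms of inner product sheaves over a smooth map. -/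
@[ext] structure IPComo {U U' : Man} (h : U ⟶ U') (A : IPSheaf U') (B : IPSheaf U) : Type extends
    Como h A.V B.V where
  st : ∀ {W} (v : Sec A.V W), app W (A.st v) = B.st (app W v)
  pair : ∀ {W} (v w : Sec A.V W), B.pair (app W v) (app W w) = pullFn h W (A.pair v w)

/-- Morphisms of `*`-algebra sheaves over a smooth map. -/
@[ext] structure AlgComo {U U' : Man} (h : U ⟶ U') (A : AlgSheaf U') (B : AlgSheaf U) : Type extends
    Como h A.V B.V where
  st : ∀ {W} (v : Sec A.V W), app W (A.st v) = B.st (app W v)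
  mul : ∀ {W} (v w : Sec A.V W), app W (A.mul v w) = B.mul (app W v) (app W w)
  one : ∀ W, app W (A.one W) = B.one (pre h W)

section pull
variable {U U' : Man} (h : U ⟶ U')
open Como

/-- The involution on the inverse image. -/
def StarSheaf.pullStar (A : StarSheaf U') : ConjComo h A.V (pullMod h A.V) where
  app W := AddMonoidHom.mk' (fun v => (unit h A.V).app W (A.st v))
    (fun v w => by rw [A.st_add, map_add])
  smul a v := by
    simp only [AddMonoidHom.mk'_apply, A.st_smul, (unit h A.V).smul]
    rfl
  nat i v := by simp only [AddMonoidHom.mk'_apply, ← A.res_st, (unit h A.V).nat]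

/-- The involution on the inverse image. -/
def StarSheaf.pst (A : StarSheaf U') {W : Opens U} : Sec (pullMod h A.V) W → Sec (pullMod h A.V) W :=
  (A.pullStar h).ext.app W

variable {h}

theorem StarSheaf.pst_add (A : StarSheaf U') {W : Opens U} (v w : Sec (pullMod h A.V) W) :
    A.pst h (v + w) = A.pst h v + A.pst h w := map_add _ _ _

theorem StarSheaf.pst_zero (A : StarSheaf U') {W : Opens U} :
    A.pst h (0 : Sec (pullMod h A.V) W) = 0 := map_zero _

theorem StarSheaf.pst_smul (A : StarSheaf U') {W : Opens U} (a : Fn U W)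
    (v : Sec (pullMod h A.V) W) : A.pst h (a • v) = star a • A.pst h v :=
  (A.pullStar h).ext.smul a v

theorem StarSheaf.res_pst (A : StarSheaf U') {W₁ W₂ : Opens U} (i : W₁ ≤ W₂)
    (v : Sec (pullMod h A.V) W₂) : Sec.res i (A.pst h v) = A.pst h (Sec.res i v) :=
  ((A.pullStar h).ext.nat i v).symm

theorem StarSheaf.pst_unit (A : StarSheaf U') (W : Opens U') (v : Sec A.V W) :
    A.pst h ((unit h A.V).app W v) = (unit h A.V).app W (A.st v) :=
  ConjComo.ext_unit _ _ _

theorem StarSheaf.pst_pst (A : StarSheaf U') {W : Opens U} (v : Sec (pullMod h A.V) W) :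
    A.pst h (A.pst h v) = v := by
  induction W, v using pull_induction with
  | hloc N s H =>
    refine Sec.eq_of_locally fun x hx => ?_
    obtain ⟨M, i, hxM, hM⟩ := H x hx
    exact ⟨M, i, hxM, by rw [A.res_pst, A.res_pst, hM]⟩
  | hadd N s t hs ht => rw [A.pst_add, A.pst_add, hs, ht]
  | hsmul N a s hs => rw [A.pst_smul, A.pst_smul, hs, star_star]
  | hunit W v N i => rw [← A.res_pst, ← A.res_pst, A.pst_unit, A.pst_unit, A.st_st]

variable (h) in
/-- The inverse image of a sheaf with involution. -/
def StarSheaf.pull (A : StarSheaf U') : StarSheaf U where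
  V := pullMod h A.V
  st := A.pst h
  st_add := A.pst_add
  st_smul := A.pst_smul
  res_st := A.res_pst
  st_st := A.pst_pst

variable (h) in
/-- The pulled back pairing. -/
def IPSheaf.pullPair (A : IPSheaf U') : Bi h A.V (fnMod U) where
  app W v w := pullFn h W (A.pair v w)
  add_left v v' w := by rw [A.pair_add]; exact map_add (pullFn h _) _ _
  add_right v w w' := by
    rw [A.pair_symm, A.pair_add, A.pair_symm w, A.pair_symm w']; exact map_add (pullFn h _) _ _
  smul_left a v w := by rw [A.pair_smul]; exact map_mul (pullFn h _) _ _
  smul_right a v w := by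
    rw [A.pair_symm, A.pair_smul, A.pair_symm w]; exact map_mul (pullFn h _) _ _
  nat i v w := by rw [← A.res_pair]; rfl

/-- The pulled back pairing as a function. -/
def IPSheaf.ppair (A : IPSheaf U') {N : Opens U} (s t : Sec (pullMod h A.V) N) : Fn U N :=
  (A.pullPair h).ext s t

section
variable (A : IPSheaf U') {N : Opens U} (s s' t t' : Sec (pullMod h A.V) N) (a : Fn U N)

theorem IPSheaf.ppair_add_left : A.ppair (s + s') t = A.ppair s t + A.ppair s' t :=
  Bi.ext_add_left _ _ _ _
theorem IPSheaf.ppair_add_right : A.ppair s (t + t') = A.ppair s t + A.ppair s t' :=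
  Bi.ext_add_right _ _ _ _
theorem IPSheaf.ppair_smul_left : A.ppair (a • s) t = a * A.ppair s t := Bi.ext_smul_left _ _ _ _
theorem IPSheaf.ppair_smul_right : A.ppair s (a • t) = a * A.ppair s t := Bi.ext_smul_right _ _ _ _
theorem IPSheaf.ppair_zero_left : A.ppair 0 t = 0 := Bi.ext_zero_left _ _
theorem IPSheaf.ppair_zero_right : A.ppair s 0 = 0 := Bi.ext_zero_right _ _
theorem IPSheaf.res_ppair {N' : Opens U} (i : N' ≤ N) :
    resFn i (A.ppair s t) = A.ppair (Sec.res i s) (Sec.res i t) :=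
  ((A.pullPair h).ext_res i s t).symm
theorem IPSheaf.ppair_unit {W : Opens U'} (v w : Sec A.V W) :
    A.ppair ((unit h A.V).app W v) ((unit h A.V).app W w) = pullFn h W (A.pair v w) :=
  Bi.ext_unit _ _ _ _
end

theorem fn_eq_of_locally {N : Opens U} {a b : Fn U N}
    (H : ∀ x ∈ N, ∃ (M : Opens U) (i : M ≤ N), x ∈ M ∧ resFn i a = resFn i b) : a = b :=
  Sec.eq_of_locally (V := fnMod U) H

theorem IPSheaf.ppair_symm (A : IPSheaf U') {N : Opens U} (s t : Sec (pullMod h A.V) N) :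
    A.ppair s t = A.ppair t s := by
  refine fn_eq_of_locally fun x hx => ?_
  obtain ⟨M, i, W, j, hxM, hs, ht, -⟩ := local_gens₃ N s t t x hx
  refine ⟨M, i, hxM, ?_⟩
  rw [A.res_ppair, A.res_ppair]
  generalize Sec.res i s = s at *
  generalize Sec.res i t = t at *
  induction hs using Submodule.span_induction with
  | mem s hs =>
    obtain ⟨v, rfl⟩ := hs
    induction ht using Submodule.span_induction with
    | mem s hs =>
      obtain ⟨w, rfl⟩ := hs
      rw [← A.res_ppair, ← A.res_ppair, A.ppair_unit, A.ppair_unit, A.pair_symm]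
    | zero => rw [A.ppair_zero_left, A.ppair_zero_right]
    | add s t _ _ h₁ h₂ => rw [A.ppair_add_left, A.ppair_add_right, h₁, h₂]
    | smul a s _ h₁ => rw [A.ppair_smul_left, A.ppair_smul_right, h₁]
  | zero => rw [A.ppair_zero_left, A.ppair_zero_right]
  | add s t _ _ h₁ h₂ => rw [A.ppair_add_left, A.ppair_add_right, h₁, h₂]
  | smul a s _ h₁ => rw [A.ppair_smul_left, A.ppair_smul_right, h₁]

theorem resFn_star {N M : Opens U} (i : M ≤ N) (a : Fn U N) : resFn i (star a) = star (resFn i a) :=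
  rfl

theorem pullFn_star {W : Opens U'} (a : Fn U' W) : pullFn h W (star a) = star (pullFn h W a) :=
  rfl

theorem IPSheaf.ppair_st (A : IPSheaf U') {N : Opens U} (s t : Sec (pullMod h A.V) N) :
    A.ppair (A.pst h s) (A.pst h t) = star (A.ppair s t) := by
  refine fn_eq_of_locally fun x hx => ?_
  obtain ⟨M, i, W, j, hxM, hs, ht, -⟩ := local_gens₃ N s t t x hx
  refine ⟨M, i, hxM, ?_⟩
  rw [resFn_star, A.res_ppair, A.res_ppair, A.res_pst, A.res_pst]
  generalize Sec.res i s = s at *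
  generalize Sec.res i t = t at *
  induction hs using Submodule.span_induction with
  | mem s hs =>
    obtain ⟨v, rfl⟩ := hs
    induction ht using Submodule.span_induction with
    | mem s hs =>
      obtain ⟨w, rfl⟩ := hs
      rw [← A.res_pst, ← A.res_pst, ← A.res_ppair, ← A.res_ppair, A.pst_unit, A.pst_unit,
        A.ppair_unit, A.ppair_unit, A.pair_st, pullFn_star, resFn_star]
    | zero => rw [A.pst_zero, A.ppair_zero_right, A.ppair_zero_right, star_zero]
    | add s t _ _ h₁ h₂ => rw [A.pst_add, A.ppair_add_right, A.ppair_add_right, h₁, h₂, star_add]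
    | smul a s _ h₁ => rw [A.pst_smul, A.ppair_smul_right, A.ppair_smul_right, h₁, star_mul']
  | zero => rw [A.pst_zero, A.ppair_zero_left, A.ppair_zero_left, star_zero]
  | add s t _ _ h₁ h₂ => rw [A.pst_add, A.ppair_add_left, A.ppair_add_left, h₁, h₂, star_add]
  | smul a s _ h₁ => rw [A.pst_smul, A.ppair_smul_left, A.ppair_smul_left, h₁, star_mul']

variable (h) in
/-- The inverse image of an inner product sheaf. -/
def IPSheaf.pull (A : IPSheaf U') : IPSheaf U where
  toStarSheaf := A.toStarSheaf.pull h
  pair := A.ppair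
  pair_add := A.ppair_add_left
  pair_smul a v w := A.ppair_smul_left v w a
  res_pair i v w := A.res_ppair v w i
  pair_symm := A.ppair_symm
  pair_st := A.ppair_st

variable (h) in
/-- The pulled back multiplication. -/
def AlgSheaf.pullMul (A : AlgSheaf U') : Bi h A.V (pullMod h A.V) where
  app W v w := (unit h A.V).app W (A.mul v w)
  add_left v v' w := by rw [A.add_mul, map_add]
  add_right v w w' := by rw [A.mul_add, map_add]
  smul_left a v w := by rw [A.smul_mul, (unit h A.V).smul]
  smul_right a v w := by rw [A.mul_smul, (unit h A.V).smul]
  nat i v w := by rw [← A.res_mul, (unit h A.V).nat]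

theorem AlgSheaf.pullMul_app (A : AlgSheaf U') (W : Opens U') (v w : Sec A.V W) :
    (A.pullMul h).app W v w = (unit h A.V).app W (A.mul v w) := rfl

section
variable (A : AlgSheaf U') {N : Opens U} (s t u : Sec (pullMod h A.V) N)

/-- The unit of the inverse image. -/
def AlgSheaf.pone (N : Opens U) : Sec (pullMod h A.V) N :=
  Sec.res (show N ≤ pre h ⊤ from fun _ _ => trivial) ((unit h A.V).app ⊤ (A.one ⊤))

theorem AlgSheaf.res_pone {N N' : Opens U} (i : N' ≤ N) :
    Sec.res i (A.pone (h := h) N) = A.pone N' := Sec.res_res (V := pullMod h A.V) _ _ _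

theorem AlgSheaf.pone_eq {W : Opens U'} (j : N ≤ pre h W) :
    A.pone (h := h) N = Sec.res j ((unit h A.V).app W (A.one W)) := by
  rw [← A.res_one (le_top : W ≤ ⊤), (unit h A.V).nat, Sec.res_res]
  rfl

theorem AlgSheaf.pmul_assoc : (A.pullMul h).ext ((A.pullMul h).ext s t) u =
    (A.pullMul h).ext s ((A.pullMul h).ext t u) := by
  refine Sec.eq_of_locally fun x hx => ?_
  obtain ⟨M, i, W, j, hxM, hs, ht, hu⟩ := local_gens₃ N s t u x hx
  refine ⟨M, i, hxM, ?_⟩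
  rw [← Bi.ext_res, ← Bi.ext_res, ← Bi.ext_res, ← Bi.ext_res]
  generalize Sec.res i s = s at *
  generalize Sec.res i t = t at *
  generalize Sec.res i u = u at *
  induction hs using Submodule.span_induction with
  | mem s hs =>
    obtain ⟨v, rfl⟩ := hs
    induction ht using Submodule.span_induction with
    | mem s hs =>
      obtain ⟨w, rfl⟩ := hs
      induction hu using Submodule.span_induction with
      | mem s hs =>
        obtain ⟨z, rfl⟩ := hs
        simp only [Bi.ext_res, Bi.ext_unit, AlgSheaf.pullMul_app, A.mul_assoc]
      | zero => simp only [Bi.ext_zero_right]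
      | add s t _ _ h₁ h₂ => simp only [Bi.ext_add_right, h₁, h₂]
      | smul a s _ h₁ => simp only [Bi.ext_smul_right, h₁]
    | zero => simp only [Bi.ext_zero_left, Bi.ext_zero_right]
    | add s t _ _ h₁ h₂ => simp only [Bi.ext_add_left, Bi.ext_add_right, h₁, h₂]
    | smul a s _ h₁ => simp only [Bi.ext_smul_left, Bi.ext_smul_right, h₁]
  | zero => simp only [Bi.ext_zero_left]
  | add s t _ _ h₁ h₂ => simp only [Bi.ext_add_left, h₁, h₂]
  | smul a s _ h₁ => simp only [Bi.ext_smul_left, h₁]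

theorem AlgSheaf.pone_mul : (A.pullMul h).ext (A.pone N) s = s := by
  refine Sec.eq_of_locally fun x hx => ?_
  obtain ⟨M, i, W, j, hxM, hs, -, -⟩ := local_gens₃ N s s s x hx
  refine ⟨M, i, hxM, ?_⟩
  rw [← Bi.ext_res, A.res_pone]
  generalize Sec.res i s = s at *
  induction hs using Submodule.span_induction with
  | mem s hs =>
    obtain ⟨v, rfl⟩ := hs
    rw [A.pone_eq j, Bi.ext_res, Bi.ext_unit, A.pullMul_app, A.one_mul]
  | zero => simp only [Bi.ext_zero_right]
  | add s t _ _ h₁ h₂ => simp only [Bi.ext_add_right, h₁, h₂]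
  | smul a s _ h₁ => simp only [Bi.ext_smul_right, h₁]

theorem AlgSheaf.pmul_one : (A.pullMul h).ext s (A.pone N) = s := by
  refine Sec.eq_of_locally fun x hx => ?_
  obtain ⟨M, i, W, j, hxM, hs, -, -⟩ := local_gens₃ N s s s x hx
  refine ⟨M, i, hxM, ?_⟩
  rw [← Bi.ext_res, A.res_pone]
  generalize Sec.res i s = s at *
  induction hs using Submodule.span_induction with
  | mem s hs =>
    obtain ⟨v, rfl⟩ := hs
    rw [A.pone_eq j, Bi.ext_res, Bi.ext_unit, A.pullMul_app, A.mul_one]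
  | zero => simp only [Bi.ext_zero_left]
  | add s t _ _ h₁ h₂ => simp only [Bi.ext_add_left, h₁, h₂]
  | smul a s _ h₁ => simp only [Bi.ext_smul_left, h₁]

theorem AlgSheaf.pst_mul : A.pst h ((A.pullMul h).ext s t) =
    (A.pullMul h).ext (A.pst h t) (A.pst h s) := by
  refine Sec.eq_of_locally fun x hx => ?_
  obtain ⟨M, i, W, j, hxM, hs, ht, -⟩ := local_gens₃ N s t t x hx
  refine ⟨M, i, hxM, ?_⟩
  rw [StarSheaf.res_pst, ← Bi.ext_res, ← Bi.ext_res, StarSheaf.res_pst, StarSheaf.res_pst]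
  generalize Sec.res i s = s at *
  generalize Sec.res i t = t at *
  induction hs using Submodule.span_induction with
  | mem s hs =>
    obtain ⟨v, rfl⟩ := hs
    induction ht using Submodule.span_induction with
    | mem s hs =>
      obtain ⟨w, rfl⟩ := hs
      simp only [Bi.ext_res, ← StarSheaf.res_pst, Bi.ext_unit, StarSheaf.pst_unit, A.pullMul_app,
        A.st_mul]
    | zero => simp only [StarSheaf.pst_zero, Bi.ext_zero_left, Bi.ext_zero_right]
    | add s t _ _ h₁ h₂ => simp only [StarSheaf.pst_add, Bi.ext_add_left, Bi.ext_add_right, h₁, h₂]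
    | smul a s _ h₁ => simp only [StarSheaf.pst_smul, Bi.ext_smul_left, Bi.ext_smul_right, h₁]
  | zero => simp only [StarSheaf.pst_zero, Bi.ext_zero_left, Bi.ext_zero_right]
  | add s t _ _ h₁ h₂ => simp only [StarSheaf.pst_add, Bi.ext_add_left, Bi.ext_add_right, h₁, h₂]
  | smul a s _ h₁ => simp only [StarSheaf.pst_smul, Bi.ext_smul_left, Bi.ext_smul_right, h₁]

end

variable (h) in
/-- The inverse image of a sheaf of `*`-algebras. -/
def AlgSheaf.pull (A : AlgSheaf U') : AlgSheaf U where
  toStarSheaf := A.toStarSheaf.pull h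
  mul := (A.pullMul h).ext
  one := A.pone
  add_mul := Bi.ext_add_left _
  mul_add := Bi.ext_add_right _
  smul_mul := Bi.ext_smul_left _
  mul_smul := Bi.ext_smul_right _
  res_mul i v w := ((A.pullMul h).ext_res i v w).symm
  res_one := A.res_pone
  mul_assoc := A.pmul_assoc
  one_mul := A.pone_mul
  mul_one := A.pmul_one
  st_mul := A.pst_mul

end pull

/-- A family of categories over a category `B` in which every object can be pushed forward along
every morphism of `B`, presented by heteromorphisms `Hom f x y` over the morphisms `f` of `B`
together with universal heteromorphisms `unit f x` out of every object. -/
structure PushSystem (B : Type 1) [Category.{0} B] where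
  Obj : B → Type 1
  Hom : ∀ {b c : B}, (b ⟶ c) → Obj b → Obj c → Type
  id : ∀ {b : B} (x : Obj b), Hom (𝟙 b) x x
  comp : ∀ {b c d : B} {f : b ⟶ c} {g : c ⟶ d} {k : b ⟶ d} {x : Obj b} {y : Obj c} {z : Obj d},
    f ≫ g = k → Hom f x y → Hom g y z → Hom k x z
  id_comp : ∀ {b c : B} {f : b ⟶ c} {x : Obj b} {y : Obj c} (u : Hom f x y),
    comp (Category.id_comp f) (id x) u = u
  comp_id : ∀ {b c : B} {f : b ⟶ c} {x : Obj b} {y : Obj c} (u : Hom f x y),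
    comp (Category.comp_id f) u (id y) = u
  assoc : ∀ {a b c d : B} {f : a ⟶ b} {g : b ⟶ c} {h : c ⟶ d} {fg : a ⟶ c} {gh : b ⟶ d}
    {k : a ⟶ d} {w : Obj a} {x : Obj b} {y : Obj c} {z : Obj d} (e₁ : f ≫ g = fg)
    (e₂ : fg ≫ h = k) (e₃ : g ≫ h = gh) (e₄ : f ≫ gh = k)
    (u : Hom f w x) (v : Hom g x y) (t : Hom h y z),
    comp e₂ (comp e₁ u v) t = comp e₄ u (comp e₃ v t)
  push : ∀ {b c : B}, (b ⟶ c) → Obj b → Obj c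
  unit : ∀ {b c : B} (f : b ⟶ c) (x : Obj b), Hom f x (push f x)
  existsUnique : ∀ {b c d : B} {f : b ⟶ c} {g : c ⟶ d} {k : b ⟶ d} (e : f ≫ g = k) {x : Obj b}
    {z : Obj d} (u : Hom k x z), ∃! v : Hom g (push f x) z, comp e (unit f x) v = u

namespace PushSystem
variable {B : Type 1} [Category.{0} B] (S : PushSystem B)

/-- The fibre category over `b`. -/
instance (b : B) : Category (S.Obj b) where
  Hom x y := S.Hom (𝟙 b) x y
  id x := S.id x
  comp u v := S.comp (Category.comp_id (𝟙 b)) u v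
  id_comp u := S.id_comp u
  comp_id u := S.comp_id u
  assoc u v w := S.assoc _ _ _ _ u v w

section
variable {S} {b c d : B} {f : b ⟶ c} {g : c ⟶ d} {k : b ⟶ d} {x y z : S.Obj b} {x' y' : S.Obj c}
  {z' : S.Obj d}

/-- The factorization of a heteromorphism through the universal one. -/
def lift (e : f ≫ g = k) (u : S.Hom k x z') : S.Hom g (S.push f x) z' :=
  (S.existsUnique e u).choose

theorem fac (e : f ≫ g = k) (u : S.Hom k x z') : S.comp e (S.unit f x) (lift e u) = u :=
  (S.existsUnique e u).choose_spec.1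

theorem hom_ext (e : f ≫ g = k) {u v : S.Hom g (S.push f x) z'}
    (H : S.comp e (S.unit f x) u = S.comp e (S.unit f x) v) : u = v :=
  (S.existsUnique e _).unique rfl H.symm

variable (S f g) in
/-- The action of the pushforward on morphisms. -/
def mapHom (u : S.Hom (𝟙 b) x y) : S.Hom (𝟙 c) (S.push f x) (S.push f y) :=
  lift (Category.comp_id f) (S.comp (Category.id_comp f) u (S.unit f y))

theorem unit_map (e : f ≫ 𝟙 c = f) (u : S.Hom (𝟙 b) x y) :
    S.comp e (S.unit f x) (S.mapHom f u) = S.comp (Category.id_comp f) u (S.unit f y) :=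
  fac _ _

theorem unit_map_comp {g : c ⟶ d} {k : b ⟶ d} (e₁ : f ≫ 𝟙 c = f) (e₂ : f ≫ g = k)
    (u : S.Hom (𝟙 b) x y) (v : S.Hom g (S.push f y) z') :
    S.comp e₂ (S.unit f x) (S.comp (Category.id_comp g) (S.mapHom f u) v) =
      S.comp (Category.id_comp k) u (S.comp e₂ (S.unit f y) v) := by
  rw [← S.assoc e₁ e₂, unit_map, S.assoc]

variable (S b) in
/-- The canonical map from the pushforward along an identity. -/
def idHom (x : S.Obj b) : S.Hom (𝟙 b) (S.push (𝟙 b) x) x := lift (Category.comp_id _) (S.id x)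

variable (S f g) in
/-- The canonical map from the pushforward along a composition. -/
def compHom (x : S.Obj b) : S.Hom (𝟙 d) (S.push (f ≫ g) x) (S.push g (S.push f x)) :=
  lift (Category.comp_id (f ≫ g)) (S.comp rfl (S.unit f x) (S.unit g (S.push f x)))

variable (S f g) in
/-- The canonical map to the pushforward along a composition. -/
def compInv (x : S.Obj b) : S.Hom (𝟙 d) (S.push g (S.push f x)) (S.push (f ≫ g) x) :=
  lift (Category.comp_id g) (lift rfl (S.unit (f ≫ g) x))

theorem unit_id (e : 𝟙 b ≫ 𝟙 b = 𝟙 b) (x : S.Obj b) :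
    S.comp e (S.unit (𝟙 b) x) (S.idHom b x) = S.id x := fac _ _

theorem unit_comp (e : (f ≫ g) ≫ 𝟙 d = f ≫ g) (x : S.Obj b) :
    S.comp e (S.unit (f ≫ g) x) (S.compHom f g x) =
      S.comp rfl (S.unit f x) (S.unit g (S.push f x)) := fac _ _

theorem unit_comp_inv (e : g ≫ 𝟙 d = g) (x : S.Obj b) :
    S.comp (f := f) rfl (S.unit f x) (S.comp e (S.unit g (S.push f x)) (S.compInv f g x)) =
      S.unit (f ≫ g) x := by
  rw [compInv, fac, fac]

local notation "⟪" u "," v "⟫" => PushSystem.comp _ (Category.comp_id _) u v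

theorem id_nat (u : S.Hom (𝟙 b) x y) :
    ⟪S.mapHom (𝟙 b) u, S.idHom b y⟫ = ⟪S.idHom b x, u⟫ := by
  apply hom_ext (Category.comp_id (𝟙 b))
  rw [unit_map_comp (Category.comp_id _), unit_id,
    ← S.assoc (Category.comp_id _) (Category.comp_id _), unit_id]
  exact (S.comp_id _).trans (S.id_comp _).symm

theorem id_hom_inv (x : S.Obj b) : ⟪S.idHom b x, S.unit (𝟙 b) x⟫ = S.id _ := by
  apply hom_ext (Category.comp_id (𝟙 b))
  rw [← S.assoc (Category.comp_id (𝟙 b)) (Category.comp_id (𝟙 b)), unit_id]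
  exact (S.id_comp _).trans (S.comp_id _).symm

theorem comp_hom_inv (x : S.Obj b) : ⟪S.compHom f g x, S.compInv f g x⟫ = S.id _ := by
  apply hom_ext (Category.comp_id (f ≫ g))
  rw [← S.assoc (Category.comp_id _) (Category.comp_id _), unit_comp,
    S.assoc rfl _ (Category.comp_id g) rfl, unit_comp_inv]
  exact (S.comp_id _).symm

theorem comp_inv_hom (x : S.Obj b) : ⟪S.compInv f g x, S.compHom f g x⟫ = S.id _ := by
  apply hom_ext (Category.comp_id g)
  apply hom_ext (f := f) rfl
  rw [S.comp_id, ← S.assoc (Category.comp_id _) (Category.comp_id _),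
    ← S.assoc rfl (Category.comp_id _), unit_comp_inv, unit_comp]

theorem comp_nat (u : S.Hom (𝟙 b) x y) :
    ⟪S.mapHom (f ≫ g) u, S.compHom f g y⟫ = ⟪S.compHom f g x, S.mapHom g (S.mapHom f u)⟫ := by
  apply hom_ext (Category.comp_id (f ≫ g))
  rw [unit_map_comp (Category.comp_id _), unit_comp,
    ← S.assoc (Category.comp_id _) (Category.comp_id _), unit_comp,
    S.assoc rfl _ (Category.comp_id g) rfl, unit_map, unit_map_comp (Category.comp_id _)]

theorem coh_left {f : b ⟶ c} (e : (𝟙 b ≫ f) ≫ 𝟙 c = f) (x : S.Obj b) :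
    S.comp e (S.unit (𝟙 b ≫ f) x) ⟪S.compHom (𝟙 b) f x, ⟪S.mapHom f (S.idHom b x), S.id _⟫⟫ =
      S.unit f x := by
  rw [S.comp_id, ← S.assoc (Category.comp_id _) e, unit_comp,
    S.assoc rfl _ (Category.comp_id _) (Category.id_comp f), unit_map,
    ← S.assoc (Category.comp_id _) (Category.id_comp f), unit_id, S.id_comp]

theorem coh_right {f : b ⟶ c} (e : (f ≫ 𝟙 c) ≫ 𝟙 c = f) (x : S.Obj b) :
    S.comp e (S.unit (f ≫ 𝟙 c) x) ⟪S.compHom f (𝟙 c) x, ⟪S.idHom c (S.push f x), S.id _⟫⟫ =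
      S.unit f x := by
  rw [S.comp_id, ← S.assoc (Category.comp_id _) e, unit_comp,
    S.assoc rfl _ (Category.comp_id _) (Category.comp_id f), unit_id, S.comp_id]

theorem coh_assoc {b₀ b₁ b₂ b₃ : B} {f : b₀ ⟶ b₁} {g : b₁ ⟶ b₂} {h : b₂ ⟶ b₃}
    (e : ((f ≫ g) ≫ h) ≫ 𝟙 b₃ = f ≫ g ≫ h) (x : S.Obj b₀) :
    S.comp e (S.unit ((f ≫ g) ≫ h) x) ⟪S.compHom (f ≫ g) h x, ⟪S.mapHom h (S.compHom f g x),
      ⟪S.id _, ⟪S.compInv g h (S.push f x), S.compInv f (g ≫ h) x⟫⟫⟫⟫ =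
        S.unit (f ≫ g ≫ h) x := by
  rw [S.id_comp, ← S.assoc (Category.comp_id _) e, unit_comp,
    S.assoc rfl _ (Category.comp_id _) (Category.assoc f g h),
    unit_map_comp (Category.comp_id _), ← S.assoc (Category.comp_id _) (Category.assoc f g h),
    unit_comp, S.assoc rfl _ rfl rfl, ← S.assoc (Category.comp_id _) (Category.comp_id _),
    ← S.assoc rfl (Category.comp_id _) _ _, unit_comp_inv, unit_comp_inv]

end

/-- The pushforward functor. -/
def pushFunctor {b c : B} (f : b ⟶ c) : S.Obj b ⥤ S.Obj c where
  obj x := S.push f x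
  map u := S.mapHom f u
  map_id x := by
    apply hom_ext (Category.comp_id f)
    exact (unit_map _ _).trans ((S.id_comp _).trans (S.comp_id _).symm)
  map_comp {x y z} u v := by
    apply hom_ext (Category.comp_id f)
    refine (unit_map _ _).trans ?_
    refine Eq.trans ?_ (S.assoc (Category.comp_id f) (Category.comp_id f) (Category.comp_id _)
      (Category.comp_id f) _ _ _)
    rw [unit_map, S.assoc _ _ (Category.comp_id f) (Category.id_comp f), unit_map]
    exact S.assoc _ _ _ _ _ _ _

/-- Pushing forward along an identity. -/
def pushId (b : B) : S.pushFunctor (𝟙 b) ≅ 𝟭 (S.Obj b) :=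
  NatIso.ofComponents
    (fun x =>
      { hom := S.idHom b x
        inv := S.unit (𝟙 b) x
        hom_inv_id := id_hom_inv x
        inv_hom_id := unit_id _ _ })
    (fun u => id_nat u)

/-- Pushing forward along a composition. -/
def pushComp {b c d : B} (f : b ⟶ c) (g : c ⟶ d) :
    S.pushFunctor (f ≫ g) ≅ S.pushFunctor f ⋙ S.pushFunctor g :=
  NatIso.ofComponents
    (fun x =>
      { hom := S.compHom f g x
        inv := S.compInv f g x
        hom_inv_id := comp_hom_inv x
        inv_hom_id := comp_inv_hom x })
    (fun u => comp_nat u)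

theorem unit_eqToHom {b c : B} {f f' : b ⟶ c} (e : f = f')
    (H : (S.pushFunctor f).toCatHom = (S.pushFunctor f').toCatHom) (x : S.Obj b) :
    S.comp ((Category.comp_id f).trans e) (S.unit f x) ((eqToHom H).toNatTrans.app x) =
      S.unit f' x := by
  subst e
  exact S.comp_id _

/-- The pseudofunctor with the given fibre categories and pushforwards. -/
def toPseudofunctor : LocallyDiscrete B ⥤ᵖ Cat.{0, 1} :=
  LocallyDiscrete.mkPseudofunctor (fun b => Cat.of (S.Obj b)) (fun f => (S.pushFunctor f).toCatHom)
    (fun b => Cat.Hom.isoMk (S.pushId b)) (fun f g => Cat.Hom.isoMk (S.pushComp f g))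
    (fun {b₀ b₁ b₂ b₃} f g h => by
      ext x
      apply hom_ext ((Category.comp_id _).trans (Category.assoc f g h))
      exact (coh_assoc _ x).trans (S.unit_eqToHom (Category.assoc f g h) _ x).symm)
    (fun {b c} f => by
      ext x
      apply hom_ext ((Category.comp_id _).trans (Category.id_comp _))
      exact (coh_left _ x).trans (S.unit_eqToHom (Category.id_comp f) _ x).symm)
    (fun {b c} f => by
      ext x
      apply hom_ext ((Category.comp_id _).trans (Category.comp_id _))
      exact (coh_right _ x).trans (S.unit_eqToHom (Category.comp_id f) _ x).symm)

end PushSystem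

/-! ### The pseudofunctors of inner product sheaves and of algebra sheaves -/

section lifts
open Como
variable {U U' T : Man} {h : U ⟶ U'} {k : T ⟶ U}

theorem st_lift {A : StarSheaf U'} {Z : StarSheaf T} (μ : Como k (pullMod h A.V) Z.V)
    (H : ∀ (W : Opens U') (v : Sec A.V W), μ.app (pre h W) ((unit h A.V).app W (A.st v)) =
      Z.st (μ.app (pre h W) ((unit h A.V).app W v))) (N : Opens U) (s : Sec (pullMod h A.V) N) :
    μ.app N (A.pst h s) = Z.st (μ.app N s) := by
  induction N, s using pull_induction with
  | hloc N s H' =>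
    refine Sec.eq_of_locally fun x hx => ?_
    obtain ⟨M, i, hxM, hM⟩ := H' (k x) hx
    exact ⟨pre k M, pre_mono k i, hxM, by rw [← μ.nat i, Z.res_st, ← μ.nat i, A.res_pst, hM]⟩
  | hadd N s t hs ht => rw [A.pst_add, map_add, map_add, Z.st_add, hs, ht]
  | hsmul N a s hs => rw [A.pst_smul, μ.smul, μ.smul, Z.st_smul, hs]; rfl
  | hunit W v N i => rw [← A.res_pst, A.pst_unit, μ.nat, μ.nat, ← Z.res_st, H]

theorem pair_lift {A : IPSheaf U'} {Z : IPSheaf T} (μ : Como k (pullMod h A.V) Z.V)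
    (H : ∀ (W : Opens U') (v w : Sec A.V W), Z.pair (μ.app (pre h W) ((unit h A.V).app W v))
      (μ.app (pre h W) ((unit h A.V).app W w)) = pullFn k (pre h W) (pullFn h W (A.pair v w)))
    (N : Opens U) (s t : Sec (pullMod h A.V) N) :
    Z.pair (μ.app N s) (μ.app N t) = pullFn k N (A.ppair s t) := by
  have pair_zero : ∀ (W : Opens T) (v : Sec Z.V W), Z.pair 0 v = 0 := fun W v => by
    simpa using Z.pair_smul 0 0 v
  refine fn_eq_of_locally fun x hx => ?_
  obtain ⟨M, i, W, j, hxM, hs, ht, -⟩ := local_gens₃ N s t t (k x) hx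
  refine ⟨pre k M, pre_mono k i, hxM, ?_⟩
  have e : resFn (pre_mono k i) (pullFn k N (A.ppair s t)) =
    pullFn k M (resFn i (A.ppair s t)) := rfl
  rw [Z.res_pair, e, A.res_ppair, ← μ.nat i, ← μ.nat i]
  generalize Sec.res i s = s at *
  generalize Sec.res i t = t at *
  induction hs using Submodule.span_induction with
  | mem s hs =>
    obtain ⟨v, rfl⟩ := hs
    induction ht using Submodule.span_induction with
    | mem s hs =>
      obtain ⟨w, rfl⟩ := hs
      dsimp only
      rw [← A.res_ppair, A.ppair_unit, μ.nat, μ.nat, ← Z.res_pair, H]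
      rfl
    | zero => rw [map_zero, Z.pair_symm, pair_zero, A.ppair_zero_right, map_zero]
    | add s t _ _ h₁ h₂ =>
      rw [map_add, Z.pair_symm, Z.pair_add, Z.pair_symm (μ.app M s), Z.pair_symm (μ.app M t),
        h₁, h₂, A.ppair_add_right, map_add]
    | smul a s _ h₁ =>
      rw [μ.smul, Z.pair_symm, Z.pair_smul, Z.pair_symm, h₁, A.ppair_smul_right, map_mul]
  | zero => rw [map_zero, pair_zero, A.ppair_zero_left, map_zero]
  | add s t _ _ h₁ h₂ => rw [map_add, Z.pair_add, h₁, h₂, A.ppair_add_left, map_add]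
  | smul a s _ h₁ => rw [μ.smul, Z.pair_smul, h₁, A.ppair_smul_left, map_mul]

theorem mul_lift {A : AlgSheaf U'} {Z : AlgSheaf T} (μ : Como k (pullMod h A.V) Z.V)
    (H : ∀ (W : Opens U') (v w : Sec A.V W), μ.app (pre h W) ((unit h A.V).app W (A.mul v w)) =
      Z.mul (μ.app (pre h W) ((unit h A.V).app W v)) (μ.app (pre h W) ((unit h A.V).app W w)))
    (N : Opens U) (s t : Sec (pullMod h A.V) N) :
    μ.app N ((A.pullMul h).ext s t) = Z.mul (μ.app N s) (μ.app N t) := by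
  have zero_mul : ∀ (W : Opens T) (v : Sec Z.V W), Z.mul 0 v = 0 := fun W v => by
    simpa using Z.smul_mul 0 0 v
  have mul_zero : ∀ (W : Opens T) (v : Sec Z.V W), Z.mul v 0 = 0 := fun W v => by
    simpa using Z.mul_smul 0 v 0
  refine Sec.eq_of_locally fun x hx => ?_
  obtain ⟨M, i, W, j, hxM, hs, ht, -⟩ := local_gens₃ N s t t (k x) hx
  refine ⟨pre k M, pre_mono k i, hxM, ?_⟩
  rw [← μ.nat i, ← Bi.ext_res, Z.res_mul, ← μ.nat i, ← μ.nat i]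
  generalize Sec.res i s = s at *
  generalize Sec.res i t = t at *
  induction hs using Submodule.span_induction with
  | mem s hs =>
    obtain ⟨v, rfl⟩ := hs
    induction ht using Submodule.span_induction with
    | mem s hs =>
      obtain ⟨w, rfl⟩ := hs
      dsimp only
      rw [Bi.ext_res, Bi.ext_unit, AlgSheaf.pullMul_app, μ.nat, μ.nat, μ.nat, ← Z.res_mul, H]
    | zero => simp only [map_zero, Bi.ext_zero_right, mul_zero]
    | add s t _ _ h₁ h₂ => simp only [map_add, Bi.ext_add_right, Z.mul_add, h₁, h₂]
    | smul a s _ h₁ => simp only [μ.smul, Bi.ext_smul_right, Z.mul_smul, h₁]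
  | zero => simp only [map_zero, Bi.ext_zero_left, zero_mul]
  | add s t _ _ h₁ h₂ => simp only [map_add, Bi.ext_add_left, Z.add_mul, h₁, h₂]
  | smul a s _ h₁ => simp only [μ.smul, Bi.ext_smul_left, Z.smul_mul, h₁]

end lifts

namespace IPComo
open Como

/-- The identity. -/
def id {U : Man} (A : IPSheaf U) : IPComo (𝟙 U) A A :=
  { Como.id A.V with st := fun _ => rfl, pair := fun _ _ => rfl }

/-- Composition. -/
def comp {U U' U'' : Man} {h : U' ⟶ U''} {k : U ⟶ U'} {A : IPSheaf U''} {B : IPSheaf U'}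
    {C : IPSheaf U} (κ : IPComo h A B) (μ : IPComo k B C) : IPComo (k ≫ h) A C :=
  { κ.toComo.comp μ.toComo with
    st := fun {W} v => (congrArg (μ.app (pre h W)) (κ.st v)).trans (μ.st _)
    pair := fun {W} v w => (μ.pair _ _).trans (congrArg (pullFn k (pre h W)) (κ.pair v w)) }

/-- The universal morphism into the inverse image. -/
def unit {U U' : Man} (h : U ⟶ U') (A : IPSheaf U') : IPComo h A (A.pull h) :=
  { Como.unit h A.V with
    st := fun {W} v => (A.pst_unit W v).symm
    pair := fun v w => A.ppair_unit v w }

theorem existsUnique {U U' T : Man} {h : U ⟶ U'} {k : T ⟶ U} {A : IPSheaf U'} {Z : IPSheaf T}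
    (κ : IPComo (k ≫ h) A Z) : ∃! μ : IPComo k (A.pull h) Z, (unit h A).comp μ = κ := by
  obtain ⟨μ, hμ, hu⟩ := Como.existsUnique (V := A.V) (Z := Z.V) κ.toComo
  refine ⟨{ μ with
    st := fun {N} s => st_lift (A := A.toStarSheaf) (Z := Z.toStarSheaf) μ
      (fun W v => by rw [hμ, hμ]; exact κ.st v) N s
    pair := fun {N} s t => pair_lift μ (fun W v w => by rw [hμ, hμ]; exact κ.pair v w) N s t },
    IPComo.ext (funext fun W => AddMonoidHom.ext fun v => hμ W v), fun ν hν => ?_⟩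
  have := hu ν.toComo fun W v => congrArg (fun f => f.app W v) hν
  exact IPComo.ext (congrArg Como.app this)

end IPComo

namespace AlgComo
open Como

/-- The identity. -/
def id {U : Man} (A : AlgSheaf U) : AlgComo (𝟙 U) A A :=
  { Como.id A.V with st := fun _ => rfl, mul := fun _ _ => rfl, one := fun _ => rfl }

/-- Composition. -/
def comp {U U' U'' : Man} {h : U' ⟶ U''} {k : U ⟶ U'} {A : AlgSheaf U''} {B : AlgSheaf U'}
    {C : AlgSheaf U} (κ : AlgComo h A B) (μ : AlgComo k B C) : AlgComo (k ≫ h) A C :=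
  { κ.toComo.comp μ.toComo with
    st := fun {W} v => (congrArg (μ.app (pre h W)) (κ.st v)).trans (μ.st _)
    mul := fun {W} v w => (congrArg (μ.app (pre h W)) (κ.mul v w)).trans (μ.mul _ _)
    one := fun W => (congrArg (μ.app (pre h W)) (κ.one W)).trans (μ.one _) }

/-- The universal morphism into the inverse image. -/
def unit {U U' : Man} (h : U ⟶ U') (A : AlgSheaf U') : AlgComo h A (A.pull h) :=
  { Como.unit h A.V with
    st := fun {W} v => (A.pst_unit W v).symm
    mul := fun {W} v w => ((A.pullMul h).ext_unit W v w).symm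
    one := fun W => ((A.pone_eq (h := h) (le_refl (pre h W))).trans (Sec.res_id _)).symm }

theorem existsUnique {U U' T : Man} {h : U ⟶ U'} {k : T ⟶ U} {A : AlgSheaf U'} {Z : AlgSheaf T}
    (κ : AlgComo (k ≫ h) A Z) : ∃! μ : AlgComo k (A.pull h) Z, (unit h A).comp μ = κ := by
  obtain ⟨μ, hμ, hu⟩ := Como.existsUnique (V := A.V) (Z := Z.V) κ.toComo
  refine ⟨{ μ with
    st := fun {N} s => st_lift (A := A.toStarSheaf) (Z := Z.toStarSheaf) μ
      (fun W v => by rw [hμ, hμ]; exact κ.st v) N s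
    mul := fun {N} s t => mul_lift μ (fun W v w => by rw [hμ, hμ, hμ]; exact κ.mul v w) N s t
    one := fun N => ?_ },
    AlgComo.ext (funext fun W => AddMonoidHom.ext fun v => hμ W v), fun ν hν => ?_⟩
  · have h₁ := (hμ ⊤ (A.one ⊤)).trans (κ.one ⊤)
    have h₂ : μ.app N (A.pone N) = Sec.res (show pre k N ≤ pre k (pre h ⊤) from fun _ _ => trivial)
      (μ.app (pre h ⊤) ((Como.unit h A.V).app ⊤ (A.one ⊤))) := μ.nat _ _
    exact h₂.trans ((congrArg _ h₁).trans (Z.res_one _))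
  · have := hu ν.toComo fun W v => congrArg (fun f => f.app W v) hν
    exact AlgComo.ext (congrArg Como.app this)

end AlgComo

/-- Inner product sheaves and their morphisms over smooth maps. -/
def ipSystem : PushSystem Manᵒᵖ where
  Obj U := IPSheaf U.unop
  Hom f A B := IPComo f.unop A B
  id A := IPComo.id A
  comp e κ μ := e ▸ κ.comp μ
  id_comp _ := rfl
  comp_id _ := rfl
  assoc e₁ e₂ e₃ e₄ u v t := by subst e₁ e₃ e₂; rfl
  push f A := A.pull f.unop
  unit f A := IPComo.unit f.unop A
  existsUnique e A Z κ := by subst e; exact IPComo.existsUnique κ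

/-- Sheaves of `*`-algebras and their morphisms over smooth maps. -/
def algSystem : PushSystem Manᵒᵖ where
  Obj U := AlgSheaf U.unop
  Hom f A B := AlgComo f.unop A B
  id A := AlgComo.id A
  comp e κ μ := e ▸ κ.comp μ
  id_comp _ := rfl
  comp_id _ := rfl
  assoc e₁ e₂ e₃ e₄ u v t := by subst e₁ e₃ e₂; rfl
  push f A := A.pull f.unop
  unit f A := AlgComo.unit f.unop A
  existsUnique e A Z κ := by subst e; exact AlgComo.existsUnique κ

/-- Prestacks of categories on manifolds. -/
abbrev Prestack : Type 2 := LocallyDiscrete Manᵒᵖ ⥤ᵖ Cat.{0, 1}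

/-- The prestack of inner product sheaves. -/
def IPVec : Prestack := ipSystem.toPseudofunctor

/-- The prestack of sheaves of `*`-algebras. -/
def StarAlg : Prestack := algSystem.toPseudofunctor

/-- The product of two prestacks. -/
def Prestack.prod (X Y : Prestack) : Prestack where
  obj b := Cat.of (X.obj b × Y.obj b)
  map f := ((X.map f).toFunctor.prod (Y.map f).toFunctor).toCatHom
  map₂ η := (NatTrans.prod (X.map₂ η).toNatTrans (Y.map₂ η).toNatTrans).toCatHom₂
  mapId b := Cat.Hom.isoMk <| NatIso.ofComponents
    (fun x => ((Cat.Hom.toNatIso (X.mapId b)).app x.1).prod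
      ((Cat.Hom.toNatIso (Y.mapId b)).app x.2))
    (fun u => Prod.ext ((X.mapId b).hom.toNatTrans.naturality u.1)
      ((Y.mapId b).hom.toNatTrans.naturality u.2))
  mapComp f g := Cat.Hom.isoMk <| NatIso.ofComponents
    (fun x => ((Cat.Hom.toNatIso (X.mapComp f g)).app x.1).prod
      ((Cat.Hom.toNatIso (Y.mapComp f g)).app x.2))
    (fun u => Prod.ext ((X.mapComp f g).hom.toNatTrans.naturality u.1)
      ((Y.mapComp f g).hom.toNatTrans.naturality u.2))
  map₂_id f := by
    ext x
    exact Prod.ext (congrArg (fun t => t.toNatTrans.app x.1) (X.map₂_id f))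
      (congrArg (fun t => t.toNatTrans.app x.2) (Y.map₂_id f))
  map₂_comp η θ := by
    ext x
    exact Prod.ext (congrArg (fun t => t.toNatTrans.app x.1) (X.map₂_comp η θ))
      (congrArg (fun t => t.toNatTrans.app x.2) (Y.map₂_comp η θ))
  map₂_whisker_left f _ _ η := by
    ext x
    exact Prod.ext (congrArg (fun t => t.toNatTrans.app x.1) (X.map₂_whisker_left f η))
      (congrArg (fun t => t.toNatTrans.app x.2) (Y.map₂_whisker_left f η))
  map₂_whisker_right η h := by
    ext x
    exact Prod.ext (congrArg (fun t => t.toNatTrans.app x.1) (X.map₂_whisker_right η h))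
      (congrArg (fun t => t.toNatTrans.app x.2) (Y.map₂_whisker_right η h))
  map₂_associator f g h := by
    ext x
    exact Prod.ext (congrArg (fun t => t.toNatTrans.app x.1) (X.map₂_associator f g h))
      (congrArg (fun t => t.toNatTrans.app x.2) (Y.map₂_associator f g h))
  map₂_left_unitor f := by
    ext x
    exact Prod.ext (congrArg (fun t => t.toNatTrans.app x.1) (X.map₂_left_unitor f))
      (congrArg (fun t => t.toNatTrans.app x.2) (Y.map₂_left_unitor f))
  map₂_right_unitor f := by
    ext x
    exact Prod.ext (congrArg (fun t => t.toNatTrans.app x.1) (X.map₂_right_unitor f))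
      (congrArg (fun t => t.toNatTrans.app x.2) (Y.map₂_right_unitor f))

/-! ### The quotient prestack of a point by a Lie group -/

section BG
variable {EG : Type} [NormedAddCommGroup EG] [NormedSpace ℝ EG] {HG : Type} [TopologicalSpace HG]
  (I : ModelWithCorners ℝ EG HG) (G : Type) [TopologicalSpace G] [ChartedSpace HG G] [Group G]
  [LieGroup I ∞ G]

/-- The category with one object and the smooth maps `U → G` as morphisms. -/
def BGObj (_ : ModelWithCorners ℝ EG HG) (_ : Type) (_ : Man) : Type 1 := PUnit

instance (U : Man) : Category (BGObj I G U) where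
  Hom _ _ := C^∞⟮𝓡 U.dim, U; I, G⟯
  id _ := (1 : C^∞⟮𝓡 U.dim, U; I, G⟯)
  comp f g := (g * f : C^∞⟮𝓡 U.dim, U; I, G⟯)
  id_comp f := mul_one f
  comp_id f := one_mul f
  assoc f g h := (mul_assoc h g f).symm

/-- The only object. -/
def BGObj.pt {U : Man} : BGObj I G U := PUnit.unit

/-- The pullback functor. -/
def BGObj.pull {U U' : Man} (h : U ⟶ U') : BGObj I G U' ⥤ BGObj I G U where
  obj _ := BGObj.pt I G
  map g := ContMDiffMap.comp (I'' := I) g h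
  map_id _ := rfl
  map_comp _ _ := rfl

/-- The prestack `[{*}/G]_pre`. -/
def quotPrestack : Prestack :=
  Functor.toPseudofunctor'
    { obj := fun U => Cat.of (BGObj I G U.unop)
      map := fun f => (BGObj.pull I G f.unop).toCatHom
      map_id := fun _ => rfl
      map_comp := fun _ _ => rfl : Manᵒᵖ ⥤ Cat.{0, 1} }

end BG

/-! ### Bundles of intervals -/

/-- The model space of the total space of a bundle of intervals. -/
abbrev TS (U : Man) : Type := EuclideanSpace ℝ (Fin U.dim) × ℝ

/-- The model of the total space of a bundle of intervals. -/
abbrev IT (U : Man) : ModelWithCorners ℝ (TS U) (TS U) := 𝓘(ℝ, TS U)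

/-- The model of the product of the base with the real line. -/
abbrev IP (U : Man) := (𝓡 U.dim).prod 𝓘(ℝ, ℝ)

/-- Smoothness of a local trivialization. -/
structure IsSmoothTriv {U : Man} {M : Type} [TopologicalSpace M] [ChartedSpace (TS U) M]
    {π : M → U} (e : Bundle.Trivialization ℝ π) : Prop where
  smooth : ContMDiffOn (IT U) (IP U) ∞ e e.source
  smooth_symm : ContMDiffOn (IP U) (IT U) ∞ e.toOpenPartialHomeomorph.symm e.target

/-- Locally trivial smooth fibre bundles whose typical fibre is an open interval; as all
non-empty open intervals are diffeomorphic to `ℝ`, the typical fibre is taken to be `ℝ`.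
The total space is automatically Hausdorff and second countable. -/
structure Bdl (U : Man) : Type 1 where
  carrier : Type
  [top : TopologicalSpace carrier]
  [charted : ChartedSpace (TS U) carrier]
  [smooth : IsManifold (IT U) ∞ carrier]
  π : carrier → U
  smooth_π : ContMDiff (IT U) (𝓡 U.dim) ∞ π
  triv : ∀ u : U, ∃ e : Bundle.Trivialization ℝ π, u ∈ e.baseSet ∧ IsSmoothTriv e

instance (U : Man) : CoeSort (Bdl U) Type := ⟨Bdl.carrier⟩

attribute [instance] Bdl.top Bdl.charted Bdl.smooth

namespace Bdl

theorem tgt {U : Man} {M : Type} [TopologicalSpace M] {π : M → U}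
    (e : Bundle.Trivialization ℝ π) {u : U} (t : ℝ) (hu : u ∈ e.baseSet) : (u, t) ∈ e.target :=
  e.mem_target.2 hu

theorem src {U : Man} {M : Type} [TopologicalSpace M] {π : M → U}
    (e : Bundle.Trivialization ℝ π) {m : M} {u : U} (hm : u = π m) (hu : u ∈ e.baseSet) :
    m ∈ e.source := e.mem_source.2 (hm ▸ hu)

theorem surj {U : Man} (X : Bdl U) (u : U) : ∃ m : X, X.π m = u := by
  obtain ⟨e, hu, -⟩ := X.triv u
  have hm := tgt e 0 hu
  exact ⟨e.toOpenPartialHomeomorph.symm (u, 0), e.proj_symm_apply hm⟩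

section pull
variable {U U' : Man} (h : U ⟶ U') (X : Bdl U')

/-- The total space of the pullback bundle. -/
def PB : Type := {p : U × X // h p.1 = X.π p.2}

namespace PB

instance : TopologicalSpace (PB h X) := instTopologicalSpaceSubtype

variable {h X}

/-- The projection of the pullback bundle. -/
def fst (p : PB h X) : U := p.1.1

/-- The canonical map to the original bundle. -/
def snd (p : PB h X) : X := p.1.2

theorem w (p : PB h X) : h p.fst = X.π p.snd := p.2

@[ext] theorem ext {p q : PB h X} (h₁ : p.fst = q.fst) (h₂ : p.snd = q.snd) : p = q :=
  Subtype.ext (Prod.ext h₁ h₂)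

theorem continuous_fst : Continuous (fst : PB h X → U) := _root_.continuous_fst.comp continuous_subtype_val

theorem continuous_snd : Continuous (snd : PB h X → X) := _root_.continuous_snd.comp continuous_subtype_val

/-- A point of the pullback bundle. -/
def mk (u : U) (m : X) (e : h u = X.π m) : PB h X := ⟨(u, m), e⟩

theorem surj (u : U) : ∃ p : PB h X, p.fst = u := by
  obtain ⟨m, hm⟩ := X.surj (h u)
  exact ⟨mk u m hm.symm, rfl⟩

variable (h) in
/-- The inverse of the pulled back trivialization. -/
def inv (e : Bundle.Trivialization ℝ X.π) (y : U × ℝ) : PB h X := by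
  classical
  exact if hy : h y.1 = X.π (e.toOpenPartialHomeomorph.symm (h y.1, y.2)) then mk y.1 _ hy else
    (surj (h := h) (X := X) y.1).choose

theorem inv_fst (e : Bundle.Trivialization ℝ X.π) (y : U × ℝ) : (inv h e y).fst = y.1 := by
  unfold inv
  split_ifs
  · rfl
  · exact (surj (h := h) (X := X) y.1).choose_spec

theorem inv_snd (e : Bundle.Trivialization ℝ X.π) {y : U × ℝ} (hy : h y.1 ∈ e.baseSet) :
    (inv h e y).snd = e.toOpenPartialHomeomorph.symm (h y.1, y.2) := by
  unfold inv
  rw [dif_pos]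
  · rfl
  · exact (e.proj_symm_apply (tgt e y.2 hy)).symm

/-- The inclusion into the product. -/
def val (p : PB h X) : U × X := (p.fst, p.snd)

theorem inducing_val : Topology.IsInducing (val : PB h X → U × X) :=
  Topology.IsInducing.subtypeVal

theorem mk_snd (e : Bundle.Trivialization ℝ X.π) {p : PB h X} (hp : h p.fst ∈ e.baseSet) :
    (h p.fst, (e p.snd).2) = e p.snd :=
  Prod.ext (p.w.trans (e.coe_fst' (p.w ▸ hp)).symm) rfl

variable (h) in
/-- The pulled back trivialization. -/
def triv (e : Bundle.Trivialization ℝ X.π) : Bundle.Trivialization ℝ (fst : PB h X → U) where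
  toFun p := (p.fst, (e p.snd).2)
  invFun := inv h e
  source := fst ⁻¹' (h ⁻¹' e.baseSet)
  target := (h ⁻¹' e.baseSet) ×ˢ univ
  baseSet := h ⁻¹' e.baseSet
  open_baseSet := e.open_baseSet.preimage (Man.cont_hom h)
  source_eq := rfl
  target_eq := rfl
  proj_toFun _ _ := rfl
  map_source' p hp := ⟨hp, trivial⟩
  map_target' y hy := by
    change h (inv h e y).fst ∈ e.baseSet
    rw [inv_fst]
    exact hy.1
  left_inv' p hp := by
    apply ext
    · exact inv_fst e _
    · refine (inv_snd e (y := (p.fst, (e p.snd).2)) hp).trans ?_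
      change e.toOpenPartialHomeomorph.symm (h p.fst, (e p.snd).2) = p.snd
      rw [mk_snd e hp]
      exact e.toOpenPartialHomeomorph.left_inv (src e p.w hp)
  right_inv' y hy := by
    refine Prod.ext (inv_fst e y) ?_
    change (e (inv h e y).snd).2 = y.2
    rw [inv_snd e hy.1]
    exact congrArg Prod.snd (e.apply_symm_apply (tgt e y.2 hy.1))
  open_source := (e.open_baseSet.preimage (Man.cont_hom h)).preimage continuous_fst
  open_target := (e.open_baseSet.preimage (Man.cont_hom h)).prod isOpen_univ
  continuousOn_toFun := by
    refine continuous_fst.continuousOn.prodMk (_root_.continuous_snd.comp_continuousOn ?_)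
    exact ContinuousOn.comp (f := snd) (t := e.source) e.toOpenPartialHomeomorph.continuousOn continuous_snd.continuousOn
      (fun p hp => src e p.w hp)
  continuousOn_invFun := by
    rw [inducing_val.continuousOn_iff]
    refine ContinuousOn.congr (f := fun y : U × ℝ =>
      (y.1, e.toOpenPartialHomeomorph.symm (h y.1, y.2))) ?_ ?_
    · refine _root_.continuous_fst.continuousOn.prodMk ?_
      refine e.toOpenPartialHomeomorph.continuousOn_symm.comp
        (((Man.cont_hom h).comp _root_.continuous_fst).prodMk _root_.continuous_snd).continuousOn ?_
      exact fun y hy => tgt e y.2 hy.1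
    · intro y hy
      exact Prod.ext (inv_fst e y) (inv_snd e hy.1)

theorem triv_apply (e : Bundle.Trivialization ℝ X.π) (p : PB h X) :
    triv h e p = (p.fst, (e p.snd).2) := rfl

theorem triv_symm (e : Bundle.Trivialization ℝ X.π) (y : U × ℝ) :
    (triv h e).toOpenPartialHomeomorph.symm y = inv h e y := rfl

/-- The charts of the pullback bundle. -/
def chart (e : Bundle.Trivialization ℝ X.π) (c : OpenPartialHomeomorph U (EuclideanSpace ℝ (Fin U.dim))) :
    OpenPartialHomeomorph (PB h X) (TS U) :=
  (triv h e).toOpenPartialHomeomorph.trans (c.prod (OpenPartialHomeomorph.refl ℝ))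

theorem chart_apply (e : Bundle.Trivialization ℝ X.π)
    (c : OpenPartialHomeomorph U (EuclideanSpace ℝ (Fin U.dim))) (p : PB h X) :
    chart e c p = (c p.fst, (e p.snd).2) := rfl

theorem chart_symm (e : Bundle.Trivialization ℝ X.π)
    (c : OpenPartialHomeomorph U (EuclideanSpace ℝ (Fin U.dim))) (y : TS U) :
    (chart (h := h) e c).symm y = inv h e (c.symm y.1, y.2) := rfl

theorem mem_source_chart (e : Bundle.Trivialization ℝ X.π)
    (c : OpenPartialHomeomorph U (EuclideanSpace ℝ (Fin U.dim))) (p : PB h X) :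
    p ∈ (chart (h := h) e c).source ↔ h p.fst ∈ e.baseSet ∧ p.fst ∈ c.source := by
  simp only [chart, OpenPartialHomeomorph.trans_source, mem_inter_iff, mem_preimage,
    OpenPartialHomeomorph.prod_source, mem_prod]
  refine and_congr (Iff.rfl) ⟨fun H => H.1, fun H => ⟨H, trivial⟩⟩

theorem mem_target_chart (e : Bundle.Trivialization ℝ X.π)
    (c : OpenPartialHomeomorph U (EuclideanSpace ℝ (Fin U.dim))) {y : TS U}
    (hy : y ∈ (chart (h := h) e c).target) : y.1 ∈ c.target ∧ h (c.symm y.1) ∈ e.baseSet := by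
  simp only [chart, OpenPartialHomeomorph.trans_target, mem_inter_iff, mem_preimage,
    OpenPartialHomeomorph.prod_target, mem_prod] at hy
  exact ⟨hy.1.1, hy.2.1⟩

instance : ChartedSpace (TS U) (PB h X) where
  atlas := {φ | ∃ e : Bundle.Trivialization ℝ X.π, IsSmoothTriv e ∧
    ∃ u : U, φ = chart e (chartAt _ u)}
  chartAt p := chart (X.triv (h p.fst)).choose (chartAt _ p.fst)
  mem_chart_source p := (mem_source_chart _ _ _).2
    ⟨(X.triv (h p.fst)).choose_spec.1, mem_chart_source _ _⟩
  chart_mem_atlas p := ⟨_, (X.triv (h p.fst)).choose_spec.2, _, rfl⟩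

theorem chart_eq (p : PB h X) : ∃ e : Bundle.Trivialization ℝ X.π, IsSmoothTriv e ∧
    h p.fst ∈ e.baseSet ∧ chartAt (TS U) p = chart e (chartAt _ p.fst) :=
  ⟨_, (X.triv (h p.fst)).choose_spec.2, (X.triv (h p.fst)).choose_spec.1, rfl⟩

/-- The map underlying the inverse of a chart. -/
theorem smooth_symm_snd {e : Bundle.Trivialization ℝ X.π} (he : IsSmoothTriv e) (u : U) :
    ContMDiffOn (IT U) (IT U') ∞
      (fun y : TS U => (inv h e ((chartAt _ u).symm y.1, y.2)).snd)
      (chart (h := h) e (chartAt _ u)).target := by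
  have h₁ : ContMDiffOn (IT U) (𝓡 U.dim) ∞ (fun y : TS U => (chartAt _ u).symm y.1)
      (chart (h := h) e (chartAt _ u)).target :=
    (contMDiffOn_chart_symm (n := ∞) (x := u)).comp
      (contDiff_fst.contMDiff).contMDiffOn (fun y hy => (mem_target_chart _ _ hy).1)
  have h₂ : ContMDiffOn (IT U) (IP U') ∞ (fun y : TS U => (h ((chartAt _ u).symm y.1), y.2))
      (chart (h := h) e (chartAt _ u)).target :=
    ((Man.smooth_hom h).comp_contMDiffOn h₁).prodMk (contDiff_snd.contMDiff).contMDiffOn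
  refine ContMDiffOn.congr (he.smooth_symm.comp h₂ ?_) ?_
  · intro y hy
    exact e.mem_target.2 (mem_target_chart _ _ hy).2
  · intro y hy
    exact inv_snd e (y := ((chartAt _ u).symm y.1, y.2)) (mem_target_chart _ _ hy).2

instance : IsManifold (IT U) ∞ (PB h X) := by
  refine isManifold_of_contDiffOn _ _ _ ?_
  rintro _ _ ⟨e, he, u, rfl⟩ ⟨e', he', u', rfl⟩
  simp only [modelWithCornersSelf_coe, modelWithCornersSelf_coe_symm, Function.id_comp,
    Function.comp_id, preimage_id, range_id, inter_univ]
  rw [← contMDiffOn_iff_contDiffOn]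
  have hs : ∀ y ∈ ((chart (h := h) e (chartAt _ u)).symm.trans (chart e' (chartAt _ u'))).source,
      y ∈ (chart (h := h) e (chartAt _ u)).target ∧
      (inv h e ((chartAt _ u).symm y.1, y.2)) ∈ (chart (h := h) e' (chartAt _ u')).source := by
    intro y hy
    exact hy
  have h₀ := (smooth_symm_snd (h := h) he u).mono (fun y hy => (hs y hy).1)
  have h₁ : ContMDiffOn (IT U) (𝓡 U.dim) ∞ (fun y : TS U => (chartAt _ u).symm y.1)
      (chart (h := h) e (chartAt _ u)).target :=
    (contMDiffOn_chart_symm (n := ∞) (x := u)).comp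
      (contDiff_fst.contMDiff).contMDiffOn (fun y hy => (mem_target_chart _ _ hy).1)
  refine ContMDiffOn.prodMk_space
    (f := fun y : TS U => chartAt _ u' (inv h e ((chartAt _ u).symm y.1, y.2)).fst)
    (g := fun y : TS U => (e' (inv h e ((chartAt _ u).symm y.1, y.2)).snd).2) ?_ ?_
  · simp only [inv_fst]
    refine (contMDiffOn_chart (n := ∞) (x := u')).comp (h₁.mono fun y hy => (hs y hy).1) ?_
    intro y hy
    have := ((mem_source_chart _ _ _).1 (hs y hy).2).2
    rwa [inv_fst] at this
  · refine contMDiff_snd.comp_contMDiffOn (he'.smooth.comp h₀ ?_)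
    intro y hy
    have h₃ := ((mem_source_chart _ _ _).1 (hs y hy).2).1
    rw [w] at h₃
    exact e'.mem_source.2 h₃

theorem smooth_fst : ContMDiff (IT U) (𝓡 U.dim) ∞ (fst : PB h X → U) := by
  intro p
  obtain ⟨e, he, hu, hc⟩ := chart_eq p
  have hp : p ∈ (chart (h := h) e (chartAt _ p.fst)).source := hc ▸ mem_chart_source _ p
  rw [contMDiffAt_iff_target]
  refine ⟨continuous_fst.continuousAt, ?_⟩
  have h₁ : ContMDiffOn (IT U) (IT U) ∞ (chart (h := h) e (chartAt _ p.fst))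
      (chart (h := h) e (chartAt _ p.fst)).source := hc ▸ contMDiffOn_chart (x := p)
  exact contDiff_fst.contMDiff.contMDiffAt.comp p
    (h₁.contMDiffAt ((chart e (chartAt _ p.fst)).open_source.mem_nhds hp))

theorem smooth_snd : ContMDiff (IT U) (IT U') ∞ (snd : PB h X → X) := by
  intro p
  obtain ⟨e, he, hu, hc⟩ := chart_eq p
  have hp : p ∈ (chart (h := h) e (chartAt _ p.fst)).source := hc ▸ mem_chart_source _ p
  have h₁ : ContMDiffOn (IT U) (IT U) ∞ (chart (h := h) e (chartAt _ p.fst))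
      (chart (h := h) e (chartAt _ p.fst)).source := hc ▸ contMDiffOn_chart (x := p)
  have h₂ := (smooth_symm_snd (h := h) he p.fst).comp h₁
    (fun q hq => (chart (h := h) e (chartAt _ p.fst)).map_source hq)
  refine ((h₂.congr ?_).contMDiffAt ((chart e (chartAt _ p.fst)).open_source.mem_nhds hp))
  intro q hq
  exact (congrArg snd ((chart (h := h) e (chartAt _ p.fst)).left_inv hq)).symm

theorem smooth_of_comp {E H N : Type} [NormedAddCommGroup E] [NormedSpace ℝ E]
    [TopologicalSpace H] {J : ModelWithCorners ℝ E H} [TopologicalSpace N] [ChartedSpace H N]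
    {f : N → PB h X} {s : Set N} (h₁ : ContMDiffOn J (𝓡 U.dim) ∞ (fun x => (f x).fst) s)
    (h₂ : ContMDiffOn J (IT U') ∞ (fun x => (f x).snd) s) : ContMDiffOn J (IT U) ∞ f s := by
  intro x hx
  obtain ⟨e, he, hu, hc⟩ := chart_eq (f x)
  rw [contMDiffWithinAt_iff_target]
  refine ⟨?_, ?_⟩
  · rw [inducing_val.continuousWithinAt_iff]
    exact (h₁ x hx).continuousWithinAt.prodMk (h₂ x hx).continuousWithinAt
  · have e₁ : (extChartAt (IT U) (f x) ∘ f) = fun y =>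
        (chartAt (EuclideanSpace ℝ (Fin U.dim)) (f x).fst (f y).fst, (e (f y).snd).2) := by
      funext y
      simp only [Function.comp_apply, extChartAt, hc]
      rfl
    rw [e₁]
    refine ContMDiffWithinAt.prodMk_space ?_ ?_
    · exact ((contMDiffOn_chart (n := ∞)).contMDiffAt
        ((chartAt _ (f x).fst).open_source.mem_nhds (mem_chart_source _ _))).comp_contMDiffWithinAt
        x (h₁ x hx)
    · have hm : (f x).snd ∈ e.source := e.mem_source.2 ((f x).w ▸ hu)
      have := (he.smooth.contMDiffAt (e.open_source.mem_nhds hm)).comp_contMDiffWithinAt x (h₂ x hx)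
      exact contMDiffAt_snd.comp_contMDiffWithinAt x this

theorem smooth_triv {e : Bundle.Trivialization ℝ X.π} (he : IsSmoothTriv e) :
    IsSmoothTriv (U := U) (triv h e) where
  smooth := by
    refine smooth_fst.contMDiffOn.prodMk (contMDiff_snd.comp_contMDiffOn
      (he.smooth.comp smooth_snd.contMDiffOn ?_))
    exact fun p hp => src e p.w hp
  smooth_symm := by
    refine smooth_of_comp ?_ ?_
    · exact contMDiff_fst.contMDiffOn.congr fun y hy => inv_fst e y
    · refine ContMDiffOn.congr (f := fun y : U × ℝ => e.toOpenPartialHomeomorph.symm (h y.1, y.2))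
        (he.smooth_symm.comp (((Man.smooth_hom h).comp contMDiff_fst).prodMk
          contMDiff_snd).contMDiffOn ?_) ?_
      · exact fun y hy => tgt e y.2 hy.1
      · exact fun y hy => inv_snd e hy.1

end PB

/-- The pullback bundle. -/
def pull : Bdl U where
  carrier := PB h X
  π := PB.fst
  smooth_π := PB.smooth_fst
  triv u := by
    obtain ⟨e, hu, he⟩ := X.triv (h u)
    exact ⟨PB.triv h e, hu, PB.smooth_triv he⟩

end pull
end Bdl

/-! ### Smooth families of one-dimensional spacetimes -/

/-- The vertical tangent spaces of a bundle of intervals. -/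
def Bdl.Vert {U : Man} (X : Bdl U) (m : X) : Submodule ℝ (TangentSpace (IT U) m) :=
  LinearMap.ker (mfderiv (IT U) (𝓡 U.dim) X.π m).toLinearMap

/-- The differential of the fibre coordinate of a local trivialization. -/
def Bdl.dcoord {U : Man} (X : Bdl U) (e : Bundle.Trivialization ℝ X.π) (m : X) :
    TangentSpace (IT U) m →L[ℝ] ℝ :=
  mfderiv (IT U) 𝓘(ℝ, ℝ) (fun m' : X => (e m').2) m

/-- Smooth families of one-dimensional spacetimes over `U`: bundles of intervals with a nowhere
vanishing smooth vertical one-form `E`. In a local trivialization with fibre coordinate `t`,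
smoothness means that `E = ρ dt` with a smooth function `ρ`. -/
structure LocObj (U : Man) : Type 1 extends Bdl U where
  E : ∀ m : toBdl, toBdl.Vert m →ₗ[ℝ] ℝ
  E_ne_zero : ∀ m, E m ≠ 0
  E_smooth : ∀ u : U, ∃ e : Bundle.Trivialization ℝ π, u ∈ e.baseSet ∧ IsSmoothTriv e ∧
    ∃ ρ : U × ℝ → ℝ, ContMDiffOn (IP U) 𝓘(ℝ, ℝ) ∞ ρ e.target ∧
      ∀ m ∈ e.source, ∀ v : toBdl.Vert m, E m v = ρ (e m) * toBdl.dcoord e m v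

instance (U : Man) : CoeSort (LocObj U) Type := ⟨fun X => X.carrier⟩

/-- Morphisms of smooth families of one-dimensional spacetimes: bundle maps over the identity which
are diffeomorphisms onto open subsets and preserve the vertical one-forms. -/
structure LocHom {U : Man} (X Y : LocObj U) : Type where
  toFun : X → Y
  smooth : ContMDiff (IT U) (IT U) ∞ toFun
  w : ∀ m, Y.π (toFun m) = X.π m
  isOpen : IsOpen (range toFun)
  smooth_inv : ∃ s : Y → X, ContMDiffOn (IT U) (IT U) ∞ s (range toFun) ∧ ∀ m, s (toFun m) = m
  form : ∀ (m : X) (v : X.Vert m) (v' : Y.Vert (toFun m)),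
    (v' : TangentSpace (IT U) (toFun m)) = mfderiv (IT U) (IT U) toFun m v →
      Y.E (toFun m) v' = X.E m v

@[ext] theorem LocHom.ext {U : Man} {X Y : LocObj U} {f g : LocHom X Y}
    (H : ∀ m, f.toFun m = g.toFun m) : f = g := by
  obtain ⟨f, _, _, _, _, _⟩ := f
  obtain ⟨g, _, _, _, _, _⟩ := g
  obtain rfl : f = g := funext H
  rfl

/-- A bundle map over the identity maps vertical vectors to vertical vectors. -/
theorem mem_vert {U : Man} {X Y : Bdl U} {f : X → Y} (hf : ContMDiff (IT U) (IT U) ∞ f)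
    (w : ∀ m, Y.π (f m) = X.π m) (m : X) (v : X.Vert m) :
    mfderiv (IT U) (IT U) f m v ∈ Y.Vert (f m) := by
  have h₁ : Y.π ∘ f = X.π := funext w
  have h₂ := mfderiv_comp_apply m (Y.smooth_π.mdifferentiableAt (by simp) (x := f m))
    (hf.mdifferentiableAt (by simp) (x := m)) (v : TangentSpace (IT U) m)
  rw [h₁] at h₂
  exact h₂.symm.trans v.2

instance (U : Man) : Category (LocObj U) where
  Hom X Y := LocHom X Y
  id X :=
    { toFun := fun m => m
      smooth := contMDiff_id
      w := fun _ => rfl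
      isOpen := by
        have : range (fun m : X => m) = univ := range_id
        rw [this]; exact isOpen_univ
      smooth_inv := ⟨fun m => m, contMDiff_id.contMDiffOn, fun _ => rfl⟩
      form := fun m v v' e => by
        have h₁ : mfderiv (IT U) (IT U) (fun m : X => m) m = ContinuousLinearMap.id ℝ _ :=
          mfderiv_id
        rw [h₁] at e
        exact congrArg _ (Subtype.ext e) }
  comp {X Y Z} f g :=
    { toFun := fun m => g.toFun (f.toFun m)
      smooth := g.smooth.comp f.smooth
      w := fun m => (g.w _).trans (f.w m)
      isOpen := by
        obtain ⟨s, hs, hsg⟩ := g.smooth_inv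
        have : range (fun m => g.toFun (f.toFun m)) = range g.toFun ∩ s ⁻¹' range f.toFun := by
          ext z
          constructor
          · rintro ⟨m, rfl⟩
            exact ⟨⟨_, rfl⟩, m, (hsg _).symm⟩
          · rintro ⟨⟨y, rfl⟩, m, hm⟩
            rw [hsg] at hm
            exact ⟨m, congrArg g.toFun hm⟩
        rw [this]
        exact hs.continuousOn.isOpen_inter_preimage g.isOpen f.isOpen
      smooth_inv := by
        obtain ⟨s, hs, hsg⟩ := g.smooth_inv
        obtain ⟨t, ht, htf⟩ := f.smooth_inv
        refine ⟨t ∘ s, ?_, fun m => by simp only [Function.comp_apply, hsg, htf]⟩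
        refine ht.comp (hs.mono ?_) ?_
        · rintro _ ⟨m, rfl⟩
          exact ⟨_, rfl⟩
        · rintro _ ⟨m, rfl⟩
          exact ⟨m, (hsg _).symm⟩
      form := fun m v v' e => by
        have h₂ : mfderiv (IT U) (IT U) (fun m => g.toFun (f.toFun m)) m v = _ :=
          mfderiv_comp_apply m (g.smooth.mdifferentiableAt (by simp) (x := f.toFun m))
            (f.smooth.mdifferentiableAt (by simp) (x := m)) (v : TangentSpace (IT U) m)
        rw [h₂] at e
        exact (g.form (f.toFun m) ⟨_, mem_vert f.smooth f.w m v⟩ v' e).trans (f.form m v _ rfl) }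
  id_comp _ := rfl
  comp_id _ := rfl
  assoc _ _ _ := rfl

theorem Bdl.exists_vert {U : Man} (X : Bdl U) {e : Bundle.Trivialization ℝ X.π}
    (he : IsSmoothTriv e) {m : X} (hm : m ∈ e.source) : ∃ v : X.Vert m, X.dcoord e m v = 1 := by
  set y := e m with hy
  have hyt : y ∈ e.target := e.toOpenPartialHomeomorph.map_source hm
  have hym : e.toOpenPartialHomeomorph.symm y = m := e.toOpenPartialHomeomorph.left_inv hm
  have hn : e.target ∈ 𝓝 y := e.open_target.mem_nhds hyt
  have hs : MDifferentiableAt (IP U) (IT U) e.toOpenPartialHomeomorph.symm y :=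
    (he.smooth_symm.contMDiffAt hn).mdifferentiableAt (by simp)
  have hd : MDifferentiableAt (IT U) 𝓘(ℝ, ℝ) (fun m' : X => (e m').2) m :=
    (contMDiffAt_snd.comp m (he.smooth.contMDiffAt (e.open_source.mem_nhds hm))).mdifferentiableAt
      (by simp)
  have hp : MDifferentiableAt (IT U) (𝓡 U.dim) X.π m := X.smooth_π.mdifferentiableAt (by simp)
  have h₁ : X.π ∘ e.toOpenPartialHomeomorph.symm =ᶠ[𝓝 y] Prod.fst := by
    filter_upwards [hn] with z hz
    exact e.proj_symm_apply hz
  have h₂ : (fun m' : X => (e m').2) ∘ e.toOpenPartialHomeomorph.symm =ᶠ[𝓝 y] Prod.snd := by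
    filter_upwards [hn] with z hz
    exact congrArg Prod.snd (e.apply_symm_apply hz)
  have h₃ := h₁.mfderiv_eq (I := IP U) (I' := 𝓡 U.dim)
  have h₄ := h₂.mfderiv_eq (I := IP U) (I' := 𝓘(ℝ, ℝ))
  rw [← hym] at hd hp
  rw [mfderiv_comp y hp hs, mfderiv_fst] at h₃
  rw [mfderiv_comp y hd hs, mfderiv_snd] at h₄
  let v₀ : TangentSpace (IP U) y := ((0 : EuclideanSpace ℝ (Fin U.dim)), (1 : ℝ))
  have h₅ := congrArg (fun L => L v₀) h₃
  have h₆ := congrArg (fun L => L v₀) h₄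
  rw [← hym]
  exact ⟨⟨mfderiv (IP U) (IT U) e.toOpenPartialHomeomorph.symm y v₀, h₅⟩, h₆⟩

namespace Bdl.PB
variable {U U' : Man} {h : U ⟶ U'} {X : Bdl U'}

theorem d_snd_mem (p : PB h X) {v : TangentSpace (IT U) p} (hv : v ∈ (X.pull h).Vert p) :
    (mfderiv (IT U) (IT U') (snd : PB h X → X) p).toLinearMap v ∈ X.Vert p.snd := by
  have h₁ : X.π ∘ (snd : PB h X → X) = h ∘ fst := funext fun q => q.w.symm
  have h₂ := mfderiv_comp_apply p (X.smooth_π.mdifferentiableAt (by simp) (x := p.snd))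
    (smooth_snd.mdifferentiableAt (by simp) (x := p)) v
  rw [h₁, mfderiv_comp_apply p ((Man.smooth_hom h).mdifferentiableAt (by simp))
    (smooth_fst.mdifferentiableAt (by simp))] at h₂
  have h₃ : mfderiv (IT U) (𝓡 U.dim) (fst : PB h X → U) p v = 0 := hv
  rw [h₃, map_zero] at h₂
  exact h₂.symm

/-- The vertical differential of the canonical map out of the pullback bundle. -/
def dsnd (p : PB h X) : (X.pull h).Vert p →ₗ[ℝ] X.Vert p.snd :=
  (mfderiv (IT U) (IT U') (snd : PB h X → X) p).toLinearMap.restrict (fun _ hv => d_snd_mem p hv)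

theorem dcoord_dsnd {e : Bundle.Trivialization ℝ X.π} (he : IsSmoothTriv e) {p : PB h X}
    (hp : p.snd ∈ e.source) (v : (X.pull h).Vert p) :
    X.dcoord e p.snd (dsnd p v) = (X.pull h).dcoord (triv h e) p v := by
  have hd : MDifferentiableAt (IT U') 𝓘(ℝ, ℝ) (fun m' : X => (e m').2) p.snd :=
    (contMDiffAt_snd.comp _ (he.smooth.contMDiffAt (e.open_source.mem_nhds hp))).mdifferentiableAt
      (by simp)
  exact (mfderiv_comp_apply p hd (smooth_snd.mdifferentiableAt (by simp) (x := p)) _).symm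

end Bdl.PB

namespace LocObj
open Bdl

variable {U U' : Man} (h : U ⟶ U') (X : LocObj U')

/-- The pullback of a smooth family of spacetimes. -/
def pull : LocObj U where
  toBdl := X.toBdl.pull h
  E p := (X.E (PB.snd p)).comp (PB.dsnd p)
  E_ne_zero p := by
    intro H
    obtain ⟨e, hu, he, ρ, hρ, hE⟩ := X.E_smooth (h (PB.fst p))
    have hp : PB.snd p ∈ e.source := src e (PB.w p) hu
    obtain ⟨v, hv⟩ := (X.toBdl.pull h).exists_vert (PB.smooth_triv he) (m := p)
      ((PB.triv h e).mem_source.2 hu)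
    have h₁ : X.E (PB.snd p) (PB.dsnd p v) = 0 := congrArg (fun L => L v) H
    rw [hE _ hp, PB.dcoord_dsnd he hp, hv, mul_one] at h₁
    refine X.E_ne_zero (PB.snd p) (LinearMap.ext fun v' => ?_)
    rw [hE _ hp, h₁, zero_mul]
    rfl
  E_smooth u := by
    obtain ⟨e, hu, he, ρ, hρ, hE⟩ := X.E_smooth (h u)
    refine ⟨PB.triv h e, hu, PB.smooth_triv he, fun y => ρ (h y.1, y.2), ?_, ?_⟩
    · refine ContMDiffOn.comp hρ (((Man.smooth_hom h).comp contMDiff_fst).prodMk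
        contMDiff_snd).contMDiffOn ?_
      exact fun y hy => tgt e y.2 hy.1
    · intro p hp v
      have hp' : PB.snd p ∈ e.source := src e (PB.w p) hp
      refine (hE _ hp' _).trans ?_
      rw [PB.dcoord_dsnd he hp']
      congr 2
      exact (PB.mk_snd e hp).symm

/-- The canonical map out of the total space of the pullback. -/
def bar : X.pull h → X := PB.snd

end LocObj

namespace LocObj
open Bdl

/-- Preservation of vertical one-forms by a map between total spaces over different bases. -/
def FormEq {U V : Man} (X : LocObj U) (Y : LocObj V) (f : X → Y) : Prop :=
  ∀ (m : X) (v : X.Vert m) (v' : Y.Vert (f m)),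
    (v' : TangentSpace (IT V) (f m)) = mfderiv (IT U) (IT V) f m v → Y.E (f m) v' = X.E m v

theorem FormEq.comp {U V W : Man} {X : LocObj U} {Y : LocObj V} {Z : LocObj W} {f : X → Y}
    {g : Y → Z} (hg : FormEq Y Z g) (hf : FormEq X Y f) (sg : ContMDiff (IT V) (IT W) ∞ g)
    (sf : ContMDiff (IT U) (IT V) ∞ f)
    (hv : ∀ m (v : X.Vert m), mfderiv (IT U) (IT V) f m v ∈ Y.Vert (f m)) :
    FormEq X Z (fun m => g (f m)) := by
  intro m v v' e
  have h₂ : mfderiv (IT U) (IT W) (fun m => g (f m)) m v = _ :=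
    mfderiv_comp_apply m (sg.mdifferentiableAt (by simp) (x := f m))
      (sf.mdifferentiableAt (by simp) (x := m)) (v : TangentSpace (IT U) m)
  rw [h₂] at e
  exact (hg (f m) ⟨_, hv m v⟩ v' e).trans (hf m v _ rfl)

theorem formEq_bar {U U' : Man} (h : U ⟶ U') (X : LocObj U') : FormEq (X.pull h) X (X.bar h) :=
  fun p v v' e => congrArg (X.E (X.bar h p)) (Subtype.ext e : v' = PB.dsnd p v)

theorem smooth_bar {U U' : Man} (h : U ⟶ U') (X : LocObj U') :
    ContMDiff (IT U) (IT U') ∞ (X.bar h) := PB.smooth_snd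

theorem formEq_pull {U U' V : Man} {h : U ⟶ U'} {X : LocObj U'} {Z : LocObj V}
    {f : Z → X.pull h} (sf : ContMDiff (IT V) (IT U) ∞ f)
    (hf : FormEq Z X (fun z => X.bar h (f z))) : FormEq Z (X.pull h) f := by
  intro z v v' e
  refine hf z v (PB.dsnd (f z) v') ?_
  have h₂ : mfderiv (IT V) (IT U') (fun z => X.bar h (f z)) z v = _ :=
    mfderiv_comp_apply z ((smooth_bar h X).mdifferentiableAt (by simp) (x := f z))
      (sf.mdifferentiableAt (by simp) (x := z)) (v : TangentSpace (IT V) z)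
  rw [h₂, ← e]
  rfl

theorem formEq_id {U : Man} (X : LocObj U) : FormEq X X (fun m => m) := (𝟙 X : LocHom X X).form

/-- Morphisms from diffeomorphisms. -/
def diffeo {U : Man} {X Y : LocObj U} (f : X → Y) (s : Y → X)
    (sf : ContMDiff (IT U) (IT U) ∞ f) (ss : ContMDiff (IT U) (IT U) ∞ s)
    (w : ∀ m, Y.π (f m) = X.π m) (h₁ : ∀ m, s (f m) = m) (h₂ : ∀ m, f (s m) = m)
    (hf : FormEq X Y f) : X ⟶ Y :=
  { toFun := f
    smooth := sf
    w := w
    isOpen := by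
      rw [(show Function.Surjective f from fun m => ⟨s m, h₂ m⟩).range_eq]
      exact isOpen_univ
    smooth_inv := ⟨s, ss.contMDiffOn, h₁⟩
    form := hf }

section
variable {U U' : Man} (h : U ⟶ U') {X Y : LocObj U'}

/-- The pullback of a morphism. -/
def pullMap (f : X ⟶ Y) : X.pull h ⟶ Y.pull h :=
  have sm : ContMDiff (IT U) (IT U) ∞ (fun p : PB h X.toBdl =>
      (PB.mk p.fst (f.toFun p.snd) (p.w.trans (f.w p.snd).symm) : PB h Y.toBdl)) := by
    rw [← contMDiffOn_univ]
    exact PB.smooth_of_comp PB.smooth_fst.contMDiffOn (f.smooth.comp PB.smooth_snd).contMDiffOn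
  have hr : range (fun p : PB h X.toBdl =>
      (PB.mk p.fst (f.toFun p.snd) (p.w.trans (f.w p.snd).symm) : PB h Y.toBdl)) =
      PB.snd ⁻¹' range f.toFun := by
    ext q
    constructor
    · rintro ⟨p, rfl⟩
      exact ⟨_, rfl⟩
    · rintro ⟨m, hm⟩
      refine ⟨PB.mk q.fst m (q.w.trans (hm ▸ f.w m)), PB.ext rfl hm⟩
  { toFun := fun p : PB h X.toBdl => PB.mk p.fst (f.toFun p.snd) (p.w.trans (f.w p.snd).symm)
    smooth := sm
    w := fun _ => rfl
    isOpen := by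
      refine Eq.mpr (congrArg _ hr) ?_
      exact f.isOpen.preimage PB.continuous_snd
    smooth_inv := by
      classical
      obtain ⟨s, hs, hsf⟩ := f.smooth_inv
      let t : PB h Y.toBdl → PB h X.toBdl := fun q =>
        if e : h q.fst = X.π (s q.snd) then PB.mk q.fst (s q.snd) e else
          (PB.surj (h := h) (X := X.toBdl) q.fst).choose
      have t₁ : ∀ q, (t q).fst = q.fst := by
        intro q
        by_cases e : h q.fst = X.π (s q.snd)
        · simp only [t, dif_pos e]; rfl
        · simp only [t, dif_neg e]; exact (PB.surj (h := h) (X := X.toBdl) q.fst).choose_spec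
      have t₂ : ∀ q : PB h Y.toBdl, q.snd ∈ range f.toFun → (t q).snd = s q.snd := by
        rintro q ⟨m, hm⟩
        have e : h q.fst = X.π (s q.snd) := by rw [q.w, ← hm, hsf, f.w]
        simp only [t, dif_pos e]; rfl
      refine ⟨t, ?_, ?_⟩
      · refine (PB.smooth_of_comp (s := PB.snd ⁻¹' range f.toFun) ?_ ?_).mono (le_of_eq hr)
        · exact PB.smooth_fst.contMDiffOn.congr fun q _ => t₁ q
        · exact (hs.comp PB.smooth_snd.contMDiffOn fun q hq => hq).congr fun q hq => t₂ q hq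
      · intro p
        exact PB.ext (t₁ _) ((t₂ _ ⟨PB.snd p, rfl⟩).trans (hsf _))
    form := formEq_pull sm (FormEq.comp (f := X.bar h) (g := f.toFun) f.form (formEq_bar h X)
      f.smooth (smooth_bar h X) (fun p v => PB.d_snd_mem p v.2)) }

/-- The pullback functor. -/
def pullFunctor : LocObj U' ⥤ LocObj U where
  obj X := X.pull h
  map f := pullMap h f
  map_id _ := rfl
  map_comp _ _ := rfl

end

/-- Pulling back along an identity. -/
def pullIdIso {U : Man} (X : LocObj U) : X.pull (𝟙 U) ≅ X :=
  have si : ContMDiff (IT U) (IT U) ∞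
      (fun m : X => (PB.mk (X.π m) m rfl : PB (𝟙 U) X.toBdl)) := by
    rw [← contMDiffOn_univ]
    exact PB.smooth_of_comp X.smooth_π.contMDiffOn contMDiff_id.contMDiffOn
  { hom := diffeo (X.bar (𝟙 U)) (fun m : X => (PB.mk (X.π m) m rfl : PB (𝟙 U) X.toBdl))
      (smooth_bar _ X) si (fun p => (PB.w p).symm) (fun p => PB.ext (PB.w p).symm rfl)
      (fun _ => rfl) (formEq_bar _ X)
    inv := diffeo (fun m : X => (PB.mk (X.π m) m rfl : PB (𝟙 U) X.toBdl)) (X.bar (𝟙 U))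
      si (smooth_bar _ X) (fun _ => rfl) (fun _ => rfl) (fun p => PB.ext (PB.w p).symm rfl)
      (formEq_pull si (formEq_id X))
    hom_inv_id := LocHom.ext fun p => PB.ext (PB.w p).symm rfl
    inv_hom_id := LocHom.ext fun _ => rfl }

section
variable {U U' U'' : Man} (h : U' ⟶ U'') (k : U ⟶ U') (X : LocObj U'')

/-- The comparison map of iterated pullbacks. -/
def toIter (p : X.pull (k ≫ h)) : (X.pull h).pull k :=
  PB.mk (X := (X.pull h).toBdl) (PB.fst p) (PB.mk (X := X.toBdl) (k (PB.fst p)) (PB.snd p) (PB.w p))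
    rfl

/-- The inverse of the comparison map of iterated pullbacks. -/
def ofIter (q : (X.pull h).pull k) : X.pull (k ≫ h) :=
  PB.mk (X := X.toBdl) (PB.fst q) (X.bar h ((X.pull h).bar k q))
    ((congrArg h (PB.w q)).trans (PB.w (PB.snd q)))

theorem smooth_toIter : ContMDiff (IT U) (IT U) ∞ (toIter h k X) := by
  rw [← contMDiffOn_univ]
  refine PB.smooth_of_comp (h := k) (X := (X.pull h).toBdl) PB.smooth_fst.contMDiffOn ?_
  exact PB.smooth_of_comp (h := h) (X := X.toBdl)
    ((Man.smooth_hom k).comp PB.smooth_fst).contMDiffOn PB.smooth_snd.contMDiffOn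

theorem smooth_ofIter : ContMDiff (IT U) (IT U) ∞ (ofIter h k X) := by
  rw [← contMDiffOn_univ]
  exact PB.smooth_of_comp (h := k ≫ h) (X := X.toBdl) PB.smooth_fst.contMDiffOn
    ((smooth_bar h X).comp (smooth_bar k (X.pull h))).contMDiffOn

theorem ofIter_toIter (p : X.pull (k ≫ h)) : ofIter h k X (toIter h k X p) = p := rfl

theorem toIter_ofIter (q : (X.pull h).pull k) : toIter h k X (ofIter h k X q) = q :=
  PB.ext (X := (X.pull h).toBdl) rfl (PB.ext (X := X.toBdl) (PB.w q) rfl)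

theorem formEq_toIter : FormEq (X.pull (k ≫ h)) ((X.pull h).pull k) (toIter h k X) := by
  refine formEq_pull (smooth_toIter h k X) (formEq_pull ?_ ?_)
  · exact (smooth_bar k (X.pull h)).comp (smooth_toIter h k X)
  · exact formEq_bar (k ≫ h) X

theorem formEq_ofIter : FormEq ((X.pull h).pull k) (X.pull (k ≫ h)) (ofIter h k X) := by
  refine formEq_pull (smooth_ofIter h k X) ?_
  have := FormEq.comp (formEq_bar h X) (formEq_bar k (X.pull h)) (smooth_bar _ _)
    (smooth_bar _ _) (fun p v => PB.d_snd_mem p v.2)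
  exact this

/-- Pulling back along a composition. -/
def pullCompIso : X.pull (k ≫ h) ≅ (X.pull h).pull k where
  hom := diffeo (toIter h k X) (ofIter h k X) (smooth_toIter h k X) (smooth_ofIter h k X)
    (fun _ => rfl) (ofIter_toIter h k X) (toIter_ofIter h k X) (formEq_toIter h k X)
  inv := diffeo (ofIter h k X) (toIter h k X) (smooth_ofIter h k X) (smooth_toIter h k X)
    (fun _ => rfl) (toIter_ofIter h k X) (ofIter_toIter h k X) (formEq_ofIter h k X)
  hom_inv_id := LocHom.ext (ofIter_toIter h k X)
  inv_hom_id := LocHom.ext (toIter_ofIter h k X)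

end

end LocObj

open LocObj in
/-- The prestack of smooth families of one-dimensional spacetimes. -/
def Loc : Prestack :=
  LocallyDiscrete.mkPseudofunctor (fun U => Cat.of (LocObj U.unop))
    (fun f => (pullFunctor f.unop).toCatHom)
    (fun U => Cat.Hom.isoMk (NatIso.ofComponents (fun X => pullIdIso X) (fun _ => rfl)))
    (fun f g => Cat.Hom.isoMk (NatIso.ofComponents (fun X => pullCompIso f.unop g.unop X)
      (fun _ => rfl)))
    (fun f g h => by
      ext X
      exact LocHom.ext fun p => rfl)
    (fun f => by
      ext X
      exact LocHom.ext fun p => rfl)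
    (fun f => by
      ext X
      exact LocHom.ext fun p => rfl)

/-! ### Functions with restricted vertical support, the Dirac operator and fibre integration -/

namespace LocObj
variable {U : Man} (X : LocObj U)

/-- The value of the vertical one-form on a tangent vector, extended by zero to the tangent vectors
that are not vertical. -/
def ev (m : X) (v : TangentSpace (IT U) m) : ℝ := by
  classical
  exact if hv : v ∈ X.Vert m then X.E m ⟨v, hv⟩ else 0

theorem exists_unit (m : X) : ∃ v : X.Vert m, X.E m v = 1 := by
  obtain ⟨v, hv⟩ : ∃ v, X.E m v ≠ 0 := by
    by_contra! H
    exact X.E_ne_zero m (LinearMap.ext H)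
  exact ⟨(X.E m v)⁻¹ • v, by rw [map_smul, smul_eq_mul, inv_mul_cancel₀ hv]⟩

/-- The vertical tangent vector on which the one-form takes the value one. -/
def unitVec (m : X) : TangentSpace (IT U) m := ((X.exists_unit m).choose : X.Vert m)

/-- The operator `∗ d` on functions, with the vertical differential `d` and the vertical Hodge
operator `∗` of the one-form `E`, i.e. `d φ = (∗ d φ) E`. -/
def starD (φ : X → ℂ) (m : X) : ℂ := mfderiv (IT U) 𝓘(ℝ, ℂ) φ m (X.unitVec m)

/-- The vertical velocity of a curve, measured by the one-form. -/
def speed (γ : ℝ → X) (t : ℝ) : ℝ := X.ev (γ t) (mfderiv 𝓘(ℝ, ℝ) (IT U) γ t (1 : ℝ))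

/-- The vertical future of a subset. -/
def future (S : Set X) : Set X :=
  {m | ∃ γ : ℝ → X, ContMDiff 𝓘(ℝ, ℝ) (IT U) ∞ γ ∧ (∀ t, X.π (γ t) = X.π m) ∧
    (∀ t, 0 ≤ X.speed γ t) ∧ γ 0 ∈ S ∧ γ 1 = m}

/-- The vertical past of a subset. -/
def past (S : Set X) : Set X :=
  {m | ∃ γ : ℝ → X, ContMDiff 𝓘(ℝ, ℝ) (IT U) ∞ γ ∧ (∀ t, X.π (γ t) = X.π m) ∧
    (∀ t, X.speed γ t ≤ 0) ∧ γ 0 ∈ S ∧ γ 1 = m}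

/-- Smooth sections of `C^∞_π ⊗ ℂ²` over `W`, i.e. smooth functions on `π⁻¹(W)` with values in
`ℂ²`, represented by their extensions by zero to the total space. -/
structure IsFld (W : Opens U) (Ψ : X → ℂ × ℂ) : Prop where
  smooth : ContMDiffOn (IT U) 𝓘(ℝ, ℂ × ℂ) ∞ Ψ (X.π ⁻¹' W)
  zero : ∀ m, X.π m ∉ W → Ψ m = 0

/-- The support over `N` is contained in `J(σ(N))` for a smooth section `σ` over `N`. -/
def SuppIn (J : Set X → Set X) (N : Opens U) (Ψ : X → ℂ × ℂ) : Prop :=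
  ∃ σ : U → X, ContMDiffOn (𝓡 U.dim) (IT U) ∞ σ N ∧ (∀ u ∈ N, X.π (σ u) = u) ∧
    ∀ m, X.π m ∈ N → m ∈ tsupport Ψ → m ∈ J (σ '' N)

/-- Sections of the sheaf of functions whose support is locally bounded by sections with respect to
`J`: the vertically past compactly supported functions for `J = future`, the vertically future
compactly supported functions for `J = past`. -/
structure IsBdd (J : Set X → Set X) (W : Opens U) (Ψ : X → ℂ × ℂ) : Prop extends X.IsFld W Ψ where
  bdd : ∀ x ∈ W, ∃ N : Opens U, N ≤ W ∧ x ∈ N ∧ X.SuppIn J N Ψ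

/-- Sections of the sheaf of vertically compactly supported functions with values in `ℂ²`. -/
structure IsVc (W : Opens U) (Ψ : X → ℂ × ℂ) : Prop extends X.IsFld W Ψ where
  bdd : ∀ x ∈ W, ∃ N : Opens U, N ≤ W ∧ x ∈ N ∧ X.SuppIn X.future N Ψ ∧ X.SuppIn X.past N Ψ

/-- Restriction to the part over `W`. -/
def restr (W : Opens U) (Ψ : X → ℂ × ℂ) : X → ℂ × ℂ := (X.π ⁻¹' W).indicator Ψ

/-- Multiplication by a function on the base. -/
def smulFn {W : Opens U} (a : Fn U W) (Ψ : X → ℂ × ℂ) (m : X) : ℂ × ℂ := by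
  classical
  exact if hm : X.π m ∈ W then a ⟨X.π m, hm⟩ • Ψ m else 0

/-- The Dirac operator `diag(i ∗ d, -i ∗ d)` over `W`. -/
def dirac (W : Opens U) (Ψ : X → ℂ × ℂ) : X → ℂ × ℂ :=
  X.restr W fun m => (Complex.I * X.starD (fun m' => (Ψ m').1) m,
    -Complex.I * X.starD (fun m' => (Ψ m').2) m)

/-- Retarded (`J = future`) and advanced (`J = past`) Green operators for the Dirac operator:
morphisms of sheaves of modules `G` on the sheaf of vertically past (future) compactly supported
functions that are inverse to the Dirac operator and satisfy `supp (G Ψ) ⊆ J (supp Ψ)`. -/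
structure IsGreen (J : Set X → Set X) (G : Opens U → (X → ℂ × ℂ) → X → ℂ × ℂ) : Prop where
  bdd : ∀ {W Ψ}, X.IsBdd J W Ψ → X.IsBdd J W (G W Ψ)
  add : ∀ {W Ψ Ψ'}, X.IsBdd J W Ψ → X.IsBdd J W Ψ' → G W (Ψ + Ψ') = G W Ψ + G W Ψ'
  smul : ∀ {W Ψ} (a : Fn U W), X.IsBdd J W Ψ → G W (X.smulFn a Ψ) = X.smulFn a (G W Ψ)
  restr : ∀ {W W' Ψ}, W' ≤ W → X.IsBdd J W Ψ → G W' (X.restr W' Ψ) = X.restr W' (G W Ψ)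
  dirac_green : ∀ {W Ψ}, X.IsBdd J W Ψ → X.dirac W (G W Ψ) = Ψ
  green_dirac : ∀ {W Ψ}, X.IsBdd J W Ψ → G W (X.dirac W Ψ) = Ψ
  supp : ∀ {W Ψ}, X.IsBdd J W Ψ → ∀ m, X.π m ∈ W → m ∈ tsupport (G W Ψ) →
    m ∈ J (tsupport Ψ ∩ X.π ⁻¹' W)

/-- The integral of `Φ E` over the fibre above `x`, with respect to the orientation defined by `E`,
computed in a local trivialization. -/
def fibreIntegral (e : Bundle.Trivialization ℝ X.π) (x : U) (Φ : X → ℂ) : ℂ :=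
  ∫ t : ℝ, |X.speed (fun s => e.toOpenPartialHomeomorph.symm (x, s)) t| •
    Φ (e.toOpenPartialHomeomorph.symm (x, t))

/-- The involution `(ψ, ψ') ↦ (ψ'^*, ψ^*)` on functions with values in `ℂ²`. -/
def conjSwap (Ψ : X → ℂ × ℂ) (m : X) : ℂ × ℂ :=
  (starRingEnd ℂ (Ψ m).2, starRingEnd ℂ (Ψ m).1)

/-- The pushforward of functions along a morphism, combined with the phase rotation
`(g, g⁻¹)` of the two components. -/
def rotPush {X Y : LocObj U} (f : X ⟶ Y) (g : C^∞⟮𝓡 U.dim, U; 𝓡 1, Circle⟯) (Ψ : X → ℂ × ℂ)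
    (m : Y) : ℂ × ℂ :=
  ((g (Y.π m) : ℂ) * (Function.extend f.toFun Ψ 0 m).1,
    (g (Y.π m) : ℂ)⁻¹ * (Function.extend f.toFun Ψ 0 m).2)

end LocObj

/-! ### Pseudo-natural transformations -/

/-- Pseudo-natural transformations. -/
abbrev PsNat (F F' : Prestack) : Type _ := Pseudofunctor.StrongTrans F F'

/-- The prestack `Loc × [{*}/U(1)]_pre`. -/
abbrev LocU1 : Prestack := Loc.prod (quotPrestack (𝓡 1) Circle)

/-- Smooth one-dimensional AQFTs that are equivariant with respect to a Lie group. -/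
abbrev EquivariantAQFT {EG : Type} [NormedAddCommGroup EG] [NormedSpace ℝ EG] {HG : Type}
    [TopologicalSpace HG] (I : ModelWithCorners ℝ EG HG) (G : Type) [TopologicalSpace G]
    [ChartedSpace HG G] [Group G] [LieGroup I ∞ G] : Type _ :=
  PsNat (Loc.prod (quotPrestack I G)) StarAlg

namespace PushSystem
variable {S : PushSystem Manᵒᵖ} {F : Prestack} (T : PsNat F S.toPseudofunctor) {U U' : Man}

/-- The value of a transformation on an object. -/
def ob (x : F.obj ⟨op U⟩) : S.Obj (op U) := (T.app ⟨op U⟩).toFunctor.obj x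

/-- The value of a transformation on a morphism. -/
def mp {x y : F.obj ⟨op U⟩} (f : x ⟶ y) : S.Hom (𝟙 (op U)) (ob T x) (ob T y) :=
  (T.app ⟨op U⟩).toFunctor.map f

/-- The coherence isomorphism `h^* T(x) ⟶ T(h^* x)` of a transformation, regarded as a morphism
from `T(x)` to `T(h^* x)` over `h`. -/
def coh (h : U ⟶ U') (x : F.obj ⟨op U'⟩) :
    S.Hom h.op (ob T x) (ob T ((F.map h.op.toLoc).toFunctor.obj x)) :=
  S.comp (Category.comp_id h.op) (S.unit h.op (ob T x))
    ((T.naturality h.op.toLoc).inv.toNatTrans.app x)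

end PushSystem

section LocU1
variable {U U' : Man}

/-- Objects of `Loc(U) × [{*}/U(1)]_pre(U)`. -/
def LocU1.mk (X : LocObj U) : LocU1.obj ⟨op U⟩ :=
  (X, BGObj.pt (𝓡 1) Circle (U := U))

/-- Morphisms of `Loc(U) × [{*}/U(1)]_pre(U)`. -/
def LocU1.mkHom {X Y : LocObj U} (f : X ⟶ Y) (g : C^∞⟮𝓡 U.dim, U; 𝓡 1, Circle⟯) :
    LocU1.mk X ⟶ LocU1.mk Y :=
  Prod.mk (α := LocHom X Y) (β := C^∞⟮𝓡 U.dim, U; 𝓡 1, Circle⟯) f g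

section
variable (L : PsNat LocU1 IPVec)

/-- The inner product sheaf assigned to an object. -/
def ipOb (X : LocObj U) : IPSheaf U := PushSystem.ob (S := ipSystem) L (LocU1.mk X)

/-- The action of a morphism on sections. -/
def ipAct {X Y : LocObj U} (f : X ⟶ Y) (g : C^∞⟮𝓡 U.dim, U; 𝓡 1, Circle⟯) (W : Opens U) :
    Sec (ipOb L X).V W → Sec (ipOb L Y).V W :=
  (show IPComo (𝟙 U) (ipOb L X) (ipOb L Y) from
    PushSystem.mp (S := ipSystem) L (LocU1.mkHom f g)).app W

/-- The action of the coherence isomorphisms on pulled back sections. -/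
def ipCoh (h : U ⟶ U') (X : LocObj U') (W : Opens U') :
    Sec (ipOb L X).V W → Sec (ipOb L (X.pull h)).V (pre h W) :=
  (show IPComo h (ipOb L X) (ipOb L (X.pull h)) from
    PushSystem.coh (S := ipSystem) L h (LocU1.mk X)).app W

end
end LocU1

section CAR
variable {U U' : Man}

/-- Objects of the fibre category. -/
def IPVec.mk (V : IPSheaf U) : IPVec.obj ⟨op U⟩ := V

/-- Morphisms of the fibre category. -/
def IPVec.mkHom {V V' : IPSheaf U} (f : IPComo (𝟙 U) V V') : IPVec.mk V ⟶ IPVec.mk V' := f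

section
variable (C : PsNat IPVec StarAlg)

/-- The sheaf of algebras assigned to an inner product sheaf. -/
def carOb (V : IPSheaf U) : AlgSheaf U := PushSystem.ob (S := algSystem) C (IPVec.mk V)

/-- The action of a morphism on sections. -/
def carAct {V V' : IPSheaf U} (f : IPComo (𝟙 U) V V') (W : Opens U) :
    Sec (carOb C V).V W → Sec (carOb C V').V W :=
  (show AlgComo (𝟙 U) (carOb C V) (carOb C V') from
    PushSystem.mp (S := algSystem) C (IPVec.mkHom f)).app W

/-- The action of the coherence isomorphisms on pulled back sections. -/
def carCoh (h : U ⟶ U') (V : IPSheaf U') (W : Opens U') :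
    Sec (carOb C V).V W → Sec (carOb C (V.pull h)).V (pre h W) :=
  (show AlgComo h (carOb C V) (carOb C (V.pull h)) from
    PushSystem.coh (S := algSystem) C h (IPVec.mk V)).app W

end

/-- The equivariant AQFT obtained by composition with a transformation to `*`-algebras. -/
def composeAQFT (L : PsNat LocU1 IPVec) (C : PsNat IPVec StarAlg) :
    EquivariantAQFT (𝓡 1) Circle := L.vcomp C

section
variable (A : EquivariantAQFT (𝓡 1) Circle)

/-- The sheaf of algebras assigned to an object. -/
def aqftOb (X : LocObj U) : AlgSheaf U := PushSystem.ob (S := algSystem) A (LocU1.mk X)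

/-- The action of a morphism on sections. -/
def aqftAct {X Y : LocObj U} (f : X ⟶ Y) (g : C^∞⟮𝓡 U.dim, U; 𝓡 1, Circle⟯) (W : Opens U) :
    Sec (aqftOb A X).V W → Sec (aqftOb A Y).V W :=
  (show AlgComo (𝟙 U) (aqftOb A X) (aqftOb A Y) from
    PushSystem.mp (S := algSystem) A (LocU1.mkHom f g)).app W

end
end CAR

/-- The Dirac field transformation on `Loc × [{*}/U(1)]_pre`. The map `q X W` assigns to a
vertically compactly supported function its class in the sheaf
`(C^∞_{π vc} ⊗ ℂ²) / D (C^∞_{π vc} ⊗ ℂ²)`; its values on other functions are irrelevant. -/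
structure IsDirac (L : PsNat LocU1 IPVec)
    (q : ∀ {U : Man} (X : LocObj U) (W : Opens U), (X → ℂ × ℂ) → Sec (ipOb L X).V W) : Prop where
  add : ∀ {U : Man} (X : LocObj U) {W : Opens U} {Ψ Ψ' : X → ℂ × ℂ}, X.IsVc W Ψ → X.IsVc W Ψ' →
    q X W (Ψ + Ψ') = q X W Ψ + q X W Ψ'
  smul : ∀ {U : Man} (X : LocObj U) {W : Opens U} (a : Fn U W) {Ψ : X → ℂ × ℂ}, X.IsVc W Ψ →
    q X W (X.smulFn a Ψ) = a • q X W Ψ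
  res : ∀ {U : Man} (X : LocObj U) {W W' : Opens U} (i : W' ≤ W) {Ψ : X → ℂ × ℂ}, X.IsVc W Ψ →
    q X W' (X.restr W' Ψ) = Sec.res i (q X W Ψ)
  /-- The kernel is the image of the Dirac operator. -/
  exact : ∀ {U : Man} (X : LocObj U) {W : Opens U} {Ψ : X → ℂ × ℂ}, X.IsVc W Ψ →
    (q X W Ψ = 0 ↔ ∀ x ∈ W, ∃ N : Opens U, N ≤ W ∧ x ∈ N ∧
      ∃ Φ : X → ℂ × ℂ, X.IsVc N Φ ∧ X.restr N Ψ = X.dirac N Φ)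
  /-- Every section is locally a class. -/
  surj : ∀ {U : Man} (X : LocObj U) {W : Opens U} (s : Sec (ipOb L X).V W), ∀ x ∈ W,
    ∃ (N : Opens U) (i : N ≤ W), x ∈ N ∧ ∃ Ψ : X → ℂ × ℂ, X.IsVc N Ψ ∧ q X N Ψ = Sec.res i s
  /-- The involution. -/
  st : ∀ {U : Man} (X : LocObj U) {W : Opens U} {Ψ : X → ℂ × ℂ}, X.IsVc W Ψ →
    (ipOb L X).st (q X W Ψ) = q X W (X.conjSwap Ψ)
  /-- The pairing, with the causal propagator `S = S⁺ - S⁻`. -/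
  pair : ∀ {U : Man} (X : LocObj U), ∃ Sp Sm : Opens U → (X → ℂ × ℂ) → X → ℂ × ℂ,
    X.IsGreen X.future Sp ∧ X.IsGreen X.past Sm ∧
    ∀ (W : Opens U) (Ψ Ψ' : X → ℂ × ℂ), X.IsVc W Ψ → X.IsVc W Ψ' → ∀ x : W,
      ∀ e : Bundle.Trivialization ℝ X.π, IsSmoothTriv e → (x : U) ∈ e.baseSet →
        (ipOb L X).pair (q X W Ψ) (q X W Ψ') x = X.fibreIntegral e x fun m =>
          Complex.I * (Ψ m).1 * (Sp W Ψ' m - Sm W Ψ' m).2 -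
            Complex.I * (Ψ m).2 * (Sp W Ψ' m - Sm W Ψ' m).1
  /-- The action of morphisms. -/
  act : ∀ {U : Man} {X Y : LocObj U} (f : X ⟶ Y) (g : C^∞⟮𝓡 U.dim, U; 𝓡 1, Circle⟯)
    {W : Opens U} {Ψ : X → ℂ × ℂ}, X.IsVc W Ψ →
      ipAct L f g W (q X W Ψ) = q Y W (LocObj.rotPush f g Ψ)
  /-- The coherence isomorphisms are induced by the pullback of functions. -/
  coh : ∀ {U U' : Man} (h : U ⟶ U') (X : LocObj U') {W : Opens U'} {Ψ : X → ℂ × ℂ}, X.IsVc W Ψ →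
    ipCoh L h X W (q X W Ψ) = q (X.pull h) (pre h W) (fun p => Ψ (X.bar h p))

/-- The CAR quantization: `C` assigns to an inner product sheaf `V` the universal sheaf of
`*`-algebras generated by `V`, via `ι`, subject to the canonical anti-commutation relations. -/
structure IsCAR (C : PsNat IPVec StarAlg)
    (ι : ∀ {U : Man} (V : IPSheaf U) (W : Opens U), Sec V.V W → Sec (carOb C V).V W) : Prop where
  add : ∀ {U : Man} (V : IPSheaf U) {W : Opens U} (v w : Sec V.V W),
    ι V W (v + w) = ι V W v + ι V W w
  smul : ∀ {U : Man} (V : IPSheaf U) {W : Opens U} (a : Fn U W) (v : Sec V.V W),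
    ι V W (a • v) = a • ι V W v
  res : ∀ {U : Man} (V : IPSheaf U) {W W' : Opens U} (i : W' ≤ W) (v : Sec V.V W),
    ι V W' (Sec.res i v) = Sec.res i (ι V W v)
  st : ∀ {U : Man} (V : IPSheaf U) {W : Opens U} (v : Sec V.V W),
    ι V W (V.st v) = (carOb C V).st (ι V W v)
  rel : ∀ {U : Man} (V : IPSheaf U) {W : Opens U} (v w : Sec V.V W),
    (carOb C V).mul (ι V W v) (ι V W w) + (carOb C V).mul (ι V W w) (ι V W v) =
      V.pair v w • (carOb C V).one W
  /-- The universal property. -/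
  univ : ∀ {U : Man} (V : IPSheaf U) (B : AlgSheaf U) (κ : Como (𝟙 U) V.V B.V),
    (∀ W (v : Sec V.V W), κ.app W (V.st v) = B.st (κ.app W v)) →
    (∀ W (v w : Sec V.V W), B.mul (κ.app W v) (κ.app W w) + B.mul (κ.app W w) (κ.app W v) =
      pullFn (𝟙 U) W (V.pair v w) • B.one (pre (𝟙 U) W)) →
    ∃! φ : AlgComo (𝟙 U) (carOb C V) B, ∀ W (v : Sec V.V W), φ.app W (ι V W v) = κ.app W v
  /-- The action of morphisms. -/
  act : ∀ {U : Man} {V V' : IPSheaf U} (f : IPComo (𝟙 U) V V') {W : Opens U} (v : Sec V.V W),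
    carAct C f W (ι V W v) = ι V' W (f.app W v)
  /-- The coherence isomorphisms. -/
  coh : ∀ {U U' : Man} (h : U ⟶ U') (V : IPSheaf U') {W : Opens U'} (v : Sec V.V W),
    carCoh C h V W (ι V W v) = ι (V.pull h) (pre h W) ((IPComo.unit h V).app W v)

end SmoothAQFT

end

open SmoothAQFT

/-!
The Dirac field in one dimension has no propagating degrees of freedom along the fibres, and this
is why everything can be computed. Locally over the base, a vertical coordinate
(`LocObj.exists_vcoord`) identifies the total space with `N × ℝ`, with `E = ρ dT` for a positive
density `ρ`; on each fibre the Dirac equation `D Φ = Ψ` is the ordinary differential equation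
`dΦ/dT = ρ · symb Ψ` with a constant invertible matrix `symb` (`LocObj.dirac_eq_iff`). Hence:

* Integrating from below or from above the support of `Ψ` gives the Green operators. A solution
  with vertically bounded support is unique (`LocObj.IsBdd.ext`), so the local solutions glue
  (`LocObj.IsBdd.exists_green`), and linearity and compatibility with restrictions are automatic
  (`LocObj.isGreen_green`).
* `S Ψ = S⁺ Ψ - S⁻ Ψ` is, on each fibre, the constant `symb (∫ Ψ E)`
  (`LocObj.IsVc.green_sub_green`). So a field with vertically compact support lies in the image of
  `D` if and only if its two fibre integrals vanish (`LocObj.IsVc.charge_dirac`,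
  `LocObj.IsVc.exists_dirac_eq`), and bump functions show that every pair of smooth functions on the
  base occurs locally as a pair of fibre integrals (`VCoord.exists_charge`).

Therefore integration over the fibres identifies the quotient sheaf with the free sheaf `hyp U` of
pairs of smooth functions on the base, and the pairing of the fields becomes the hyperbolic pairing
`-(a b' + b a')`. Extension by zero along a morphism preserves the fibre integrals, because
morphisms preserve `E`, and pullback along a map of the bases pulls them back. In terms of `hyp`,
the transformation thus has constant value on objects, `(f, g)` acts by `(a, b) ↦ (g a, g⁻¹ b)`, and the
coherence morphisms are the pullback of functions, so that pseudo-naturality is immediate; they are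
invertible because the inverse image of a free sheaf is free (`hypPullInv`). The analytic content is
that the class map `cls` has all required properties (`isDirac_diracTrans`).

The CAR algebra of an inner product sheaf is the sheafification of the presheaf of rings on scalars
and vectors subject to the defining relations (`CARRing`). Maps out of the presheaf extend to the
sheaf (`CAR.exists_extend`), which provides the involution and the universal property (`CAR.lift`,
`CAR.alg_hom_ext`). That the comparison with inverse images is invertible holds because both
sides represent the representations of the inner product sheaf over the map of bases
(`CAR.isRep_of_unit`, `CAR.pull_hom_ext`).

Both transformations are assembled from heteromorphisms, that is, morphisms of sheaves over a map of
base manifolds: `PushSystem.HetTrans` reduces the coherence conditions for morphisms out of inverse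
images to equations between heteromorphisms.
-/

noncomputable section

namespace SmoothAQFT

/-! ### Pseudo-natural transformations from heteromorphisms -/

namespace PushSystem

/-- Data presenting a pseudo-natural transformation from a prestack `F` to the prestack of a
`PushSystem` by heteromorphisms: functors `T b` on fibres together with natural heteromorphisms
`c f x` from `T x` to `T (f^* x)` over `f`, compatible with the unit and composition constraints of
`F`, whose factorizations through the universal heteromorphisms are invertible. -/
structure HetTrans (S : PushSystem Manᵒᵖ) (F : Prestack) where
  T : ∀ b : Manᵒᵖ, F.obj ⟨b⟩ ⥤ S.Obj b
  c : ∀ {b b' : Manᵒᵖ} (f : b ⟶ b') (x : F.obj ⟨b⟩),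
    S.Hom f ((T b).obj x) ((T b').obj ((F.map f.toLoc).toFunctor.obj x))
  nat : ∀ {b b' : Manᵒᵖ} (f : b ⟶ b') {x y : F.obj ⟨b⟩} (u : x ⟶ y),
    S.comp (Category.id_comp f) ((T b).map u) (c f y) =
      S.comp (Category.comp_id f) (c f x) ((T b').map ((F.map f.toLoc).toFunctor.map u))
  inv : ∀ {b b' : Manᵒᵖ} (f : b ⟶ b') (x : F.obj ⟨b⟩),
    S.Hom (𝟙 b') ((T b').obj ((F.map f.toLoc).toFunctor.obj x)) (S.push f ((T b).obj x))
  c_inv : ∀ {b b' : Manᵒᵖ} (f : b ⟶ b') (x : F.obj ⟨b⟩),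
    S.comp (Category.comp_id f) (c f x) (inv f x) = S.unit f _
  inv_c : ∀ {b b' : Manᵒᵖ} (f : b ⟶ b') (x : F.obj ⟨b⟩),
    S.comp (Category.comp_id (𝟙 b')) (inv f x) (lift (Category.comp_id f) (c f x)) = S.id _
  c_id : ∀ (b : Manᵒᵖ) (x : F.obj ⟨b⟩),
    S.comp (Category.comp_id (𝟙 b)) (c (𝟙 b) x) ((T b).map ((F.mapId ⟨b⟩).hom.toNatTrans.app x)) =
      S.id ((T b).obj x)
  c_comp : ∀ {b b' b'' : Manᵒᵖ} (f : b ⟶ b') (g : b' ⟶ b'') (x : F.obj ⟨b⟩),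
    S.comp (Category.comp_id (f ≫ g)) (c (f ≫ g) x)
        ((T b'').map ((F.mapComp f.toLoc g.toLoc).hom.toNatTrans.app x)) =
      S.comp rfl (c f x) (c g ((F.map f.toLoc).toFunctor.obj x))

namespace HetTrans
variable {S : PushSystem Manᵒᵖ} {F : Prestack} (H : HetTrans S F)

/-- The factorization of `c f x` through the universal heteromorphism. -/
def desc {b b' : Manᵒᵖ} (f : b ⟶ b') (x : F.obj ⟨b⟩) :
    S.Hom (𝟙 b') (S.push f ((H.T b).obj x)) ((H.T b').obj ((F.map f.toLoc).toFunctor.obj x)) :=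
  lift (Category.comp_id f) (H.c f x)

theorem unit_desc {b b' : Manᵒᵖ} (f : b ⟶ b') (x : F.obj ⟨b⟩) (e : f ≫ 𝟙 b' = f) :
    S.comp e (S.unit f ((H.T b).obj x)) (H.desc f x) = H.c f x := fac _ _

theorem desc_inv {b b' : Manᵒᵖ} (f : b ⟶ b') (x : F.obj ⟨b⟩) :
    S.comp (Category.comp_id (𝟙 b')) (H.desc f x) (H.inv f x) = S.id _ := by
  apply hom_ext (Category.comp_id f)
  rw [← S.assoc (Category.comp_id f) (Category.comp_id f), unit_desc, H.c_inv, S.comp_id]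

/-- The coherence isomorphism `f^* T(x) ≅ T(f^* x)`. -/
def iso {b b' : Manᵒᵖ} (f : b ⟶ b') (x : F.obj ⟨b⟩) :
    (H.T b').obj ((F.map f.toLoc).toFunctor.obj x) ≅ (S.pushFunctor f).obj ((H.T b).obj x) where
  hom := H.inv f x
  inv := H.desc f x
  hom_inv_id := H.inv_c f x
  inv_hom_id := H.desc_inv f x

theorem desc_nat {b b' : Manᵒᵖ} (f : b ⟶ b') {x y : F.obj ⟨b⟩} (u : x ⟶ y) :
    S.comp (Category.comp_id (𝟙 b')) (S.mapHom f ((H.T b).map u)) (H.desc f y) =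
      S.comp (Category.comp_id (𝟙 b')) (H.desc f x)
        ((H.T b').map ((F.map f.toLoc).toFunctor.map u)) := by
  apply hom_ext (Category.comp_id f)
  rw [unit_map_comp (Category.comp_id f), unit_desc, ← S.assoc (Category.comp_id f)
    (Category.comp_id f), unit_desc]
  exact H.nat f u

/-- The naturality isomorphism. -/
def natIso {b b' : Manᵒᵖ} (f : b ⟶ b') :
    (F.map f.toLoc).toFunctor ⋙ H.T b' ≅ H.T b ⋙ S.pushFunctor f :=
  NatIso.ofComponents (fun x => H.iso f x) (fun {x y} u => by
    have : (S.pushFunctor f).map ((H.T b).map u) ≫ (H.iso f y).inv =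
      (H.iso f x).inv ≫ (H.T b').map ((F.map f.toLoc).toFunctor.map u) := H.desc_nat f u
    exact ((Iso.inv_comp_eq _).1 ((Category.assoc _ _ _).symm.trans
      ((Iso.eq_comp_inv _).1 this.symm))))

theorem desc_id (b : Manᵒᵖ) (x : F.obj ⟨b⟩) :
    S.comp (Category.comp_id (𝟙 b)) (H.desc (𝟙 b) x)
      ((H.T b).map ((F.mapId ⟨b⟩).hom.toNatTrans.app x)) = S.idHom b _ := by
  apply hom_ext (Category.comp_id (𝟙 b))
  rw [unit_id, ← S.assoc (Category.comp_id _) (Category.comp_id _)]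
  exact (congrArg (fun t => S.comp _ t _) (H.unit_desc (𝟙 b) x _)).trans (H.c_id b x)

theorem desc_comp {b b' b'' : Manᵒᵖ} (f : b ⟶ b') (g : b' ⟶ b'') (x : F.obj ⟨b⟩) :
    S.comp (Category.comp_id (𝟙 b'')) (H.desc (f ≫ g) x)
        ((H.T b'').map ((F.mapComp f.toLoc g.toLoc).hom.toNatTrans.app x)) =
      S.comp (Category.comp_id (𝟙 b'')) (S.compHom f g _)
        (S.comp (Category.comp_id (𝟙 b'')) (S.mapHom g (H.desc f x))
          (H.desc g ((F.map f.toLoc).toFunctor.obj x))) := by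
  apply hom_ext (Category.comp_id (f ≫ g))
  rw [← S.assoc (Category.comp_id _) (Category.comp_id _) (Category.comp_id _)
      (Category.comp_id _) (S.unit (f ≫ g) _) (S.compHom f g _), unit_comp,
      S.assoc rfl (Category.comp_id _) (Category.comp_id g) rfl,
      unit_map_comp (Category.comp_id g), unit_desc,
      ← S.assoc (Category.comp_id f) rfl (Category.id_comp g) rfl, unit_desc, ← H.c_comp f g x,
      ← S.assoc (Category.comp_id _) (Category.comp_id _)]
  exact congrArg (fun t => S.comp _ t _) (H.unit_desc (f ≫ g) x _)

section
variable {D : Type*} [Category* D]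

theorem expand₁ {x y : D} (u : x ⟶ y) : u = u ≫ 𝟙 y ≫ 𝟙 y := by simp

theorem expand₃ {x y z w : D} (u : x ⟶ y) (v : y ⟶ z) (t : z ⟶ w) :
    u ≫ v ≫ t = u ≫ 𝟙 y ≫ v ≫ 𝟙 z ≫ t ≫ 𝟙 w := by simp

theorem eq_comp_of_cancel {x y z w v : D} {a : x ⟶ v} {i : x ⟶ y} {b : y ⟶ z} {c : z ⟶ w}
    {d : w ⟶ v} {d' : v ⟶ w} {c' : w ⟶ z} (h : a = i ≫ b ≫ c ≫ d) (hd : d ≫ d' = 𝟙 w)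
    (hc : c ≫ c' = 𝟙 z) : i ≫ b = a ≫ d' ≫ c' := by
  simp only [h, Category.assoc, reassoc_of% hd, hc, Category.comp_id]
end

/-- The pseudo-natural transformation presented by heteromorphisms. -/
def toPsNat : PsNat F S.toPseudofunctor where
  app b := (H.T b.as).toCatHom
  naturality f := Cat.Hom.isoMk (H.natIso f.as)
  naturality_naturality {a b f g} η := by
    obtain rfl : f = g := LocallyDiscrete.eq_of_hom η
    obtain rfl : η = 𝟙 _ := Subsingleton.elim _ _
    ext x
    have h₁ : (F.map₂ (𝟙 f)).toNatTrans.app x = 𝟙 _ :=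
      congrArg (fun t => t.toNatTrans.app x) (F.map₂_id f)
    have h₂ : (S.toPseudofunctor.map₂ (𝟙 f)).toNatTrans.app ((H.T a.as).obj x) = 𝟙 _ :=
      congrArg (fun t => t.toNatTrans.app ((H.T a.as).obj x)) (S.toPseudofunctor.map₂_id f)
    refine (congrArg (fun t => (H.T b.as).map t ≫ (H.iso f.as x).hom) h₁).trans ?_
    refine Eq.trans ?_ (congrArg (fun t => (H.iso f.as x).hom ≫ t) h₂).symm
    exact (congrArg (fun t => t ≫ (H.iso f.as x).hom) ((H.T b.as).map_id _)).trans
      ((Category.id_comp _).trans (Category.comp_id _).symm)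
  naturality_id a := by
    ext x
    have h₁ := H.desc_id a.as x
    have h₂ : (H.iso (𝟙 a.as) x).hom ≫ (S.pushId a.as).hom.app ((H.T a.as).obj x) =
        (H.T a.as).map ((F.mapId a).hom.toNatTrans.app x) :=
      (Iso.inv_comp_eq _).1 (by exact h₁) |>.symm
    exact h₂.trans (expand₁ _)
  naturality_comp {a b c} f g := by
    ext x
    have h₁ := H.desc_comp f.as g.as x
    have h₂ : (H.iso (f.as ≫ g.as) x).hom ≫ (S.pushComp f.as g.as).hom.app ((H.T a.as).obj x) =
        (H.T c.as).map ((F.mapComp f g).hom.toNatTrans.app x) ≫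
          (H.iso g.as ((F.map f).toFunctor.obj x)).hom ≫
            (S.pushFunctor g.as).map (H.iso f.as x).hom := by
      have h₃ : (H.iso (f.as ≫ g.as) x).inv ≫
          (H.T c.as).map ((F.mapComp f g).hom.toNatTrans.app x) =
          (S.pushComp f.as g.as).hom.app ((H.T a.as).obj x) ≫
            (S.pushFunctor g.as).map (H.iso f.as x).inv ≫
              (H.iso g.as ((F.map f).toFunctor.obj x)).inv := h₁
      have h₄ := (Iso.inv_comp_eq _).1 h₃
      exact eq_comp_of_cancel h₄ (Iso.inv_hom_id _)
        ((Functor.map_comp _ _ _).symm.trans ((congrArg _ (Iso.inv_hom_id _)).trans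
          (CategoryTheory.Functor.map_id _ _)))
    refine h₂.trans ?_
    exact expand₃ _ _ _

theorem coh_toPsNat {U U' : Man} (h : U ⟶ U') (x : F.obj ⟨op U'⟩) :
    coh H.toPsNat h x = H.c h.op x := fac _ _

end HetTrans
end PushSystem

/-! ### The ring generated by the canonical anti-commutation relations -/

section CARRing
variable {R : Type} [CommRing R] {M : Type} [AddCommGroup M] [Module R M] (p : M → M → R)

/-- The defining relations of the CAR algebra of a module with a pairing, as an abstract ring on
generators for the scalars and for the vectors. Presenting it over `ℤ` rather than over `R` lets
ring homomorphisms that are only semilinear over a map of scalars be defined on generators. -/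
inductive CARRel : FreeAlgebra ℤ (R ⊕ M) → FreeAlgebra ℤ (R ⊕ M) → Prop
  | one : CARRel (FreeAlgebra.ι ℤ (Sum.inl 1)) 1
  | add (a b : R) : CARRel (FreeAlgebra.ι ℤ (Sum.inl (a + b)))
      (FreeAlgebra.ι ℤ (Sum.inl a) + FreeAlgebra.ι ℤ (Sum.inl b))
  | mul (a b : R) : CARRel (FreeAlgebra.ι ℤ (Sum.inl (a * b)))
      (FreeAlgebra.ι ℤ (Sum.inl a) * FreeAlgebra.ι ℤ (Sum.inl b))
  | addv (v w : M) : CARRel (FreeAlgebra.ι ℤ (Sum.inr (v + w)))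
      (FreeAlgebra.ι ℤ (Sum.inr v) + FreeAlgebra.ι ℤ (Sum.inr w))
  | smul (a : R) (v : M) : CARRel (FreeAlgebra.ι ℤ (Sum.inr (a • v)))
      (FreeAlgebra.ι ℤ (Sum.inl a) * FreeAlgebra.ι ℤ (Sum.inr v))
  | comm (a : R) (v : M) : CARRel (FreeAlgebra.ι ℤ (Sum.inl a) * FreeAlgebra.ι ℤ (Sum.inr v))
      (FreeAlgebra.ι ℤ (Sum.inr v) * FreeAlgebra.ι ℤ (Sum.inl a))
  | car (v w : M) : CARRel (FreeAlgebra.ι ℤ (Sum.inr v) * FreeAlgebra.ι ℤ (Sum.inr w) +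
      FreeAlgebra.ι ℤ (Sum.inr w) * FreeAlgebra.ι ℤ (Sum.inr v)) (FreeAlgebra.ι ℤ (Sum.inl (p v w)))

/-- The CAR algebra of a module with a pairing. -/
def CARRing : Type := RingQuot (CARRel p)

namespace CARRing

instance : Ring (CARRing p) := inferInstanceAs (Ring (RingQuot (CARRel p)))

variable {p}

/-- The quotient map from the free ring. -/
def mk : FreeAlgebra ℤ (R ⊕ M) →+* CARRing p := RingQuot.mkRingHom (CARRel p)

theorem mk_rel {x y : FreeAlgebra ℤ (R ⊕ M)} (h : CARRel p x y) : mk (p := p) x = mk y :=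
  RingQuot.mkRingHom_rel h

theorem mk_surjective : Function.Surjective (mk (p := p)) := RingQuot.mkRingHom_surjective _

variable (p) in
/-- The scalars. -/
def coef : R →+* CARRing p where
  toFun a := mk (FreeAlgebra.ι ℤ (Sum.inl a))
  map_one' := (mk_rel CARRel.one).trans (map_one _)
  map_mul' a b := (mk_rel (CARRel.mul a b)).trans (map_mul _ _ _)
  map_add' a b := (mk_rel (CARRel.add a b)).trans (map_add _ _ _)
  map_zero' := by
    have := (mk_rel (p := p) (CARRel.add 0 0)).trans (map_add _ _ _)
    rwa [add_zero, left_eq_add] at this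

variable (p) in
/-- The generators. -/
def gen : M →+ CARRing p :=
  AddMonoidHom.mk' (fun v => mk (FreeAlgebra.ι ℤ (Sum.inr v)))
    (fun v w => (mk_rel (CARRel.addv v w)).trans (map_add _ _ _))

theorem gen_smul (a : R) (v : M) : gen p (a • v) = coef p a * gen p v :=
  (mk_rel (CARRel.smul a v)).trans (map_mul _ _ _)

theorem coef_gen (a : R) (v : M) : coef p a * gen p v = gen p v * coef p a :=
  (map_mul _ _ _).symm.trans ((mk_rel (CARRel.comm a v)).trans (map_mul _ _ _))

theorem car (v w : M) : gen p v * gen p w + gen p w * gen p v = coef p (p v w) := by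
  refine Eq.trans ?_ (mk_rel (CARRel.car v w))
  rw [map_add, map_mul, map_mul]
  rfl

theorem induction {P : CARRing p → Prop} (hc : ∀ a, P (coef p a)) (hg : ∀ v, P (gen p v))
    (ha : ∀ x y, P x → P y → P (x + y)) (hm : ∀ x y, P x → P y → P (x * y)) (x : CARRing p) :
    P x := by
  obtain ⟨x, rfl⟩ := mk_surjective x
  induction x using FreeAlgebra.induction with
  | grade0 r =>
    have e₁ : mk (p := p) (algebraMap ℤ (FreeAlgebra ℤ (R ⊕ M)) r) = r :=
      map_intCast (mk.comp (algebraMap ℤ (FreeAlgebra ℤ (R ⊕ M)))) r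
    have e₂ : coef p (r : R) = r := map_intCast _ r
    rw [e₁, ← e₂]
    exact hc _
  | grade1 x =>
    cases x with
    | inl a => exact hc a
    | inr v => exact hg v
  | mul x y hx hy => rw [map_mul]; exact hm _ _ hx hy
  | add x y hx hy => rw [map_add]; exact ha _ _ hx hy

theorem coef_comm (a : R) (x : CARRing p) : coef p a * x = x * coef p a := by
  induction x using induction with
  | hc b => rw [← map_mul, mul_comm, map_mul]
  | hg v => exact coef_gen a v
  | ha x y hx hy => rw [mul_add, add_mul, hx, hy]
  | hm x y hx hy => rw [← mul_assoc, hx, mul_assoc, hy, mul_assoc]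

theorem hom_ext {B : Type} [Ring B] {f g : CARRing p →+* B} (h₁ : ∀ a, f (coef p a) = g (coef p a))
    (h₂ : ∀ v, f (gen p v) = g (gen p v)) (x : CARRing p) : f x = g x := by
  induction x using induction with
  | hc a => exact h₁ a
  | hg v => exact h₂ v
  | ha x y hx hy => rw [map_add, map_add, hx, hy]
  | hm x y hx hy => rw [map_mul, map_mul, hx, hy]

section lift
variable {B : Type} [Ring B] (f : R →+* B) (g : M →+ B) (hs : ∀ a v, g (a • v) = f a * g v)
  (hc : ∀ a v, f a * g v = g v * f a) (hp : ∀ v w, g v * g w + g w * g v = f (p v w))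

/-- The universal property of the CAR algebra. -/
def lift : CARRing p →+* B :=
  RingQuot.lift ⟨(FreeAlgebra.lift ℤ (Sum.elim f g)).toRingHom, fun x y h => by
    cases h <;> simp [hs, hc, hp]⟩

theorem lift_coef (a : R) : lift f g hs hc hp (coef p a) = f a := by
  refine (RingQuot.lift_mkRingHom_apply _ _ _).trans ?_
  simp

theorem lift_gen (v : M) : lift f g hs hc hp (gen p v) = g v := by
  refine (RingQuot.lift_mkRingHom_apply _ _ _).trans ?_
  simp

end lift
end CARRing
end CARRing

/-! ### The sheaf of CAR algebras -/

/-- The sections of a sheaf of algebras, as a ring. -/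
def AlgSheaf.Rg {U : Man} (B : AlgSheaf U) (W : Opens U) : Type := Sec B.V W

instance {U : Man} (B : AlgSheaf U) (W : Opens U) : Ring (B.Rg W) :=
  { (inferInstance : AddCommGroup (Sec B.V W)) with
    mul := B.mul
    one := B.one W
    left_distrib := B.mul_add
    right_distrib := B.add_mul
    zero_mul := fun v => by
      have := B.smul_mul 0 0 v
      rwa [zero_smul, zero_smul] at this
    mul_zero := fun v => by
      have := B.mul_smul 0 v 0
      rwa [zero_smul, zero_smul] at this
    mul_assoc := B.mul_assoc
    one_mul := B.one_mul
    mul_one := B.mul_one }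

namespace CAR
variable {U : Man} (V : IPSheaf U)

/-- The CAR algebra of the sections over an open subset. -/
abbrev PreSec (W : Opens U) : Type := CARRing (V.pair (W := W))

/-- Restriction on the presheaf of CAR algebras. -/
def preRes {W₁ W₂ : Opens U} (i : W₁ ≤ W₂) : PreSec V W₂ →+* PreSec V W₁ :=
  CARRing.lift ((CARRing.coef _).comp (resFn i)) ((CARRing.gen _).comp (Sec.res i))
    (fun a v => by
      simp only [AddMonoidHom.comp_apply, Sec.res_smul, CARRing.gen_smul, RingHom.comp_apply])
    (fun a v => CARRing.coef_comm _ _)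
    (fun v w => by
      simp only [AddMonoidHom.comp_apply, CARRing.car, RingHom.comp_apply, V.res_pair])

theorem preRes_coef {W₁ W₂ : Opens U} (i : W₁ ≤ W₂) (a : Fn U W₂) :
    preRes V i (CARRing.coef _ a) = CARRing.coef _ (resFn i a) := CARRing.lift_coef ..

theorem preRes_gen {W₁ W₂ : Opens U} (i : W₁ ≤ W₂) (v : Sec V.V W₂) :
    preRes V i (CARRing.gen _ v) = CARRing.gen _ (Sec.res i v) := CARRing.lift_gen ..

theorem preRes_id {W : Opens U} (x : PreSec V W) : preRes V le_rfl x = x :=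
  CARRing.hom_ext (g := RingHom.id _) (fun a => preRes_coef V _ a)
    (fun v => by rw [preRes_gen, Sec.res_id]; rfl) x

theorem preRes_preRes {W₁ W₂ W₃ : Opens U} (i : W₁ ≤ W₂) (j : W₂ ≤ W₃) (x : PreSec V W₃) :
    preRes V i (preRes V j x) = preRes V (i.trans j) x :=
  CARRing.hom_ext (f := (preRes V i).comp (preRes V j))
    (fun a => by rw [RingHom.comp_apply, preRes_coef, preRes_coef, preRes_coef]; rfl)
    (fun v => by rw [RingHom.comp_apply, preRes_gen, preRes_gen, preRes_gen, Sec.res_res]) x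

/-- The presheaf of CAR algebras. -/
def pre : (Opens (TopCat.of U))ᵒᵖ ⥤ RingCat.{0} where
  obj W := RingCat.of (PreSec V W.unop)
  map i := RingCat.ofHom (preRes V i.unop.le)
  map_id W := by ext x; exact preRes_id V x
  map_comp i j := by ext x; exact (preRes_preRes V _ _ x).symm

/-- The associated sheaf of rings. -/
def shf : (Opens (TopCat.of U))ᵒᵖ ⥤ RingCat.{0} :=
  sheafify (Opens.grothendieckTopology (TopCat.of U)) (pre V)

/-- The sections of the sheaf of CAR algebras. -/
def S (W : Opens U) : Type := (shf V).obj (op W)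

instance (W : Opens U) : Ring (S V W) := inferInstanceAs (Ring ((shf V).obj (op W)))

/-- Restriction of sections. -/
def res {W₁ W₂ : Opens U} (i : W₁ ≤ W₂) : S V W₂ →+* S V W₁ :=
  ((shf V).map (homOfLE i).op).hom

/-- The map from the presheaf to the sheaf. -/
def η (W : Opens U) : PreSec V W →+* S V W :=
  ((toSheafify (Opens.grothendieckTopology (TopCat.of U)) (pre V)).app (op W)).hom

theorem res_id {W : Opens U} (v : S V W) : res V le_rfl v = v := by
  have : (shf V).map (𝟙 (op W)) = 𝟙 _ := (shf V).map_id _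
  exact congrArg (fun f => f.hom v) this

theorem res_res {W₁ W₂ W₃ : Opens U} (i : W₁ ≤ W₂) (j : W₂ ≤ W₃) (v : S V W₃) :
    res V i (res V j v) = res V (i.trans j) v := by
  have := (shf V).map_comp (homOfLE j).op (homOfLE i).op
  exact (congrArg (fun f => f.hom v) this).symm

theorem res_η {W₁ W₂ : Opens U} (i : W₁ ≤ W₂) (x : PreSec V W₂) :
    res V i (η V W₂ x) = η V W₁ (preRes V i x) := by
  have := (toSheafify (Opens.grothendieckTopology (TopCat.of U)) (pre V)).naturality (homOfLE i).op
  exact (congrArg (fun f => f.hom x) this).symm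

/-- Sections of the sheaf come locally from the presheaf. -/
theorem exists_η {W : Opens U} (s : S V W) : ∀ x ∈ W, ∃ (N : Opens U) (i : N ≤ W), x ∈ N ∧
    ∃ p : PreSec V N, η V N p = res V i s := by
  intro x hx
  obtain ⟨N, f, ⟨p, hp⟩, hN⟩ := Presheaf.imageSieve_mem
    (Opens.grothendieckTopology (TopCat.of U))
    (toSheafify (Opens.grothendieckTopology (TopCat.of U)) (pre V)) (U := op W) s x hx
  exact ⟨N, f.le, hN, p, hp⟩

/-- Sections of the presheaf with equal images in the sheaf are locally equal. -/
theorem eq_of_η {W : Opens U} {p q : PreSec V W} (e : η V W p = η V W q) : ∀ x ∈ W,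
    ∃ (N : Opens U) (i : N ≤ W), x ∈ N ∧ preRes V i p = preRes V i q := by
  intro x hx
  obtain ⟨N, f, hp, hN⟩ := Presheaf.equalizerSieve_mem
    (Opens.grothendieckTopology (TopCat.of U))
    (toSheafify (Opens.grothendieckTopology (TopCat.of U)) (pre V)) (X := op W) p q e x hx
  exact ⟨N, f.le, hN, hp⟩

theorem glue {W : Opens U} {ι : Type} (N : ι → Opens U) (i : ∀ j, N j ≤ W)
    (hc : ∀ x ∈ W, ∃ j, x ∈ N j) (s : ∀ j, S V (N j))
    (hs : ∀ j k (M : Opens U) (hj : M ≤ N j) (hk : M ≤ N k), res V hj (s j) = res V hk (s k)) :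
    ∃! v : S V W, ∀ j, res V (i j) v = s j :=
  TopCat.Sheaf.existsUnique_gluing' (X := TopCat.of U)
    ((presheafToSheaf (Opens.grothendieckTopology (TopCat.of U)) RingCat).obj (pre V))
    N W (fun x => homOfLE (i x))
    (fun x hxW => Opens.mem_iSup.2 (hc x hxW)) s (fun j k => hs j k _ inf_le_left inf_le_right)

/-- The ring homomorphism from the structure sheaf. -/
def alg (W : Opens U) : Fn U W →+* S V W := (η V W).comp (CARRing.coef _)

theorem res_alg {W₁ W₂ : Opens U} (i : W₁ ≤ W₂) (a : Fn U W₂) :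
    res V i (alg V W₂ a) = alg V W₁ (resFn i a) := by
  simp only [alg, RingHom.comp_apply, res_η, preRes_coef]

/-- The sheaf of CAR algebras as a sheaf of modules. -/
def mod : ModSheaf U := SecData.toModSheaf
  { S := S V
    mod := fun W => Module.compHom _ (alg V W)
    r := fun i => (res V i).toAddMonoidHom
    r_smul := fun i a v => by
      change res V i (alg V _ a * v) = alg V _ (resFn i a) * res V i v
      rw [map_mul, res_alg]
    r_id := res_id V
    r_r := res_res V
    glue := glue V }

section extend
variable {U' : Man} {h : U' ⟶ U} {B : ModSheaf U'}

/-- Maps out of the presheaf of CAR algebras extend to the associated sheaf. -/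
theorem exists_extend (κ : ∀ W : Opens U, PreSec V W → Sec B (SmoothAQFT.pre h W))
    (hκ : ∀ {W₁ W₂ : Opens U} (i : W₁ ≤ W₂) (p : PreSec V W₂),
      κ W₁ (preRes V i p) = Sec.res (pre_mono h i) (κ W₂ p)) :
    ∃ μ : ∀ W : Opens U, S V W → Sec B (SmoothAQFT.pre h W),
      (∀ W p, μ W (η V W p) = κ W p) ∧
      ∀ {W₁ W₂ : Opens U} (i : W₁ ≤ W₂) (s : S V W₂),
        μ W₁ (res V i s) = Sec.res (pre_mono h i) (μ W₂ s) := by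
  have key : ∀ {W₁ W₂ : Opens U} (p : PreSec V W₁) (q : PreSec V W₂) (M : Opens U) (i : M ≤ W₁)
      (j : M ≤ W₂), res V i (η V _ p) = res V j (η V _ q) →
      Sec.res (pre_mono h i) (κ W₁ p) = Sec.res (pre_mono h j) (κ W₂ q) := by
    intro W₁ W₂ p q M i j e
    rw [← hκ i, ← hκ j]
    rw [res_η, res_η] at e
    refine Sec.eq_of_locally fun x hx => ?_
    obtain ⟨N, k, hN, hk⟩ := eq_of_η V e (h x) hx
    exact ⟨SmoothAQFT.pre h N, pre_mono h k, hN, by rw [← hκ k, hk, hκ k]⟩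
  -- A section of the sheaf is covered by the opens on which it comes from the presheaf.
  have G : ∀ (W : Opens U) (s : S V W), ∃! v : Sec B (SmoothAQFT.pre h W),
      ∀ j : (Σ N : {N : Opens U // N ≤ W}, {p : PreSec V N // η V N p = res V N.2 s}),
        Sec.res (pre_mono h j.1.2) v = κ _ j.2.1 := by
    intro W s
    refine Sec.glue (fun j : (Σ N : {N : Opens U // N ≤ W}, {p : PreSec V N //
      η V N p = res V N.2 s}) => SmoothAQFT.pre h j.1.1) (fun j => pre_mono h j.1.2) ?_ _ ?_
    · intro x hx
      obtain ⟨N, i, hN, p, hp⟩ := exists_η V s (h x) hx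
      exact ⟨⟨⟨N, i⟩, ⟨p, hp⟩⟩, hN⟩
    · rintro ⟨⟨N, i⟩, ⟨p, hp⟩⟩ ⟨⟨N', i'⟩, ⟨p', hp'⟩⟩ M hj hk
      refine Sec.eq_of_locally fun x hx => ?_
      have e := key p p' (N ⊓ N') inf_le_left inf_le_right (by
        rw [hp, hp', res_res, res_res])
      have := congrArg (Sec.res (show M ≤ SmoothAQFT.pre h (N ⊓ N') from
        fun y hy => ⟨hj hy, hk hy⟩)) e
      rw [Sec.res_res, Sec.res_res] at this
      exact ⟨M, le_rfl, hx, congrArg _ this⟩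
  choose μ hμ hu using G
  refine ⟨μ, fun W p => ?_, fun {W₁ W₂} i s => ?_⟩
  · have := hμ W (η V W p) ⟨⟨W, le_rfl⟩, ⟨p, (res_id V _).symm⟩⟩
    exact (Sec.res_id _).symm.trans this
  · refine (hu W₁ (res V i s) _ ?_).symm
    rintro ⟨⟨N, j⟩, ⟨p, hp⟩⟩
    have := hμ W₂ s ⟨⟨N, j.trans i⟩, ⟨p, by rw [hp, res_res]⟩⟩
    exact (Sec.res_res (pre_mono h j) (pre_mono h i) _).trans this

end extend

/-- Two sections come from the presheaf on a common neighbourhood. -/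
theorem exists_η₂ {W : Opens U} (s t : S V W) (x : U) (hx : x ∈ W) :
    ∃ (N : Opens U) (i : N ≤ W), x ∈ N ∧
      ∃ p q : PreSec V N, η V N p = res V i s ∧ η V N q = res V i t := by
  obtain ⟨N, i, hN, p, hp⟩ := exists_η V s x hx
  obtain ⟨N', i', hN', p', hp'⟩ := exists_η V t x hx
  refine ⟨N ⊓ N', inf_le_left.trans i, ⟨hN, hN'⟩, preRes V inf_le_left p,
    preRes V inf_le_right p', ?_, ?_⟩
  · rw [← res_η, hp, res_res]
  · rw [← res_η, hp', res_res]

theorem eq_of_locally {W : Opens U} {s t : S V W}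
    (H : ∀ x ∈ W, ∃ (N : Opens U) (i : N ≤ W), x ∈ N ∧ res V i s = res V i t) : s = t :=
  Sec.eq_of_locally (V := mod V) H

/-- The involution on the presheaf of CAR algebras, as an anti-homomorphism. -/
def preStar (W : Opens U) : PreSec V W →+* (PreSec V W)ᵐᵒᵖ :=
  CARRing.lift (((CARRing.coef _).comp (starRingEnd (Fn U W))).toOpposite
      fun a b => CARRing.coef_comm _ _)
    (MulOpposite.opAddEquiv.toAddMonoidHom.comp ((CARRing.gen _).comp
      (AddMonoidHom.mk' V.st V.st_add)))
    (fun a v => MulOpposite.unop_injective (by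
      refine (congrArg (CARRing.gen _) (V.st_smul a v)).trans ((CARRing.gen_smul _ _).trans ?_)
      exact CARRing.coef_comm _ _))
    (fun a v => MulOpposite.unop_injective (CARRing.coef_comm _ _).symm)
    (fun v w => MulOpposite.unop_injective (by
      refine (add_comm (G := PreSec V W) _ _).trans ?_
      refine Eq.trans ?_ (congrArg (CARRing.coef _) (V.pair_st v w))
      refine Eq.trans ?_ (CARRing.car _ _)
      rfl))

theorem preStar_coef {W : Opens U} (a : Fn U W) :
    preStar V W (CARRing.coef _ a) = MulOpposite.op (CARRing.coef _ (star a)) :=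
  CARRing.lift_coef ..

theorem preStar_gen {W : Opens U} (v : Sec V.V W) :
    preStar V W (CARRing.gen _ v) = MulOpposite.op (CARRing.gen _ (V.st v)) :=
  CARRing.lift_gen ..

theorem preStar_preStar {W : Opens U} (p : PreSec V W) :
    (preStar V W (preStar V W p).unop).unop = p := by
  induction p using CARRing.induction with
  | hc a => rw [preStar_coef, MulOpposite.unop_op, preStar_coef, star_star]; rfl
  | hg v => rw [preStar_gen, MulOpposite.unop_op, preStar_gen, V.st_st]; rfl
  | ha x y hx hy => simp only [map_add, MulOpposite.unop_add, hx, hy]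
  | hm x y hx hy => simp only [map_mul, MulOpposite.unop_mul, hx, hy]

theorem preRes_preStar {W₁ W₂ : Opens U} (i : W₁ ≤ W₂) (p : PreSec V W₂) :
    (preStar V W₁ (preRes V i p)).unop = preRes V i (preStar V W₂ p).unop := by
  induction p using CARRing.induction with
  | hc a =>
    rw [preRes_coef, preStar_coef, preStar_coef, MulOpposite.unop_op, MulOpposite.unop_op,
      preRes_coef]
    rfl
  | hg v =>
    rw [preRes_gen, preStar_gen, preStar_gen, MulOpposite.unop_op, MulOpposite.unop_op,
      preRes_gen, V.res_st]
  | ha x y hx hy => simp only [map_add, MulOpposite.unop_add, hx, hy]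
  | hm x y hx hy => simp only [map_mul, MulOpposite.unop_mul, hx, hy]

/-- The involution of the presheaf extends to the sheaf. -/
theorem exists_star : ∃ μ : ∀ W : Opens U, S V W → S V W,
      (∀ W p, μ W (η V W p) = η V W (preStar V W p).unop) ∧
      ∀ {W₁ W₂ : Opens U} (i : W₁ ≤ W₂) (s : S V W₂), μ W₁ (res V i s) = res V i (μ W₂ s) :=
  exists_extend (h := 𝟙 U) (B := mod V) V (fun W p => η V W (preStar V W p).unop)
    (fun {W₁ _} i p => (congrArg (η V W₁) (preRes_preStar V i p)).trans (res_η V i _).symm)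

/-- The involution on the sheaf of CAR algebras. -/
def st {W : Opens U} (s : S V W) : S V W := (exists_star V).choose W s

theorem st_η {W : Opens U} (p : PreSec V W) : st V (η V W p) = η V W (preStar V W p).unop :=
  (exists_star V).choose_spec.1 W p

theorem res_st {W₁ W₂ : Opens U} (i : W₁ ≤ W₂) (s : S V W₂) : res V i (st V s) = st V (res V i s) :=
  ((exists_star V).choose_spec.2 i s).symm

theorem st_add {W : Opens U} (s t : S V W) : st V (s + t) = st V s + st V t := by
  refine eq_of_locally V fun x hx => ?_
  obtain ⟨N, i, hN, p, q, hp, hq⟩ := exists_η₂ V s t x hx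
  refine ⟨N, i, hN, ?_⟩
  rw [map_add, res_st, res_st, res_st, map_add, ← hp, ← hq, ← map_add, st_η, st_η, st_η, map_add,
    MulOpposite.unop_add, map_add]

theorem st_mul {W : Opens U} (s t : S V W) : st V (s * t) = st V t * st V s := by
  refine eq_of_locally V fun x hx => ?_
  obtain ⟨N, i, hN, p, q, hp, hq⟩ := exists_η₂ V s t x hx
  refine ⟨N, i, hN, ?_⟩
  rw [map_mul, res_st, res_st, res_st, map_mul, ← hp, ← hq, ← map_mul, st_η, st_η, st_η, map_mul,
    MulOpposite.unop_mul, map_mul]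

theorem st_st {W : Opens U} (s : S V W) : st V (st V s) = s := by
  refine eq_of_locally V fun x hx => ?_
  obtain ⟨N, i, hN, p, hp⟩ := exists_η V s x hx
  refine ⟨N, i, hN, ?_⟩
  rw [res_st, res_st, ← hp, st_η, st_η, preStar_preStar]

theorem st_alg {W : Opens U} (a : Fn U W) : st V (alg V W a) = alg V W (star a) := by
  rw [alg, RingHom.comp_apply, st_η, preStar_coef]
  rfl

theorem alg_comm {W : Opens U} (a : Fn U W) (s : S V W) : alg V W a * s = s * alg V W a := by
  refine eq_of_locally V fun x hx => ?_
  obtain ⟨N, i, hN, p, hp⟩ := exists_η V s x hx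
  refine ⟨N, i, hN, ?_⟩
  rw [map_mul, map_mul, res_alg, ← hp, alg, RingHom.comp_apply, ← map_mul, CARRing.coef_comm,
    map_mul]

theorem mul_alg {W : Opens U} (a : Fn U W) (s t : S V W) :
    s * (alg V W a * t) = alg V W a * (s * t) := by
  rw [← mul_assoc, ← alg_comm, mul_assoc]

/-- The sheaf of CAR algebras of an inner product sheaf. -/
def algSheaf : AlgSheaf U where
  V := mod V
  st := st V
  st_add := st_add V
  st_smul a _ := (st_mul V _ _).trans ((congrArg (fun t => _ * t) (st_alg V a)).trans
    (alg_comm V _ _).symm)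
  st_st := st_st V
  res_st := res_st V
  mul {W} s t := (show S V W from s) * (show S V W from t)
  one W := (1 : S V W)
  add_mul {W} := add_mul (R := S V W)
  mul_add {W} := mul_add (R := S V W)
  smul_mul {W} a s t := mul_assoc (G := S V W) (alg V W a) s t
  mul_smul a s t := mul_alg V a s t
  mul_assoc {W} := mul_assoc (G := S V W)
  one_mul {W} := one_mul (M := S V W)
  mul_one {W} := mul_one (M := S V W)
  st_mul := st_mul V
  res_mul {_ W₂} i s t := map_mul (res V i) (show S V W₂ from s) t
  res_one i := map_one (res V i)

/-- The generators of the sheaf of CAR algebras. -/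
def ι (W : Opens U) : Sec V.V W →+ Sec (algSheaf V).V W :=
  (η V W).toAddMonoidHom.comp (CARRing.gen _)

theorem ι_smul {W : Opens U} (a : Fn U W) (v : Sec V.V W) : ι V W (a • v) = a • ι V W v :=
  (congrArg (η V W) (CARRing.gen_smul a v)).trans (map_mul (η V W) _ _)

theorem ι_res {W W' : Opens U} (i : W' ≤ W) (v : Sec V.V W) :
    ι V W' (Sec.res i v) = Sec.res i (ι V W v) :=
  ((res_η V i _).trans (congrArg (η V W') (preRes_gen V i v))).symm

theorem ι_st {W : Opens U} (v : Sec V.V W) : ι V W (V.st v) = (algSheaf V).st (ι V W v) :=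
  ((st_η V _).trans (congrArg (fun t => η V W (MulOpposite.unop t)) (preStar_gen V v))).symm

theorem smul_one {W : Opens U} (a : Fn U W) : a • (algSheaf V).one W = alg V W a :=
  mul_one (M := S V W) _

theorem ι_rel {W : Opens U} (v w : Sec V.V W) :
    (algSheaf V).mul (ι V W v) (ι V W w) + (algSheaf V).mul (ι V W w) (ι V W v) =
      V.pair v w • (algSheaf V).one W := by
  rw [smul_one]
  have := congrArg (η V W) (CARRing.car (p := V.pair (W := W)) v w)
  rw [map_add, map_mul, map_mul] at this
  exact this

end CAR

/-! ### The universal property and functoriality of the sheaf of CAR algebras -/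

namespace CAR

section lift
variable {U U' : Man} {h : U' ⟶ U} {V : IPSheaf U} {B : AlgSheaf U'} (κ : Como h V.V B.V)

/-- A morphism from an inner product sheaf to a sheaf of `*`-algebras over `h` that is compatible
with the involutions and satisfies the canonical anti-commutation relations. -/
structure IsRep : Prop where
  st : ∀ W (v : Sec V.V W), κ.app W (V.st v) = B.st (κ.app W v)
  rel : ∀ W (v w : Sec V.V W), B.mul (κ.app W v) (κ.app W w) + B.mul (κ.app W w) (κ.app W v) =
    pullFn h W (V.pair v w) • B.one (SmoothAQFT.pre h W)

variable {κ}

/-- The scalar multiples of the unit of a sheaf of algebras. -/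
def unitHom (B : AlgSheaf U') (W : Opens U') : Fn U' W →+* B.Rg W where
  toFun a := a • B.one W
  map_one' := one_smul (Fn U' W) (B.one W)
  map_mul' a b := by
    refine Eq.trans ?_ (B.smul_mul a _ _).symm
    exact (mul_smul a b (B.one W)).trans (congrArg (a • ·) (B.one_mul _).symm)
  map_zero' := zero_smul (Fn U' W) (B.one W)
  map_add' a b := add_smul a b (B.one W)

theorem unitHom_mul {W : Opens U'} (a : Fn U' W) (s : Sec B.V W) :
    B.mul (unitHom B W a) s = a • s :=
  (B.smul_mul a _ _).trans (congrArg (a • ·) (B.one_mul s))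

theorem mul_unitHom {W : Opens U'} (a : Fn U' W) (s : Sec B.V W) :
    B.mul s (unitHom B W a) = a • s :=
  (B.mul_smul a _ _).trans (congrArg (a • ·) (B.mul_one s))

/-- The extension of a representation to the presheaf of CAR algebras. -/
def preLift (H : IsRep κ) (W : Opens U) : PreSec V W →+* B.Rg (SmoothAQFT.pre h W) :=
  CARRing.lift ((unitHom B _).comp (pullFn h W)) (κ.app W)
    (fun a v => (κ.smul a v).trans (unitHom_mul _ _).symm)
    (fun _ _ => (unitHom_mul _ _).trans (mul_unitHom _ _).symm)
    (fun v w => H.rel W v w)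

theorem preLift_coef (H : IsRep κ) {W : Opens U} (a : Fn U W) :
    preLift H W (CARRing.coef _ a) = unitHom B _ (pullFn h W a) := CARRing.lift_coef ..

theorem preLift_gen (H : IsRep κ) {W : Opens U} (v : Sec V.V W) :
    preLift H W (CARRing.gen _ v) = κ.app W v := CARRing.lift_gen ..

/-- Restriction of sections as a ring homomorphism. -/
def rgRes (B : AlgSheaf U') {W₁ W₂ : Opens U'} (i : W₁ ≤ W₂) : B.Rg W₂ →+* B.Rg W₁ :=
  { Sec.res i with
    map_one' := B.res_one i
    map_mul' := B.res_mul i }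

theorem preLift_res (H : IsRep κ) {W₁ W₂ : Opens U} (i : W₁ ≤ W₂) (p : PreSec V W₂) :
    preLift H W₁ (preRes V i p) = rgRes B (pre_mono h i) (preLift H W₂ p) := by
  refine CARRing.hom_ext (f := (preLift H W₁).comp (preRes V i))
    (g := (rgRes B (pre_mono h i)).comp (preLift H W₂)) (fun a => ?_) (fun v => ?_) p
  · rw [RingHom.comp_apply, RingHom.comp_apply, preRes_coef, preLift_coef, preLift_coef]
    refine Eq.trans ?_ (Sec.res_smul (V := B.V) _ _ _).symm
    exact congrArg _ (B.res_one _).symm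
  · rw [RingHom.comp_apply, RingHom.comp_apply, preRes_gen, preLift_gen, preLift_gen]
    exact κ.nat i v

theorem preLift_st (H : IsRep κ) {W : Opens U} (p : PreSec V W) :
    preLift H W (preStar V W p).unop = B.st (preLift H W p) := by
  induction p using CARRing.induction with
  | hc a =>
    rw [preStar_coef, MulOpposite.unop_op, preLift_coef, preLift_coef]
    refine Eq.trans ?_ (B.st_smul _ _).symm
    have := B.st_mul (B.st (B.one (SmoothAQFT.pre h W))) (B.one _)
    rw [B.mul_one, B.st_st, B.mul_one] at this
    rw [← this]
    rfl
  | hg v =>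
    rw [preStar_gen, MulOpposite.unop_op, preLift_gen, preLift_gen]
    exact H.st W v
  | ha x y hx hy =>
    rw [map_add, MulOpposite.unop_add, map_add, hx, hy, map_add]
    exact (B.st_add _ _).symm
  | hm x y hx hy =>
    rw [map_mul, MulOpposite.unop_mul, map_mul, hx, hy, map_mul]
    exact (B.st_mul _ _).symm

theorem exists_lift (H : IsRep κ) : ∃ μ : ∀ W : Opens U, S V W → Sec B.V (SmoothAQFT.pre h W),
      (∀ W p, μ W (η V W p) = preLift H W p) ∧
      ∀ {W₁ W₂ : Opens U} (i : W₁ ≤ W₂) (s : S V W₂),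
        μ W₁ (res V i s) = Sec.res (pre_mono h i) (μ W₂ s) :=
  exists_extend V (fun W p => preLift H W p) (fun i p => preLift_res H i p)

/-- The extension of a representation to the sheaf of CAR algebras, as a map. -/
def liftFun (H : IsRep κ) (W : Opens U) : S V W → Sec B.V (SmoothAQFT.pre h W) :=
  (exists_lift H).choose W

theorem liftFun_η (H : IsRep κ) {W : Opens U} (p : PreSec V W) :
    liftFun H W (η V W p) = preLift H W p := (exists_lift H).choose_spec.1 W p

theorem liftFun_res (H : IsRep κ) {W₁ W₂ : Opens U} (i : W₁ ≤ W₂) (s : S V W₂) :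
    liftFun H W₁ (res V i s) = Sec.res (pre_mono h i) (liftFun H W₂ s) :=
  (exists_lift H).choose_spec.2 i s

theorem liftFun_add (H : IsRep κ) {W : Opens U} (s t : S V W) :
    liftFun H W (s + t) = liftFun H W s + liftFun H W t := by
  refine Sec.eq_of_locally fun x hx => ?_
  obtain ⟨N, i, hN, p, q, hp, hq⟩ := exists_η₂ V s t (h x) hx
  refine ⟨SmoothAQFT.pre h N, pre_mono h i, hN, ?_⟩
  rw [map_add, ← liftFun_res H i, ← liftFun_res H i, ← liftFun_res H i, map_add, ← hp, ← hq,
    ← map_add, liftFun_η, liftFun_η, liftFun_η]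
  exact map_add (preLift H N) p q

theorem liftFun_mul (H : IsRep κ) {W : Opens U} (s t : S V W) :
    liftFun H W (s * t) = B.mul (liftFun H W s) (liftFun H W t) := by
  refine Sec.eq_of_locally fun x hx => ?_
  obtain ⟨N, i, hN, p, q, hp, hq⟩ := exists_η₂ V s t (h x) hx
  refine ⟨SmoothAQFT.pre h N, pre_mono h i, hN, ?_⟩
  rw [B.res_mul, ← liftFun_res H i, ← liftFun_res H i, ← liftFun_res H i, map_mul, ← hp, ← hq,
    ← map_mul, liftFun_η, liftFun_η, liftFun_η]
  exact map_mul (preLift H N) p q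

theorem liftFun_st (H : IsRep κ) {W : Opens U} (s : S V W) :
    liftFun H W (st V s) = B.st (liftFun H W s) := by
  refine Sec.eq_of_locally fun x hx => ?_
  obtain ⟨N, i, hN, p, hp⟩ := exists_η V s (h x) hx
  refine ⟨SmoothAQFT.pre h N, pre_mono h i, hN, ?_⟩
  rw [B.res_st, ← liftFun_res H i, ← liftFun_res H i, res_st, ← hp, st_η, liftFun_η, liftFun_η]
  exact preLift_st H p

theorem liftFun_alg (H : IsRep κ) {W : Opens U} (a : Fn U W) :
    liftFun H W (alg V W a) = unitHom B _ (pullFn h W a) :=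
  (liftFun_η H _).trans (preLift_coef H a)

/-- The morphism of sheaves of `*`-algebras induced by a representation. -/
def lift (H : IsRep κ) : AlgComo h (algSheaf V) B where
  app W := AddMonoidHom.mk' (fun s => liftFun H W s) (liftFun_add H)
  smul a _ := (liftFun_mul H _ _).trans ((congrArg (fun t => B.mul t _) (liftFun_alg H a)).trans
    (unitHom_mul _ _))
  nat i s := liftFun_res H i s
  st s := liftFun_st H s
  mul s t := liftFun_mul H s t
  one W := (congrArg (liftFun H W) (map_one (alg V W)).symm).trans
    ((liftFun_alg H 1).trans ((congrArg _ (map_one (pullFn h W))).trans (map_one (unitHom B _))))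

theorem lift_ι (H : IsRep κ) (W : Opens U) (v : Sec V.V W) :
    (lift H).app W (ι V W v) = κ.app W v :=
  (liftFun_η H _).trans (preLift_gen H v)

/-- Morphisms out of the sheaf of CAR algebras are determined by the generators. -/
theorem alg_hom_ext {φ ψ : AlgComo h (algSheaf V) B}
    (H : ∀ W (v : Sec V.V W), φ.app W (ι V W v) = ψ.app W (ι V W v)) : φ = ψ := by
  refine AlgComo.ext (funext fun W => AddMonoidHom.ext fun s => Sec.eq_of_locally fun x hx => ?_)
  obtain ⟨N, i, hN, p, hp⟩ := exists_η V s (h x) hx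
  refine ⟨SmoothAQFT.pre h N, pre_mono h i, hN, ?_⟩
  rw [← φ.nat i, ← ψ.nat i]
  have e : Sec.res (V := (algSheaf V).V) i s = η V N p := hp.symm
  rw [e]
  have hc : ∀ (χ : AlgComo h (algSheaf V) B) (a : Fn U N),
      χ.app N (alg V N a) = pullFn h N a • B.one _ := by
    intro χ a
    have := congrArg (χ.app N) (smul_one V a)
    exact this.symm.trans ((χ.smul a _).trans (congrArg _ (χ.one N)))
  clear e hp
  induction p using CARRing.induction with
  | hc a => exact (hc φ a).trans (hc ψ a).symm
  | hg v => exact H N v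
  | ha p q hp hq =>
    rw [map_add]
    exact (map_add (φ.app N) _ _).trans ((congrArg₂ _ hp hq).trans (map_add (ψ.app N) _ _).symm)
  | hm p q hp hq =>
    rw [map_mul]
    exact (φ.mul _ _).trans ((congrArg₂ _ hp hq).trans (ψ.mul _ _).symm)

end lift

section functor
variable {U U' U'' : Man}

variable {h : U' ⟶ U} {k : U'' ⟶ U'} {A : IPSheaf U} {B : IPSheaf U'} {C : IPSheaf U''}

/-- The representation of `A` on the CAR algebra of `B` defined by a morphism. -/
def repOf (κ : IPComo h A B) : Como h A.V (algSheaf B).V where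
  app W := (ι B _).comp (κ.app W)
  smul a v := (congrArg (ι B _) (κ.smul a v)).trans (ι_smul B _ _)
  nat i v := (congrArg (ι B _) (κ.nat i v)).trans (ι_res B _ _)

theorem isRep_repOf (κ : IPComo h A B) : IsRep (repOf κ) where
  st _ v := (congrArg (ι B _) (κ.st v)).trans (ι_st B _)
  rel _ v w := (ι_rel B _ _).trans (congrArg (fun a => a • (algSheaf B).one _) (κ.pair v w))

/-- The action of the CAR quantization on morphisms. -/
def map (κ : IPComo h A B) : AlgComo h (algSheaf A) (algSheaf B) := lift (isRep_repOf κ)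

theorem map_ι (κ : IPComo h A B) (W : Opens U) (v : Sec A.V W) :
    (map κ).app W (ι A W v) = ι B _ (κ.app W v) := lift_ι _ _ _

theorem map_id (A : IPSheaf U) : map (IPComo.id A) = AlgComo.id (algSheaf A) :=
  alg_hom_ext fun W v => map_ι _ W v

theorem map_comp (κ : IPComo h A B) (μ : IPComo k B C) :
    map (κ.comp μ) = (map κ).comp (map μ) :=
  alg_hom_ext fun W v => (map_ι _ W v).trans
    ((congrArg ((map μ).app _) (map_ι κ W v)).trans (map_ι μ _ _)).symm

/-- The anti-commutation relations hold on the inverse image as soon as they hold on the pulled back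
sections. -/
theorem rel_lift {Z : AlgSheaf U''} {μ : Como k (pullMod h A.V) Z.V}
    (hrel : ∀ (W : Opens U) (v w : Sec A.V W),
      Z.mul (μ.app (SmoothAQFT.pre h W) ((Como.unit h A.V).app W v))
          (μ.app (SmoothAQFT.pre h W) ((Como.unit h A.V).app W w)) +
        Z.mul (μ.app (SmoothAQFT.pre h W) ((Como.unit h A.V).app W w))
          (μ.app (SmoothAQFT.pre h W) ((Como.unit h A.V).app W v)) =
        pullFn k (SmoothAQFT.pre h W) (pullFn h W (A.pair v w)) • Z.one _)
    (N : Opens U') (s t : Sec (pullMod h A.V) N) :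
    Z.mul (μ.app N s) (μ.app N t) + Z.mul (μ.app N t) (μ.app N s) =
      pullFn k N (A.ppair s t) • Z.one _ := by
  have zl : ∀ (W : Opens U'') (v : Sec Z.V W), Z.mul 0 v = 0 :=
    fun W v => zero_mul (M₀ := Z.Rg W) v
  have zr : ∀ (W : Opens U'') (v : Sec Z.V W), Z.mul v 0 = 0 :=
    fun W v => mul_zero (M₀ := Z.Rg W) v
  refine Sec.eq_of_locally fun x hx => ?_
  obtain ⟨M, i, W, j, hxM, hs, ht, -⟩ := Como.local_gens₃ N s t t (k x) hx
  refine ⟨SmoothAQFT.pre k M, pre_mono k i, hxM, ?_⟩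
  have e : resFn (pre_mono k i) (pullFn k N (A.ppair s t)) =
    pullFn k M (resFn i (A.ppair s t)) := rfl
  have e₁ : ∀ v : Sec (pullMod h A.V) N, Sec.res (pre_mono k i) (μ.app N v) =
    μ.app M (Sec.res i v) := fun v => (μ.nat i v).symm
  rw [Sec.res_smul, Z.res_one, e, A.res_ppair, map_add, Z.res_mul, Z.res_mul, e₁, e₁]
  clear e e₁
  generalize Sec.res i s = s at *
  generalize Sec.res i t = t at *
  induction hs using Submodule.span_induction with
  | mem s hs =>
    obtain ⟨v, rfl⟩ := hs
    induction ht using Submodule.span_induction with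
    | mem s hs =>
      obtain ⟨w, rfl⟩ := hs
      dsimp only
      rw [← A.res_ppair, A.ppair_unit, μ.nat, μ.nat, ← Z.res_mul, ← Z.res_mul, ← map_add, hrel,
        Sec.res_smul, Z.res_one]
      rfl
    | zero => rw [map_zero, zl, zr, A.ppair_zero_right, map_zero, zero_smul, add_zero]
    | add s t _ _ h₁ h₂ =>
      rw [map_add, Z.mul_add, Z.add_mul, A.ppair_add_right, map_add, add_smul, ← h₁, ← h₂]
      abel
    | smul a s _ h₁ =>
      rw [μ.smul, Z.mul_smul, Z.smul_mul, A.ppair_smul_right, map_mul, mul_smul, ← h₁, smul_add]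
  | zero => rw [map_zero, zl, zr, A.ppair_zero_left, map_zero, zero_smul, add_zero]
  | add s t _ _ h₁ h₂ =>
    rw [map_add, Z.mul_add, Z.add_mul, A.ppair_add_left, map_add, add_smul, ← h₁, ← h₂]
    abel
  | smul a s _ h₁ =>
    rw [μ.smul, Z.mul_smul, Z.smul_mul, A.ppair_smul_left, map_mul, mul_smul, ← h₁, smul_add]

/-- A morphism out of the inverse image is a representation if it is one on pulled back sections. -/
theorem isRep_of_unit {Z : AlgSheaf U''} {μ : Como k (pullMod h A.V) Z.V}
    (hst : ∀ (W : Opens U) (v : Sec A.V W),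
      μ.app (SmoothAQFT.pre h W) ((Como.unit h A.V).app W (A.st v)) =
        Z.st (μ.app (SmoothAQFT.pre h W) ((Como.unit h A.V).app W v)))
    (hrel : ∀ (W : Opens U) (v w : Sec A.V W),
      Z.mul (μ.app (SmoothAQFT.pre h W) ((Como.unit h A.V).app W v))
          (μ.app (SmoothAQFT.pre h W) ((Como.unit h A.V).app W w)) +
        Z.mul (μ.app (SmoothAQFT.pre h W) ((Como.unit h A.V).app W w))
          (μ.app (SmoothAQFT.pre h W) ((Como.unit h A.V).app W v)) =
        pullFn k (SmoothAQFT.pre h W) (pullFn h W (A.pair v w)) • Z.one _) :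
    IsRep (V := A.pull h) μ where
  st N s := st_lift (A := A.toStarSheaf) (Z := Z.toStarSheaf) μ hst N s
  rel N s t := rel_lift hrel N s t

/-- The representation of `A` on the inverse image of its CAR algebra. -/
def pullRep (h : U' ⟶ U) (A : IPSheaf U) : Como h A.V ((algSheaf A).pull h).V where
  app W := ((AlgComo.unit h (algSheaf A)).app W).comp (ι A W)
  smul a v := (congrArg ((AlgComo.unit h (algSheaf A)).app _) (ι_smul A a v)).trans
    ((AlgComo.unit h (algSheaf A)).smul _ _)
  nat i v := (congrArg ((AlgComo.unit h (algSheaf A)).app _) (ι_res A i v)).trans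
    ((AlgComo.unit h (algSheaf A)).nat _ _)

theorem isRep_pullRep (h : U' ⟶ U) (A : IPSheaf U) : IsRep (pullRep h A) where
  st _ v := (congrArg ((AlgComo.unit h (algSheaf A)).app _) (ι_st A v)).trans
    ((AlgComo.unit h (algSheaf A)).st _)
  rel W v w := by
    have := congrArg ((AlgComo.unit h (algSheaf A)).app W) (ι_rel A v w)
    rw [map_add, AlgComo.mul, AlgComo.mul, (AlgComo.unit h (algSheaf A)).smul, AlgComo.one] at this
    exact this

/-- The representation of `A` on the inverse image of its CAR algebra extends along `A → h^* A`. -/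
theorem exists_pullExt (h : U' ⟶ U) (A : IPSheaf U) :
    ∃ φ : AlgComo (𝟙 U') (algSheaf (A.pull h)) ((algSheaf A).pull h),
      ∀ W (v : Sec A.V W), φ.app _ (ι (A.pull h) _ ((IPComo.unit h A).app W v)) =
        (AlgComo.unit h (algSheaf A)).app W (ι A W v) := by
  obtain ⟨μ, hμ, -⟩ := Como.existsUnique (k := 𝟙 U') (h := h) (pullRep h A)
  have H : IsRep (V := A.pull h) μ := isRep_of_unit
    (fun W v => by
      refine (hμ W _).trans (((isRep_pullRep h A).st W v).trans ?_)
      exact congrArg _ (hμ W v).symm)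
    (fun W v w => by
      refine Eq.trans ?_ ((isRep_pullRep h A).rel W v w)
      exact congrArg₂ (· + ·) (congrArg₂ _ (hμ W v) (hμ W w)) (congrArg₂ _ (hμ W w) (hμ W v)))
  exact ⟨lift H, fun W v => (lift_ι H _ _).trans (hμ W v)⟩

/-- The canonical morphism from the CAR algebra of an inverse image to the inverse image of the
CAR algebra. -/
def pullInv (h : U' ⟶ U) (A : IPSheaf U) :
    AlgComo (𝟙 U') (algSheaf (A.pull h)) ((algSheaf A).pull h) := (exists_pullExt h A).choose

theorem unit_pullInv (h : U' ⟶ U) (A : IPSheaf U) :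
    (map (IPComo.unit h A)).comp (pullInv h A) = AlgComo.unit h (algSheaf A) :=
  alg_hom_ext fun W v => (congrArg ((pullInv h A).app _) (map_ι (IPComo.unit h A) W v)).trans
    ((exists_pullExt h A).choose_spec W v)

/-- Morphisms out of the CAR algebra of an inverse image are determined on pulled back sections. -/
theorem pull_hom_ext {Z : AlgSheaf U''} {φ ψ : AlgComo k (algSheaf (A.pull h)) Z}
    (H : (map (IPComo.unit h A)).comp φ = (map (IPComo.unit h A)).comp ψ) : φ = ψ := by
  refine alg_hom_ext fun N s => ?_
  let r (φ : AlgComo k (algSheaf (A.pull h)) Z) : Como k (pullMod h A.V) Z.V :=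
    { app := fun W => (φ.app W).comp (ι (A.pull h) W)
      smul := fun a v => (congrArg (φ.app _) (ι_smul (A.pull h) a v)).trans (φ.smul _ _)
      nat := fun i v => (congrArg (φ.app _) (ι_res (A.pull h) i v)).trans (φ.nat _ _) }
  have e : ∀ W (v : Sec A.V W), (r φ).app _ ((Como.unit h A.V).app W v) =
      (r ψ).app _ ((Como.unit h A.V).app W v) := by
    intro W v
    have e₁ := congrArg (fun χ => χ.app W (ι A W v)) H
    have e₂ := fun χ : AlgComo k (algSheaf (A.pull h)) Z =>
      congrArg (χ.app _) (map_ι (IPComo.unit h A) W v)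
    exact (e₂ φ).symm.trans (e₁.trans (e₂ ψ))
  have := (Como.existsUnique (k := k) (h := h) ((Como.unit h A.V).comp (r ψ))).unique
    (y₁ := r φ) (y₂ := r ψ) e (fun _ _ => rfl)
  exact congrArg (fun c => c.app N s) this

end functor

theorem map_sys_comp {b c d : Manᵒᵖ} {f : b ⟶ c} {g : c ⟶ d} {k : b ⟶ d} (e : f ≫ g = k)
    {A : ipSystem.Obj b} {B : ipSystem.Obj c} {C : ipSystem.Obj d} (κ : ipSystem.Hom f A B)
    (μ : ipSystem.Hom g B C) :
    (map (ipSystem.comp e κ μ) : algSystem.Hom k (algSheaf A) (algSheaf C)) =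
      algSystem.comp e (map κ) (map μ) := by
  subst e
  exact map_comp κ μ

/-- The CAR quantization as a functor on inner product sheaves over a fixed manifold. -/
def functor (b : Manᵒᵖ) : ipSystem.Obj b ⥤ algSystem.Obj b where
  obj A := (algSheaf A : AlgSheaf b.unop)
  map κ := map κ
  map_id A := map_id A
  map_comp κ μ := map_sys_comp _ κ μ

/-- The CAR quantization with its comparison morphisms for inverse images. -/
def hetTrans : PushSystem.HetTrans algSystem IPVec where
  T := functor
  c f A := map (IPComo.unit f.unop A)
  nat {b b'} f {A B} u := by
    refine (map_sys_comp (Category.id_comp f) u (ipSystem.unit f B)).symm.trans ?_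
    refine Eq.trans ?_ (map_sys_comp (Category.comp_id f) (ipSystem.unit f A) (ipSystem.mapHom f u))
    exact congrArg map (PushSystem.unit_map (S := ipSystem) (Category.comp_id f) u).symm
  inv f A := pullInv f.unop A
  c_inv f A := unit_pullInv f.unop A
  inv_c {b b'} f A := by
    refine pull_hom_ext (h := f.unop) (A := A) (k := 𝟙 b'.unop) ?_
    have h₁ := unit_pullInv f.unop A
    have h₂ := PushSystem.fac (S := algSystem) (Category.comp_id f) (map (IPComo.unit f.unop A))
    refine Eq.trans (b := (AlgComo.unit f.unop (algSheaf A)).comp _) ?_ (h₂.trans ?_)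
    · exact congrArg (fun t => AlgComo.comp t _) h₁
    · exact (algSystem.comp_id (f := f) _).symm
  c_id b A := by
    refine (map_sys_comp (Category.comp_id (𝟙 b)) (ipSystem.unit (𝟙 b) A) _).symm.trans ?_
    exact (congrArg map (PushSystem.unit_id (S := ipSystem) _ A)).trans (map_id A)
  c_comp {b b' b''} f g A := by
    refine (map_sys_comp (Category.comp_id (f ≫ g)) (ipSystem.unit (f ≫ g) A) _).symm.trans ?_
    refine Eq.trans ?_ (map_sys_comp rfl (ipSystem.unit f A) (ipSystem.unit g _))
    exact congrArg map (PushSystem.unit_comp (S := ipSystem) _ A)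

/-- The CAR quantization as a pseudo-natural transformation. -/
def trans : PsNat IPVec StarAlg := hetTrans.toPsNat

/-- The universal property over the identity is the lift of representations. -/
theorem isCAR_trans : IsCAR trans (fun V W => ι V W) where
  add V W v w := map_add (ι V W) v w
  smul V W a v := ι_smul V a v
  res V W W' i v := ι_res V i v
  st V W v := ι_st V v
  rel V W v w := ι_rel V v w
  univ V B κ hst hrel := by
    have H : IsRep κ := ⟨hst, hrel⟩
    exact ⟨lift H, fun W v => lift_ι H W v, fun φ hφ =>
      alg_hom_ext fun W v => (hφ W v).trans (lift_ι H W v).symm⟩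
  act f W v := map_ι f W v
  coh h V W v := by
    have : PushSystem.coh (S := algSystem) trans h (IPVec.mk V) = map (IPComo.unit h V) :=
      hetTrans.coh_toPsNat h V
    exact (congrArg (fun φ : AlgComo h (algSheaf V) (algSheaf (V.pull h)) => φ.app W (ι V W v))
      this).trans (map_ι _ W v)

end CAR

/-! ### The free inner product sheaf of rank two -/

/-- Pairs of smooth functions as a sheaf of modules. -/
def pairMod (U : Man) : ModSheaf U := SecData.toModSheaf
  { S := fun W => Fn U W × Fn U W
    r := fun i => (resFn i).toAddMonoidHom.prodMap (resFn i).toAddMonoidHom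
    r_smul := fun _ _ _ => rfl
    r_id := fun _ => rfl
    r_r := fun _ _ _ => rfl
    glue := fun {W ι} N i hc s hs => by
      obtain ⟨a, ha, ha'⟩ := Sec.glue (V := Como.fnMod U) N i hc (fun j => (s j).1)
        (fun j k M hj hk => congrArg Prod.fst (hs j k M hj hk))
      obtain ⟨b, hb, hb'⟩ := Sec.glue (V := Como.fnMod U) N i hc (fun j => (s j).2)
        (fun j k M hj hk => congrArg Prod.snd (hs j k M hj hk))
      exact ⟨(a, b), fun j => Prod.ext (ha j) (hb j), fun c hcj => Prod.ext
        (ha' _ fun j => congrArg Prod.fst (hcj j)) (hb' _ fun j => congrArg Prod.snd (hcj j))⟩ }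

/-- Pairs of smooth functions with the involution `(a, b) ↦ (b^*, a^*)` and the hyperbolic pairing
`-(a b' + b a')`. -/
def hyp (U : Man) : IPSheaf U where
  V := pairMod U
  st {W} v := ((star v.2, star v.1) : Fn U W × Fn U W)
  st_add {W} v w := Prod.ext (star_add (R := Fn U W) v.2 w.2) (star_add (R := Fn U W) v.1 w.1)
  st_smul {W} a v := Prod.ext (star_mul' (R := Fn U W) a v.2) (star_mul' (R := Fn U W) a v.1)
  st_st {W} v := Prod.ext (star_star (R := Fn U W) v.1) (star_star (R := Fn U W) v.2)
  res_st _ _ := rfl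
  pair {W} v w := -((v.1 : Fn U W) * w.2 + v.2 * w.1)
  pair_add {W} v v' w := by
    change -(((v.1 : Fn U W) + v'.1) * w.2 + (v.2 + v'.2) * w.1) =
      -((v.1 : Fn U W) * w.2 + v.2 * w.1) + -((v'.1 : Fn U W) * w.2 + v'.2 * w.1)
    ring
  pair_smul {W} a v w := by
    change -(a * (v.1 : Fn U W) * w.2 + a * v.2 * w.1) = a * -((v.1 : Fn U W) * w.2 + v.2 * w.1)
    ring
  pair_symm {W} v w := by ring
  pair_st {W} v w := by
    change -((star v.2 : Fn U W) * star w.1 + star v.1 * star w.2) =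
      star (-((v.1 : Fn U W) * w.2 + v.2 * w.1))
    rw [star_neg, star_add, star_mul', star_mul', add_comm]
  res_pair _ _ _ := rfl

section
variable {U U' : Man}

/-- Sections of `hyp U` from pairs of functions. -/
def hypMk {W : Opens U} (a b : Fn U W) : Sec (hyp U).V W := ((a, b) : Fn U W × Fn U W)

/-- The components of a section of `hyp U`. -/
def hypPr {W : Opens U} (v : Sec (hyp U).V W) : Fn U W × Fn U W := v

/-- The pullback of pairs of functions. -/
def hypPull (h : U ⟶ U') : IPComo h (hyp U') (hyp U) where
  app W := (pullFn h W).toAddMonoidHom.prodMap (pullFn h W).toAddMonoidHom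
  smul _ _ := rfl
  nat _ _ := rfl
  st _ := rfl
  pair _ _ := rfl

theorem hyp_eq {W : Opens U} (v : Sec (hyp U).V W) :
    v = (hypPr v).1 • Sec.res le_top (hypMk 1 0) + (hypPr v).2 • Sec.res le_top (hypMk 0 1) := by
  refine Prod.ext (?_ : _ = (hypPr v).1 * 1 + (hypPr v).2 * 0)
    (?_ : _ = (hypPr v).1 * 0 + (hypPr v).2 * 1)
  · rw [mul_one, mul_zero, add_zero]; rfl
  · rw [mul_one, mul_zero, zero_add]; rfl

/-- A circle-valued function as a complex-valued function on an open subset. -/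
def circleFn (g : C^∞⟮𝓡 U.dim, U; 𝓡 1, Circle⟯) (W : Opens U) : Fn U W :=
  ⟨fun x => (g x : ℂ), by
    have := finrank_real_complex_fact'
    have hc : ContMDiff (𝓡 1) 𝓘(ℝ, ℂ) ∞ (fun z : Circle => (z : ℂ)) := contMDiff_coe_sphere
    exact hc.comp (g.contMDiff.comp contMDiff_subtype_val)⟩

theorem star_circleFn_mul (g : C^∞⟮𝓡 U.dim, U; 𝓡 1, Circle⟯) (W : Opens U) :
    star (circleFn g W) * circleFn g W = 1 := by
  ext x
  have hn : ‖((g x : Circle) : ℂ)‖ = 1 := Circle.norm_coe _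
  exact (Complex.conj_mul' _).trans
    ((congrArg (fun r : ℝ => (r : ℂ) ^ 2) hn).trans (by norm_num))

/-- The action `(a, b) ↦ (g a, g⁻¹ b)` of a circle-valued function. -/
def hypRot (g : C^∞⟮𝓡 U.dim, U; 𝓡 1, Circle⟯) : IPComo (𝟙 U) (hyp U) (hyp U) where
  app W := (AddMonoidHom.mulLeft (circleFn g W)).prodMap
    (AddMonoidHom.mulLeft (star (circleFn g W)))
  smul {W} a v := Prod.ext (mul_left_comm (G := Fn U W) _ _ _) (mul_left_comm (G := Fn U W) _ _ _)
  nat _ _ := rfl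
  st {W} v := Prod.ext
    ((congrArg (fun t => t * _) (star_star (circleFn g W)).symm).trans
      (star_mul' (star (circleFn g W)) (v.2 : Fn U W)).symm)
    (star_mul' (circleFn g W) (v.1 : Fn U W)).symm
  pair {W} v w := by
    have e := star_circleFn_mul g W
    generalize circleFn g W = c at *
    change -((c * (v.1 : Fn U W)) * (star c * w.2) + (star c * v.2) * (c * w.1)) =
      -((v.1 : Fn U W) * w.2 + v.2 * w.1)
    linear_combination (-((v.1 : Fn U W) * w.2 + v.2 * w.1)) * e

theorem hypRot_one : hypRot (1 : C^∞⟮𝓡 U.dim, U; 𝓡 1, Circle⟯) = IPComo.id (hyp U) :=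
  IPComo.ext (funext fun W => AddMonoidHom.ext fun v => Prod.ext
    (one_mul (M := Fn U W) v.1)
    ((congrArg (fun t => t * (v.2 : Fn U W)) (star_one (Fn U W))).trans (one_mul _)))

theorem hypRot_mul (g g' : C^∞⟮𝓡 U.dim, U; 𝓡 1, Circle⟯) :
    hypRot (g' * g) = (hypRot g).comp (hypRot g') :=
  IPComo.ext (funext fun W => AddMonoidHom.ext fun v => Prod.ext
    (mul_assoc (circleFn g' W) (circleFn g W) (v.1 : Fn U W))
    ((congrArg (fun t => t * (v.2 : Fn U W)) (star_mul' (circleFn g' W) (circleFn g W))).trans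
      (mul_assoc (star (circleFn g' W)) (star (circleFn g W)) (v.2 : Fn U W))))

theorem hypRot_pull (h : U ⟶ U') (g : C^∞⟮𝓡 U'.dim, U'; 𝓡 1, Circle⟯) :
    (hypRot g).comp (hypPull h) = (hypPull h).comp
      (hypRot (ContMDiffMap.comp (I'' := 𝓡 1) g h : C^∞⟮𝓡 U.dim, U; 𝓡 1, Circle⟯)) := rfl

/-- Morphisms out of `hyp U` are determined by the two generators. -/
theorem hyp_hom_ext {h : U ⟶ U'} {Z : ModSheaf U} {μ ν : Como h (hyp U').V Z}
    (h₁ : μ.app ⊤ (hypMk 1 0) = ν.app ⊤ (hypMk 1 0))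
    (h₂ : μ.app ⊤ (hypMk 0 1) = ν.app ⊤ (hypMk 0 1)) : μ = ν := by
  ext W v
  rw [hyp_eq v, map_add, map_add, μ.smul, μ.smul, ν.smul, ν.smul, μ.nat, μ.nat, ν.nat, ν.nat, h₁,
    h₂]

/-- The morphism out of `hyp U` with given values on the two generators. -/
def hypDesc {Z : ModSheaf U} (e₁ e₂ : Sec Z ⊤) : Como (𝟙 U) (hyp U).V Z where
  app W := AddMonoidHom.mk'
    (fun v => ((hypPr v).1 • Sec.res le_top e₁ + (hypPr v).2 • Sec.res le_top e₂ : Sec Z W))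
    (fun v w => by
      change ((hypPr v).1 + (hypPr w).1) • (Sec.res le_top e₁ : Sec Z W) +
        ((hypPr v).2 + (hypPr w).2) • (Sec.res le_top e₂ : Sec Z W) = _
      rw [add_smul, add_smul]
      abel)
  smul {W} a v := by
    change (a * (hypPr v).1) • (Sec.res le_top e₁ : Sec Z W) +
        (a * (hypPr v).2) • (Sec.res le_top e₂ : Sec Z W) =
      a • ((hypPr v).1 • (Sec.res le_top e₁ : Sec Z W) +
        (hypPr v).2 • (Sec.res le_top e₂ : Sec Z W))
    rw [mul_smul, mul_smul, smul_add]
  nat {W₁ W₂} i v := by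
    change _ = Sec.res i ((hypPr v).1 • Sec.res le_top e₁ + (hypPr v).2 • Sec.res le_top e₂)
    rw [map_add, Sec.res_smul, Sec.res_smul, Sec.res_res, Sec.res_res]
    rfl

/-- An inverse of a morphism of inner product sheaves on the level of sheaves of modules is a
morphism of inner product sheaves. -/
def IPComo.inverse {A B : IPSheaf U} (μ : IPComo (𝟙 U) A B) (ν : Como (𝟙 U) B.V A.V)
    (h₁ : ∀ W v, ν.app W (μ.app W v) = v) (h₂ : ∀ W v, μ.app W (ν.app W v) = v) :
    IPComo (𝟙 U) B A :=
  { ν with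
    st := fun {W} v => by
      have := congrArg (ν.app W) (μ.st (ν.app W v))
      exact (congrArg (fun t => ν.app W (B.st t)) (h₂ W v)).symm.trans (this.symm.trans (h₁ W _))
    pair := fun {W} v w => (μ.pair (ν.app W v) (ν.app W w)).symm.trans
      (congrArg₂ B.pair (h₂ W v) (h₂ W w)) }

/-- The factorization of the pullback of pairs of functions through the inverse image. -/
def hypPullDesc (h : U ⟶ U') : IPComo (𝟙 U) ((hyp U').pull h) (hyp U) :=
  (IPComo.existsUnique (k := 𝟙 U) (hypPull h)).choose

theorem unit_hypPullDesc (h : U ⟶ U') :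
    (IPComo.unit h (hyp U')).comp (hypPullDesc h) = hypPull h :=
  (IPComo.existsUnique (k := 𝟙 U) (hypPull h)).choose_spec.1

/-- The morphism that sends the generators to their images in the inverse image, on the level of
sheaves of modules. -/
def hypPullInvComo (h : U ⟶ U') : Como (𝟙 U) (hyp U).V (pullMod h (hyp U').V) :=
  hypDesc ((Como.unit h (hyp U').V).app ⊤ (hypMk 1 0)) ((Como.unit h (hyp U').V).app ⊤ (hypMk 0 1))

theorem hypDesc_fst {Z : ModSheaf U} (e₁ e₂ : Sec Z ⊤) :
    (hypDesc e₁ e₂).app ⊤ (hypMk 1 0) = e₁ := by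
  change (1 : Fn U ⊤) • (Sec.res le_top e₁ : Sec Z ⊤) + (0 : Fn U ⊤) • (Sec.res le_top e₂) = e₁
  rw [one_smul, zero_smul, add_zero]
  exact Sec.res_id _

theorem hypDesc_snd {Z : ModSheaf U} (e₁ e₂ : Sec Z ⊤) :
    (hypDesc e₁ e₂).app ⊤ (hypMk 0 1) = e₂ := by
  change (0 : Fn U ⊤) • (Sec.res le_top e₁ : Sec Z ⊤) + (1 : Fn U ⊤) • (Sec.res le_top e₂) = e₂
  rw [one_smul, zero_smul, zero_add]
  exact Sec.res_id _

theorem pull_hypPullInvComo (h : U ⟶ U') :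
    (hypPull h).toComo.comp (hypPullInvComo h) = Como.unit h (hyp U').V :=
  hyp_hom_ext (hypDesc_fst _ _) (hypDesc_snd _ _)

theorem hypPullInvComo_desc (h : U ⟶ U') :
    (hypPullInvComo h).comp (hypPullDesc h).toComo = Como.id (hyp U).V := by
  refine hyp_hom_ext (h := 𝟙 U) ?_ ?_
  · exact (congrArg ((hypPullDesc h).app _) (hypDesc_fst _ _)).trans
      (congrArg (fun κ => κ.app ⊤ (hypMk 1 0)) (unit_hypPullDesc h))
  · exact (congrArg ((hypPullDesc h).app _) (hypDesc_snd _ _)).trans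
      (congrArg (fun κ => κ.app ⊤ (hypMk 0 1)) (unit_hypPullDesc h))

theorem desc_hypPullInvComo (h : U ⟶ U') :
    (hypPullDesc h).toComo.comp (hypPullInvComo h) = Como.id (pullMod h (hyp U').V) := by
  refine (Como.existsUnique (k := 𝟙 U) (Como.unit h (hyp U').V)).unique
    (y₁ := (hypPullDesc h).toComo.comp (hypPullInvComo h))
    (y₂ := Como.id (pullMod h (hyp U').V)) (fun W v => ?_) (fun W v => rfl)
  have h₁ := congrArg (fun κ => κ.app W v) (unit_hypPullDesc h)
  have h₂ := congrArg (fun κ => κ.app W v) (pull_hypPullInvComo h)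
  exact (congrArg ((hypPullInvComo h).app _) h₁).trans h₂

/-- The inverse of the canonical morphism from the inverse image. -/
def hypPullInv (h : U ⟶ U') : IPComo (𝟙 U) (hyp U) ((hyp U').pull h) :=
  IPComo.inverse (hypPullDesc h) (hypPullInvComo h)
    (fun W v => congrArg (fun κ => κ.app W v) (desc_hypPullInvComo h))
    (fun W v => congrArg (fun κ => κ.app W v) (hypPullInvComo_desc h))

theorem pull_hypPullInv (h : U ⟶ U') :
    (hypPull h).comp (hypPullInv h) = IPComo.unit h (hyp U') :=
  IPComo.ext (congrArg Como.app (pull_hypPullInvComo h))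

theorem hypPullInv_desc (h : U ⟶ U') :
    (hypPullInv h).comp (hypPullDesc h) = IPComo.id (hyp U) :=
  IPComo.ext (congrArg Como.app (hypPullInvComo_desc h))

end

/-! ### The Dirac transformation -/

/-- The components of an identification of equal functors into `[{*}/G]_pre(V)` are trivial. -/
theorem eqToHom_app_quot {C : Cat.{0, 1}} {V : Man}
    {F G : C ⟶ Cat.of (BGObj (𝓡 1) Circle V)} (e : F = G) (x : C) :
    (eqToHom e).toNatTrans.app x = (1 : C^∞⟮𝓡 V.dim, V; 𝓡 1, Circle⟯) := by
  subst e; rfl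

theorem quot_mapId (b : Manᵒᵖ) (x : (quotPrestack (𝓡 1) Circle).obj ⟨b⟩) :
    ((quotPrestack (𝓡 1) Circle).mapId ⟨b⟩).hom.toNatTrans.app x =
      (1 : C^∞⟮𝓡 b.unop.dim, b.unop; 𝓡 1, Circle⟯) :=
  eqToHom_app_quot (V := b.unop) rfl x

theorem quot_mapComp {b b' b'' : Manᵒᵖ} (f : b ⟶ b') (g : b' ⟶ b'')
    (x : (quotPrestack (𝓡 1) Circle).obj ⟨b⟩) :
    ((quotPrestack (𝓡 1) Circle).mapComp f.toLoc g.toLoc).hom.toNatTrans.app x =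
      (1 : C^∞⟮𝓡 b''.unop.dim, b''.unop; 𝓡 1, Circle⟯) :=
  eqToHom_app_quot (V := b''.unop) rfl x

/-- The transformation with constant value `hyp` on objects, on which circle-valued functions act by
rotations. -/
def diracHet : PushSystem.HetTrans ipSystem LocU1 where
  T b :=
    { obj := fun _ => (hyp b.unop : IPSheaf b.unop)
      map := fun u => hypRot u.2
      map_id := fun _ => hypRot_one
      map_comp := fun u v => hypRot_mul u.2 v.2 }
  c f _ := hypPull f.unop
  nat f _ _ u := hypRot_pull f.unop u.2
  inv f _ := hypPullInv f.unop
  c_inv f _ := pull_hypPullInv f.unop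
  inv_c {b b'} f x := by
    have h₂ := (IPComo.existsUnique (k := 𝟙 b'.unop) (hypPull f.unop)).unique
      (unit_hypPullDesc f.unop)
      (PushSystem.fac (S := ipSystem) (Category.comp_id f) (hypPull f.unop))
    exact (congrArg (fun t => (hypPullInv f.unop).comp t) h₂.symm).trans (hypPullInv_desc f.unop)
  c_id b x := by
    have := quot_mapId b x.2
    exact (congrArg (fun t => (hypPull (𝟙 b.unop)).comp (hypRot t)) this).trans
      (congrArg (fun t => (hypPull (𝟙 b.unop)).comp t) hypRot_one)
  c_comp {b b' b''} f g x := by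
    have := quot_mapComp f g x.2
    exact (congrArg (fun t => (hypPull (g.unop ≫ f.unop)).comp (hypRot t)) this).trans
      (congrArg (fun t => (hypPull (g.unop ≫ f.unop)).comp t) hypRot_one)

/-- The pseudo-natural transformation underlying the Dirac field. -/
def diracTrans : PsNat LocU1 IPVec := diracHet.toPsNat

theorem ipCoh_diracTrans {U U' : Man} (h : U ⟶ U') (X : LocObj U') (W : Opens U')
    (v : Sec (hyp U').V W) : ipCoh diracTrans h X W v = (hypPull h).app W v :=
  congrArg (fun φ : IPComo h (hyp U') (hyp U) => φ.app W v) (diracHet.coh_toPsNat h (LocU1.mk X))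

/-! ### Parametric derivatives and primitives -/

section param
variable {H F : Type} [NormedAddCommGroup H] [NormedSpace ℝ H] [NormedAddCommGroup F]
  [NormedSpace ℝ F]

/-- Differentiation under the integral sign: by compactness of the interval the derivative of the
integrand is bounded over a neighbourhood of the parameter. -/
theorem hasFDerivAt_integral_param {V : Set H} (hV : IsOpen V) {g : H × ℝ → F}
    (hg : ContDiffOn ℝ ∞ g (V ×ˢ univ)) {y : H} (hy : y ∈ V) :
    HasFDerivAt (fun z => ∫ r in (0 : ℝ)..1, g (z, r))
      (∫ r in (0 : ℝ)..1, (fderiv ℝ g (y, r)).comp (ContinuousLinearMap.inl ℝ H ℝ)) y := by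
  have hO : IsOpen (V ×ˢ (univ : Set ℝ)) := hV.prod isOpen_univ
  set D : H × ℝ → H →L[ℝ] F := fun p => (fderiv ℝ g p).comp (ContinuousLinearMap.inl ℝ H ℝ)
  have hD : ContinuousOn D (V ×ˢ univ) :=
    (hg.continuousOn_fderiv_of_isOpen hO (by simp)).clm_comp continuousOn_const
  have hslice : ∀ z ∈ V, Continuous (fun r : ℝ => g (z, r)) := fun z hz =>
    hg.continuousOn.comp_continuous (by fun_prop) (fun r => ⟨hz, mem_univ _⟩)
  obtain ⟨M, hM⟩ : ∃ M, ∀ r ∈ Icc (0 : ℝ) 1, ‖D (y, r)‖ ≤ M :=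
    isCompact_Icc.exists_bound_of_continuousOn
      (hD.comp (by fun_prop : Continuous fun r : ℝ => (y, r)).continuousOn
        (fun r _ => ⟨hy, mem_univ _⟩))
  have hW : IsOpen ((V ×ˢ univ) ∩ D ⁻¹' Metric.ball 0 (M + 1)) :=
    hD.isOpen_inter_preimage hO Metric.isOpen_ball
  obtain ⟨u, v, hu, hv, hyu, hIv, huv⟩ := generalized_tube_lemma (isCompact_singleton (x := y))
    (isCompact_Icc (a := (0 : ℝ)) (b := 1)) hW (by
      rintro ⟨z, r⟩ ⟨rfl, hr⟩
      refine ⟨⟨hy, mem_univ _⟩, ?_⟩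
      simpa using (hM r hr).trans_lt (lt_add_one M))
  have hIoc : Set.uIoc (0 : ℝ) 1 ⊆ Icc 0 1 := by
    rw [uIoc_of_le zero_le_one]; exact Ioc_subset_Icc_self
  refine (intervalIntegral.hasFDerivAt_integral_of_dominated_of_fderiv_le
    (s := u) (hu.mem_nhds (hyu rfl)) (bound := fun _ => M + 1) (F' := fun z r => D (z, r))
    ?_ ?_ ?_ ?_ ?_ ?_)
  · filter_upwards [hV.mem_nhds hy] with z hz
    exact (hslice z hz).aestronglyMeasurable
  · exact (hslice y hy).intervalIntegrable _ _
  · have : Continuous (fun r : ℝ => D (y, r)) :=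
      hD.comp_continuous (by fun_prop) (fun r => ⟨hy, mem_univ _⟩)
    exact this.aestronglyMeasurable
  · refine Filter.Eventually.of_forall fun r hr z hz => ?_
    have := (huv (mk_mem_prod hz (hIv (hIoc hr)))).2
    exact (by simpa using this : ‖D (z, r)‖ < M + 1).le
  · exact intervalIntegrable_const
  · refine Filter.Eventually.of_forall fun r hr z hz => ?_
    have hzV : (z, r) ∈ V ×ˢ (univ : Set ℝ) := (huv (mk_mem_prod hz (hIv (hIoc hr)))).1
    have h₁ : HasFDerivAt g (fderiv ℝ g (z, r)) (z, r) :=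
      ((hg.contDiffAt (hO.mem_nhds hzV)).differentiableAt (by simp)).hasFDerivAt
    exact h₁.comp z (hasFDerivAt_prodMk_left z r)

/-- Smoothness of an integral in its parameter. The derivative is again such an integral, so that
every order of differentiability follows by induction, for all target spaces at once. -/
theorem contDiffOn_integral_param {V : Set H} (hV : IsOpen V) {g : H × ℝ → F}
    (hg : ContDiffOn ℝ ∞ g (V ×ˢ univ)) :
    ContDiffOn ℝ ∞ (fun z => ∫ r in (0 : ℝ)..1, g (z, r)) V := by
  rw [contDiffOn_infty]
  intro n
  induction n generalizing F with
  | zero =>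
    exact contDiffOn_zero.2 fun y hy =>
      (hasFDerivAt_integral_param hV hg hy).continuousAt.continuousWithinAt
  | succ n ih =>
    push_cast
    rw [contDiffOn_succ_iff_fderiv_of_isOpen hV]
    refine ⟨fun y hy =>
      (hasFDerivAt_integral_param hV hg hy).differentiableAt.differentiableWithinAt, by simp, ?_⟩
    have h₁ : ContDiffOn ℝ ∞
        (fun p => (fderiv ℝ g p).comp (ContinuousLinearMap.inl ℝ H ℝ)) (V ×ˢ univ) :=
      (hg.fderiv_of_isOpen (hV.prod isOpen_univ) (by simp)).clm_comp contDiffOn_const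
    exact (ih h₁).congr fun y hy => (hasFDerivAt_integral_param hV hg hy).fderiv

/-- Primitives depend smoothly on the upper limit and the parameter: the substitution
`s = a + (t - a) r` turns them into integrals over the unit interval. -/
theorem contDiffOn_primitive {V : Set H} (hV : IsOpen V) {g : H × ℝ → F}
    (hg : ContDiffOn ℝ ∞ g (V ×ˢ univ)) (a : ℝ) :
    ContDiffOn ℝ ∞ (fun p : H × ℝ => ∫ s in a..p.2, g (p.1, s)) (V ×ˢ univ) := by
  have h₁ : ContDiffOn ℝ ∞ (fun q : (H × ℝ) × ℝ => g (q.1.1, a + (q.1.2 - a) * q.2))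
      ((V ×ˢ univ) ×ˢ univ) :=
    hg.comp (by fun_prop) (fun q hq => ⟨hq.1.1, mem_univ _⟩)
  have h₂ := contDiffOn_integral_param (hV.prod isOpen_univ) h₁
  have h₃ : ContDiffOn ℝ ∞ (fun p : H × ℝ => p.2 - a) (V ×ˢ univ) := by fun_prop
  refine (h₃.smul h₂).congr fun p _ => ?_
  have := intervalIntegral.smul_integral_comp_add_mul (a := 0) (b := 1) (fun s => g (p.1, s))
    (p.2 - a) a
  simpa using this.symm

theorem contDiffOn_deriv_param {V : Set H} (hV : IsOpen V) {g : H × ℝ → F}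
    (hg : ContDiffOn ℝ ∞ g (V ×ˢ univ)) :
    ContDiffOn ℝ ∞ (fun p : H × ℝ => deriv (fun s => g (p.1, s)) p.2) (V ×ˢ univ) := by
  have hO : IsOpen (V ×ˢ (univ : Set ℝ)) := hV.prod isOpen_univ
  have h₁ : ContDiffOn ℝ ∞ (fun p => fderiv ℝ g p (0, 1)) (V ×ˢ univ) :=
    (hg.fderiv_of_isOpen hO (by simp)).clm_apply contDiffOn_const
  refine h₁.congr fun p hp => ?_
  have h₂ : HasFDerivAt g (fderiv ℝ g p) (p.1, p.2) :=
    ((hg.contDiffAt (hO.mem_nhds hp)).differentiableAt (by simp)).hasFDerivAt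
  have h₃ : HasDerivAt (fun s : ℝ => (p.1, s)) ((0 : H), (1 : ℝ)) p.2 :=
    (hasDerivAt_const p.2 p.1).prodMk (hasDerivAt_id p.2)
  exact (h₂.comp_hasDerivAt p.2 h₃).deriv

end param

section
variable {U : Man} {F : Type} [NormedAddCommGroup F] [NormedSpace ℝ F]

/-- Smoothness of functions on `N × ℝ` is tested in the charts of the base. -/
theorem contMDiffOn_prod_iff {N : Opens U} {f : U × ℝ → F} :
    ContMDiffOn (IP U) 𝓘(ℝ, F) ∞ f ((N : Set U) ×ˢ univ) ↔
      ∀ x : U, ContDiffOn ℝ ∞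
        (fun p : EuclideanSpace ℝ (Fin U.dim) × ℝ =>
          f ((chartAt (EuclideanSpace ℝ (Fin U.dim)) x).symm p.1, p.2))
        (((chartAt (EuclideanSpace ℝ (Fin U.dim)) x).target ∩
          (chartAt (EuclideanSpace ℝ (Fin U.dim)) x).symm ⁻¹' N) ×ˢ univ) := by
  constructor
  · intro hf x
    set c := chartAt (EuclideanSpace ℝ (Fin U.dim)) x
    rw [← contMDiffOn_iff_contDiffOn]
    have h₁ : ContMDiffOn 𝓘(ℝ, EuclideanSpace ℝ (Fin U.dim) × ℝ) (IP U) ∞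
        (fun p : EuclideanSpace ℝ (Fin U.dim) × ℝ => (c.symm p.1, p.2))
        ((c.target ∩ c.symm ⁻¹' N) ×ˢ univ) := by
      refine ContMDiffOn.prodMk ?_ contDiff_snd.contMDiff.contMDiffOn
      exact (contMDiffOn_chart_symm (n := ∞) (x := x)).comp contDiff_fst.contMDiff.contMDiffOn
        (fun p hp => hp.1.1)
    exact hf.comp h₁ fun p hp => ⟨hp.1.2, mem_univ _⟩
  · intro hf
    rintro ⟨x, t⟩ ⟨hx, -⟩
    set c := chartAt (EuclideanSpace ℝ (Fin U.dim)) x with hc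
    have hO : IsOpen (c.target ∩ c.symm ⁻¹' N) := c.isOpen_inter_preimage_symm N.isOpen
    have hxc : x ∈ c.source := mem_chart_source _ x
    have h₁ : ContMDiffAt (IP U) 𝓘(ℝ, EuclideanSpace ℝ (Fin U.dim) × ℝ) ∞
        (fun p : U × ℝ => (c p.1, p.2)) (x, t) := by
      refine ContMDiffAt.prodMk_space ?_ contMDiffAt_snd
      exact ((contMDiffOn_chart (n := ∞) (x := x)).contMDiffAt
        (c.open_source.mem_nhds hxc)).comp (x, t) contMDiffAt_fst
    have hm : c x ∈ c.target ∩ c.symm ⁻¹' N :=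
      ⟨c.map_source hxc, by rw [mem_preimage, c.left_inv hxc]; exact hx⟩
    have h₂ := ((contMDiffOn_iff_contDiffOn.2 (hf x)).contMDiffAt
      ((hO.prod isOpen_univ).mem_nhds ⟨hm, mem_univ t⟩)).comp (x, t) h₁
    refine (h₂.congr_of_eventuallyEq ?_).contMDiffWithinAt
    have : ∀ᶠ p : U × ℝ in 𝓝 (x, t), p.1 ∈ c.source :=
      continuousAt_fst.eventually (c.open_source.mem_nhds hxc)
    filter_upwards [this] with p hp
    exact congrArg f (Prod.ext (c.left_inv hp).symm rfl)

theorem smooth_primitive {N : Opens U} {f : U × ℝ → F}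
    (hf : ContMDiffOn (IP U) 𝓘(ℝ, F) ∞ f ((N : Set U) ×ˢ univ)) (a : ℝ) :
    ContMDiffOn (IP U) 𝓘(ℝ, F) ∞ (fun p => ∫ s in a..p.2, f (p.1, s)) ((N : Set U) ×ˢ univ) :=
  contMDiffOn_prod_iff.2 fun x => contDiffOn_primitive
    ((chartAt _ x).isOpen_inter_preimage_symm N.isOpen) (contMDiffOn_prod_iff.1 hf x) a

theorem smooth_deriv {N : Opens U} {f : U × ℝ → F}
    (hf : ContMDiffOn (IP U) 𝓘(ℝ, F) ∞ f ((N : Set U) ×ˢ univ)) :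
    ContMDiffOn (IP U) 𝓘(ℝ, F) ∞ (fun p => deriv (fun s => f (p.1, s)) p.2)
      ((N : Set U) ×ˢ univ) :=
  contMDiffOn_prod_iff.2 fun x => contDiffOn_deriv_param
    ((chartAt _ x).isOpen_inter_preimage_symm N.isOpen) (contMDiffOn_prod_iff.1 hf x)

end

/-! ### Vertical coordinates -/

section
variable {U : Man} (X : LocObj U) {F : Type} [NormedAddCommGroup F] [NormedSpace ℝ F]

/-- The differential of a vector-valued function on the total space. -/
def LocObj.diff (φ : X → F) (m : X) : TangentSpace (IT U) m →L[ℝ] F := mfderiv (IT U) 𝓘(ℝ, F) φ m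

/-- The velocity of a curve in the total space. -/
def LocObj.vel (γ : ℝ → X) (t : ℝ) : TangentSpace (IT U) (γ t) :=
  mfderiv 𝓘(ℝ, ℝ) (IT U) γ t (1 : ℝ)

variable {X}

theorem LocObj.hasDerivAt_comp {γ : ℝ → X} {t : ℝ} {φ : X → F}
    (hγ : MDifferentiableAt 𝓘(ℝ, ℝ) (IT U) γ t)
    (hφ : MDifferentiableAt (IT U) 𝓘(ℝ, F) φ (γ t)) :
    HasDerivAt (fun s => φ (γ s)) (X.diff φ (γ t) (X.vel γ t)) t := by
  have h₁ : HasFDerivAt (fun s => φ (γ s)) ((show TS U →L[ℝ] F from X.diff φ (γ t)).comp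
      (show ℝ →L[ℝ] TS U from mfderiv 𝓘(ℝ, ℝ) (IT U) γ t)) t :=
    hasMFDerivAt_iff_hasFDerivAt.1 (hφ.hasMFDerivAt.comp t hγ.hasMFDerivAt)
  exact h₁.hasDerivAt

end

/-- A fibre coordinate `T` over an open subset `N` of the base which is increasing with respect to
the vertical one-form, with the inverse parametrization `P` of the part over `N` and the density
`ρ > 0` determined by `E = ρ dT`. The values of the three functions away from `N` are arbitrary. -/
structure VCoord {U : Man} (X : LocObj U) (N : Opens U) where
  T : X → ℝ
  P : U × ℝ → X
  ρ : U × ℝ → ℝ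
  smooth_T : ContMDiffOn (IT U) 𝓘(ℝ, ℝ) ∞ T (X.π ⁻¹' N)
  smooth_P : ContMDiffOn (IP U) (IT U) ∞ P ((N : Set U) ×ˢ univ)
  smooth_ρ : ContMDiffOn (IP U) 𝓘(ℝ, ℝ) ∞ ρ ((N : Set U) ×ˢ univ)
  π_P : ∀ u ∈ N, ∀ t, X.π (P (u, t)) = u
  T_P : ∀ u ∈ N, ∀ t, T (P (u, t)) = t
  P_T : ∀ m, X.π m ∈ N → P (X.π m, T m) = m
  ρ_pos : ∀ u ∈ N, ∀ t, 0 < ρ (u, t)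
  E_eq : ∀ m, X.π m ∈ N → ∀ v : X.Vert m,
    X.E m v = ρ (X.π m, T m) * X.diff T m v

namespace LocObj
variable {U : Man} (X : LocObj U)

theorem isOpen_over (N : Opens U) : IsOpen (X.π ⁻¹' (N : Set U)) :=
  N.isOpen.preimage X.smooth_π.continuous

theorem over_mem_nhds {N : Opens U} {m : X} (hm : X.π m ∈ N) : X.π ⁻¹' (N : Set U) ∈ 𝓝 m :=
  (X.isOpen_over N).mem_nhds hm

/-- Vertical coordinates exist near every point of the base. Since `E` has no zeros, its density in
a trivialization has a constant sign on each fibre, and the same one on nearby fibres; the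
coordinate of the trivialization is multiplied by this sign. -/
theorem exists_vcoord (x : U) : ∃ N : Opens U, x ∈ N ∧ Nonempty (VCoord X N) := by
  obtain ⟨e, hx, he, ρ, hρ, hE⟩ := X.E_smooth x
  have hne : ∀ u ∈ e.baseSet, ∀ t : ℝ, ρ (u, t) ≠ 0 := by
    intro u hu t h0
    have ht : (u, t) ∈ e.target := e.mem_target.2 hu
    have hs := e.toOpenPartialHomeomorph.map_target ht
    refine X.E_ne_zero (e.toOpenPartialHomeomorph.symm (u, t)) (LinearMap.ext fun v => ?_)
    have h1 : e (e.toOpenPartialHomeomorph.symm (u, t)) = (u, t) :=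
      e.toOpenPartialHomeomorph.right_inv ht
    rw [hE _ hs, h1, h0, zero_mul]
    rfl
  have hslice : ∀ u ∈ e.baseSet, Continuous fun t : ℝ => ρ (u, t) := fun u hu =>
    hρ.continuousOn.comp_continuous (by fun_prop) (fun t => e.mem_target.2 hu)
  obtain ⟨s, hs1, hsx⟩ : ∃ s : ℝ, s * s = 1 ∧ 0 < s * ρ (x, 0) := by
    rcases lt_or_gt_of_ne (hne x hx 0) with h | h
    · exact ⟨-1, by norm_num, by linarith⟩
    · exact ⟨1, by norm_num, by linarith⟩
  have hbase : ContinuousOn (fun u : U => s * ρ (u, 0)) e.baseSet :=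
    continuousOn_const.mul (hρ.continuousOn.comp (by fun_prop)
      (fun u hu => e.mem_target.2 hu))
  let N : Opens U := ⟨e.baseSet ∩ (fun u : U => s * ρ (u, 0)) ⁻¹' Ioi 0,
    hbase.isOpen_inter_preimage e.open_baseSet isOpen_Ioi⟩
  have hpos : ∀ u ∈ N, ∀ t, 0 < s * ρ (u, t) := by
    rintro u ⟨hu, hu0⟩ t
    by_contra hle
    have hs0 : s ≠ 0 := by rintro rfl; simp at hs1
    have hc : Continuous fun t => s * ρ (u, t) := continuous_const.mul (hslice u hu)
    obtain ⟨t', ht'⟩ := mem_range_of_exists_le_of_exists_ge hc ⟨t, not_lt.1 hle⟩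
      ⟨0, (le_of_lt hu0)⟩
    exact mul_ne_zero hs0 (hne u hu t') ht'
  have hsrc : ∀ m, X.π m ∈ N → m ∈ e.source := fun m hm => e.mem_source.2 hm.1
  have htgt : ∀ u ∈ N, ∀ t : ℝ, (u, t) ∈ e.target := fun u hu t => e.mem_target.2 hu.1
  have hsm : ∀ m, X.π m ∈ N → e m = (X.π m, (e m).2) := fun m hm =>
    Prod.ext (e.coe_fst (hsrc m hm)) rfl
  have hsmooth : ContMDiffOn (IT U) 𝓘(ℝ, ℝ) ∞ (fun m : X => (e m).2) (X.π ⁻¹' N) :=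
    contMDiff_snd.comp_contMDiffOn (he.smooth.mono hsrc)
  have hflip : ContMDiff (IP U) (IP U) ∞ (fun p : U × ℝ => (p.1, s * p.2)) :=
    contMDiff_fst.prodMk ((contDiff_const.mul contDiff_id).contMDiff.comp contMDiff_snd)
  refine ⟨N, ⟨hx, hsx⟩, ⟨{
    T := fun m => s * (e m).2
    P := fun p => e.toOpenPartialHomeomorph.symm (p.1, s * p.2)
    ρ := fun p => s * ρ (p.1, s * p.2)
    smooth_T := (contDiff_const.mul contDiff_id).contMDiff.comp_contMDiffOn hsmooth
    smooth_P := he.smooth_symm.comp hflip.contMDiffOn (fun p hp => htgt _ hp.1 _)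
    smooth_ρ := (contDiff_const.mul contDiff_id).contMDiff.comp_contMDiffOn
      (hρ.comp hflip.contMDiffOn (fun p hp => htgt _ hp.1 _))
    π_P := fun u hu t => e.proj_symm_apply (htgt u hu _)
    T_P := fun u hu t => by
      have : e (e.toOpenPartialHomeomorph.symm (u, s * t)) = (u, s * t) :=
        e.toOpenPartialHomeomorph.right_inv (htgt u hu _)
      rw [this]
      linear_combination t * hs1
    P_T := fun m hm => by
      have h1 : s * (s * (e m).2) = (e m).2 := by linear_combination (e m).2 * hs1
      have h2 : (X.π m, s * (s * (e m).2)) = e m := by rw [h1]; exact (hsm m hm).symm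
      exact (congrArg e.toOpenPartialHomeomorph.symm h2).trans
        (e.toOpenPartialHomeomorph.left_inv (hsrc m hm))
    ρ_pos := fun u hu t => hpos u hu _
    E_eq := fun m hm v => by
      have h1 : s * (s * (e m).2) = (e m).2 := by linear_combination (e m).2 * hs1
      have h2 : (X.π m, s * (s * (e m).2)) = e m := by rw [h1]; exact (hsm m hm).symm
      have hd : MDifferentiableAt (IT U) 𝓘(ℝ, ℝ) (fun m : X => (e m).2) m :=
        (hsmooth.contMDiffAt (X.over_mem_nhds hm)).mdifferentiableAt (by simp)
      have h3 : X.diff (fun m : X => s * (e m).2) m =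
          s • mfderiv (IT U) 𝓘(ℝ, ℝ) (fun m : X => (e m).2) m := const_smul_mfderiv hd s
      rw [hE m (hsrc m hm), h2, h3]
      change ρ (e m) * X.dcoord e m v = s * ρ (e m) * (s * X.dcoord e m v)
      linear_combination (-(ρ (e m) * X.dcoord e m v)) * hs1 }⟩⟩

end LocObj

namespace VCoord
open LocObj
variable {U : Man} {X : LocObj U} {N : Opens U} (C : VCoord X N)

/-- Restriction of a vertical coordinate to a smaller open subset of the base. -/
def mono {N' : Opens U} (i : N' ≤ N) : VCoord X N' where
  T := C.T
  P := C.P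
  ρ := C.ρ
  smooth_T := C.smooth_T.mono fun _ hm => i hm
  smooth_P := C.smooth_P.mono (prod_mono i le_rfl)
  smooth_ρ := C.smooth_ρ.mono (prod_mono i le_rfl)
  π_P u hu := C.π_P u (i hu)
  T_P u hu := C.T_P u (i hu)
  P_T m hm := C.P_T m (i hm)
  ρ_pos u hu := C.ρ_pos u (i hu)
  E_eq m hm := C.E_eq m (i hm)

theorem isOpen_dom (N : Opens U) : IsOpen ((N : Set U) ×ˢ (univ : Set ℝ)) :=
  N.isOpen.prod isOpen_univ

theorem contMDiffAt_T {m : X} (hm : X.π m ∈ N) : ContMDiffAt (IT U) 𝓘(ℝ, ℝ) ∞ C.T m :=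
  C.smooth_T.contMDiffAt (X.over_mem_nhds hm)

theorem contMDiffAt_P {u : U} (hu : u ∈ N) (t : ℝ) : ContMDiffAt (IP U) (IT U) ∞ C.P (u, t) :=
  C.smooth_P.contMDiffAt ((isOpen_dom N).mem_nhds ⟨hu, mem_univ t⟩)

theorem smooth_line {u : U} (hu : u ∈ N) :
    ContMDiff 𝓘(ℝ, ℝ) (IT U) ∞ (fun t : ℝ => C.P (u, t)) := fun t =>
  (C.contMDiffAt_P hu t).comp t (contMDiffAt_const.prodMk contMDiffAt_id)

theorem smooth_πT : ContMDiffOn (IT U) (IP U) ∞ (fun m : X => (X.π m, C.T m)) (X.π ⁻¹' N) :=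
  X.smooth_π.contMDiffOn.prodMk C.smooth_T

theorem smooth_ρ_line {u : U} (hu : u ∈ N) : Continuous (fun t : ℝ => C.ρ (u, t)) :=
  C.smooth_ρ.continuousOn.comp_continuous (by fun_prop) (fun _ => ⟨hu, mem_univ _⟩)

/-- A tangent vector is determined by its projection to the base and its fibre coordinate. -/
theorem tangent_ext {m : X} (hm : X.π m ∈ N) {v w : TangentSpace (IT U) m}
    (h₁ : mfderiv (IT U) (𝓡 U.dim) X.π m v = mfderiv (IT U) (𝓡 U.dim) X.π m w)
    (h₂ : X.diff C.T m v = X.diff C.T m w) : v = w := by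
  have hπ : MDifferentiableAt (IT U) (𝓡 U.dim) X.π m := X.smooth_π.mdifferentiableAt (by simp)
  have hT : MDifferentiableAt (IT U) 𝓘(ℝ, ℝ) C.T m :=
    (C.contMDiffAt_T hm).mdifferentiableAt (by simp)
  have hP : MDifferentiableAt (IP U) (IT U) C.P (X.π m, C.T m) :=
    (C.contMDiffAt_P hm (C.T m)).mdifferentiableAt (by simp)
  have hid : (C.P ∘ fun m : X => (X.π m, C.T m)) =ᶠ[𝓝 m] id := by
    filter_upwards [X.over_mem_nhds hm] with m' hm' using C.P_T m' hm'
  have key : ∀ v : TangentSpace (IT U) m, v = mfderiv (IP U) (IT U) C.P (X.π m, C.T m)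
      (mfderiv (IT U) (𝓡 U.dim) X.π m v, X.diff C.T m v) := by
    intro v
    have e₁ := mfderiv_comp_apply (I := IT U) (I' := IP U) (I'' := IT U) m hP
      (hπ.prodMk hT) v
    rw [hid.mfderiv_eq, mfderiv_id, mfderiv_prodMk hπ hT] at e₁
    exact e₁
  rw [key v, key w, h₁, h₂]

theorem ev_eq {m : X} (hm : X.π m ∈ N) {v : TangentSpace (IT U) m}
    (hv : mfderiv (IT U) (𝓡 U.dim) X.π m v = 0) :
    X.ev m v = C.ρ (X.π m, C.T m) * X.diff C.T m v :=
  (dif_pos (show v ∈ X.Vert m from hv)).trans (C.E_eq m hm ⟨v, hv⟩)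

theorem d_π_curve {γ : ℝ → X} {t : ℝ} {u : U} (hγ : MDifferentiableAt 𝓘(ℝ, ℝ) (IT U) γ t)
    (hu : ∀ s, X.π (γ s) = u) :
    mfderiv (IT U) (𝓡 U.dim) X.π (γ t) (X.vel γ t) = 0 := by
  have hπ : MDifferentiableAt (IT U) (𝓡 U.dim) X.π (γ t) := X.smooth_π.mdifferentiableAt (by simp)
  have e₁ := mfderiv_comp_apply t hπ hγ (1 : ℝ)
  have e₂ : X.π ∘ γ = fun _ => u := funext hu
  rw [e₂, mfderiv_const] at e₁
  exact e₁.symm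

/-- The pairing of `E` with the velocity of a vertical curve, in a vertical coordinate. -/
theorem speed_eq {γ : ℝ → X} {t : ℝ} {u : U} (hγ : MDifferentiableAt 𝓘(ℝ, ℝ) (IT U) γ t)
    (hu : ∀ s, X.π (γ s) = u) (huN : u ∈ N) :
    X.speed γ t = C.ρ (u, C.T (γ t)) * deriv (fun s => C.T (γ s)) t := by
  have hm : X.π (γ t) ∈ N := (hu t).symm ▸ huN
  rw [(hasDerivAt_comp hγ ((C.contMDiffAt_T hm).mdifferentiableAt (by simp))).deriv, ← hu t]
  exact C.ev_eq hm (d_π_curve hγ hu)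

/-- In a vertical coordinate, `*_v d_v` is `ρ⁻¹ d/dT`. -/
theorem starD_eq {φ : X → ℂ} {m : X} (hm : X.π m ∈ N)
    (hφ : MDifferentiableAt (IT U) 𝓘(ℝ, ℂ) φ m) :
    X.starD φ m = (C.ρ (X.π m, C.T m))⁻¹ • deriv (fun t => φ (C.P (X.π m, t))) (C.T m) := by
  set γ : ℝ → X := fun t => C.P (X.π m, t) with hγdef
  set ρ := C.ρ (X.π m, C.T m) with hρdef
  have hρ : ρ ≠ 0 := (C.ρ_pos _ hm _).ne'
  have hγm : γ (C.T m) = m := C.P_T m hm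
  have hγ : MDifferentiableAt 𝓘(ℝ, ℝ) (IT U) γ (C.T m) :=
    (C.smooth_line hm).mdifferentiableAt (by simp)
  have hu : ∀ s, X.π (γ s) = X.π m := fun s => C.π_P _ hm s
  have h₁ := d_π_curve hγ hu
  have h₂ := (hasDerivAt_comp hγ
    ((C.contMDiffAt_T (by rw [hγm]; exact hm)).mdifferentiableAt (by simp))).deriv
  have h₃ : (fun s => C.T (γ s)) = id := funext fun s => C.T_P _ hm s
  rw [h₃, deriv_id] at h₂
  have h₄ : X.E m ⟨X.unitVec m, (X.exists_unit m).choose.2⟩ = 1 := (X.exists_unit m).choose_spec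
  rw [C.E_eq m hm] at h₄
  have hφ' : MDifferentiableAt (IT U) 𝓘(ℝ, ℂ) φ (γ (C.T m)) := by rw [hγm]; exact hφ
  have h₅ := (hasDerivAt_comp hγ hφ').deriv
  generalize X.vel γ (C.T m) = w at h₁ h₂ h₅
  revert w
  rw [hγm]
  intro w h₁ h₂ h₅
  have h₆ : X.unitVec m = ρ⁻¹ • w := by
    refine C.tangent_ext hm ?_ ?_
    · rw [map_smul, h₁, smul_zero]
      exact (X.exists_unit m).choose.2
    · rw [map_smul, ← h₂]
      change _ = ρ⁻¹ * 1
      field_simp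
      rw [mul_comm]
      exact h₄
  rw [h₅]
  exact (congrArg (X.diff φ m) h₆).trans (map_smul _ _ _)

end VCoord

/-! ### Vertical cones and supports -/

namespace LocObj
variable {U : Man} (X : LocObj U)

/-- The vertical future (`τ = 1`) or past (`τ = -1`) of a subset. -/
def cone (τ : ℝ) (S : Set X) : Set X :=
  {m | ∃ γ : ℝ → X, ContMDiff 𝓘(ℝ, ℝ) (IT U) ∞ γ ∧ (∀ t, X.π (γ t) = X.π m) ∧
    (∀ t, 0 ≤ τ * X.speed γ t) ∧ γ 0 ∈ S ∧ γ 1 = m}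

theorem future_eq : X.future = X.cone 1 := by
  funext S
  simp only [future, cone, one_mul]

theorem past_eq : X.past = X.cone (-1) := by
  funext S
  simp only [past, cone, neg_mul, one_mul, Left.nonneg_neg_iff]

variable {X} {N W : Opens U} {Ψ : X → ℂ × ℂ} {τ : ℝ}

/-- The fibre coordinate is monotone along causal curves. -/
theorem exists_le_of_mem_cone {S : Set X} {m : X} (hm : m ∈ X.cone τ S) (C : VCoord X N)
    (hN : X.π m ∈ N) : ∃ m₀ ∈ S, X.π m₀ = X.π m ∧ τ * C.T m₀ ≤ τ * C.T m := by
  obtain ⟨γ, hγ, hπ, hs, h0, h1⟩ := hm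
  refine ⟨γ 0, h0, hπ 0, ?_⟩
  have hd : ∀ t, HasDerivAt (fun s => C.T (γ s)) (deriv (fun s => C.T (γ s)) t) t := fun t =>
    (hasDerivAt_comp (hγ.mdifferentiableAt (by simp)) ((C.contMDiffAt_T
      (by rw [hπ t]; exact hN)).mdifferentiableAt (by simp))).differentiableAt.hasDerivAt
  have hmono : Monotone (fun t => τ * C.T (γ t)) := by
    refine monotone_of_deriv_nonneg (fun t => ((hd t).const_mul τ).differentiableAt) fun t => ?_
    have h2 := hs t
    rw [C.speed_eq (hγ.mdifferentiableAt (by simp)) hπ hN] at h2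
    rw [((hd t).const_mul τ).deriv]
    have h3 := C.ρ_pos _ hN (C.T (γ t))
    refine nonneg_of_mul_nonneg_right (a := C.ρ (X.π m, C.T (γ t))) ?_ h3
    linarith
  have := hmono zero_le_one
  simpa only [h1] using this

/-- Points with comparable fibre coordinates are connected by a causal curve, which is a line in the
fibre coordinate. -/
theorem mem_cone_of_le {S : Set X} {m m₀ : X} (C : VCoord X N) (hN : X.π m ∈ N) (h₀ : m₀ ∈ S)
    (hπ : X.π m₀ = X.π m) (hle : τ * C.T m₀ ≤ τ * C.T m) : m ∈ X.cone τ S := by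
  have hγ : ContMDiff 𝓘(ℝ, ℝ) (IT U) ∞
      (fun s : ℝ => C.P (X.π m, C.T m₀ + (C.T m - C.T m₀) * s)) :=
    (C.smooth_line hN).comp
      ((contDiff_const.add (contDiff_const.mul contDiff_id)).contMDiff)
  have hπγ : ∀ s : ℝ, X.π (C.P (X.π m, C.T m₀ + (C.T m - C.T m₀) * s)) = X.π m :=
    fun s => C.π_P _ hN _
  refine ⟨_, hγ, hπγ, fun t => ?_, ?_, ?_⟩
  · rw [C.speed_eq (hγ.mdifferentiableAt (by simp)) hπγ hN]
    have h1 : (fun s : ℝ => C.T (C.P (X.π m, C.T m₀ + (C.T m - C.T m₀) * s))) =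
        fun s => C.T m₀ + (C.T m - C.T m₀) * s := funext fun s => C.T_P _ hN _
    have h2 : HasDerivAt (fun s : ℝ => C.T m₀ + (C.T m - C.T m₀) * s) (C.T m - C.T m₀) t := by
      simpa using ((hasDerivAt_id t).const_mul (C.T m - C.T m₀)).const_add (C.T m₀)
    rw [h1, h2.deriv]
    have h3 := C.ρ_pos _ hN (C.T (C.P (X.π m, C.T m₀ + (C.T m - C.T m₀) * t)))
    have h4 : 0 ≤ τ * (C.T m - C.T m₀) := by linarith
    have := mul_nonneg h3.le h4
    linarith
  · have h5 := C.P_T m₀ (by rw [hπ]; exact hN)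
    rw [hπ] at h5
    have h6 : C.P (X.π m, C.T m₀ + (C.T m - C.T m₀) * 0) = m₀ := by rw [mul_zero, add_zero, h5]
    rw [h6]
    exact h₀
  · rw [mul_one, add_sub_cancel, C.P_T m hN]

theorem SuppIn.exists_zero {N' : Opens U} (h : X.SuppIn (X.cone τ) N' Ψ) (C : VCoord X N) {x : U}
    (hx' : x ∈ N') (hx : x ∈ N) : ∃ M : Opens U, M ≤ N' ∧ M ≤ N ∧ x ∈ M ∧ ∃ c : ℝ,
      ∀ m, X.π m ∈ M → τ * C.T m < c → Ψ m = 0 := by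
  obtain ⟨σ, hσ, hσπ, hs⟩ := h
  have hc : ContinuousOn (fun u => τ * C.T (σ u)) (N' ⊓ N : Opens U) :=
    continuousOn_const.mul (C.smooth_T.continuousOn.comp (hσ.continuousOn.mono fun _ h => h.1)
      (fun u hu => by rw [mem_preimage, hσπ u hu.1]; exact hu.2))
  refine ⟨⟨(N' ⊓ N : Opens U) ∩ (fun u => τ * C.T (σ u)) ⁻¹' Ioi (τ * C.T (σ x) - 1),
    hc.isOpen_inter_preimage (N' ⊓ N).isOpen isOpen_Ioi⟩, fun _ h => h.1.1, fun _ h => h.1.2,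
    ⟨⟨hx', hx⟩, by simp⟩, τ * C.T (σ x) - 1, ?_⟩
  rintro m ⟨⟨hm', hm⟩, hmc⟩ hlt
  by_contra hne
  obtain ⟨_, ⟨u, hu, rfl⟩, hπ, hle⟩ :=
    exists_le_of_mem_cone (hs m hm' (subset_tsupport _ hne)) C hm
  rw [hσπ u hu] at hπ
  subst hπ
  exact absurd (lt_of_lt_of_le hmc hle) (not_lt.2 hlt.le)

theorem le_of_mem_tsupport {Z : Type} [Zero Z] {Ψ : X → Z} {c : ℝ} (C : VCoord X N)
    (h : ∀ m, X.π m ∈ N → τ * C.T m < c → Ψ m = 0) {m : X} (hm : X.π m ∈ N)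
    (hs : m ∈ tsupport Ψ) : c ≤ τ * C.T m := by
  by_contra! hlt
  refine notMem_tsupport_iff_eventuallyEq.2 ?_ hs
  have h₁ : ∀ᶠ m' in 𝓝 m, τ * C.T m' < c :=
    (continuousAt_const.mul (C.contMDiffAt_T hm).continuousAt).eventually (gt_mem_nhds hlt)
  filter_upwards [h₁, X.over_mem_nhds hm] with m' hm' hN using h m' hN hm'

/-- A function that vanishes below a value of the fibre coordinate is supported in the cone of the
local section at which the coordinate takes this value. -/
theorem suppIn_of_zero (hτ : τ * τ = 1) {c : ℝ} (C : VCoord X N)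
    (h : ∀ m, X.π m ∈ N → τ * C.T m < c → Ψ m = 0) : X.SuppIn (X.cone τ) N Ψ := by
  refine ⟨fun u => C.P (u, τ * c), ?_, fun u hu => C.π_P u hu _, fun m hm hs => ?_⟩
  · exact C.smooth_P.comp (contMDiff_id.prodMk contMDiff_const).contMDiffOn
      (fun u hu => ⟨hu, mem_univ _⟩)
  · refine mem_cone_of_le C hm (m₀ := C.P (X.π m, τ * c)) ⟨X.π m, hm, rfl⟩ (C.π_P _ hm _) ?_
    rw [C.T_P _ hm, ← mul_assoc, hτ, one_mul]
    exact le_of_mem_tsupport C h hm hs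

/-- Functions with vertically bounded support vanish, locally over the base, below some value of the
fibre coordinate. -/
theorem IsBdd.exists_zero (h : X.IsBdd (X.cone τ) W Ψ) (C : VCoord X N) {x : U}
    (hx' : x ∈ W) (hx : x ∈ N) : ∃ M : Opens U, M ≤ W ∧ M ≤ N ∧ x ∈ M ∧ ∃ c : ℝ,
      ∀ m, X.π m ∈ M → τ * C.T m < c → Ψ m = 0 := by
  obtain ⟨N', i, hxN', hs⟩ := h.bdd x hx'
  obtain ⟨M, j, k, hM, c, hc⟩ := hs.exists_zero C hxN' hx
  exact ⟨M, j.trans i, k, hM, c, hc⟩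

theorem isBdd_of (hτ : τ * τ = 1) (h : X.IsFld W Ψ) (H : ∀ x ∈ W, ∃ N : Opens U, N ≤ W ∧ x ∈ N ∧
    ∃ (C : VCoord X N) (c : ℝ), ∀ m, X.π m ∈ N → τ * C.T m < c → Ψ m = 0) :
    X.IsBdd (X.cone τ) W Ψ :=
  ⟨h, fun x hx => by
    obtain ⟨N, i, hxN, C, c, hc⟩ := H x hx
    exact ⟨N, i, hxN, suppIn_of_zero hτ C hc⟩⟩

/-- Functions with vertically compact support vanish, locally over the base, outside an interval of
the fibre coordinate. -/
theorem IsVc.exists_Icc (h : X.IsVc W Ψ) (C : VCoord X N) {x : U}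
    (hx' : x ∈ W) (hx : x ∈ N) : ∃ M : Opens U, M ≤ W ∧ M ≤ N ∧ x ∈ M ∧ ∃ a b : ℝ, a ≤ b ∧
      ∀ m, X.π m ∈ M → C.T m ∉ Icc a b → Ψ m = 0 := by
  obtain ⟨N', i, hxN', hs, hs'⟩ := h.bdd x hx'
  rw [future_eq] at hs
  rw [past_eq] at hs'
  obtain ⟨M, j, k, hM, a, ha⟩ := hs.exists_zero C hxN' hx
  obtain ⟨M', j', k', hM', b, hb⟩ := hs'.exists_zero C hxN' hx
  refine ⟨M ⊓ M', inf_le_left.trans (j.trans i), inf_le_left.trans k, ⟨hM, hM'⟩, a, max a (-b),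
    le_max_left _ _, fun m hm hT => ?_⟩
  by_contra hne
  refine hT ⟨?_, le_max_of_le_right ?_⟩
  · by_contra! hlt
    exact hne (ha m hm.1 (by linarith))
  · by_contra! hlt
    exact hne (hb m hm.2 (by linarith))

theorem isVc_of (h : X.IsFld W Ψ) (H : ∀ x ∈ W, ∃ N : Opens U, N ≤ W ∧ x ∈ N ∧
    ∃ (C : VCoord X N) (a b : ℝ), ∀ m, X.π m ∈ N → C.T m ∉ Icc a b → Ψ m = 0) : X.IsVc W Ψ :=
  ⟨h, fun x hx => by
    obtain ⟨N, i, hxN, C, a, b, hc⟩ := H x hx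
    refine ⟨N, i, hxN, ?_, ?_⟩
    · rw [future_eq]
      exact suppIn_of_zero (by norm_num) C (c := a) fun m hm hT => hc m hm fun h' => by
        have := h'.1
        linarith
    · rw [past_eq]
      exact suppIn_of_zero (by norm_num) C (c := -b) fun m hm hT => hc m hm fun h' => by
        have := h'.2
        linarith⟩

theorem IsVc.isBdd (h : X.IsVc W Ψ) (hτ : τ = 1 ∨ τ = -1) : X.IsBdd (X.cone τ) W Ψ :=
  ⟨h.toIsFld, fun x hx => by
    obtain ⟨N, i, hxN, h₁, h₂⟩ := h.bdd x hx
    rw [future_eq] at h₁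
    rw [past_eq] at h₂
    rcases hτ with rfl | rfl
    exacts [⟨N, i, hxN, h₁⟩, ⟨N, i, hxN, h₂⟩]⟩

/-- Every point of the base has a neighbourhood inside a given one that carries a vertical
coordinate. -/
theorem exists_vcoord_le (X : LocObj U) {x : U} (hx : x ∈ W) :
    ∃ N : Opens U, N ≤ W ∧ x ∈ N ∧ Nonempty (VCoord X N) := by
  obtain ⟨N, hxN, ⟨C⟩⟩ := X.exists_vcoord x
  exact ⟨N ⊓ W, inf_le_right, ⟨hxN, hx⟩, ⟨C.mono inf_le_left⟩⟩

/-! ### Fields in vertical coordinates -/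

theorem IsFld.contMDiffAt (h : X.IsFld W Ψ) {m : X} (hm : X.π m ∈ W) :
    ContMDiffAt (IT U) 𝓘(ℝ, ℂ × ℂ) ∞ Ψ m := h.smooth.contMDiffAt (X.over_mem_nhds hm)

theorem IsFld.smooth_P (h : X.IsFld W Ψ) (C : VCoord X N) (i : N ≤ W) :
    ContMDiffOn (IP U) 𝓘(ℝ, ℂ × ℂ) ∞ (fun p => Ψ (C.P p)) ((N : Set U) ×ˢ univ) :=
  h.smooth.comp C.smooth_P fun p hp => by
    change X.π (C.P (p.1, p.2)) ∈ W
    rw [C.π_P _ hp.1]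
    exact i hp.1

/-- Fields are smooth if they are given by smooth functions in vertical coordinates. -/
theorem isFld_of (h₀ : ∀ m, X.π m ∉ W → Ψ m = 0) (H : ∀ x ∈ W, ∃ N : Opens U, x ∈ N ∧
    ∃ (C : VCoord X N) (f : U × ℝ → ℂ × ℂ),
      ContMDiffOn (IP U) 𝓘(ℝ, ℂ × ℂ) ∞ f ((N : Set U) ×ˢ univ) ∧
      ∀ u ∈ N, ∀ t, Ψ (C.P (u, t)) = f (u, t)) : X.IsFld W Ψ where
  smooth m hm := by
    obtain ⟨N, hN, C, f, hf, hΨ⟩ := H (X.π m) hm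
    have h₁ : ContMDiffOn (IT U) 𝓘(ℝ, ℂ × ℂ) ∞ (fun m : X => f (X.π m, C.T m)) (X.π ⁻¹' N) :=
      hf.comp C.smooth_πT fun m hm => ⟨hm, mem_univ _⟩
    refine ((h₁.congr fun m' hm' => ?_).contMDiffAt (X.over_mem_nhds hN)).contMDiffWithinAt
    rw [← hΨ _ hm', C.P_T _ hm']
  zero := h₀

/-- The matrix `diag(-i, i)`, the inverse of the matrix coefficient of the Dirac operator. -/
def symb : ℂ × ℂ →L[ℝ] ℂ × ℂ :=
  ((ContinuousLinearMap.mul ℝ ℂ (-Complex.I)).comp (ContinuousLinearMap.fst ℝ ℂ ℂ)).prod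
    ((ContinuousLinearMap.mul ℝ ℂ Complex.I).comp (ContinuousLinearMap.snd ℝ ℂ ℂ))

@[simp] theorem symb_apply (v : ℂ × ℂ) : symb v = (-Complex.I * v.1, Complex.I * v.2) := rfl

/-- On a fibre, the Dirac equation is an ordinary differential equation. -/
theorem dirac_eq_iff (h : X.IsFld W Ψ) (C : VCoord X N) (i : N ≤ W) {u : U} (hu : u ∈ N) (t : ℝ)
    (v : ℂ × ℂ) : X.dirac W Ψ (C.P (u, t)) = v ↔
      HasDerivAt (fun s => Ψ (C.P (u, s))) (C.ρ (u, t) • symb v) t := by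
  have hπ : X.π (C.P (u, t)) = u := C.π_P u hu t
  have hT : C.T (C.P (u, t)) = t := C.T_P u hu t
  have hρ : C.ρ (u, t) ≠ 0 := (C.ρ_pos u hu t).ne'
  have hm : X.π (C.P (u, t)) ∈ N := by rw [hπ]; exact hu
  have hd := (h.contMDiffAt (i hm)).mdifferentiableAt (by simp : (∞ : WithTop ℕ∞) ≠ 0)
  have hd₁ : MDifferentiableAt (IT U) 𝓘(ℝ, ℂ) (fun m => (Ψ m).1) (C.P (u, t)) :=
    (contDiff_fst.contMDiff.mdifferentiableAt (by simp : (∞ : WithTop ℕ∞) ≠ 0)).comp _ hd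
  have hd₂ : MDifferentiableAt (IT U) 𝓘(ℝ, ℂ) (fun m => (Ψ m).2) (C.P (u, t)) :=
    (contDiff_snd.contMDiff.mdifferentiableAt (by simp : (∞ : WithTop ℕ∞) ≠ 0)).comp _ hd
  have hl : MDifferentiableAt 𝓘(ℝ, ℝ) (IT U) (fun s => C.P (u, s)) t :=
    (C.smooth_line hu).mdifferentiableAt (by simp)
  have hc : HasDerivAt (fun s => Ψ (C.P (u, s))) (deriv (fun s => Ψ (C.P (u, s))) t) t :=
    (hasDerivAt_comp hl hd).differentiableAt.hasDerivAt
  generalize deriv (fun s => Ψ (C.P (u, s))) t = d at hc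
  have h₁ : deriv (fun s => (Ψ (C.P (u, s))).1) t = d.1 :=
    ((ContinuousLinearMap.fst ℝ ℂ ℂ).hasFDerivAt.comp_hasDerivAt t hc).deriv
  have h₂ : deriv (fun s => (Ψ (C.P (u, s))).2) t = d.2 :=
    ((ContinuousLinearMap.snd ℝ ℂ ℂ).hasFDerivAt.comp_hasDerivAt t hc).deriv
  have hD : X.dirac W Ψ (C.P (u, t)) =
      (Complex.I * ((C.ρ (u, t))⁻¹ • d.1), -Complex.I * ((C.ρ (u, t))⁻¹ • d.2)) := by
    rw [dirac, restr, indicator_of_mem (show C.P (u, t) ∈ X.π ⁻¹' (W : Set U) from i hm),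
      C.starD_eq hm hd₁, C.starD_eq hm hd₂, hπ, hT, h₁, h₂]
  have key : X.dirac W Ψ (C.P (u, t)) = v ↔ d = C.ρ (u, t) • symb v := by
    rw [hD, Prod.ext_iff, Prod.ext_iff]
    simp only [symb_apply, Prod.smul_fst, Prod.smul_snd, Complex.real_smul]
    have hρ' : (C.ρ (u, t) : ℂ) ≠ 0 := by exact_mod_cast hρ
    push_cast
    have hI := Complex.I_mul_I
    refine and_congr ⟨fun e => ?_, fun e => ?_⟩ ⟨fun e => ?_, fun e => ?_⟩
    · rw [← e]; field_simp; linear_combination (d.1) * hI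
    · rw [e]; field_simp; linear_combination (-v.1) * hI
    · rw [← e]; field_simp; linear_combination (d.2) * hI
    · rw [e]; field_simp; linear_combination (-v.2) * hI
  rw [key]
  exact ⟨fun e => e ▸ hc, fun e => hc.unique e⟩

end LocObj

/-! ### Operations on fields -/

namespace LocObj
variable {U : Man} {X : LocObj U} {N W W' : Opens U} {Ψ Ψ' Φ Φ' : X → ℂ × ℂ} {τ : ℝ}

theorem restr_apply {m : X} (hm : X.π m ∈ W) : X.restr W Ψ m = Ψ m :=
  indicator_of_mem (s := X.π ⁻¹' (W : Set U)) hm Ψ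

theorem restr_apply_not {m : X} (hm : X.π m ∉ W) : X.restr W Ψ m = 0 :=
  indicator_of_notMem (s := X.π ⁻¹' (W : Set U)) hm Ψ

theorem restr_eventuallyEq {m : X} (hm : X.π m ∈ W) : X.restr W Ψ =ᶠ[𝓝 m] Ψ := by
  filter_upwards [X.over_mem_nhds hm] with m' hm' using restr_apply hm'

theorem starD_congr {φ φ' : X → ℂ} {m : X} (h : φ =ᶠ[𝓝 m] φ') : X.starD φ m = X.starD φ' m :=
  congrArg (fun L : TangentSpace (IT U) m →L[ℝ] ℂ => L (X.unitVec m)) h.mfderiv_eq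

theorem dirac_apply {m : X} (hm : X.π m ∈ W) : X.dirac W Ψ m =
    (Complex.I * X.starD (fun m' => (Ψ m').1) m, -Complex.I * X.starD (fun m' => (Ψ m').2) m) :=
  restr_apply hm

theorem dirac_congr {m : X} (hm : X.π m ∈ W) (hm' : X.π m ∈ W') (h : Ψ =ᶠ[𝓝 m] Ψ') :
    X.dirac W Ψ m = X.dirac W' Ψ' m := by
  have h₁ : X.starD (fun m' => (Ψ m').1) m = X.starD (fun m' => (Ψ' m').1) m :=
    starD_congr (h.fun_comp Prod.fst)
  have h₂ : X.starD (fun m' => (Ψ m').2) m = X.starD (fun m' => (Ψ' m').2) m :=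
    starD_congr (h.fun_comp Prod.snd)
  rw [dirac_apply hm, dirac_apply hm', h₁, h₂]

theorem dirac_eq_zero {m : X} (h : Ψ =ᶠ[𝓝 m] 0) : X.dirac W Ψ m = 0 := by
  by_cases hm : X.π m ∈ W
  · have h₀ : X.starD (fun _ => 0) m = 0 :=
      congrArg (fun L : TangentSpace (IT U) m →L[ℝ] ℂ => L (X.unitVec m)) mfderiv_const
    have h₁ : X.starD (fun m' => (Ψ m').1) m = 0 := (starD_congr (h.fun_comp Prod.fst)).trans h₀
    have h₂ : X.starD (fun m' => (Ψ m').2) m = 0 := (starD_congr (h.fun_comp Prod.snd)).trans h₀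
    rw [dirac_apply hm, h₁, h₂, mul_zero, mul_zero]
    rfl
  · exact restr_apply_not hm

theorem dirac_restr (i : W' ≤ W) : X.dirac W' (X.restr W' Ψ) = X.restr W' (X.dirac W Ψ) := by
  funext m
  by_cases hm : X.π m ∈ W'
  · rw [restr_apply hm]
    exact dirac_congr hm (i hm) (restr_eventuallyEq hm)
  · rw [restr_apply_not hm]
    exact restr_apply_not hm

theorem restr_restr (i : W' ≤ W) : X.restr W' (X.restr W Ψ) = X.restr W' Ψ := by
  funext m
  by_cases hm : X.π m ∈ W'
  · rw [restr_apply hm, restr_apply hm, restr_apply (i hm)]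
  · rw [restr_apply_not hm, restr_apply_not hm]

theorem IsFld.restr_self (h : X.IsFld W Ψ) : X.restr W Ψ = Ψ := by
  funext m
  by_cases hm : X.π m ∈ W
  · exact restr_apply hm
  · rw [restr_apply_not hm, h.zero m hm]

/-- Equality of functions is tested in vertical coordinates. -/
theorem eq_of_coords (h : ∀ m, X.π m ∉ W → Φ m = Φ' m)
    (H : ∀ (N : Opens U) (_ : N ≤ W) (C : VCoord X N), ∀ u ∈ N, ∀ t,
      Φ (C.P (u, t)) = Φ' (C.P (u, t))) : Φ = Φ' := by
  funext m
  by_cases hm : X.π m ∈ W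
  · obtain ⟨N, i, hN, ⟨C⟩⟩ := X.exists_vcoord_le hm
    rw [← C.P_T m hN]
    exact H N i C _ hN _
  · exact h m hm

theorem IsFld.of_contMDiffAt (h₀ : ∀ m, X.π m ∉ W → Ψ m = 0)
    (h : ∀ m, X.π m ∈ W → ContMDiffAt (IT U) 𝓘(ℝ, ℂ × ℂ) ∞ Ψ m) : X.IsFld W Ψ :=
  ⟨fun m hm => (h m hm).contMDiffWithinAt, h₀⟩

theorem IsFld.add (h : X.IsFld W Ψ) (h' : X.IsFld W Ψ') : X.IsFld W (Ψ + Ψ') :=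
  .of_contMDiffAt (fun m hm => by rw [Pi.add_apply, h.zero m hm, h'.zero m hm, add_zero])
    fun m hm => (h.contMDiffAt hm).add (h'.contMDiffAt hm)

theorem IsFld.restr (h : X.IsFld W Ψ) (i : W' ≤ W) : X.IsFld W' (X.restr W' Ψ) :=
  .of_contMDiffAt (fun _ hm => restr_apply_not hm)
    fun _ hm => (h.contMDiffAt (i hm)).congr_of_eventuallyEq (restr_eventuallyEq hm)

theorem smulFn_apply {a : Fn U W} {m : X} (hm : X.π m ∈ W) :
    X.smulFn a Ψ m = a ⟨X.π m, hm⟩ • Ψ m := dif_pos hm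

theorem smulFn_apply_not {a : Fn U W} {m : X} (hm : X.π m ∉ W) : X.smulFn a Ψ m = 0 := dif_neg hm

/-- The extension by zero of a smooth function on an open subset. -/
def extFn (a : Fn U W) (u : U) : ℂ := by
  classical
  exact if h : u ∈ W then a ⟨u, h⟩ else 0

theorem extFn_apply (a : Fn U W) {u : U} (h : u ∈ W) : extFn a u = a ⟨u, h⟩ := dif_pos h

theorem smooth_extFn (a : Fn U W) : ContMDiffOn (𝓡 U.dim) 𝓘(ℝ, ℂ) ∞ (extFn a) W := by
  intro u hu
  have h₁ : ContMDiffAt (𝓡 U.dim) 𝓘(ℝ, ℂ) ∞ (fun x : W => extFn a x) ⟨u, hu⟩ := by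
    have : (fun x : W => extFn a x) = a := funext fun x => extFn_apply a x.2
    rw [this]
    exact a.contMDiff _
  exact (contMDiffAt_subtype_iff.1 h₁).contMDiffWithinAt

/-- Smooth functions on an open subset from functions on the manifold. -/
def fnOf (b : U → ℂ) (h : ContMDiffOn (𝓡 U.dim) 𝓘(ℝ, ℂ) ∞ b W) : Fn U W :=
  ⟨fun x => b x, fun x => contMDiffAt_subtype_iff.2 (h.contMDiffAt (W.isOpen.mem_nhds x.2))⟩

theorem IsFld.smulFn (h : X.IsFld W Ψ) (a : Fn U W) : X.IsFld W (X.smulFn a Ψ) :=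
  .of_contMDiffAt (fun _ hm => smulFn_apply_not hm) fun m hm => by
    have h₁ : ContMDiffAt (IT U) 𝓘(ℝ, ℂ) ∞ (fun m : X => extFn a (X.π m)) m :=
      ((smooth_extFn a).contMDiffAt (W.isOpen.mem_nhds hm)).comp m X.smooth_π.contMDiffAt
    have hs : ContDiff ℝ ∞ (fun p : ℂ × ℂ × ℂ => p.1 • p.2) :=
      (contDiff_fst.mul contDiff_snd.fst).prodMk (contDiff_fst.mul contDiff_snd.snd)
    refine (hs.contMDiff.contMDiffAt.comp m
      (h₁.prodMk_space (h.contMDiffAt hm))).congr_of_eventuallyEq ?_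
    filter_upwards [X.over_mem_nhds hm] with m' hm'
    rw [smulFn_apply hm']
    exact congrArg (fun z => z • Ψ m') (extFn_apply a hm').symm

theorem IsFld.conjSwap (h : X.IsFld W Ψ) : X.IsFld W (X.conjSwap Ψ) :=
  .of_contMDiffAt (fun m hm => by
    rw [LocObj.conjSwap, h.zero m hm]
    exact Prod.ext (map_zero _) (map_zero _)) fun m hm => by
    have hc : ContDiff ℝ ∞ (fun v : ℂ × ℂ => ((starRingEnd ℂ) v.2, (starRingEnd ℂ) v.1)) :=
      ((Complex.conjCLE.contDiff (n := ∞)).comp contDiff_snd).prodMk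
        ((Complex.conjCLE.contDiff (n := ∞)).comp contDiff_fst)
    exact hc.contMDiff.contMDiffAt.comp m (h.contMDiffAt hm)

theorem symb_symb (v : ℂ × ℂ) : symb (-symb v) = v := by
  have hI := Complex.I_mul_I
  refine Prod.ext ?_ ?_
  · change -Complex.I * -(-Complex.I * v.1) = v.1
    linear_combination (-v.1) * hI
  · change Complex.I * -(Complex.I * v.2) = v.2
    linear_combination (-v.2) * hI

theorem IsFld.hasDerivAt (h : X.IsFld W Ψ) (C : VCoord X N) (i : N ≤ W) {u : U} (hu : u ∈ N)
    (t : ℝ) :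
    HasDerivAt (fun s => Ψ (C.P (u, s))) (C.ρ (u, t) • symb (X.dirac W Ψ (C.P (u, t)))) t :=
  (dirac_eq_iff h C i hu t _).1 rfl

theorem IsFld.dirac (h : X.IsFld W Ψ) : X.IsFld W (X.dirac W Ψ) := by
  refine isFld_of (fun m hm => restr_apply_not hm) fun x hx => ?_
  obtain ⟨N, i, hN, ⟨C⟩⟩ := X.exists_vcoord_le hx
  refine ⟨N, hN, C, fun p => -((C.ρ p)⁻¹ • symb (deriv (fun s => Ψ (C.P (p.1, s))) p.2)),
    ?_, fun u hu t => ?_⟩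
  · have h₁ : ContMDiffOn (IP U) 𝓘(ℝ, ℝ) ∞ (fun p => (C.ρ p)⁻¹) ((N : Set U) ×ˢ univ) :=
      fun p hp => (contDiffAt_inv ℝ (C.ρ_pos p.1 hp.1 p.2).ne').contMDiffAt.comp_contMDiffWithinAt
        p (C.smooth_ρ p hp)
    exact (h₁.smul (symb.contDiff.contMDiff.comp_contMDiffOn (smooth_deriv (h.smooth_P C i)))).neg
  · have hρ : C.ρ (u, t) ≠ 0 := (C.ρ_pos u hu t).ne'
    change _ = -((C.ρ (u, t))⁻¹ • symb (deriv (fun s => Ψ (C.P (u, s))) t))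
    rw [(h.hasDerivAt C i hu t).deriv, map_smul, smul_smul, inv_mul_cancel₀ hρ, one_smul,
      ← map_neg]
    have := symb_symb (X.dirac W Ψ (C.P (u, t)))
    rw [map_neg] at this ⊢
    exact this.symm

theorem dirac_add (h : X.IsFld W Ψ) (h' : X.IsFld W Ψ') :
    X.dirac W (Ψ + Ψ') = X.dirac W Ψ + X.dirac W Ψ' := by
  refine eq_of_coords (W := W) (fun m hm => ?_) fun N i C u hu t => ?_
  · rw [Pi.add_apply, (h.add h').dirac.zero m hm, h.dirac.zero m hm, h'.dirac.zero m hm, add_zero]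
  · refine (dirac_eq_iff (h.add h') C i hu t _).2 ?_
    rw [Pi.add_apply, map_add, smul_add]
    exact (h.hasDerivAt C i hu t).add (h'.hasDerivAt C i hu t)

theorem symb_smul (z : ℂ) (v : ℂ × ℂ) : symb (z • v) = z • symb v :=
  Prod.ext (mul_left_comm _ _ _) (mul_left_comm _ _ _)

theorem dirac_smulFn (h : X.IsFld W Ψ) (a : Fn U W) :
    X.dirac W (X.smulFn a Ψ) = X.smulFn a (X.dirac W Ψ) := by
  refine eq_of_coords (W := W) (fun m hm => ?_) fun N i C u hu t => ?_
  · rw [(h.smulFn a).dirac.zero m hm, smulFn_apply_not hm]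
  · refine (dirac_eq_iff (h.smulFn a) C i hu t _).2 ?_
    have h₁ : ∀ (Φ : X → ℂ × ℂ) s, X.smulFn a Φ (C.P (u, s)) = a ⟨u, i hu⟩ • Φ (C.P (u, s)) := by
      intro Φ s
      have hπ := C.π_P u hu s
      rw [smulFn_apply (by rw [hπ]; exact i hu)]
      congr 2
      exact Subtype.ext hπ
    rw [h₁, symb_smul, smul_comm]
    simp only [h₁]
    exact (h.hasDerivAt C i hu t).const_smul (a ⟨u, i hu⟩)

/-- A field whose support is controlled by the supports of two functions with vertically bounded
support has vertically bounded support. -/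
theorem IsBdd.of_support (hτ : τ * τ = 1) {W₁ W₂ : Opens U} (h : X.IsBdd (X.cone τ) W₁ Ψ)
    (h' : X.IsBdd (X.cone τ) W₂ Ψ') (i : W ≤ W₁) (i' : W ≤ W₂) (hΦ : X.IsFld W Φ)
    (H : ∀ m, X.π m ∈ W → Ψ =ᶠ[𝓝 m] 0 → Ψ' =ᶠ[𝓝 m] 0 → Φ m = 0) : X.IsBdd (X.cone τ) W Φ := by
  refine isBdd_of hτ hΦ fun x hx => ?_
  obtain ⟨N, j, hN, ⟨C⟩⟩ := X.exists_vcoord_le hx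
  obtain ⟨M, -, k, hM, c, hc⟩ := h.exists_zero C (i hx) hN
  obtain ⟨M', -, k', hM', c', hc'⟩ := h'.exists_zero C (i' hx) hN
  refine ⟨M ⊓ M', (inf_le_left.trans k).trans j, ⟨hM, hM'⟩, C.mono (inf_le_left.trans k),
    min c c', fun m hm hT => ?_⟩
  have hT' : ∀ᶠ m' in 𝓝 m, τ * C.T m' < min c c' :=
    (continuousAt_const.mul (C.contMDiffAt_T (k hm.1)).continuousAt).eventually (gt_mem_nhds hT)
  refine H m (j (k hm.1)) ?_ ?_
  · filter_upwards [hT', X.over_mem_nhds hm.1] with m' h₁ h₂ using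
      hc m' h₂ (h₁.trans_le (min_le_left _ _))
  · filter_upwards [hT', X.over_mem_nhds hm.2] with m' h₁ h₂ using
      hc' m' h₂ (h₁.trans_le (min_le_right _ _))

theorem IsVc.of_support {W₁ W₂ : Opens U} (h : X.IsVc W₁ Ψ)
    (h' : X.IsVc W₂ Ψ') (i : W ≤ W₁) (i' : W ≤ W₂) (hΦ : X.IsFld W Φ)
    (H : ∀ m, X.π m ∈ W → Ψ =ᶠ[𝓝 m] 0 → Ψ' =ᶠ[𝓝 m] 0 → Φ m = 0) : X.IsVc W Φ := by
  refine isVc_of hΦ fun x hx => ?_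
  obtain ⟨N, j, hN, ⟨C⟩⟩ := X.exists_vcoord_le hx
  obtain ⟨M, -, k, hM, a, b, -, hc⟩ := h.exists_Icc C (i hx) hN
  obtain ⟨M', -, k', hM', a', b', -, hc'⟩ := h'.exists_Icc C (i' hx) hN
  refine ⟨M ⊓ M', (inf_le_left.trans k).trans j, ⟨hM, hM'⟩, C.mono (inf_le_left.trans k),
    min a a', max b b', fun m hm hT => ?_⟩
  have hT' : ∀ᶠ m' in 𝓝 m, C.T m' ∈ (Icc (min a a') (max b b'))ᶜ :=
    (C.contMDiffAt_T (k hm.1)).continuousAt.eventually (isClosed_Icc.isOpen_compl.mem_nhds hT)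
  refine H m (j (k hm.1)) ?_ ?_
  · filter_upwards [hT', X.over_mem_nhds hm.1] with m' h₁ h₂ using
      hc m' h₂ fun h₃ => h₁ ⟨(min_le_left _ _).trans h₃.1, h₃.2.trans (le_max_left _ _)⟩
  · filter_upwards [hT', X.over_mem_nhds hm.2] with m' h₁ h₂ using
      hc' m' h₂ fun h₃ => h₁ ⟨(min_le_right _ _).trans h₃.1, h₃.2.trans (le_max_right _ _)⟩

theorem IsBdd.add (hτ : τ * τ = 1) (h : X.IsBdd (X.cone τ) W Ψ) (h' : X.IsBdd (X.cone τ) W Ψ') :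
    X.IsBdd (X.cone τ) W (Ψ + Ψ') :=
  .of_support hτ h h' le_rfl le_rfl (h.toIsFld.add h'.toIsFld) fun m _ h₁ h₂ => by
    rw [Pi.add_apply, h₁.self_of_nhds, h₂.self_of_nhds]; exact add_zero _

theorem IsBdd.restr (hτ : τ * τ = 1) (h : X.IsBdd (X.cone τ) W Ψ) (i : W' ≤ W) :
    X.IsBdd (X.cone τ) W' (X.restr W' Ψ) :=
  .of_support hτ h h i i (h.toIsFld.restr i) fun m hm h₁ _ => by
    rw [restr_apply hm]; exact h₁.self_of_nhds

theorem IsBdd.smulFn (hτ : τ * τ = 1) (h : X.IsBdd (X.cone τ) W Ψ) (a : Fn U W) :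
    X.IsBdd (X.cone τ) W (X.smulFn a Ψ) :=
  .of_support hτ h h le_rfl le_rfl (h.toIsFld.smulFn a) fun m hm h₁ _ => by
    rw [smulFn_apply hm, h₁.self_of_nhds]; exact smul_zero _

theorem IsBdd.dirac (hτ : τ * τ = 1) (h : X.IsBdd (X.cone τ) W Ψ) :
    X.IsBdd (X.cone τ) W (X.dirac W Ψ) :=
  .of_support hτ h h le_rfl le_rfl h.toIsFld.dirac fun _ _ h₁ _ => dirac_eq_zero h₁

theorem IsVc.add (h : X.IsVc W Ψ) (h' : X.IsVc W Ψ') : X.IsVc W (Ψ + Ψ') :=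
  .of_support h h' le_rfl le_rfl (h.toIsFld.add h'.toIsFld) fun m _ h₁ h₂ => by
    rw [Pi.add_apply, h₁.self_of_nhds, h₂.self_of_nhds]; exact add_zero _

theorem IsVc.restr (h : X.IsVc W Ψ) (i : W' ≤ W) : X.IsVc W' (X.restr W' Ψ) :=
  .of_support h h i i (h.toIsFld.restr i) fun m hm h₁ _ => by
    rw [restr_apply hm]; exact h₁.self_of_nhds

theorem IsVc.smulFn (h : X.IsVc W Ψ) (a : Fn U W) : X.IsVc W (X.smulFn a Ψ) :=
  .of_support h h le_rfl le_rfl (h.toIsFld.smulFn a) fun m hm h₁ _ => by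
    rw [smulFn_apply hm, h₁.self_of_nhds]; exact smul_zero _

theorem IsVc.conjSwap (h : X.IsVc W Ψ) : X.IsVc W (X.conjSwap Ψ) :=
  .of_support h h le_rfl le_rfl h.toIsFld.conjSwap fun m hm h₁ _ => by
    rw [LocObj.conjSwap, h₁.self_of_nhds]; exact Prod.ext (map_zero _) (map_zero _)

theorem IsVc.dirac (h : X.IsVc W Ψ) : X.IsVc W (X.dirac W Ψ) :=
  .of_support h h le_rfl le_rfl h.toIsFld.dirac fun _ _ h₁ _ => dirac_eq_zero h₁

theorem IsBdd.of_locally (h₀ : ∀ m, X.π m ∉ W → Ψ m = 0) {J : Set X → Set X}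
    (H : ∀ x ∈ W, ∃ N : Opens U, N ≤ W ∧ x ∈ N ∧ X.IsBdd J N (X.restr N Ψ)) (hτ : τ * τ = 1)
    (hJ : J = X.cone τ) : X.IsBdd J W Ψ := by
  subst hJ
  refine isBdd_of hτ (.of_contMDiffAt h₀ fun m hm => ?_) fun x hx => ?_
  · obtain ⟨N, i, hN, h⟩ := H _ hm
    exact (h.toIsFld.contMDiffAt hN).congr_of_eventuallyEq (restr_eventuallyEq hN).symm
  · obtain ⟨N, i, hN, h⟩ := H x hx
    obtain ⟨N', j, hN', ⟨C⟩⟩ := X.exists_vcoord_le hN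
    obtain ⟨M, -, k, hM, c, hc⟩ := h.exists_zero C hN hN'
    exact ⟨M, (k.trans j).trans i, hM, C.mono k, c, fun m hm hT =>
      (restr_apply (j (k hm))).symm.trans (hc m hm hT)⟩

end LocObj

/-! ### Green operators -/

namespace LocObj
variable {U : Man} {X : LocObj U} {N W W' : Opens U} {Ψ Ψ' Φ Φ' : X → ℂ × ℂ} {τ : ℝ}

theorem sign_sq (hτ : τ = 1 ∨ τ = -1) : τ * τ = 1 := by
  rcases hτ with rfl | rfl <;> norm_num

/-- Solutions of the Dirac equation with vertically bounded support are unique, since on every fibre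
they solve an ordinary differential equation with zero initial condition. -/
theorem IsBdd.ext (hτ : τ = 1 ∨ τ = -1) (h : X.IsBdd (X.cone τ) W Φ)
    (h' : X.IsBdd (X.cone τ) W Φ') (H : X.dirac W Φ = X.dirac W Φ') : Φ = Φ' := by
  refine eq_of_coords (W := W) (fun m hm => by rw [h.zero m hm, h'.zero m hm])
    fun N i C u hu t => ?_
  obtain ⟨M, -, k, hM, c, hc⟩ := h.exists_zero C (i hu) hu
  obtain ⟨M', -, k', hM', c', hc'⟩ := h'.exists_zero C (i hu) hu
  have hd : ∀ s, HasDerivAt (fun s => Φ (C.P (u, s)) - Φ' (C.P (u, s))) 0 s := fun s => by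
    have := (h.toIsFld.hasDerivAt C i hu s).sub (h'.toIsFld.hasDerivAt C i hu s)
    rwa [H, sub_self] at this
  have hconst := is_const_of_deriv_eq_zero (fun s => (hd s).differentiableAt)
    (fun s => (hd s).deriv) t (τ * (min c c' - 1))
  have hτT : τ * C.T (C.P (u, τ * (min c c' - 1))) = min c c' - 1 := by
    rw [C.T_P u hu, ← mul_assoc, sign_sq hτ, one_mul]
  have hπ : X.π (C.P (u, τ * (min c c' - 1))) = u := C.π_P u hu _
  rw [hc (C.P (u, τ * (min c c' - 1))) (by rw [hπ]; exact hM)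
      (by rw [hτT]; linarith [min_le_left c c']),
    hc' (C.P (u, τ * (min c c' - 1))) (by rw [hπ]; exact hM')
      (by rw [hτT]; linarith [min_le_right c c']), sub_self] at hconst
  exact sub_eq_zero.1 hconst

/-- Local solutions of the Dirac equation are obtained by integration along the fibres. -/
theorem IsBdd.exists_local (hτ : τ = 1 ∨ τ = -1) (h : X.IsBdd (X.cone τ) W Ψ) {x : U} (hx : x ∈ W) :
    ∃ N : Opens U, N ≤ W ∧ x ∈ N ∧ ∃ Φ, X.IsBdd (X.cone τ) N Φ ∧ X.dirac N Φ = X.restr N Ψ := by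
  obtain ⟨N, i, hN, ⟨C₀⟩⟩ := X.exists_vcoord_le hx
  obtain ⟨M, j, k, hM, c, hc⟩ := h.exists_zero C₀ hx hN
  set C := C₀.mono k
  have hc : ∀ m, X.π m ∈ M → τ * C.T m < c → Ψ m = 0 := hc
  clear_value C
  have hf : ContMDiffOn (IP U) 𝓘(ℝ, ℂ × ℂ) ∞ (fun p => C.ρ p • symb (Ψ (C.P p)))
      ((M : Set U) ×ˢ univ) :=
    C.smooth_ρ.smul (symb.contDiff.contMDiff.comp_contMDiffOn (h.toIsFld.smooth_P C j))
  have hline : ∀ u ∈ M, Continuous fun s : ℝ => C.ρ (u, s) • symb (Ψ (C.P (u, s))) :=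
    fun u hu => hf.continuousOn.comp_continuous (by fun_prop) (fun s => ⟨hu, mem_univ _⟩)
  set F : U × ℝ → ℂ × ℂ := fun p =>
    ∫ s in (τ * (c - 1))..p.2, C.ρ (p.1, s) • symb (Ψ (C.P (p.1, s)))
  let Φ : X → ℂ × ℂ := X.restr M fun m => F (X.π m, C.T m)
  have hΦ : ∀ u ∈ M, ∀ t, Φ (C.P (u, t)) = F (u, t) := fun u hu t => by
    have hπ := C.π_P u hu t
    change X.restr M _ _ = _
    rw [restr_apply (by rw [hπ]; exact hu), hπ, C.T_P u hu]
  have hfld : X.IsFld M Φ := isFld_of (fun m hm => restr_apply_not hm) fun y hy =>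
    ⟨M, hy, C, F, smooth_primitive hf _, hΦ⟩
  refine ⟨M, j, hM, Φ, isBdd_of (sign_sq hτ) hfld fun y hy => ⟨M, le_rfl, hy, C, c, ?_⟩, ?_⟩
  · intro m hm hT
    rw [← C.P_T m hm, hΦ _ hm]
    refine (intervalIntegral.integral_congr (g := fun _ => (0 : ℂ × ℂ)) fun s hs => ?_).trans
      intervalIntegral.integral_zero
    have hs' : τ * s < c := by
      rcases hτ with rfl | rfl
      · have := hs.2
        rw [le_sup_iff] at this
        rcases this with h | h <;> linarith
      · have := hs.1
        rw [inf_le_iff] at this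
        rcases this with h | h <;> linarith
    have hπ := C.π_P _ hm s
    change C.ρ (X.π m, s) • symb (Ψ (C.P (X.π m, s))) = 0
    rw [hc _ (by rw [hπ]; exact hm) (by rw [C.T_P _ hm]; exact hs'), map_zero, smul_zero]
  · refine eq_of_coords (W := M) (fun m hm => by
      rw [hfld.dirac.zero m hm, restr_apply_not hm]) fun N' i' C' u hu t => ?_
    -- the equation may be checked in the coordinate used for the integration
    have hm : X.π (C'.P (u, t)) ∈ M := by rw [C'.π_P u hu]; exact i' hu
    rw [← C.P_T _ hm]
    generalize X.π (C'.P (u, t)) = u at *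
    generalize C.T (C'.P _) = t
    refine (dirac_eq_iff hfld C le_rfl hm t _).2 ?_
    have hπ := C.π_P u hm t
    rw [restr_apply (by rw [hπ]; exact hm)]
    have h₁ := ((hline u hm).integral_hasStrictDerivAt (τ * (c - 1)) t).hasDerivAt
    exact h₁.congr_of_eventuallyEq (Filter.Eventually.of_forall fun s => hΦ u hm s)

/-- The Dirac equation is solvable with vertically bounded support: the local solutions agree on
overlaps by uniqueness. -/
theorem IsBdd.exists_green (hτ : τ = 1 ∨ τ = -1) (h : X.IsBdd (X.cone τ) W Ψ) :
    ∃ Φ, X.IsBdd (X.cone τ) W Φ ∧ X.dirac W Φ = Ψ := by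
  have hτ' := sign_sq hτ
  choose N i hN S hS hD using fun x : W => h.exists_local hτ x.2
  classical
  let Φ : X → ℂ × ℂ := fun m => if hm : X.π m ∈ W then S ⟨X.π m, hm⟩ m else 0
  have hΦ : ∀ x : W, X.restr (N x) Φ = S x := by
    intro x
    funext m
    by_cases hm : X.π m ∈ N x
    · rw [restr_apply hm]
      have hmW : X.π m ∈ W := i x hm
      let z : W := ⟨X.π m, hmW⟩
      have e₁ : Φ m = S z m := dif_pos hmW
      have hK : X.π m ∈ N x ⊓ N z := ⟨hm, hN z⟩
      have e₂ : X.restr (N x ⊓ N z) (S z) = X.restr (N x ⊓ N z) (S x) := by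
        refine IsBdd.ext hτ ((hS z).restr hτ' inf_le_right) ((hS x).restr hτ' inf_le_left) ?_
        rw [dirac_restr inf_le_right, dirac_restr inf_le_left, hD, hD, restr_restr inf_le_right,
          restr_restr inf_le_left]
      have e₃ := congrFun e₂ m
      rw [restr_apply hK, restr_apply hK] at e₃
      exact e₁.trans e₃
    · rw [restr_apply_not hm, (hS x).zero m hm]
  have h₀ : ∀ m, X.π m ∉ W → Φ m = 0 := fun m hm => dif_neg hm
  have hB : X.IsBdd (X.cone τ) W Φ := .of_locally h₀
    (fun x hx => ⟨N ⟨x, hx⟩, i _, hN _, by rw [hΦ]; exact hS _⟩) hτ' rfl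
  refine ⟨Φ, hB, ?_⟩
  funext m
  by_cases hm : X.π m ∈ W
  · have hm' := hN ⟨X.π m, hm⟩
    have e₁ := dirac_restr (Ψ := Φ) (i ⟨X.π m, hm⟩)
    rw [hΦ, hD] at e₁
    have e₂ := congrFun e₁ m
    rw [restr_apply hm', restr_apply hm'] at e₂
    exact e₂.symm
  · rw [hB.toIsFld.dirac.zero m hm, h.zero m hm]

variable (X) in
/-- The retarded (`τ = 1`) and advanced (`τ = -1`) Green operators: the solution of the Dirac
equation with support bounded in the respective direction, and zero where there is none. -/
def green (τ : ℝ) (W : Opens U) (Ψ : X → ℂ × ℂ) : X → ℂ × ℂ := by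
  classical
  exact if h : ∃ Φ, X.IsBdd (X.cone τ) W Φ ∧ X.dirac W Φ = Ψ then h.choose else 0

theorem isBdd_green (hτ : τ = 1 ∨ τ = -1) (h : X.IsBdd (X.cone τ) W Ψ) :
    X.IsBdd (X.cone τ) W (X.green τ W Ψ) := by
  rw [green, dif_pos (h.exists_green hτ)]
  exact (h.exists_green hτ).choose_spec.1

theorem dirac_green (hτ : τ = 1 ∨ τ = -1) (h : X.IsBdd (X.cone τ) W Ψ) :
    X.dirac W (X.green τ W Ψ) = Ψ := by
  rw [green, dif_pos (h.exists_green hτ)]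
  exact (h.exists_green hτ).choose_spec.2

theorem green_eq (hτ : τ = 1 ∨ τ = -1) (h : X.IsBdd (X.cone τ) W Φ) (e : X.dirac W Φ = Ψ) :
    X.green τ W Ψ = Φ := by
  subst e
  have h' := h.dirac (sign_sq hτ)
  exact IsBdd.ext hτ (isBdd_green hτ h') h (dirac_green hτ h')

/-- A solution of the Dirac equation is constant along the segments of the fibres that do not meet
the support of the source. -/
theorem IsFld.eq_of_dirac_eq_zero (h : X.IsFld W Φ) (C : VCoord X N) (i : N ≤ W) {u : U}
    (hu : u ∈ N) {a b : ℝ} (H : ∀ s ∈ uIcc a b, X.dirac W Φ (C.P (u, s)) = 0) :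
    Φ (C.P (u, b)) = Φ (C.P (u, a)) := by
  have hd : ∀ s ∈ uIcc a b, HasDerivAt (fun s => Φ (C.P (u, s))) 0 s := fun s hs => by
    have := h.hasDerivAt C i hu s
    rwa [H s hs, map_zero, smul_zero] at this
  have := intervalIntegral.integral_eq_sub_of_hasDerivAt hd intervalIntegrable_const
  rw [intervalIntegral.integral_zero] at this
  exact (sub_eq_zero.1 this.symm)

/-- The support property of the Green operators. If the cone of the support of the source does not
contain `m`, the source vanishes along the fibres near `m` from the far past up to `m`, and the
solution keeps its initial value zero. -/
theorem green_supp (hτ : τ = 1 ∨ τ = -1) (h : X.IsBdd (X.cone τ) W Ψ) {m : X} (hm : X.π m ∈ W)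
    (hs : m ∈ tsupport (X.green τ W Ψ)) : m ∈ X.cone τ (tsupport Ψ ∩ X.π ⁻¹' W) := by
  have hτ' := sign_sq hτ
  have hB := isBdd_green hτ h
  have hD := dirac_green hτ h
  set Φ := X.green τ W Ψ
  obtain ⟨N, i, hN, ⟨C⟩⟩ := X.exists_vcoord_le hm
  by_contra hcon
  obtain ⟨M, -, k, hM, c, hc⟩ := hB.exists_zero C hm hN
  refine notMem_tsupport_iff_eventuallyEq.2 ?_ hs
  -- the source vanishes along the fibre of `m` up to the point `m`
  set b := τ * C.T m
  set a := min c b - 1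
  have hbT : τ * b = C.T m := by rw [← mul_assoc, hτ', one_mul]
  have hO : IsOpen (((N : Set U) ×ˢ (univ : Set ℝ)) ∩
      (fun p : U × ℝ => C.P (p.1, τ * p.2)) ⁻¹' (tsupport Ψ)ᶜ) := by
    refine ContinuousOn.isOpen_inter_preimage ?_ (VCoord.isOpen_dom N)
      (isClosed_tsupport Ψ).isOpen_compl
    exact C.smooth_P.continuousOn.comp (by fun_prop) fun p hp => ⟨hp.1, mem_univ _⟩
  obtain ⟨V, I, hV, hI, hVm, hIab, hVI⟩ := generalized_tube_lemma
    (isCompact_singleton (x := X.π m)) (isCompact_Icc (a := a) (b := b)) hO (by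
      rintro ⟨u, r⟩ ⟨hu, hr⟩
      obtain rfl : u = X.π m := hu
      refine ⟨⟨hN, mem_univ _⟩, fun hmem => hcon ?_⟩
      have hπ : X.π (C.P (X.π m, τ * r)) = X.π m := C.π_P _ hN _
      refine mem_cone_of_le C hN (m₀ := C.P (X.π m, τ * r)) ⟨hmem, ?_⟩ hπ ?_
      · rw [mem_preimage, hπ]; exact hm
      · rw [C.T_P _ hN, ← mul_assoc, hτ', one_mul]
        exact hr.2)
  have hab : a ≤ b := by linarith [min_le_right c b]
  obtain ⟨δ, hδ, hball⟩ := Metric.isOpen_iff.1 hI b (hIab ⟨hab, le_rfl⟩)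
  have h₁ : ∀ᶠ m' in 𝓝 m, X.π m' ∈ V :=
    X.smooth_π.continuous.continuousAt.eventually (hV.mem_nhds (hVm rfl))
  have h₂ : ∀ᶠ m' in 𝓝 m, τ * C.T m' ∈ Metric.ball b δ :=
    (continuousAt_const.mul (C.contMDiffAt_T hN).continuousAt).eventually
      (Metric.ball_mem_nhds b hδ)
  have h₃ : ∀ᶠ m' in 𝓝 m, a < τ * C.T m' :=
    (continuousAt_const.mul (C.contMDiffAt_T hN).continuousAt).eventually
      (lt_mem_nhds (show a < b by linarith [min_le_right c b]))
  filter_upwards [h₁, h₂, h₃, X.over_mem_nhds hM] with m' hV' hb' ha' hM'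
  have hN' : X.π m' ∈ N := k hM'
  have hseg : ∀ r, a ≤ r → r ≤ τ * C.T m' → r ∈ I := by
    intro r hr hr'
    by_cases hrb : r ≤ b
    · exact hIab ⟨hr, hrb⟩
    · refine hball ?_
      rw [Metric.mem_ball, Real.dist_eq, abs_lt] at hb' ⊢
      constructor <;> linarith
  have hzero : ∀ s ∈ uIcc (τ * a) (C.T m'), X.dirac W Φ (C.P (X.π m', s)) = 0 := by
    intro s hs
    have hτs : τ * s ∈ I := by
      rcases hτ with rfl | rfl
      · rw [uIcc_of_le (by linarith)] at hs
        exact hseg _ (by linarith [hs.1]) (by linarith [hs.2])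
      · rw [uIcc_of_ge (by linarith)] at hs
        exact hseg _ (by linarith [hs.2]) (by linarith [hs.1])
    have := (hVI (mk_mem_prod hV' hτs)).2
    have hss : τ * (τ * s) = s := by rw [← mul_assoc, hτ', one_mul]
    rw [mem_preimage] at this
    simp only [hss] at this
    rw [hD]
    exact image_eq_zero_of_notMem_tsupport this
  have e := hB.toIsFld.eq_of_dirac_eq_zero C i hN' hzero
  rw [C.P_T m' hN'] at e
  rw [e]
  refine hc _ (by rw [C.π_P _ hN']; exact hM') ?_
  rw [C.T_P _ hN', ← mul_assoc, hτ', one_mul]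
  linarith [min_le_left c b]

theorem isGreen_green (hτ : τ = 1 ∨ τ = -1) : X.IsGreen (X.cone τ) (X.green τ) where
  bdd h := isBdd_green hτ h
  add h h' := by
    have := sign_sq hτ
    refine green_eq hτ ((isBdd_green hτ h).add this (isBdd_green hτ h')) ?_
    rw [dirac_add (isBdd_green hτ h).toIsFld (isBdd_green hτ h').toIsFld, dirac_green hτ h,
      dirac_green hτ h']
  smul a h := by
    refine green_eq hτ ((isBdd_green hτ h).smulFn (sign_sq hτ) a) ?_
    rw [dirac_smulFn (isBdd_green hτ h).toIsFld, dirac_green hτ h]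
  restr i h := by
    refine green_eq hτ ((isBdd_green hτ h).restr (sign_sq hτ) i) ?_
    rw [dirac_restr i, dirac_green hτ h]
  dirac_green h := dirac_green hτ h
  green_dirac h := green_eq hτ h rfl
  supp h _ hm hs := green_supp hτ h hm hs

end LocObj

/-! ### Fibre integrals -/

section
open MeasureTheory LocObj
variable {U : Man} {X : LocObj U} {N W W' : Opens U} {Ψ Ψ' Φ Φ' : X → ℂ × ℂ} {τ : ℝ}
  {F : Type} [NormedAddCommGroup F] [NormedSpace ℝ F]

/-- The integral of `Φ E` over the fibre above `u` in a vertical coordinate. -/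
def VCoord.integral (C : VCoord X N) (u : U) (Φ : X → F) : F := ∫ t : ℝ, C.ρ (u, t) • Φ (C.P (u, t))

/-- Integration over a fibre by means of an injective parametrization that covers the support. -/
theorem VCoord.integral_curve (C : VCoord X N) {u : U} (hu : u ∈ N) {γ : ℝ → X}
    (hγ : ∀ t, MDifferentiableAt 𝓘(ℝ, ℝ) (IT U) γ t) (hπ : ∀ t, X.π (γ t) = u)
    (hi : Function.Injective γ) {Φ : X → F} (h₀ : ∀ m, X.π m = u → m ∉ range γ → Φ m = 0) :
    ∫ t : ℝ, |X.speed γ t| • Φ (γ t) = C.integral u Φ := by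
  have hP : ∀ t, C.P (u, C.T (γ t)) = γ t := fun t => by
    have := C.P_T (γ t) (by rw [hπ]; exact hu)
    rwa [hπ] at this
  have hd : ∀ t, HasDerivAt (fun s => C.T (γ s)) (deriv (fun s => C.T (γ s)) t) t := fun t =>
    (hasDerivAt_comp (hγ t) ((C.contMDiffAt_T
      (by rw [hπ t]; exact hu)).mdifferentiableAt (by simp))).differentiableAt.hasDerivAt
  have hinj : InjOn (fun s => C.T (γ s)) univ := fun s _ t _ e => hi <| by
    rw [← hP s, ← hP t]
    exact congrArg (fun r => C.P (u, r)) e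
  have key := integral_image_eq_integral_abs_deriv_smul MeasurableSet.univ
    (fun t _ => (hd t).hasDerivWithinAt) hinj (fun t => C.ρ (u, t) • Φ (C.P (u, t)))
  rw [setIntegral_eq_integral_of_forall_compl_eq_zero, setIntegral_univ] at key
  · rw [VCoord.integral, key]
    refine integral_congr_ae (Filter.Eventually.of_forall fun t => ?_)
    change |X.speed γ t| • Φ (γ t) = |deriv (fun s => C.T (γ s)) t| •
      C.ρ (u, C.T (γ t)) • Φ (C.P (u, C.T (γ t)))
    rw [C.speed_eq (hγ t) hπ hu, abs_mul, abs_of_pos (C.ρ_pos u hu _), hP, smul_smul, mul_comm]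
  · intro t ht
    rw [h₀ _ (C.π_P u hu t), smul_zero]
    rintro ⟨s, hs⟩
    refine ht ⟨s, mem_univ _, ?_⟩
    change C.T (γ s) = t
    rw [hs, C.T_P u hu]

theorem VCoord.speed_line (C : VCoord X N) {u : U} (hu : u ∈ N) (t : ℝ) :
    X.speed (fun s => C.P (u, s)) t = C.ρ (u, t) := by
  have h₁ : (fun s => C.T (C.P (u, s))) = id := funext fun s => C.T_P u hu s
  rw [C.speed_eq ((C.smooth_line hu).mdifferentiableAt (by simp)) (C.π_P u hu) hu, h₁, deriv_id,
    mul_one, C.T_P u hu]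

theorem VCoord.injective_line (C : VCoord X N) {u : U} (hu : u ∈ N) :
    Function.Injective (fun s => C.P (u, s)) := fun s t e => by
  rw [← C.T_P u hu s, ← C.T_P u hu t]
  exact congrArg C.T e

/-- The integral over a fibre does not depend on the vertical coordinate. -/
theorem VCoord.integral_eq (C : VCoord X N) {N' : Opens U} (C' : VCoord X N') {u : U} (hu : u ∈ N)
    (hu' : u ∈ N') (Φ : X → F) : C.integral u Φ = C'.integral u Φ := by
  rw [← C'.integral_curve hu' (fun t => (C.smooth_line hu).mdifferentiableAt (by simp)) (C.π_P u hu)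
    (C.injective_line hu) (Φ := Φ)]
  · refine integral_congr_ae (Filter.Eventually.of_forall fun t => ?_)
    change _ = |X.speed (fun s => C.P (u, s)) t| • Φ (C.P (u, t))
    rw [C.speed_line hu, abs_of_pos (C.ρ_pos u hu t)]
  · intro m hm hr
    refine absurd ⟨C.T m, ?_⟩ hr
    have := C.P_T m (by rw [hm]; exact hu)
    rwa [hm] at this

/-- The integral over a fibre in a trivialization agrees with the one in a vertical coordinate. -/
theorem VCoord.fibreIntegral_eq (C : VCoord X N) {u : U} (hu : u ∈ N)
    {e : Bundle.Trivialization ℝ X.π} (he : IsSmoothTriv e) (hue : u ∈ e.baseSet) (Φ : X → ℂ) :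
    X.fibreIntegral e u Φ = C.integral u Φ := by
  have ht : ∀ t : ℝ, (u, t) ∈ e.target := fun t => e.mem_target.2 hue
  refine C.integral_curve hu (fun t => ?_) (fun t => e.proj_symm_apply (ht t)) ?_ ?_
  · have h₁ := (he.smooth_symm.contMDiffAt (e.open_target.mem_nhds (ht t))).comp t
      (contMDiffAt_const.prodMk contMDiffAt_id :
        ContMDiffAt 𝓘(ℝ, ℝ) (IP U) ∞ (fun s : ℝ => (u, s)) t)
    exact h₁.mdifferentiableAt (by simp)
  · intro s t h
    have := congrArg e h
    have h₁ : e (e.toOpenPartialHomeomorph.symm (u, s)) = (u, s) :=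
      e.toOpenPartialHomeomorph.right_inv (ht s)
    have h₂ : e (e.toOpenPartialHomeomorph.symm (u, t)) = (u, t) :=
      e.toOpenPartialHomeomorph.right_inv (ht t)
    rw [h₁, h₂] at this
    exact congrArg Prod.snd this
  · intro m hm hr
    have hs : m ∈ e.source := e.mem_source.2 (hm ▸ hue)
    refine absurd ⟨(e m).2, ?_⟩ hr
    have h₁ : e m = (u, (e m).2) := Prod.ext ((e.coe_fst hs).trans hm) rfl
    change e.toOpenPartialHomeomorph.symm (u, (e m).2) = m
    rw [← h₁]
    exact e.toOpenPartialHomeomorph.left_inv hs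

variable (X) in
/-- The integral of `Φ E` over the fibre above `u`, for functions with values in `ℂ²`, computed in a
chosen vertical coordinate; by `VCoord.charge_eq` the choice does not matter. -/
def LocObj.charge (u : U) (Ψ : X → ℂ × ℂ) : ℂ × ℂ :=
  (X.exists_vcoord u).choose_spec.2.some.integral u Ψ

theorem VCoord.charge_eq (C : VCoord X N) {u : U} (hu : u ∈ N) (Ψ : X → ℂ × ℂ) :
    X.charge u Ψ = C.integral u Ψ :=
  VCoord.integral_eq _ _ (X.exists_vcoord u).choose_spec.1 hu Ψ

theorem LocObj.IsFld.continuous_line (h : X.IsFld W Ψ) (C : VCoord X N) {u : U} (hu : u ∈ N)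
    (hW : u ∈ W) : Continuous fun t : ℝ => C.ρ (u, t) • Ψ (C.P (u, t)) := by
  have h₁ : Continuous fun t : ℝ => Ψ (C.P (u, t)) :=
    h.smooth.continuousOn.comp_continuous (C.smooth_line hu).continuous fun t => by
      rw [mem_preimage, C.π_P u hu]; exact hW
  exact (C.smooth_ρ_line hu).smul h₁

/-- The fibre integral as an integral over a bounded interval that contains the support. -/
theorem VCoord.integral_eq_interval (C : VCoord X N) {u : U} (hu : u ∈ N) {a b : ℝ} (hab : a ≤ b)
    {Φ : X → F} (h : ∀ m, X.π m = u → C.T m ∉ Icc a b → Φ m = 0) :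
    C.integral u Φ = ∫ t in a..b, C.ρ (u, t) • Φ (C.P (u, t)) := by
  rw [intervalIntegral.integral_of_le hab, ← integral_Icc_eq_integral_Ioc,
    setIntegral_eq_integral_of_forall_compl_eq_zero]
  · rfl
  · intro t ht
    rw [h _ (C.π_P u hu t) (by rw [C.T_P u hu]; exact ht), smul_zero]

theorem LocObj.IsVc.integrable (h : X.IsVc W Ψ) (C : VCoord X N) {u : U} (hu : u ∈ N)
    (hW : u ∈ W) : Integrable fun t : ℝ => C.ρ (u, t) • Ψ (C.P (u, t)) := by
  obtain ⟨M, -, k, hM, a, b, -, hc⟩ := h.exists_Icc C hW hu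
  refine (h.toIsFld.continuous_line C hu hW).integrable_of_hasCompactSupport
    (.intro (isCompact_Icc (a := a) (b := b)) fun t ht => ?_)
  have hπ := C.π_P u hu t
  rw [hc _ (by rw [hπ]; exact hM) (by rw [C.T_P u hu]; exact ht), smul_zero]

theorem LocObj.IsVc.integral_comp (h : X.IsVc W Ψ) (C : VCoord X N) {u : U} (hu : u ∈ N)
    (hW : u ∈ W) [CompleteSpace F] (L : ℂ × ℂ →L[ℝ] F) :
    C.integral u (fun m => L (Ψ m)) = L (X.charge u Ψ) := by
  rw [C.charge_eq hu]
  refine Eq.trans ?_ (L.integral_comp_comm (h.integrable C hu hW))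
  refine integral_congr_ae (Filter.Eventually.of_forall fun t => ?_)
  exact (map_smul L _ _).symm

theorem LocObj.charge_congr {u : U} (h : ∀ m, X.π m = u → Ψ m = Ψ' m) :
    X.charge u Ψ = X.charge u Ψ' := by
  obtain ⟨N, hN, ⟨C⟩⟩ := X.exists_vcoord u
  rw [C.charge_eq hN, C.charge_eq hN]
  refine integral_congr_ae (Filter.Eventually.of_forall fun t => ?_)
  exact congrArg (fun v => C.ρ (u, t) • v) (h _ (C.π_P u hN t))

theorem LocObj.IsVc.charge_comp (h : X.IsVc W Ψ) {u : U} (hW : u ∈ W) (L : ℂ × ℂ →L[ℝ] ℂ × ℂ) :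
    X.charge u (fun m => L (Ψ m)) = L (X.charge u Ψ) := by
  obtain ⟨N, hN, ⟨C⟩⟩ := X.exists_vcoord u
  rw [C.charge_eq hN, h.integral_comp C hN hW]

theorem LocObj.IsVc.charge_add (h : X.IsVc W Ψ) (h' : X.IsVc W Ψ') {u : U} (hW : u ∈ W) :
    X.charge u (Ψ + Ψ') = X.charge u Ψ + X.charge u Ψ' := by
  obtain ⟨N, hN, ⟨C⟩⟩ := X.exists_vcoord u
  rw [C.charge_eq hN, C.charge_eq hN, C.charge_eq hN]
  refine Eq.trans ?_ (integral_add (h.integrable C hN hW) (h'.integrable C hN hW))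
  refine integral_congr_ae (Filter.Eventually.of_forall fun t => ?_)
  exact smul_add _ _ _

theorem LocObj.IsVc.smooth_charge (h : X.IsVc W Ψ) :
    ContMDiffOn (𝓡 U.dim) 𝓘(ℝ, ℂ × ℂ) ∞ (fun u => X.charge u Ψ) W := by
  intro x hx
  obtain ⟨N, i, hN, ⟨C⟩⟩ := X.exists_vcoord_le hx
  obtain ⟨M, j, k, hM, a, b, hab, hc⟩ := h.exists_Icc C hx hN
  have h₁ : ContMDiffOn (IP U) 𝓘(ℝ, ℂ × ℂ) ∞ (fun p => C.ρ p • Ψ (C.P p)) ((N : Set U) ×ˢ univ) :=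
    C.smooth_ρ.smul (h.toIsFld.smooth_P C i)
  have h₂ : ContMDiffOn (𝓡 U.dim) 𝓘(ℝ, ℂ × ℂ) ∞
      (fun u => ∫ s in a..b, C.ρ (u, s) • Ψ (C.P (u, s))) N :=
    (smooth_primitive h₁ a).comp (contMDiff_id.prodMk contMDiff_const).contMDiffOn
      (fun u hu => ⟨hu, mem_univ b⟩)
  refine ((h₂.contMDiffAt (N.isOpen.mem_nhds hN)).congr_of_eventuallyEq ?_).contMDiffWithinAt
  filter_upwards [M.isOpen.mem_nhds hM] with u hu
  rw [C.charge_eq (k hu)]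
  exact C.integral_eq_interval (k hu) hab fun m hm hT => hc m (by rw [hm]; exact hu) hT

theorem LocObj.symb_injective : Function.Injective symb := by
  intro v w e
  have h : ∀ v, v = -symb (symb v) := fun v => by
    rw [← map_neg, symb_symb]
  rw [h v, h w, e]

/-- The fundamental theorem of calculus for the Dirac equation on a fibre. -/
theorem LocObj.IsFld.sub_eq_integral (h : X.IsFld W Φ) (C : VCoord X N) (i : N ≤ W) {u : U}
    (hu : u ∈ N) {a b : ℝ} (hab : a ≤ b)
    (H : ∀ m, X.π m = u → C.T m ∉ Icc a b → X.dirac W Φ m = 0) :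
    Φ (C.P (u, b)) - Φ (C.P (u, a)) = symb (C.integral u (X.dirac W Φ)) := by
  have hc := h.dirac.continuous_line C hu (i hu)
  have h₁ := intervalIntegral.integral_eq_sub_of_hasDerivAt (a := a) (b := b)
    (f := fun s => Φ (C.P (u, s))) (fun s _ => h.hasDerivAt C i hu s) (by
      have : Continuous fun s => symb (C.ρ (u, s) • X.dirac W Φ (C.P (u, s))) :=
        symb.continuous.comp hc
      simp only [map_smul] at this
      exact this.intervalIntegrable _ _)
  rw [← h₁, C.integral_eq_interval hu hab H, ← symb.intervalIntegral_comp_comm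
    (hc.intervalIntegrable _ _)]
  simp only [map_smul]

/-- The fibre integrals of a total derivative vanish. -/
theorem LocObj.IsVc.charge_dirac (h : X.IsVc W Φ) {u : U} (hu : u ∈ W) :
    X.charge u (X.dirac W Φ) = 0 := by
  obtain ⟨N, i, hN, ⟨C⟩⟩ := X.exists_vcoord_le hu
  obtain ⟨M, -, k, hM, a, b, hab, hc⟩ := h.exists_Icc C hu hN
  obtain ⟨M', -, k', hM', a', b', hab', hc'⟩ := h.dirac.exists_Icc C hu hN
  set α := min a a' - 1
  set β := max b b' + 1
  have hα : α < a := by linarith [min_le_left a a']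
  have hα' : α < a' := by linarith [min_le_right a a']
  have hβ : b < β := by linarith [le_max_left b b']
  have hβ' : b' < β := by linarith [le_max_right b b']
  have e := h.toIsFld.sub_eq_integral C i hN (a := α) (b := β) (by linarith) fun m hm hT =>
    hc' m (by rw [hm]; exact hM') fun hT' => hT ⟨by linarith [hT'.1], by linarith [hT'.2]⟩
  have hz : ∀ t, t ∉ Icc a b → Φ (C.P (u, t)) = 0 := fun t ht =>
    hc _ (by rw [C.π_P u hN]; exact hM) (by rw [C.T_P u hN]; exact ht)
  rw [hz β fun h => by linarith [h.2], hz α fun h => by linarith [h.1], sub_zero] at e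
  rw [C.charge_eq hN]
  exact symb_injective (e.symm.trans (map_zero symb).symm)

/-- The causal propagator integrates over the fibres: the difference of the two solutions is
constant on a fibre, and far in the future it is the total integral of the source. -/
theorem LocObj.IsVc.green_sub_green (h : X.IsVc W Ψ) {m : X} (hm : X.π m ∈ W) :
    X.green 1 W Ψ m - X.green (-1) W Ψ m = symb (X.charge (X.π m) Ψ) := by
  have h₁ := h.isBdd (τ := 1) (.inl rfl)
  have h₂ := h.isBdd (τ := -1) (.inr rfl)
  have b₁ := isBdd_green (.inl rfl) h₁
  have b₂ := isBdd_green (.inr rfl) h₂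
  have d₁ := dirac_green (.inl rfl) h₁
  have d₂ := dirac_green (.inr rfl) h₂
  set R := X.green 1 W Ψ
  set A := X.green (-1) W Ψ
  obtain ⟨N, i, hN, ⟨C⟩⟩ := X.exists_vcoord_le hm
  obtain ⟨M, -, k, hM, a, b, hab, hc⟩ := h.exists_Icc C hm hN
  obtain ⟨M₁, -, k₁, hM₁, c₁, hc₁⟩ := b₁.exists_zero C hm hN
  obtain ⟨M₂, -, k₂, hM₂, c₂, hc₂⟩ := b₂.exists_zero C hm hN
  set α := min a c₁ - 1
  set β := max b (-c₂) + 1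
  have hα : α < a := by linarith [min_le_left a c₁]
  have hα' : α < c₁ := by linarith [min_le_right a c₁]
  have hβ : b < β := by linarith [le_max_left b (-c₂)]
  have hβ' : -c₂ < β := by linarith [le_max_right b (-c₂)]
  have hconst : ∀ s, HasDerivAt (fun s => R (C.P (X.π m, s)) - A (C.P (X.π m, s))) 0 s :=
    fun s => by
      have := (b₁.toIsFld.hasDerivAt C i hN s).sub (b₂.toIsFld.hasDerivAt C i hN s)
      rwa [d₁, d₂, sub_self] at this
  have e₁ := is_const_of_deriv_eq_zero (fun s => (hconst s).differentiableAt)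
    (fun s => (hconst s).deriv) (C.T m) β
  rw [C.P_T m hN] at e₁
  have e₂ := b₁.toIsFld.sub_eq_integral C i hN (a := α) (b := β) (by linarith) fun m' hm' hT => by
    rw [d₁]
    exact hc m' (by rw [hm']; exact hM) fun hT' => hT ⟨by linarith [hT'.1], by linarith [hT'.2]⟩
  rw [d₁, hc₁ (C.P (X.π m, α)) (by rw [C.π_P _ hN]; exact hM₁) (by rw [C.T_P _ hN]; linarith),
    sub_zero] at e₂
  rw [e₁, e₂, hc₂ (C.P (X.π m, β)) (by rw [C.π_P _ hN]; exact hM₂)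
    (by rw [C.T_P _ hN]; linarith), sub_zero, C.charge_eq hN]

theorem LocObj.isVc_of_isBdd (h₁ : X.IsBdd (X.cone 1) W Φ) (h₂ : X.IsBdd (X.cone (-1)) W Φ) :
    X.IsVc W Φ := by
  refine isVc_of h₁.toIsFld fun x hx => ?_
  obtain ⟨N, i, hN, ⟨C⟩⟩ := X.exists_vcoord_le hx
  obtain ⟨M₁, -, k₁, hM₁, c₁, hc₁⟩ := h₁.exists_zero C hx hN
  obtain ⟨M₂, -, k₂, hM₂, c₂, hc₂⟩ := h₂.exists_zero C hx hN
  refine ⟨M₁ ⊓ M₂, (inf_le_left.trans k₁).trans i, ⟨hM₁, hM₂⟩, C.mono (inf_le_left.trans k₁), c₁,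
    -c₂, fun m hm hT => ?_⟩
  by_contra hne
  refine hT ⟨?_, ?_⟩
  · by_contra! hlt
    exact hne (hc₁ m hm.1 (by rw [one_mul]; exact hlt))
  · by_contra! hlt
    have hlt' : -c₂ < C.T m := hlt
    exact hne (hc₂ m hm.2 (by linarith))

/-- A field with vertically compact support and vanishing fibre integrals is in the image of the
Dirac operator: its retarded and advanced solutions agree. -/
theorem LocObj.IsVc.exists_dirac_eq (h : X.IsVc W Ψ) (H : ∀ u ∈ W, X.charge u Ψ = 0) :
    ∃ Φ, X.IsVc W Φ ∧ X.dirac W Φ = Ψ := by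
  have h₁ := h.isBdd (τ := 1) (.inl rfl)
  have h₂ := h.isBdd (τ := -1) (.inr rfl)
  have b₁ := isBdd_green (.inl rfl) h₁
  have b₂ := isBdd_green (.inr rfl) h₂
  have e : X.green 1 W Ψ = X.green (-1) W Ψ := by
    funext m
    by_cases hm : X.π m ∈ W
    · have := h.green_sub_green hm
      rw [H _ hm, map_zero] at this
      exact sub_eq_zero.1 this
    · rw [b₁.zero m hm, b₂.zero m hm]
  exact ⟨_, isVc_of_isBdd b₁ (e ▸ b₂), dirac_green (.inl rfl) h₁⟩

end

/-! ### Existence of fields with given fibre integrals -/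

section
open MeasureTheory LocObj
variable {U : Man} {X : LocObj U} {N W W' : Opens U} {Ψ : X → ℂ × ℂ}

theorem exists_bump : ∃ χ : ℝ → ℝ, ContDiff ℝ ∞ χ ∧ (∀ t, t ∉ Icc (-2 : ℝ) 2 → χ t = 0) ∧
    ∫ t, χ t = 1 := by
  let f : ContDiffBump (0 : ℝ) := ⟨1, 2, one_pos, one_lt_two⟩
  refine ⟨f.normed volume, f.contDiff_normed, fun t ht => ?_, f.integral_normed⟩
  have : t ∉ Function.support (f.normed volume) := by
    rw [f.support_normed_eq]
    intro h
    rw [Metric.mem_ball, Real.dist_eq, sub_zero, abs_lt] at h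
    exact ht ⟨h.1.le, h.2.le⟩
  exact Function.notMem_support.1 this

/-- Every smooth function with values in `ℂ²` is the fibre integral of a field that is concentrated
in an interval of the fibre coordinate. -/
theorem VCoord.exists_charge (C : VCoord X N) {c : U → ℂ × ℂ}
    (hc : ContMDiffOn (𝓡 U.dim) 𝓘(ℝ, ℂ × ℂ) ∞ c N) :
    ∃ Ψ, X.IsVc N Ψ ∧ ∀ u ∈ N, X.charge u Ψ = c u := by
  obtain ⟨χ, hχ, hχ₀, hχ₁⟩ := exists_bump
  let f : U × ℝ → ℂ × ℂ := fun p => ((C.ρ p)⁻¹ * χ p.2) • c p.1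
  let Ψ : X → ℂ × ℂ := X.restr N fun m => f (X.π m, C.T m)
  have hΨ : ∀ u ∈ N, ∀ t, Ψ (C.P (u, t)) = f (u, t) := fun u hu t => by
    have hπ := C.π_P u hu t
    change X.restr N _ _ = _
    rw [restr_apply (by rw [hπ]; exact hu), hπ, C.T_P u hu]
  have h₁ : ContMDiffOn (IP U) 𝓘(ℝ, ℝ) ∞ (fun p => (C.ρ p)⁻¹) ((N : Set U) ×ˢ univ) :=
    fun p hp => (contDiffAt_inv ℝ (C.ρ_pos p.1 hp.1 p.2).ne').contMDiffAt.comp_contMDiffWithinAt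
      p (C.smooth_ρ p hp)
  have hf : ContMDiffOn (IP U) 𝓘(ℝ, ℂ × ℂ) ∞ f ((N : Set U) ×ˢ univ) := by
    refine ContMDiffOn.smul (h₁.mul (hχ.contMDiff.comp contMDiff_snd).contMDiffOn) ?_
    exact hc.comp contMDiff_fst.contMDiffOn fun p hp => hp.1
  refine ⟨Ψ, isVc_of (isFld_of (fun m hm => restr_apply_not hm) fun x hx => ⟨N, hx, C, f, hf, hΨ⟩)
    fun x hx => ⟨N, le_rfl, hx, C, -2, 2, fun m hm hT => ?_⟩, fun u hu => ?_⟩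
  · rw [← C.P_T m hm, hΨ _ hm]
    change ((C.ρ _)⁻¹ * χ (C.T m)) • _ = _
    rw [hχ₀ _ hT, mul_zero, zero_smul]
  · rw [C.charge_eq hu, VCoord.integral]
    have : ∀ t, C.ρ (u, t) • Ψ (C.P (u, t)) = χ t • c u := fun t => by
      rw [hΨ u hu, smul_smul, mul_inv_cancel_left₀ (C.ρ_pos u hu t).ne']
    simp only [this]
    rw [integral_smul_const, hχ₁, one_smul]

/-! ### Pullback of fields -/

variable {U' : Man} (h : U ⟶ U') {X' : LocObj U'} {N' W₀ : Opens U'}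

/-- The pullback of a vertical coordinate. Outside the preimage of its domain, the parametrization
takes arbitrary values in the fibres. -/
def VCoord.pull (C : VCoord X' N') : VCoord (X'.pull h) (pre h N') := by
  classical
  let Q : U × ℝ → X'.pull h := fun p =>
    if hp : h p.1 ∈ N' then Bdl.PB.mk p.1 (C.P (h p.1, p.2)) (C.π_P _ hp _).symm
    else ((X'.pull h).toBdl.surj p.1).choose
  have hQ : ∀ p : U × ℝ, ∀ hp : h p.1 ∈ N',
      Q p = Bdl.PB.mk p.1 (C.P (h p.1, p.2)) (C.π_P _ hp _).symm :=
    fun p hp => dif_pos hp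
  have hs : ContMDiff (IP U) (IP U') ∞ (fun p : U × ℝ => (h p.1, p.2)) :=
    ((Man.smooth_hom h).comp contMDiff_fst).prodMk contMDiff_snd
  have hw : ∀ m : X'.pull h, h ((X'.pull h).π m) = X'.π (X'.bar h m) := fun m => Bdl.PB.w m
  exact
  { T := fun m => C.T (X'.bar h m)
    P := Q
    ρ := fun p => C.ρ (h p.1, p.2)
    smooth_T := C.smooth_T.comp (smooth_bar h X').contMDiffOn fun m hm => by
      change X'.π (X'.bar h m) ∈ N'
      rw [← hw]; exact hm
    smooth_P := Bdl.PB.smooth_of_comp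
      (contMDiff_fst.contMDiffOn.congr fun p hp => congrArg Bdl.PB.fst (hQ p hp.1))
      ((C.smooth_P.comp hs.contMDiffOn fun p hp => ⟨hp.1, mem_univ _⟩).congr fun p hp =>
        congrArg Bdl.PB.snd (hQ p hp.1))
    smooth_ρ := C.smooth_ρ.comp hs.contMDiffOn fun p hp => ⟨hp.1, mem_univ _⟩
    π_P := fun u hu t => congrArg Bdl.PB.fst (hQ (u, t) hu)
    T_P := fun u hu t => (congrArg (fun m => C.T (Bdl.PB.snd m)) (hQ (u, t) hu)).trans
      (C.T_P _ hu t)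
    P_T := fun m hm => by
      refine (hQ ((X'.pull h).π m, C.T (X'.bar h m)) hm).trans ?_
      refine Subtype.ext (Prod.ext rfl ?_)
      have hb : X'.π (X'.bar h m) ∈ N' := by rw [← hw]; exact hm
      change C.P (h ((X'.pull h).π m), C.T (X'.bar h m)) = X'.bar h m
      rw [hw]
      exact C.P_T _ hb
    ρ_pos := fun u hu t => C.ρ_pos _ hu t
    E_eq := fun m hm v => by
      have hb : X'.π (X'.bar h m) ∈ N' := by rw [← hw]; exact hm
      have h₁ : (X'.pull h).E m v = X'.E (X'.bar h m) (Bdl.PB.dsnd m v) := rfl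
      have h₂ := mfderiv_comp_apply m ((C.contMDiffAt_T hb).mdifferentiableAt (by simp))
        ((smooth_bar h X').mdifferentiableAt (by simp) (x := m)) (v : TangentSpace (IT U) m)
      refine h₁.trans ((C.E_eq _ hb (Bdl.PB.dsnd m v)).trans ?_)
      refine congrArg₂ (· * ·) (congrArg (fun u => C.ρ (u, C.T (X'.bar h m))) (hw m).symm) ?_
      exact h₂.symm }

variable {h}

theorem VCoord.bar_pull (C : VCoord X' N') {u : U} (hu : h u ∈ N') (t : ℝ) :
    X'.bar h ((C.pull h).P (u, t)) = C.P (h u, t) :=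
  congrArg Bdl.PB.snd (dif_pos hu)

theorem LocObj.π_bar (m : X'.pull h) : X'.π (X'.bar h m) = h ((X'.pull h).π m) := (Bdl.PB.w m).symm

theorem LocObj.IsVc.pull {Ψ : X' → ℂ × ℂ} (hΨ : X'.IsVc W₀ Ψ) :
    (X'.pull h).IsVc (pre h W₀) (fun p => Ψ (X'.bar h p)) := by
  refine isVc_of ⟨hΨ.smooth.comp (smooth_bar h X').contMDiffOn fun m hm => ?_, fun m hm => ?_⟩
    fun x hx => ?_
  · change X'.π (X'.bar h m) ∈ W₀
    rw [π_bar]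
    exact hm
  · exact hΨ.zero _ (by rw [π_bar]; exact hm)
  · obtain ⟨N, i, hN, ⟨C⟩⟩ := X'.exists_vcoord_le (show h x ∈ W₀ from hx)
    obtain ⟨M, -, k, hM, a, b, -, hc⟩ := hΨ.exists_Icc C (i hN) hN
    exact ⟨pre h M, pre_mono h (k.trans i), hM, (C.mono k).pull h, a, b, fun m hm hT =>
      hc _ (by rw [π_bar]; exact hm) hT⟩

theorem LocObj.charge_pull {Ψ : X' → ℂ × ℂ} (u : U) :
    (X'.pull h).charge u (fun p => Ψ (X'.bar h p)) = X'.charge (h u) Ψ := by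
  obtain ⟨N, hN, ⟨C⟩⟩ := X'.exists_vcoord (h u)
  rw [C.charge_eq hN, (C.pull h).charge_eq (show u ∈ pre h N from hN)]
  refine integral_congr_ae (Filter.Eventually.of_forall fun t => ?_)
  change C.ρ (h u, t) • Ψ (X'.bar h ((C.pull h).P (u, t))) = _
  rw [C.bar_pull hN]

/-! ### Pushforward of fields -/

variable {Y : LocObj U} (f : X ⟶ Y)

theorem LocHom.injective : Function.Injective f.toFun := by
  obtain ⟨s, -, hs⟩ := f.smooth_inv
  exact Function.LeftInverse.injective hs

theorem LocHom.extend_apply (Ψ : X → ℂ × ℂ) (m : X) :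
    Function.extend f.toFun Ψ 0 (f.toFun m) = Ψ m := (LocHom.injective f).extend_apply _ _ _

theorem LocHom.extend_eventuallyEq (Ψ : X → ℂ × ℂ) {s : Y → X} (hs : ∀ m, s (f.toFun m) = m)
    (m : X) : Function.extend f.toFun Ψ 0 =ᶠ[𝓝 (f.toFun m)] Ψ ∘ s := by
  filter_upwards [f.isOpen.mem_nhds ⟨m, rfl⟩]
  rintro _ ⟨m', rfl⟩
  rw [LocHom.extend_apply, Function.comp_apply, hs]

/-- The extension by zero along a morphism is again smooth with vertically compact support. In
vertical coordinates, locally over the base, its support is the image of a compact interval of each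
fibre, which is bounded, and closed jointly in the base variable. -/
theorem LocObj.IsVc.extend (hΨ : X.IsVc W Ψ) : Y.IsVc W (Function.extend f.toFun Ψ 0) := by
  obtain ⟨s, hss, hs⟩ := f.smooth_inv
  have key : ∀ x ∈ W, ∃ (M : Opens U) (_ : M ≤ W) (_ : x ∈ M) (C : VCoord X M) (D : VCoord Y M)
      (a b : ℝ), ∀ m : Y, Y.π m ∈ M → (∀ t ∈ Icc a b, D.T (f.toFun (C.P (Y.π m, t))) ≠ D.T m) →
        Function.extend f.toFun Ψ 0 m = 0 := by
    intro x hx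
    obtain ⟨N, i, hN, ⟨C⟩⟩ := X.exists_vcoord_le hx
    obtain ⟨N₂, i₂, hN₂, ⟨D⟩⟩ := Y.exists_vcoord_le hx
    obtain ⟨M, j, k, hM, a, b, hab, hc⟩ := hΨ.exists_Icc C hx hN
    refine ⟨M ⊓ N₂, inf_le_left.trans j, ⟨hM, hN₂⟩, C.mono (inf_le_left.trans k),
      D.mono inf_le_right, a, b, fun m hm hT => ?_⟩
    by_cases hr : m ∈ range f.toFun
    · obtain ⟨m, rfl⟩ := hr
      rw [f.w] at hm hT
      rw [LocHom.extend_apply]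
      refine hc m hm.1 fun hT' => hT _ hT' ?_
      change D.T (f.toFun (C.P (X.π m, C.T m))) = _
      rw [C.P_T _ (k hm.1)]
      rfl
    · exact Function.extend_apply' _ _ _ hr
  -- the image under `f` of the compact part of the fibres is locally bounded and closed
  have hcont : ∀ (M : Opens U) (C : VCoord X M) (D : VCoord Y M), ContinuousOn
      (fun p : (U × ℝ) × ℝ => (D.T (f.toFun (C.P (p.1.1, p.2))), p.1.2))
      (((M : Set U) ×ˢ univ) ×ˢ univ) := by
    intro M C D
    refine ContinuousOn.prodMk (D.smooth_T.continuousOn.comp (f.smooth.continuous.comp_continuousOn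
      (C.smooth_P.continuousOn.comp (by fun_prop) fun p hp => ⟨hp.1.1, mem_univ _⟩)) fun p hp => ?_)
      (by fun_prop)
    rw [mem_preimage, f.w]
    change X.π (C.P (p.1.1, p.2)) ∈ M
    rw [C.π_P _ hp.1.1]
    exact hp.1.1
  refine isVc_of (.of_contMDiffAt (fun m hm => ?_) fun m hm => ?_) fun x hx => ?_
  · by_cases hr : m ∈ range f.toFun
    · obtain ⟨m, rfl⟩ := hr
      rw [f.w] at hm
      rw [LocHom.extend_apply, hΨ.zero m hm]
    · exact Function.extend_apply' _ _ _ hr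
  · by_cases hr : m ∈ range f.toFun
    · obtain ⟨m, rfl⟩ := hr
      rw [f.w] at hm
      refine ContMDiffAt.congr_of_eventuallyEq ?_ (LocHom.extend_eventuallyEq f Ψ hs m)
      have h₁ : ContMDiffAt (IT U) 𝓘(ℝ, ℂ × ℂ) ∞ Ψ (s (f.toFun m)) := by
        rw [hs]; exact hΨ.toIsFld.contMDiffAt hm
      exact h₁.comp _ (hss.contMDiffAt (f.isOpen.mem_nhds ⟨m, rfl⟩))
    · obtain ⟨M, j, hM, C, D, a, b, hc⟩ := key _ hm
      obtain ⟨V, I, hV, hI, hVm, hIab, hVI⟩ := generalized_tube_lemma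
        (isCompact_singleton (x := (Y.π m, D.T m))) (isCompact_Icc (a := a) (b := b))
        ((hcont M C D).isOpen_inter_preimage ((VCoord.isOpen_dom M).prod isOpen_univ)
          (isClosed_diagonal (X := ℝ)).isOpen_compl) (by
          rintro ⟨p, t⟩ ⟨hp, ht⟩
          obtain rfl : p = (Y.π m, D.T m) := hp
          refine ⟨⟨⟨hM, mem_univ _⟩, mem_univ _⟩, fun e => hr ⟨C.P (Y.π m, t), ?_⟩⟩
          have e' : D.T (f.toFun (C.P (Y.π m, t))) = D.T m := e
          have hπ : Y.π (f.toFun (C.P (Y.π m, t))) = Y.π m := by rw [f.w, C.π_P _ hM]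
          rw [← D.P_T (f.toFun (C.P (Y.π m, t))) (by rw [hπ]; exact hM), hπ, e', D.P_T m hM])
      have h₁ : ∀ᶠ m' in 𝓝 m, (Y.π m', D.T m') ∈ V :=
        (D.smooth_πT.contMDiffAt (Y.over_mem_nhds hM)).continuousAt.eventually
          (hV.mem_nhds (hVm rfl))
      refine ContMDiffAt.congr_of_eventuallyEq (f := fun _ => (0 : ℂ × ℂ)) contMDiffAt_const ?_
      filter_upwards [h₁, Y.over_mem_nhds hM] with m' hm' hM'
      exact hc m' hM' fun t ht e => (hVI (mk_mem_prod hm' (hIab ht))).2 e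
  · obtain ⟨M, j, hM, C, D, a, b, hc⟩ := key _ hx
    have h₀ : ContinuousOn (fun p : U × ℝ => D.T (f.toFun (C.P p))) ((M : Set U) ×ˢ univ) :=
      continuous_fst.comp_continuousOn ((hcont M C D).comp
        (by fun_prop : Continuous fun p : U × ℝ => ((p.1, (0 : ℝ)), p.2)).continuousOn
        fun p hp => ⟨⟨hp.1, mem_univ _⟩, mem_univ _⟩)
    obtain ⟨R, hR⟩ : ∃ R, ∀ t ∈ Icc a b, ‖D.T (f.toFun (C.P (x, t)))‖ ≤ R :=
      isCompact_Icc.exists_bound_of_continuousOn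
        (h₀.comp (by fun_prop : Continuous fun t : ℝ => (x, t)).continuousOn
          fun t _ => ⟨hM, mem_univ _⟩)
    obtain ⟨V, I, hV, hI, hVx, hIab, hVI⟩ := generalized_tube_lemma
      (isCompact_singleton (x := x)) (isCompact_Icc (a := a) (b := b))
      (h₀.isOpen_inter_preimage (VCoord.isOpen_dom M)
        (show IsOpen (Metric.ball (0 : ℝ) (R + 1)) from Metric.isOpen_ball))
      (by
        rintro ⟨u, t⟩ ⟨hu, ht⟩
        obtain rfl : u = x := hu
        refine ⟨⟨hM, mem_univ _⟩, ?_⟩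
        simpa using (hR t ht).trans_lt (lt_add_one R))
    refine ⟨⟨V ∩ M, hV.inter M.isOpen⟩, fun u hu => j hu.2, ⟨hVx rfl, hM⟩,
      D.mono fun u hu => hu.2, -(R + 1), R + 1, fun m hm hT => hc m hm.2 fun t ht e => hT ?_⟩
    have := (hVI (mk_mem_prod hm.1 (hIab ht))).2
    rw [mem_preimage, mem_ball_zero_iff, Real.norm_eq_abs, abs_lt, e] at this
    exact ⟨this.1.le, this.2.le⟩

/-- Rotation of the two components by a phase. -/
def rotLin (z : Circle) : ℂ × ℂ →L[ℝ] ℂ × ℂ :=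
  ((ContinuousLinearMap.mul ℝ ℂ (z : ℂ)).comp (ContinuousLinearMap.fst ℝ ℂ ℂ)).prod
    ((ContinuousLinearMap.mul ℝ ℂ (z : ℂ)⁻¹).comp (ContinuousLinearMap.snd ℝ ℂ ℂ))

theorem LocObj.IsVc.rotPush (hΨ : X.IsVc W Ψ) (g : C^∞⟮𝓡 U.dim, U; 𝓡 1, Circle⟯) :
    Y.IsVc W (LocObj.rotPush f g Ψ) := by
  have hE := hΨ.extend f
  set Θ := Function.extend f.toFun Ψ 0
  refine .of_support hE hE le_rfl le_rfl (.of_contMDiffAt (fun m hm => ?_) fun m hm => ?_)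
    fun m _ h₁ _ => ?_
  · have h₀ : Θ m = 0 := hE.zero m hm
    change ((g (Y.π m) : ℂ) * (Θ m).1, (g (Y.π m) : ℂ)⁻¹ * (Θ m).2) = 0
    rw [h₀]
    exact Prod.ext (mul_zero _) (mul_zero _)
  · have hsm := hE.toIsFld.contMDiffAt hm
    have h₁ : ContMDiffAt (IT U) 𝓘(ℝ, ℂ) ∞ (fun m => extFn (circleFn g W) (Y.π m)) m :=
      ((smooth_extFn (circleFn g W)).contMDiffAt (W.isOpen.mem_nhds hm)).comp m
        Y.smooth_π.contMDiffAt
    have hs : ContDiff ℝ ∞ (fun p : ℂ × ℂ × ℂ => (p.1 * p.2.1, (starRingEnd ℂ) p.1 * p.2.2)) :=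
      (contDiff_fst.mul contDiff_snd.fst).prodMk
        (((Complex.conjCLE.contDiff (n := ∞)).comp contDiff_fst).mul contDiff_snd.snd)
    refine (hs.contMDiff.contMDiffAt.comp m (h₁.prodMk_space hsm)).congr_of_eventuallyEq ?_
    filter_upwards [Y.over_mem_nhds hm] with m' hm'
    have e : extFn (circleFn g W) (Y.π m') = (g (Y.π m') : ℂ) := extFn_apply _ hm'
    have e' : (g (Y.π m') : ℂ)⁻¹ = (starRingEnd ℂ) (g (Y.π m') : ℂ) := by
      rw [← Circle.coe_inv, Circle.coe_inv_eq_conj]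
    change ((g (Y.π m') : ℂ) * (Θ m').1, (g (Y.π m') : ℂ)⁻¹ * (Θ m').2) =
      (extFn (circleFn g W) (Y.π m') * (Θ m').1,
        (starRingEnd ℂ) (extFn (circleFn g W) (Y.π m')) * (Θ m').2)
    rw [e, e']
  · have h₀ : Θ m = 0 := h₁.self_of_nhds
    change ((g (Y.π m) : ℂ) * (Θ m).1, (g (Y.π m) : ℂ)⁻¹ * (Θ m).2) = 0
    rw [h₀]
    exact Prod.ext (mul_zero _) (mul_zero _)

/-- Morphisms preserve the speed of vertical curves. -/
theorem LocHom.speed_comp {γ : ℝ → X} {t : ℝ} {u : U} (hγ : MDifferentiableAt 𝓘(ℝ, ℝ) (IT U) γ t)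
    (hu : ∀ s, X.π (γ s) = u) : Y.speed (fun s => f.toFun (γ s)) t = X.speed γ t := by
  have hf : MDifferentiableAt (IT U) (IT U) f.toFun (γ t) := f.smooth.mdifferentiableAt (by simp)
  have h₁ : X.vel γ t ∈ X.Vert (γ t) := VCoord.d_π_curve hγ hu
  have h₂ : Y.vel (fun s => f.toFun (γ s)) t ∈ Y.Vert (f.toFun (γ t)) :=
    VCoord.d_π_curve (hf.comp t hγ) fun s => (f.w _).trans (hu s)
  exact ((dif_pos h₂).trans (f.form (γ t) ⟨_, h₁⟩ ⟨_, h₂⟩ (mfderiv_comp_apply t hf hγ _))).trans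
    (dif_pos h₁).symm

/-- The fibre integrals rotate with the field, since a morphism preserves the vertical one-form. -/
theorem LocObj.IsVc.charge_rotPush (hΨ : X.IsVc W Ψ) (g : C^∞⟮𝓡 U.dim, U; 𝓡 1, Circle⟯) {u : U}
    (hu : u ∈ W) : Y.charge u (LocObj.rotPush f g Ψ) = rotLin (g u) (X.charge u Ψ) := by
  obtain ⟨N, hN, ⟨C⟩⟩ := X.exists_vcoord u
  obtain ⟨N', hN', ⟨D⟩⟩ := Y.exists_vcoord u
  have hline : ∀ t, MDifferentiableAt 𝓘(ℝ, ℝ) (IT U) (fun s => C.P (u, s)) t := fun t =>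
    (C.smooth_line hN).mdifferentiableAt (by simp)
  rw [D.charge_eq hN', ← hΨ.integral_comp C hN hu,
    ← D.integral_curve hN' (γ := fun t => f.toFun (C.P (u, t)))]
  · refine integral_congr_ae (Filter.Eventually.of_forall fun t => ?_)
    have e : LocObj.rotPush f g Ψ (f.toFun (C.P (u, t))) = rotLin (g u) (Ψ (C.P (u, t))) := by
      rw [LocObj.rotPush, LocHom.extend_apply, f.w, C.π_P u hN]
      rfl
    change |Y.speed (fun s => f.toFun (C.P (u, s))) t| •
        LocObj.rotPush f g Ψ (f.toFun (C.P (u, t))) =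
      C.ρ (u, t) • rotLin (g u) (Ψ (C.P (u, t)))
    rw [LocHom.speed_comp f (hline t) (C.π_P u hN), C.speed_line hN, abs_of_pos (C.ρ_pos u hN t), e]
  · exact fun t => (f.smooth.mdifferentiableAt (by simp)).comp t (hline t)
  · exact fun t => (f.w _).trans (C.π_P u hN t)
  · exact (LocHom.injective f).comp (C.injective_line hN)
  · intro m hm hr
    have h₀ : Function.extend f.toFun Ψ 0 m = 0 := by
      refine Function.extend_apply' _ _ _ ?_
      rintro ⟨m', rfl⟩
      rw [f.w] at hm
      refine hr ⟨C.T m', ?_⟩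
      change f.toFun (C.P (u, C.T m')) = _
      rw [← hm, C.P_T _ (by rw [hm]; exact hN)]
    rw [LocObj.rotPush, h₀]
    exact Prod.ext (mul_zero _) (mul_zero _)

end

/-! ### The class of a field -/

section
open LocObj
variable {U : Man} {X : LocObj U} {W W' : Opens U} {Ψ Ψ' : X → ℂ × ℂ}

/-- The value of a section of `hyp U` at a point. -/
def hypVal (v : Sec (hyp U).V W) (x : W) : ℂ × ℂ := ((hypPr v).1 x, (hypPr v).2 x)

theorem hypVal_ext {v w : Sec (hyp U).V W} (h : ∀ x, hypVal v x = hypVal w x) : v = w :=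
  Prod.ext (ContMDiffMap.ext fun x => congrArg Prod.fst (h x))
    (ContMDiffMap.ext fun x => congrArg Prod.snd (h x))

variable (X W Ψ) in
/-- The class of a field with vertically compact support: its pair of fibre integrals, as smooth
functions of the base point. Fields whose fibre integrals are not smooth have the class zero. -/
def cls : Sec (hyp U).V W := by
  classical
  exact if h : ContMDiffOn (𝓡 U.dim) 𝓘(ℝ, ℂ × ℂ) ∞ (fun u => X.charge u Ψ) W then
    hypMk (fnOf (fun u => (X.charge u Ψ).1) (contDiff_fst.contMDiff.comp_contMDiffOn h))
      (fnOf (fun u => (X.charge u Ψ).2) (contDiff_snd.contMDiff.comp_contMDiffOn h))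
  else 0

theorem hypVal_cls (h : X.IsVc W Ψ) (x : W) : hypVal (cls X W Ψ) x = X.charge x Ψ := by
  rw [cls, dif_pos h.smooth_charge]
  rfl

theorem cls_add (h : X.IsVc W Ψ) (h' : X.IsVc W Ψ') :
    cls X W (Ψ + Ψ') = cls X W Ψ + cls X W Ψ' := hypVal_ext fun x => by
  have e : hypVal (cls X W Ψ + cls X W Ψ') x = hypVal (cls X W Ψ) x + hypVal (cls X W Ψ') x := rfl
  rw [e, hypVal_cls h, hypVal_cls h', hypVal_cls (h.add h'), h.charge_add h' x.2]

theorem cls_smul (h : X.IsVc W Ψ) (a : Fn U W) : cls X W (X.smulFn a Ψ) = a • cls X W Ψ :=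
  hypVal_ext fun x => by
    have e : hypVal (a • cls X W Ψ) x = a x • hypVal (cls X W Ψ) x := rfl
    let L : ℂ × ℂ →L[ℝ] ℂ × ℂ := (a x • ContinuousLinearMap.id ℂ (ℂ × ℂ)).restrictScalars ℝ
    rw [e, hypVal_cls h, hypVal_cls (h.smulFn a)]
    refine Eq.trans (charge_congr (Ψ' := fun m => L (Ψ m)) fun m hm => ?_) (h.charge_comp x.2 L)
    rw [smulFn_apply (show X.π m ∈ W from hm ▸ x.2)]
    exact congrArg (fun y => a y • Ψ m) (Subtype.ext hm)

theorem cls_restr (h : X.IsVc W Ψ) (i : W' ≤ W) :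
    cls X W' (X.restr W' Ψ) = Sec.res i (cls X W Ψ) := hypVal_ext fun x => by
  have e : hypVal (Sec.res i (cls X W Ψ)) x = hypVal (cls X W Ψ) ⟨x, i x.2⟩ := rfl
  rw [e, hypVal_cls h, hypVal_cls (h.restr i)]
  exact charge_congr fun m hm => restr_apply (show X.π m ∈ W' from hm ▸ x.2)

/-- The involution on pairs of complex numbers. -/
def conjLin : ℂ × ℂ →L[ℝ] ℂ × ℂ :=
  (Complex.conjCLE.toContinuousLinearMap.comp (ContinuousLinearMap.snd ℝ ℂ ℂ)).prod
    (Complex.conjCLE.toContinuousLinearMap.comp (ContinuousLinearMap.fst ℝ ℂ ℂ))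

theorem st_cls (h : X.IsVc W Ψ) : (hyp U).st (cls X W Ψ) = cls X W (X.conjSwap Ψ) :=
  hypVal_ext fun x => by
    have e : hypVal ((hyp U).st (cls X W Ψ)) x = conjLin (hypVal (cls X W Ψ) x) := rfl
    rw [e, hypVal_cls h, hypVal_cls h.conjSwap]
    exact (h.charge_comp x.2 conjLin).symm

/-- The kernel of the class map is the image of the Dirac operator. -/
theorem cls_eq_zero_iff (h : X.IsVc W Ψ) : cls X W Ψ = 0 ↔ ∀ x ∈ W, ∃ N : Opens U, N ≤ W ∧ x ∈ N ∧
    ∃ Φ : X → ℂ × ℂ, X.IsVc N Φ ∧ X.restr N Ψ = X.dirac N Φ := by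
  constructor
  · intro hz x hx
    obtain ⟨Φ, hΦ, e⟩ := h.exists_dirac_eq fun u hu => by
      have h₁ := hypVal_cls h ⟨u, hu⟩
      rw [hz] at h₁
      exact h₁.symm
    exact ⟨W, le_rfl, hx, Φ, hΦ, h.toIsFld.restr_self.trans e.symm⟩
  · intro H
    refine hypVal_ext fun x => ?_
    obtain ⟨N, i, hN, Φ, hΦ, e⟩ := H x x.2
    have h₁ : X.charge x (X.restr N Ψ) = X.charge x Ψ :=
      charge_congr fun m hm => restr_apply (show X.π m ∈ N from hm ▸ hN)
    rw [hypVal_cls h, ← h₁, e, hΦ.charge_dirac hN]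
    rfl

/-- Locally, every section is the class of a field. -/
theorem exists_cls (s : Sec (hyp U).V W) {x : U} (hx : x ∈ W) : ∃ (N : Opens U) (i : N ≤ W), x ∈ N ∧
    ∃ Ψ : X → ℂ × ℂ, X.IsVc N Ψ ∧ cls X N Ψ = Sec.res i s := by
  obtain ⟨N, i, hN, ⟨C⟩⟩ := X.exists_vcoord_le hx
  have hs : ContMDiffOn (𝓡 U.dim) 𝓘(ℝ, ℂ × ℂ) ∞
      (fun u => (extFn (hypPr s).1 u, extFn (hypPr s).2 u)) W :=
    (smooth_extFn _).prodMk_space (smooth_extFn _)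
  obtain ⟨Ψ, hΨ, e⟩ := C.exists_charge (hs.mono i)
  refine ⟨N, i, hN, Ψ, hΨ, hypVal_ext fun x => ?_⟩
  rw [hypVal_cls hΨ, e x x.2, extFn_apply _ (i x.2), extFn_apply _ (i x.2)]
  rfl

/-- The pairing of two classes, computed by the causal propagator. -/
theorem pair_cls (h : X.IsVc W Ψ) (h' : X.IsVc W Ψ') (x : W) {e : Bundle.Trivialization ℝ X.π}
    (he : IsSmoothTriv e) (hx : (x : U) ∈ e.baseSet) :
    (hyp U).pair (cls X W Ψ) (cls X W Ψ') x = X.fibreIntegral e x fun m =>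
      Complex.I * (Ψ m).1 * (X.green 1 W Ψ' m - X.green (-1) W Ψ' m).2 -
        Complex.I * (Ψ m).2 * (X.green 1 W Ψ' m - X.green (-1) W Ψ' m).1 := by
  obtain ⟨N, hN, ⟨C⟩⟩ := X.exists_vcoord (x : U)
  have e₁ : (hyp U).pair (cls X W Ψ) (cls X W Ψ') x =
      -((hypVal (cls X W Ψ) x).1 * (hypVal (cls X W Ψ') x).2 +
        (hypVal (cls X W Ψ) x).2 * (hypVal (cls X W Ψ') x).1) := rfl
  rw [e₁, hypVal_cls h, hypVal_cls h', C.fibreIntegral_eq hN he hx]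
  set d := X.charge x Ψ'
  let L : ℂ × ℂ →L[ℝ] ℂ :=
    (ContinuousLinearMap.mul ℝ ℂ (-d.2)).comp (ContinuousLinearMap.fst ℝ ℂ ℂ) +
      (ContinuousLinearMap.mul ℝ ℂ (-d.1)).comp (ContinuousLinearMap.snd ℝ ℂ ℂ)
  have hL : ∀ v, L v = -d.2 * v.1 + -d.1 * v.2 := fun v => rfl
  have e₂ := h.integral_comp C hN x.2 L
  rw [hL] at e₂
  -- On the fibre, the causal propagator is constant, so the integrand is a linear function of `Ψ`.
  have e₃ : C.integral (x : U) (fun m => Complex.I * (Ψ m).1 *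
      (X.green 1 W Ψ' m - X.green (-1) W Ψ' m).2 -
        Complex.I * (Ψ m).2 * (X.green 1 W Ψ' m - X.green (-1) W Ψ' m).1) =
      C.integral (x : U) (fun m => L (Ψ m)) := by
    refine MeasureTheory.integral_congr_ae (Filter.Eventually.of_forall fun t => ?_)
    refine congrArg (fun z : ℂ => C.ρ ((x : U), t) • z) ?_
    have hπ := C.π_P x hN t
    have hg := h'.green_sub_green (m := C.P ((x : U), t)) (by rw [hπ]; exact x.2)
    rw [hπ] at hg
    beta_reduce
    rw [hg, hL, symb_apply]
    linear_combination ((Ψ (C.P ((x : U), t))).1 * d.2 + (Ψ (C.P ((x : U), t))).2 * d.1) *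
      Complex.I_mul_I
  rw [e₃, e₂]
  ring

variable {Y : LocObj U} (f : X ⟶ Y)

theorem hypRot_cls (h : X.IsVc W Ψ) (g : C^∞⟮𝓡 U.dim, U; 𝓡 1, Circle⟯) :
    (hypRot g).app W (cls X W Ψ) = cls Y W (rotPush f g Ψ) := hypVal_ext fun x => by
  have key : ∀ y : W, hypVal (cls X W Ψ) y = X.charge y Ψ := hypVal_cls h
  have e : hypVal (U := U) ((hypRot g).app W (cls X W Ψ)) x =
      ((g x : ℂ) * (hypVal (cls X W Ψ) x).1,
        (starRingEnd ℂ) (g x : ℂ) * (hypVal (cls X W Ψ) x).2) := rfl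
  have e₁ : (starRingEnd ℂ) (g x : ℂ) = (g x : ℂ)⁻¹ := by
    rw [← Circle.coe_inv, Circle.coe_inv_eq_conj]
  rw [e₁] at e
  exact e.trans ((congrArg (fun v : ℂ × ℂ => ((g x : ℂ) * v.1, (g x : ℂ)⁻¹ * v.2)) (key x)).trans
    ((h.charge_rotPush f g x.2).symm.trans (hypVal_cls (h.rotPush f g) x).symm))

theorem hypPull_cls {U' : Man} (k : U' ⟶ U) (h : X.IsVc W Ψ) :
    (hypPull k).app W (cls X W Ψ) = cls (X.pull k) (pre k W) (fun p => Ψ (X.bar k p)) :=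
  hypVal_ext fun x => by
    have e : hypVal (U := U') ((hypPull k).app W (cls X W Ψ)) x =
        hypVal (cls X W Ψ) ⟨k x, x.2⟩ := rfl
    rw [hypVal_cls h] at e
    exact e.trans ((charge_pull (x : U')).symm.trans (hypVal_cls h.pull x).symm)

end

/-- Integration over the fibres exhibits the transformation with values `hyp` as the Dirac field. -/
theorem isDirac_diracTrans : IsDirac diracTrans (fun X W Ψ => cls X W Ψ) where
  add X W Ψ Ψ' h h' := cls_add h h'
  smul X W a Ψ h := cls_smul h a
  res X W W' i Ψ h := cls_restr h i
  exact X W Ψ h := cls_eq_zero_iff h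
  surj X W s x hx := exists_cls s hx
  st X W Ψ h := st_cls h
  pair X := ⟨X.green 1, X.green (-1), by
    rw [LocObj.future_eq]; exact LocObj.isGreen_green (.inl rfl), by
    rw [LocObj.past_eq]; exact LocObj.isGreen_green (.inr rfl),
    fun W Ψ Ψ' h h' x e he hx => pair_cls h h' x he hx⟩
  act f g W Ψ h := hypRot_cls f h g
  coh h X W Ψ hΨ := (ipCoh_diracTrans h X W _).trans (hypPull_cls h hΨ)

end SmoothAQFT

end

theorem mainTheorem5 :
    ∃ (L : PsNat LocU1 IPVec)
      (q : ∀ {U : Man} (X : LocObj U) (W : Opens U), (X → ℂ × ℂ) → Sec (ipOb L X).V W)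
      (C : PsNat IPVec StarAlg)
      (ι : ∀ {U : Man} (V : IPSheaf U) (W : Opens U), Sec V.V W → Sec (carOb C V).V W),
      IsDirac L q ∧ IsCAR C ι ∧
      ∀ {U : Man} {X Y : LocObj U} (f : X ⟶ Y) (g : C^∞⟮𝓡 U.dim, U; 𝓡 1, Circle⟯)
        (W : Opens U) (Ψ : X → ℂ × ℂ), X.IsVc W Ψ →
          aqftAct (composeAQFT L C) f g W (ι (ipOb L X) W (q X W Ψ)) =
            ι (ipOb L Y) W (q Y W (LocObj.rotPush f g Ψ)) := by
  refine ⟨diracTrans, fun X W Ψ => cls X W Ψ, CAR.trans, fun V W => CAR.ι V W, isDirac_diracTrans,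
    CAR.isCAR_trans, fun {U X Y} f g W Ψ hΨ => ?_⟩
  exact (CAR.isCAR_trans.act (hypRot g) (cls X W Ψ)).trans
    (congrArg (CAR.ι (hyp U) W) (isDirac_diracTrans.act f g hΨ))
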